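/- **Setting.** Let $\bar M=M\cup\partial M$ be a compact complex manifold of complex dimension $n\ge 2$ with smooth boundary (with local holomorphic coordinates, smooth up to the boundary, around every point of $\bar M$), and let $g$ be a smooth Hermitian metric on $\bar M$ with Kähler form $\omega=\frac{\sqrt{-1}}2 g_{j\bar k}\,dz_j\wedge d\bar z_k$. Let $\chi=\chi(\cdot,s)=\frac{\sqrt{-1}}2\chi_{j\bar k}(\cdot,s)\,dz_j\wedge d\bar z_k$ be a family of real $(1,1)$-forms on $\bar M$, smooth in $(z,s)\in\bar M\times\mathbb R$ and nondecreasing in $s$ (for instance independent of $s$). For a function $v$ write $v_{j\bar k}=\partial^2v/\partial z_j\partial\bar z_k$ and $\chi_v=\chi(\cdot,v)+\frac{\sqrt{-1}}2\partial\bar\partial v$. Let $\varphi\in C^\infty(\partial M)$, and let $\underline u$ be a real function on $\bar M$ which in a neighbourhood of $\partial M$ is $C^2$ up to the boundary and satisfies $\chi_{\underline u}>0$, and with $\underline u=\varphi$ on $\partial M$ (for instance an admissible subsolution). Fix real numbers $K$, $\Lambda$ and $\lambda>0$. Consider all pairs $(\psi,u)$ such that * $\psi\in C^\infty(\bar M\times\mathbb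 R)$, and on $\bar M\times[-K,K]$ one has $\lambda\le\psi\le\Lambda$, $|\partial_s\psi|\le\Lambda$ and $|d_z\psi|_g\le\Lambda$; * $u\in C^4(\bar M)$, $\chi_u>0$ on $\bar M$, $(\chi_u)^n=\psi(z,u)\,\omega^n$ on $\bar M$, i.e. $\det(\chi_{j\bar k}+u_{j\bar k})=\psi(z,u)\det(g_{j\bar k})$, and $u=\varphi$ on $\partial M$; * $u\ge\underline u$ on $\bar M$, and $|u|+|\nabla u|\le K$ on $\bar M$, where $|\nabla u|^2=g^{k\bar l}u_ku_{\bar l}$. A *regular chart* at $p\in\partial M$ is a system of local holomorphic coordinates $z_j=x_j+\sqrt{-1}\,y_j$ around $p$ with $z(p)=0$, $g_{j\bar k}(p)=\delta_{jk}$ and $\partial/\partial x_n$ at $p$ in the interior normal direction to $\partial M$. **Proposition 4.3.** 1. There is a constant $c_0>0$, depending only on $\lambda,\Lambda,K,\varphi,\underline u$ and on $(\bar M,g,\chi)$, such that for every such pair $(\psi,u)$, every $p\in\partial M$, every regular chart at $p$ and every $\xi\in\mathbb C^{n-1}$, $$\sum_{\alpha,\beta<n}\bigl(u_{\alpha\bar\beta}(p)+\chi_{\alpha\bar\beta}(p,u(p))\bigr)\,\xi_\alpha\bar\xi_\beta\;\ge\;c_0|\xi|^2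 .$$ 2. Consequently the double normal second derivative is bounded on $\partial M$: there is a constant $C$ with the same dependence such that for every such pair $(\psi,u)$, every $p\in\partial M$ and every regular chart at $p$, $|u_{x_nx_n}(p)|\le C$, where $u_{x_nx_n}=\nabla_{\partial/\partial x_n}\nabla_{\partial/\partial x_n}u=\partial_{x_n}^2u-(\nabla_{\partial/\partial x_n}\tfrac{\partial}{\partial x_n})u$ is the covariant second derivative for the Chern connection $\nabla$ of $g$. -/

import Mathlib

open scoped Manifold ContDiff

namespace HermitianMA

section Basic

variable {m : ℕ} {M : Type*} [TopologicalSpace M]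
  [ChartedSpace (EuclideanHalfSpace (2 * m + 2)) M]

/-- A (possibly non-smooth) bilinear form on each real tangent space of the manifold with
boundary `M`, whose real dimension is `2 * m + 2`. -/
abbrev BilinField (m : ℕ) (M : Type*) [TopologicalSpace M]
    [ChartedSpace (EuclideanHalfSpace (2 * m + 2)) M] : Type _ :=
  ∀ x : M, TangentSpace (𝓡∂ (2 * m + 2)) x →L[ℝ] TangentSpace (𝓡∂ (2 * m + 2)) x →L[ℝ] ℝ

/-- An endomorphism of each real tangent space. -/
abbrev EndoField (m : ℕ) (M : Type*) [TopologicalSpace M]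
    [ChartedSpace (EuclideanHalfSpace (2 * m + 2)) M] : Type _ :=
  ∀ x : M, TangentSpace (𝓡∂ (2 * m + 2)) x →L[ℝ] TangentSpace (𝓡∂ (2 * m + 2)) x

/-- The real differential at `x` of a map with values in `ℂ^(m+1)`. -/
noncomputable def realDiff (z : M → (Fin (m + 1) → ℂ)) (x : M) :
    TangentSpace (𝓡∂ (2 * m + 2)) x →L[ℝ] (Fin (m + 1) → ℂ) :=
  mfderiv (𝓡∂ (2 * m + 2)) 𝓘(ℝ, Fin (m + 1) → ℂ) z x

/-- The derivative `du(v)` of a real function `u` along the tangent vector `v` at `x`. -/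
noncomputable def dirDeriv (u : M → ℝ) (x : M) (v : TangentSpace (𝓡∂ (2 * m + 2)) x) : ℝ :=
  mfderiv (𝓡∂ (2 * m + 2)) 𝓘(ℝ, ℝ) u x v

/-- `z` is a system of local holomorphic coordinates `(z_1, …, z_{m+1})` for `J`, defined on the
open set `z.source` of `M` (which may meet the boundary): a homeomorphism of `z.source` onto its
image `z.target` in `ℂ^(m+1)`, smooth up to the boundary, with invertible differential that
intertwines `J` with multiplication by `√-1`. -/
structure IsHolCoord (J : EndoField m M) (z : PartialEquiv M (Fin (m + 1) → ℂ)) : Prop where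
  open_source : IsOpen z.source
  smooth : ContMDiffOn (𝓡∂ (2 * m + 2)) 𝓘(ℝ, Fin (m + 1) → ℂ) ∞ z z.source
  continuous_symm : ContinuousOn z.symm z.target
  injective_diff : ∀ x ∈ z.source, Function.Injective (realDiff (m := m) z x)
  complex_linear : ∀ x ∈ z.source, ∀ v : TangentSpace (𝓡∂ (2 * m + 2)) x,
    realDiff (m := m) z x (J x v) = Complex.I • realDiff (m := m) z x v

/-- `J` is the almost complex structure of a complex manifold with boundary: around every point,
boundary points included, there are local holomorphic coordinates.  (This forces `J` to be smooth
and `J² = -1`.) -/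
def IsComplexStructure (J : EndoField m M) : Prop :=
  ∀ p : M, ∃ z : PartialEquiv M (Fin (m + 1) → ℂ), IsHolCoord J z ∧ p ∈ z.source

/-- The real tangent vector at `x` whose coordinate representation is `c`.  For `c = e_j` it is
`∂/∂x_j`, for `c = √-1 e_j` it is `∂/∂y_j`, where `z_j = x_j + √-1 y_j`. -/
noncomputable def coordVec (z : PartialEquiv M (Fin (m + 1) → ℂ)) (x : M)
    (c : Fin (m + 1) → ℂ) : TangentSpace (𝓡∂ (2 * m + 2)) x :=
  (realDiff (m := m) z x).inverse c

/-- `∂/∂x_j` at `x`. -/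
noncomputable def coordX (z : PartialEquiv M (Fin (m + 1) → ℂ)) (x : M) (j : Fin (m + 1)) :
    TangentSpace (𝓡∂ (2 * m + 2)) x :=
  coordVec z x (Pi.single j 1)

/-- `∂/∂y_j` at `x`. -/
noncomputable def coordY (z : PartialEquiv M (Fin (m + 1) → ℂ)) (x : M) (j : Fin (m + 1)) :
    TangentSpace (𝓡∂ (2 * m + 2)) x :=
  coordVec z x (Pi.single j Complex.I)

/-- The coefficient `η_{j k̄}` of a real `(1,1)`-form
`η = (√-1/2) ∑ η_{j k̄} dz_j ∧ dz̄_k`.  Evaluating the right hand side gives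
`η(∂/∂x_j, ∂/∂y_k) = Re η_{j k̄}` and `η(∂/∂x_j, ∂/∂x_k) = - Im η_{j k̄}`. -/
noncomputable def formCoeff (η : ∀ x : M, TangentSpace (𝓡∂ (2 * m + 2)) x →
      TangentSpace (𝓡∂ (2 * m + 2)) x → ℝ)
    (z : PartialEquiv M (Fin (m + 1) → ℂ)) (x : M) (j k : Fin (m + 1)) : ℂ :=
  (η x (coordX z x j) (coordY z x k) : ℂ) - Complex.I * (η x (coordX z x j) (coordX z x k) : ℂ)

/-- Directional derivative, in the direction `c`, of `f` written in the coordinates `z`. -/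
noncomputable def coordDeriv (z : PartialEquiv M (Fin (m + 1) → ℂ)) (f : M → ℂ)
    (c : Fin (m + 1) → ℂ) (x : M) : ℂ :=
  fderivWithin ℝ (fun w => f (z.symm w)) z.target (z x) c

/-- `∂f/∂z_j = (1/2)(∂f/∂x_j - √-1 ∂f/∂y_j)`. -/
noncomputable def dZ (z : PartialEquiv M (Fin (m + 1) → ℂ)) (f : M → ℂ)
    (j : Fin (m + 1)) (x : M) : ℂ :=
  (coordDeriv z f (Pi.single j 1) x
    - Complex.I * coordDeriv z f (Pi.single j Complex.I) x) / 2

/-- `∂f/∂z̄_j = (1/2)(∂f/∂x_j + √-1 ∂f/∂y_j)`. -/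
noncomputable def dZbar (z : PartialEquiv M (Fin (m + 1) → ℂ)) (f : M → ℂ)
    (j : Fin (m + 1)) (x : M) : ℂ :=
  (coordDeriv z f (Pi.single j 1) x
    + Complex.I * coordDeriv z f (Pi.single j Complex.I) x) / 2

/-- `u_{j k̄} = ∂²u/∂z_j∂z̄_k`. -/
noncomputable def leviCoeff (z : PartialEquiv M (Fin (m + 1) → ℂ)) (u : M → ℝ) (x : M)
    (j k : Fin (m + 1)) : ℂ :=
  dZ z (fun y => dZbar z (fun q => (u q : ℂ)) k y) j x

/-- The coefficient matrix `χ_{j k̄}(·, u) + u_{j k̄}` of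
`χ_u = χ(·, u) + (√-1/2) ∂∂̄u`, at the point `x`. -/
noncomputable def chiUMatrix (χ : ℝ → BilinField m M) (u : M → ℝ)
    (z : PartialEquiv M (Fin (m + 1) → ℂ)) (x : M) : Matrix (Fin (m + 1)) (Fin (m + 1)) ℂ :=
  Matrix.of fun j k =>
    formCoeff (fun y v w => χ (u y) y v w) z x j k + leviCoeff z u x j k

/-- A real two-form of type `(1,1)`: alternating and `J`-invariant. -/
def IsReal11 (J : EndoField m M) (η : BilinField m M) : Prop :=
  (∀ x v, η x v v = 0) ∧ ∀ x v w, η x (J x v) (J x w) = η x v w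

/-- `χ = χ(·, s)` depends smoothly on `(x, s) ∈ M × ℝ`. -/
def SmoothFamily [IsManifold (𝓡∂ (2 * m + 2)) ∞ M] (χ : ℝ → BilinField m M) : Prop :=
  ContMDiff ((𝓡∂ (2 * m + 2)).prod 𝓘(ℝ, ℝ))
    ((𝓡∂ (2 * m + 2)).prod 𝓘(ℝ, EuclideanSpace ℝ (Fin (2 * m + 2)) →L[ℝ]
      EuclideanSpace ℝ (Fin (2 * m + 2)) →L[ℝ] ℝ)) ∞
    (fun q : M × ℝ => Bundle.TotalSpace.mk'
      (EuclideanSpace ℝ (Fin (2 * m + 2)) →L[ℝ] EuclideanSpace ℝ (Fin (2 * m + 2)) →L[ℝ] ℝ)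
      (E := fun x : M => TangentSpace (𝓡∂ (2 * m + 2)) x →L[ℝ]
        TangentSpace (𝓡∂ (2 * m + 2)) x →L[ℝ] ℝ) q.1 (χ q.2 q.1))

/-- `χ(·, s)` is nondecreasing in `s`, as Hermitian forms. -/
def MonotoneFamily (J : EndoField m M) (χ : ℝ → BilinField m M) : Prop :=
  ∀ s t : ℝ, s ≤ t → ∀ x v, χ s x v (J x v) ≤ χ t x v (J x v)

/-- Smooth Riemannian metrics on `M`, up to the boundary. -/
abbrev RMetric (m : ℕ) (M : Type*) [TopologicalSpace M]
    [ChartedSpace (EuclideanHalfSpace (2 * m + 2)) M]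
    [IsManifold (𝓡∂ (2 * m + 2)) ∞ M] : Type _ :=
  Bundle.ContMDiffRiemannianMetric (𝓡∂ (2 * m + 2)) ∞
    (EuclideanSpace ℝ (Fin (2 * m + 2))) (fun x : M => TangentSpace (𝓡∂ (2 * m + 2)) x)

/-- The real quadratic expression `∑ A_{j k} ξ_j ξ̄_k` (its real part; the sum is real for
Hermitian `A`). -/
noncomputable def hermQuad {ι : Type*} [Fintype ι] (A : Matrix ι ι ℂ) (ξ : ι → ℂ) : ℝ :=
  (∑ j, ∑ k, A j k * ξ j * (starRingEnd ℂ) (ξ k)).re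

/-- `χ_u > 0` at every point of `S`. -/
def AdmissibleOn (J : EndoField m M) (χ : ℝ → BilinField m M) (u : M → ℝ) (S : Set M) : Prop :=
  ∀ z : PartialEquiv M (Fin (m + 1) → ℂ), IsHolCoord J z → ∀ x ∈ z.source, x ∈ S →
    ∀ ξ : Fin (m + 1) → ℂ, ξ ≠ 0 → 0 < hermQuad (chiUMatrix χ u z x) ξ

/-- The first-order part of the tangent vector `v` at `p` normal to the boundary: the
differential at `p` of the first coordinate of the preferred half-space chart at `p`.
If `p` is a boundary point, this coordinate is nonnegative, vanishes exactly on the boundary near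
`p`, and has nonzero differential; so `v` is tangent to the boundary iff `bdryDiff p v = 0` and
points strictly into `M` iff `0 < bdryDiff p v`. -/
noncomputable def bdryDiff (p : M) (v : TangentSpace (𝓡∂ (2 * m + 2)) p) : ℝ :=
  dirDeriv (fun x : M => (extChartAt (𝓡∂ (2 * m + 2)) p x) 0) p v

section Metric

variable [IsManifold (𝓡∂ (2 * m + 2)) ∞ M]

/-- The metric is Hermitian: compatible with `J`. -/
def IsHermitianMetric (J : EndoField m M) (g : RMetric m M) : Prop :=
  ∀ x v w, g.inner x (J x v) (J x w) = g.inner x v w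

/-- The coefficient matrix `g_{j k̄}`, given by `ω = (√-1/2) ∑ g_{j k̄} dz_j ∧ dz̄_k` where
`ω(v, w) = - g(v, J w)`. -/
noncomputable def gMatrix (J : EndoField m M) (g : RMetric m M)
    (z : PartialEquiv M (Fin (m + 1) → ℂ)) (x : M) : Matrix (Fin (m + 1)) (Fin (m + 1)) ℂ :=
  Matrix.of fun j k => formCoeff (fun y v w => - g.inner y v (J y w)) z x j k

/-- `u` is a `C⁴` admissible solution of `(χ_u)^n = ψ(x, u) ω^n` on all of the compact manifold
with boundary `M`, with `u = φ` on the boundary.  The equation is written in local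
coordinates, `det(χ_{j k̄} + u_{j k̄}) = ψ(x, u) det g_{j k̄}`. -/
structure IsSolution (J : EndoField m M) (g : RMetric m M) (χ : ℝ → BilinField m M)
    (ψ : M → ℝ → ℝ) (φ u : M → ℝ) : Prop where
  contMDiff : ContMDiff (𝓡∂ (2 * m + 2)) 𝓘(ℝ, ℝ) 4 u
  admissible : AdmissibleOn J χ u Set.univ
  equation : ∀ z : PartialEquiv M (Fin (m + 1) → ℂ), IsHolCoord J z → ∀ x ∈ z.source,
    (chiUMatrix χ u z x).det = (ψ x (u x) : ℂ) * (gMatrix J g z x).det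
  boundary_value : ∀ x ∈ (𝓡∂ (2 * m + 2)).boundary M, u x = φ x

/-- `|u| + |∇u| ≤ K` on `M`, where `|∇u|² = g^{k l̄} u_k u_{l̄}`.  In terms of the real
differential, `|∇u| ≤ r` at `x` means `|du(v)| ≤ 2 r √(g(v, v))` for all real tangent vectors. -/
def C1Bound (g : RMetric m M) (u : M → ℝ) (K : ℝ) : Prop :=
  ∀ x : M, ∃ r : ℝ, 0 ≤ r ∧ |u x| + r ≤ K ∧
    ∀ v : TangentSpace (𝓡∂ (2 * m + 2)) x,
      |dirDeriv u x v| ≤ 2 * r * Real.sqrt (g.inner x v v)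

/-- `ψ` is smooth on `M × ℝ`, and on `M × [-K, K]` it satisfies `ψ ≥ lam` and has `C¹` norm
controlled by `Lam`. -/
structure PsiBound (g : RMetric m M) (ψ : M → ℝ → ℝ) (K lam Lam : ℝ) : Prop where
  smooth : ContMDiff ((𝓡∂ (2 * m + 2)).prod 𝓘(ℝ, ℝ)) 𝓘(ℝ, ℝ) ∞
    (fun q : M × ℝ => ψ q.1 q.2)
  lower : ∀ x s, |s| ≤ K → lam ≤ ψ x s
  upper : ∀ x s, |s| ≤ K → ψ x s ≤ Lam
  deriv_s : ∀ x s, |s| ≤ K → |deriv (fun t => ψ x t) s| ≤ Lam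
  deriv_x : ∀ x s, |s| ≤ K → ∀ v : TangentSpace (𝓡∂ (2 * m + 2)) x,
    |dirDeriv (fun y : M => ψ y s) x v|
      ≤ Lam * Real.sqrt (g.inner x v v)

/-- A regular coordinate chart at the point `p` of the boundary: holomorphic coordinates `z`
around `p` with `z(p) = 0` and `g_{j k̄}(p) = δ_{jk}`, such that `∂/∂x_n`, `n = m + 1`,
is at `p` orthogonal to the boundary and points into `M`. -/
structure IsRegularChart (J : EndoField m M) (g : RMetric m M) (p : M)
    (z : PartialEquiv M (Fin (m + 1) → ℂ)) : Prop where
  holCoord : IsHolCoord J z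
  mem_source : p ∈ z.source
  map_zero : z p = 0
  metric : gMatrix J g z p = 1
  inward : 0 < bdryDiff p (coordX z p (Fin.last m))
  normal : ∀ v : TangentSpace (𝓡∂ (2 * m + 2)) p, bdryDiff p v = 0 →
    g.inner p (coordX z p (Fin.last m)) v = 0

/-- The Christoffel symbols `Γ^l_{jk} = g^{l q̄} ∂g_{k q̄}/∂z_j` of the Chern connection, where
`g^{i q̄} g_{k q̄} = δ_{ik}`, so that `g^{l q̄}` is the `(q, l)` entry of the inverse matrix. -/
noncomputable def christoffel (J : EndoField m M) (g : RMetric m M)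
    (z : PartialEquiv M (Fin (m + 1) → ℂ)) (x : M) (l j k : Fin (m + 1)) : ℂ :=
  ∑ q, (gMatrix J g z x)⁻¹ q l * dZ z (fun y => gMatrix J g z y k q) j x

/-- The covariant second derivative `u_{x_n x_n} = ∇²u(∂/∂x_n, ∂/∂x_n)`, `n = m + 1`,
for the Chern connection `∇`.  Since `∇_{∂/∂x_n} ∂/∂x_n = 2 Re (Γ^l_{nn} ∂/∂z_l)`, it
equals `∂²u/∂x_n² - 2 Re (Γ^l_{nn} u_l)`. -/
noncomputable def chernHessNN (J : EndoField m M) (g : RMetric m M)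
    (z : PartialEquiv M (Fin (m + 1) → ℂ)) (u : M → ℝ) (x : M) : ℝ :=
  (coordDeriv z (fun y => coordDeriv z (fun q => (u q : ℂ)) (Pi.single (Fin.last m) 1) y)
      (Pi.single (Fin.last m) 1) x).re
    - 2 * (∑ l, christoffel J g z x l (Fin.last m) (Fin.last m)
        * dZ z (fun q => (u q : ℂ)) l x).re

end Metric

end Basic

end HermitianMA

open HermitianMA

/-! Write `G` for the matrix `χ_{jk̄} + u_{jk̄}` in coordinates, `ρ` for a defining function of the
boundary that is nonnegative inside, and `v0` for a fixed vector with `ρ_{v0} > 0`. The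
linearization of `log det` at `u` is, up to the factor 4, the sum of second derivatives along the
`2n` real vectors `f_a`, `√-1 f_a` of a unitary frame of `G`; this is `frameSum`. The quantity `σ =
∑ ‖f_a‖²` is comparable to the trace of `G⁻¹`. Nothing bounds `σ` in advance, so every estimate has
to hold up to multiples of `1 + σ`.

Three facts feed the minimum principle. Differentiating the equation once bounds the operator on
derivatives of `u` by `C (1 + σ)` (`LocalSol.frameSum_deriv_le`). The barrier `(u - us) + τ ρ - N
ρ²` is nonnegative near the boundary point and is mapped below `-ε (1 + σ)` (`exists_barrier`): for
large `σ` the strict positivity of the subsolution suffices, and for bounded `σ` the bound on `det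
G` makes the frame nondegenerate, so that `-2N ∑ (dρ)²` takes over. The remaining terms `∑ da(f)
u_{f v0}` in the operator applied to `a u_{v0}` are expressed through the Hermitian form of `G`,
which a unitary frame sums exactly, and through the differential of `P = u_{√-1 v0} + a_P u_{v0} +
b_P` (`exists_cross_bound`). Subtracting `P²` from the comparison function absorbs the latter.

The result is `exists_boundary_gradient_bound`: if `u_t + a u_{v0} + b` is nonnegative on the
boundary near a point and vanishes at that point, its derivative along `v0` there is bounded below,
with constants depending only on the `C²` norms of the coefficients. Applied to tangential
derivatives of `u - φ` with both signs it bounds the mixed second derivatives; the purely tangential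
ones follow from `u = φ` (`exists_tangential_bound`).

For the lower bound, let `m0` be the least eigenvalue of `χ_u` with respect to `g` on the complex
tangent spaces of the boundary, over the entire boundary. On the boundary the restriction of `χ_u`
to complex tangent vectors is affine in `u_{v0}`, with slope the Levi form of `ρ` divided by
`ρ_{v0}`. Hence for the minimizing vector `ξ`, extended by projection to nearby points, `χ_u(ξ, ξ) -
m0 g(ξ, ξ)` agrees on the boundary with a first order expression of the kind above: nonnegative, and
zero at the minimum point. If `χ_u(ξ, ξ)` is small there, comparison with `us` forces the slope to
be negative by a definite amount (`LocalSol.levi_defining_le`), and the gradient bound becomes an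
upper bound for `u_{v0 v0}`. All second derivatives are then bounded above at that one point. Since
`det G` is bounded below, `G` is uniformly positive there (`exists_lower_of_hessian_le`), so `m0` is
bounded below by `exists_tangential_lower_bound`, and with it the tangential part of `χ_u`
everywhere on the boundary.

For the second assertion, expand `det G` in a regular chart along the last row: the tangential minor
is bounded away from zero and all other entries are bounded, so the corner entry is bounded
(`exists_corner_bound`). The direction `√-1 ∂/∂x_n` is tangent to the boundary, which turns this
into a bound for `∂²u/∂x_n²`. Regular charts have no uniform second order control. Everything is
therefore expressed in finitely many fixed charts, where the second derivatives of the change of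
coordinates cancel between the Hessian and the Christoffel symbols
(`IsRegularChart.chernHessNN_eq`). Compactness of the boundary makes the local constants global. -/

namespace HermitianMA

/-! ### First and second derivatives within a set, up to the boundary. -/

section Calculus

open Set Filter Topology

variable {E V : Type*} [NormedAddCommGroup E] [NormedSpace ℝ E]
  [NormedAddCommGroup V] [NormedSpace ℝ V]

/-- Directional derivative of `w` within `S` along the constant vector `v`. -/
noncomputable def dd (S : Set E) (v : E) (w : E → V) (q : E) : V := fderivWithin ℝ w S q v

/-- Second derivative of `w` within `S`. -/
noncomputable def D2 (S : Set E) (w : E → V) (q : E) : E →L[ℝ] E →L[ℝ] V :=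
  fderivWithin ℝ (fderivWithin ℝ w S) S q

variable {S : Set E} {q : E}

theorem contDiffOn_fderivWithin (hS : UniqueDiffOn ℝ S) {k l : ℕ∞ω} {w : E → V}
    (hw : ContDiffOn ℝ l w S) (hkl : k + 1 ≤ l) : ContDiffOn ℝ k (fderivWithin ℝ w S) S :=
  hw.fderivWithin hS hkl

theorem contDiffOn_dd (hS : UniqueDiffOn ℝ S) {k l : ℕ∞ω} {w : E → V}
    (hw : ContDiffOn ℝ l w S) (hkl : k + 1 ≤ l) (v : E) : ContDiffOn ℝ k (dd S v w) S :=
  (hw.fderivWithin hS hkl).clm_apply contDiffOn_const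

theorem continuousOn_D2 (hS : UniqueDiffOn ℝ S) {w : E → V}
    (hw : ContDiffOn ℝ 2 w S) : ContinuousOn (D2 S w) S :=
  ((contDiffOn_fderivWithin hS hw (k := 1) (by norm_num)).fderivWithin hS (m := 0)
    (by norm_num)).continuousOn

theorem D2_apply (hS : UniqueDiffOn ℝ S) {w : E → V} (hw : ContDiffOn ℝ 2 w S) (hq : q ∈ S)
    (v t : E) : D2 S w q v t = dd S v (dd S t w) q := by
  have h := (contDiffOn_fderivWithin hS hw (k := 1) (by norm_num)).differentiableOn
    (by norm_num) q hq
  unfold D2 dd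
  rw [fderivWithin_clm_apply (hS q hq) h (differentiableWithinAt_const t)]
  simp

/-- At boundary points symmetry is inherited from the interior, which is why every point of `S` has
to be a limit of interior points. -/
theorem D2_symm (hS : UniqueDiffOn ℝ S) (hcl : S ⊆ closure (interior S)) {w : E → V}
    (hw : ContDiffOn ℝ 2 w S) (hq : q ∈ S) (v t : E) : D2 S w q v t = D2 S w q t v :=
  (hw q hq).isSymmSndFDerivWithinAt (by simp) hS (hcl hq) hq v t

theorem dd_comm (hS : UniqueDiffOn ℝ S) (hcl : S ⊆ closure (interior S)) {w : E → V}
    (hw : ContDiffOn ℝ 2 w S) (hq : q ∈ S) (v t : E) :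
    dd S v (dd S t w) q = dd S t (dd S v w) q := by
  rw [← D2_apply hS hw hq, ← D2_apply hS hw hq, D2_symm hS hcl hw hq]

theorem dd_congr {w w' : E → V} (h : EqOn w w' S) (hq : q ∈ S) (v : E) :
    dd S v w q = dd S v w' q := by
  unfold dd; rw [fderivWithin_congr h (h hq)]

theorem D2_congr {w w' : E → V} (h : EqOn w w' S) (hq : q ∈ S) :
    D2 S w q = D2 S w' q := by
  unfold D2
  exact fderivWithin_congr (fun x hx => fderivWithin_congr h (h hx)) (fderivWithin_congr h (h hq))

theorem dd_add (hS : UniqueDiffOn ℝ S) {a b : E → V} (ha : ContDiffOn ℝ 1 a S)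
    (hb : ContDiffOn ℝ 1 b S) (hq : q ∈ S) (v : E) :
    dd S v (fun x => a x + b x) q = dd S v a q + dd S v b q := by
  unfold dd
  rw [fderivWithin_fun_add (hS q hq) (ha.differentiableOn (by norm_num) q hq)
    (hb.differentiableOn (by norm_num) q hq)]; rfl

theorem dd_sub (hS : UniqueDiffOn ℝ S) {a b : E → V} (ha : ContDiffOn ℝ 1 a S)
    (hb : ContDiffOn ℝ 1 b S) (hq : q ∈ S) (v : E) :
    dd S v (fun x => a x - b x) q = dd S v a q - dd S v b q := by
  unfold dd
  rw [fderivWithin_fun_sub (hS q hq) (ha.differentiableOn (by norm_num) q hq)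
    (hb.differentiableOn (by norm_num) q hq)]; rfl

theorem dd_const_mul (hS : UniqueDiffOn ℝ S) {a : E → ℝ} (ha : ContDiffOn ℝ 1 a S)
    (hq : q ∈ S) (c : ℝ) (v : E) :
    dd S v (fun x => c * a x) q = c * dd S v a q := by
  unfold dd
  rw [fderivWithin_const_mul (hS q hq) (ha.differentiableOn (by norm_num) q hq)]; rfl

theorem dd_mul (hS : UniqueDiffOn ℝ S) {a b : E → ℝ} (ha : ContDiffOn ℝ 1 a S)
    (hb : ContDiffOn ℝ 1 b S) (hq : q ∈ S) (v : E) :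
    dd S v (fun x => a x * b x) q = a q * dd S v b q + b q * dd S v a q := by
  unfold dd
  rw [fderivWithin_fun_mul (hS q hq) (ha.differentiableOn (by norm_num) q hq)
    (hb.differentiableOn (by norm_num) q hq)]; rfl

theorem D2_add (hS : UniqueDiffOn ℝ S) {a b : E → V} (ha : ContDiffOn ℝ 2 a S)
    (hb : ContDiffOn ℝ 2 b S) (hq : q ∈ S) :
    D2 S (fun x => a x + b x) q = D2 S a q + D2 S b q := by
  have h1 : EqOn (fderivWithin ℝ (fun x => a x + b x) S)
      (fun x => fderivWithin ℝ a S x + fderivWithin ℝ b S x) S := fun x hx =>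
    fderivWithin_fun_add (hS x hx) (ha.differentiableOn (by norm_num) x hx)
      (hb.differentiableOn (by norm_num) x hx)
  unfold D2
  rw [fderivWithin_congr h1 (h1 hq), fderivWithin_fun_add (hS q hq)]
  · exact (contDiffOn_fderivWithin hS ha (k := 1) (by norm_num)).differentiableOn (by norm_num) q hq
  · exact (contDiffOn_fderivWithin hS hb (k := 1) (by norm_num)).differentiableOn (by norm_num) q hq

theorem D2_const_mul (hS : UniqueDiffOn ℝ S) {a : E → ℝ} (ha : ContDiffOn ℝ 2 a S)
    (hq : q ∈ S) (c : ℝ) :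
    D2 S (fun x => c * a x) q = c • D2 S a q := by
  have h1 : EqOn (fderivWithin ℝ (fun x => c * a x) S)
      (fun x => c • fderivWithin ℝ a S x) S := fun x hx =>
    fderivWithin_const_mul (hS x hx) (ha.differentiableOn (by norm_num) x hx) c
  unfold D2
  rw [fderivWithin_congr h1 (h1 hq)]
  exact fderivWithin_fun_const_smul (hS q hq)
    ((contDiffOn_fderivWithin hS ha (k := 1) (by norm_num)).differentiableOn (by norm_num) q hq) c

theorem D2_sub (hS : UniqueDiffOn ℝ S) {a b : E → V} (ha : ContDiffOn ℝ 2 a S)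
    (hb : ContDiffOn ℝ 2 b S) (hq : q ∈ S) :
    D2 S (fun x => a x - b x) q = D2 S a q - D2 S b q := by
  have h1 : EqOn (fderivWithin ℝ (fun x => a x - b x) S)
      (fun x => fderivWithin ℝ a S x - fderivWithin ℝ b S x) S := fun x hx =>
    fderivWithin_fun_sub (hS x hx) (ha.differentiableOn (by norm_num) x hx)
      (hb.differentiableOn (by norm_num) x hx)
  unfold D2
  rw [fderivWithin_congr h1 (h1 hq), fderivWithin_fun_sub (hS q hq)]
  · exact (contDiffOn_fderivWithin hS ha (k := 1) (by norm_num)).differentiableOn (by norm_num) q hq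
  · exact (contDiffOn_fderivWithin hS hb (k := 1) (by norm_num)).differentiableOn (by norm_num) q hq

theorem D2_mul (hS : UniqueDiffOn ℝ S) {a b : E → ℝ} (ha : ContDiffOn ℝ 2 a S)
    (hb : ContDiffOn ℝ 2 b S) (hq : q ∈ S) (v t : E) :
    D2 S (fun x => a x * b x) q v t = a q * D2 S b q v t + b q * D2 S a q v t
      + dd S v a q * dd S t b q + dd S v b q * dd S t a q := by
  have ha1 := ha.of_le (m := 1) (by norm_num)
  have hb1 := hb.of_le (m := 1) (by norm_num)
  have hda := contDiffOn_dd hS ha (k := 1) (by norm_num) t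
  have hdb := contDiffOn_dd hS hb (k := 1) (by norm_num) t
  rw [D2_apply hS (ha.mul hb) hq, D2_apply hS ha hq, D2_apply hS hb hq,
    dd_congr (w' := fun x => a x * dd S t b x + b x * dd S t a x)
      (fun x hx => dd_mul hS ha1 hb1 hx t) hq,
    dd_add hS (ha1.mul hdb) (hb1.mul hda) hq, dd_mul hS ha1 hdb hq, dd_mul hS hb1 hda hq]
  ring

theorem dd_vec_add (v t : E) (w : E → V) : dd S (v + t) w q = dd S v w q + dd S t w q := by
  simp [dd]

theorem dd_vec_smul (c : ℝ) (v : E) (w : E → V) : dd S (c • v) w q = c • dd S v w q := by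
  simp [dd]

/-- At a local minimum in the interior, second derivatives are nonnegative. -/
theorem D2_nonneg_of_isLocalMin {w : E → ℝ} (hS : S ∈ 𝓝 q)
    (hw : ContDiffWithinAt ℝ 2 w S q) (hmin : IsLocalMin w q) (v : E) :
    0 ≤ D2 S w q v v := by
  have hw' : ContDiffAt ℝ 2 w q := hw.contDiffAt hS
  unfold D2
  rw [fderivWithin_fderivWithin_eq_of_mem_nhds hS]
  by_contra hneg
  push Not at hneg
  have hd1 : ∀ᶠ x in 𝓝 q, DifferentiableAt ℝ w x := by
    filter_upwards [hw'.eventually (by simp)] with x hx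
    exact hx.differentiableAt (by norm_num)
  have hd2 : DifferentiableAt ℝ (fderiv ℝ w) q :=
    (hw'.fderiv_right (m := 1) (by norm_num)).differentiableAt (by norm_num)
  set γ : ℝ → E := fun s => q + s • v with hγ
  have hγd : ∀ s, HasDerivAt γ v s := fun s => by
    have := ((hasDerivAt_id s).smul_const v).const_add q
    rwa [one_smul] at this
  have hγ0 : γ 0 = q := by simp [hγ]
  have hγt : Tendsto γ (𝓝 0) (𝓝 q) := by
    have := (hγd 0).continuousAt.tendsto; rwa [hγ0] at this
  set f : ℝ → ℝ := fun s => w (γ s) with hf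
  have hfd : ∀ᶠ s in 𝓝 (0 : ℝ), HasDerivAt f (fderiv ℝ w (γ s) v) s := by
    filter_upwards [hγt.eventually hd1] with s hs
    exact hs.hasFDerivAt.comp_hasDerivAt s (hγd s)
  have hfd' : deriv f =ᶠ[𝓝 0] fun s => fderiv ℝ w (γ s) v := hfd.mono fun s hs => hs.deriv
  have hfdd : HasDerivAt (deriv f) (fderiv ℝ (fderiv ℝ w) q v v) 0 := by
    have h1 : HasDerivAt (fun s => fderiv ℝ w (γ s)) (fderiv ℝ (fderiv ℝ w) q v) 0 := by
      have := hd2.hasFDerivAt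
      rw [← hγ0] at this
      have h2 := this.comp_hasDerivAt 0 (hγd 0)
      rwa [hγ0] at h2
    have h2 := h1.clm_apply (hasDerivAt_const (0 : ℝ) v)
    simp at h2
    exact h2.congr_of_eventuallyEq hfd'
  have hfmin : IsLocalMin f 0 := by
    have : ∀ᶠ s in 𝓝 (0 : ℝ), w q ≤ w (γ s) := hγt.eventually hmin
    filter_upwards [this] with s hs
    simpa [hf, hγ0] using hs
  -- A strictly negative second derivative along the line makes the minimum also a maximum. The
  -- restriction is then locally constant, so its second derivative vanishes after all.
  have hmax : IsLocalMax f 0 := by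
    apply isLocalMax_of_deriv_deriv_neg
    · rw [hfdd.deriv]; exact hneg
    · exact hfmin.deriv_eq_zero
    · exact hfd.self_of_nhds.continuousAt
  have hconst : f =ᶠ[𝓝 0] fun _ => f 0 := by
    filter_upwards [hfmin, hmax] with s h1 h2 using le_antisymm h2 h1
  have h3 : deriv f =ᶠ[𝓝 0] fun _ => 0 := by
    filter_upwards [hconst.eventuallyEq_nhds] with s hs
    rw [hs.deriv_eq]; simp
  have h4 : deriv (deriv f) 0 = 0 := by rw [h3.deriv_eq]; simp
  rw [hfdd.deriv] at h4
  linarith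

end Calculus

end HermitianMA

namespace HermitianMA

/-! ### Hermitian forms, unitary frames and sums over frames. -/

section HermitianAlgebra

open Matrix ComplexConjugate

variable {ι : Type*} [Fintype ι]

/-- The sesquilinear form `∑ A_{jk} v_j w̄_k`. -/
noncomputable def hermC (A : Matrix ι ι ℂ) (v w : ι → ℂ) : ℂ :=
  ∑ j, ∑ k, A j k * v j * conj (w k)

theorem hermQuad_eq (A : Matrix ι ι ℂ) (ξ : ι → ℂ) : hermQuad A ξ = (hermC A ξ ξ).re := rfl

theorem hermC_add_left (A : Matrix ι ι ℂ) (v v' w : ι → ℂ) :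
    hermC A (v + v') w = hermC A v w + hermC A v' w := by
  simp [hermC, mul_add, add_mul, Finset.sum_add_distrib]

theorem hermC_add_right (A : Matrix ι ι ℂ) (v w w' : ι → ℂ) :
    hermC A v (w + w') = hermC A v w + hermC A v w' := by
  simp [hermC, mul_add, Finset.sum_add_distrib]

theorem hermC_smul_left (A : Matrix ι ι ℂ) (c : ℂ) (v w : ι → ℂ) :
    hermC A (c • v) w = c * hermC A v w := by
  simp only [hermC, Finset.mul_sum, Pi.smul_apply, smul_eq_mul]
  exact Finset.sum_congr rfl fun j _ => Finset.sum_congr rfl fun k _ => by ring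

theorem hermC_smul_right (A : Matrix ι ι ℂ) (c : ℂ) (v w : ι → ℂ) :
    hermC A v (c • w) = conj c * hermC A v w := by
  simp only [hermC, Finset.mul_sum, Pi.smul_apply, smul_eq_mul, map_mul]
  exact Finset.sum_congr rfl fun j _ => Finset.sum_congr rfl fun k _ => by ring

theorem hermC_add_mat (A B : Matrix ι ι ℂ) (v w : ι → ℂ) :
    hermC (A + B) v w = hermC A v w + hermC B v w := by
  simp [hermC, add_mul, Finset.sum_add_distrib]

theorem hermQuad_add_mat (A B : Matrix ι ι ℂ) (v : ι → ℂ) :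
    hermQuad (A + B) v = hermQuad A v + hermQuad B v := by
  simp [hermQuad_eq, hermC_add_mat]

theorem hermC_conj_symm {A : Matrix ι ι ℂ} (hA : A.IsHermitian) (v w : ι → ℂ) :
    conj (hermC A v w) = hermC A w v := by
  simp only [hermC, map_sum, map_mul, Complex.conj_conj]
  rw [Finset.sum_comm]
  refine Finset.sum_congr rfl fun j _ => Finset.sum_congr rfl fun k _ => ?_
  have : conj (A k j) = A j k := by rw [← hA.apply j k]; rfl
  rw [this]; ring

theorem hermC_self_im {A : Matrix ι ι ℂ} (hA : A.IsHermitian) (v : ι → ℂ) :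
    (hermC A v v).im = 0 := by
  have := hermC_conj_symm hA v v
  exact Complex.conj_eq_iff_im.mp this

theorem norm_hermC_le (A : Matrix ι ι ℂ) {κ : ℝ} (hA : ∀ j k, ‖A j k‖ ≤ κ) (v w : ι → ℂ) :
    ‖hermC A v w‖ ≤ (Fintype.card ι) ^ 2 * κ * ‖v‖ * ‖w‖ := by
  have h : ∀ j k, ‖A j k * v j * conj (w k)‖ ≤ κ * ‖v‖ * ‖w‖ := fun j k => by
    rw [norm_mul, norm_mul, RCLike.norm_conj]
    have h0 : 0 ≤ κ := (norm_nonneg _).trans (hA j k)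
    exact mul_le_mul (mul_le_mul (hA j k) (norm_le_pi_norm v j) (norm_nonneg _) h0)
      (norm_le_pi_norm w k) (norm_nonneg _) (by positivity)
  calc ‖hermC A v w‖ ≤ ∑ j, ∑ k, ‖A j k * v j * conj (w k)‖ :=
        (norm_sum_le _ _).trans (Finset.sum_le_sum fun j _ => norm_sum_le _ _)
    _ ≤ ∑ _j : ι, ∑ _k : ι, κ * ‖v‖ * ‖w‖ :=
        Finset.sum_le_sum fun j _ => Finset.sum_le_sum fun k _ => h j k
    _ = _ := by simp; ring

theorem abs_hermQuad_le (A : Matrix ι ι ℂ) {κ : ℝ} (hA : ∀ j k, ‖A j k‖ ≤ κ) (v : ι → ℂ) :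
    |hermQuad A v| ≤ (Fintype.card ι) ^ 2 * κ * ‖v‖ ^ 2 := by
  rw [hermQuad_eq]
  refine (Complex.abs_re_le_norm _).trans ((norm_hermC_le A hA v v).trans (le_of_eq (by ring)))

/-- A map which is complex linear in the first and conjugate linear in the second argument is given
by its values on the standard basis. -/
theorem sesq_expand [DecidableEq ι] {h : (ι → ℂ) → (ι → ℂ) → ℂ}
    (h1 : ∀ v v' w, h (v + v') w = h v w + h v' w) (h2 : ∀ (c : ℂ) v w, h (c • v) w = c * h v w)
    (h3 : ∀ v w w', h v (w + w') = h v w + h v w')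
    (h4 : ∀ (c : ℂ) v w, h v (c • w) = conj c * h v w) (v w : ι → ℂ) :
    h v w = hermC (Matrix.of fun j k => h (Pi.single j 1) (Pi.single k 1)) v w := by
  let L : (ι → ℂ) →ₗ[ℂ] (ι → ℂ) →ₛₗ[starRingEnd ℂ] ℂ :=
    LinearMap.mk₂'ₛₗ (RingHom.id ℂ) (starRingEnd ℂ) h h1 h2 h3 h4
  have key : L v w = ∑ j, ∑ k, L (Pi.single j 1) (Pi.single k 1) * v j * conj (w k) := by
    conv_lhs => rw [pi_eq_sum_univ' v, pi_eq_sum_univ' w]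
    simp only [map_sum, LinearMap.sum_apply, map_smulₛₗ, LinearMap.smul_apply, smul_eq_mul,
      RingHom.id_apply]
    simp only [Finset.mul_sum]
    rw [Finset.sum_comm]
    exact Finset.sum_congr rfl fun j _ => Finset.sum_congr rfl fun k _ => by ring
  exact key

open scoped ComplexOrder in
theorem posDef_of_hermQuad_pos {A : Matrix ι ι ℂ} (hA : A.IsHermitian)
    (hpos : ∀ ξ : ι → ℂ, ξ ≠ 0 → 0 < hermQuad A ξ) : A.PosDef := by
  refine Matrix.posDef_iff_dotProduct_mulVec.mpr ⟨hA, fun x hx => ?_⟩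
  -- `hermC` conjugates its second argument and the dot product its first, so the two conventions
  -- are matched by evaluating at `star x`.
  have e : star x ⬝ᵥ (A *ᵥ x) = hermC A (star x) (star x) := by
    simp only [dotProduct, mulVec, hermC, Finset.mul_sum, Pi.star_apply]
    refine Finset.sum_congr rfl fun j _ => Finset.sum_congr rfl fun k _ => ?_
    simp; ring
  rw [e, Complex.lt_def]
  refine ⟨?_, ?_⟩
  · exact hpos (star x) (by simpa using hx)
  · simpa using (hermC_self_im hA (star x)).symm

/-- Sum over the `2n` real vectors `f_a`, `√-1 f_a`. -/
noncomputable def frameSum (f : ι → ι → ℂ) (F : (ι → ℂ) → ℝ) : ℝ :=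
  ∑ a, (F (f a) + F (Complex.I • f a))

theorem frameSum_add (f : ι → ι → ℂ) (F G : (ι → ℂ) → ℝ) :
    frameSum f (fun v => F v + G v) = frameSum f F + frameSum f G := by
  simp only [frameSum, ← Finset.sum_add_distrib]
  exact Finset.sum_congr rfl fun a _ => by ring

theorem frameSum_sub (f : ι → ι → ℂ) (F G : (ι → ℂ) → ℝ) :
    frameSum f (fun v => F v - G v) = frameSum f F - frameSum f G := by
  simp only [frameSum, ← Finset.sum_sub_distrib]
  exact Finset.sum_congr rfl fun a _ => by ring

theorem frameSum_mul (f : ι → ι → ℂ) (c : ℝ) (F : (ι → ℂ) → ℝ) :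
    frameSum f (fun v => c * F v) = c * frameSum f F := by
  simp only [frameSum, Finset.mul_sum]
  exact Finset.sum_congr rfl fun a _ => by ring

theorem frameSum_mono (f : ι → ι → ℂ) {F G : (ι → ℂ) → ℝ} (h : ∀ v, F v ≤ G v) :
    frameSum f F ≤ frameSum f G :=
  Finset.sum_le_sum fun _ _ => add_le_add (h _) (h _)

theorem abs_frameSum_le (f : ι → ι → ℂ) {F G : (ι → ℂ) → ℝ} (h : ∀ v, |F v| ≤ G v) :
    |frameSum f F| ≤ frameSum f G :=
  (Finset.abs_sum_le_sum_abs _ _).trans (Finset.sum_le_sum fun _ _ =>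
    (abs_add_le _ _).trans (add_le_add (h _) (h _)))

theorem frameSum_nonneg (f : ι → ι → ℂ) {F : (ι → ℂ) → ℝ} (h : ∀ v, 0 ≤ F v) :
    0 ≤ frameSum f F := Finset.sum_nonneg fun _ _ => add_nonneg (h _) (h _)

/-- Multiplication by `√-1` permutes the `2n` vectors up to sign. -/
theorem frameSum_rot (f : ι → ι → ℂ) {F : (ι → ℂ) → ℝ} (h : ∀ v, F (-v) = F v) :
    frameSum f (fun v => F (Complex.I • v)) = frameSum f F := by
  refine Finset.sum_congr rfl fun a _ => ?_
  have : Complex.I • Complex.I • f a = - f a := by rw [smul_smul]; simp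
  simp only [this, h]; ring

theorem frameSum_norm_sq (f : ι → ι → ℂ) :
    frameSum f (fun v => ‖v‖ ^ 2) = 2 * ∑ a, ‖f a‖ ^ 2 := by
  simp only [frameSum, norm_smul, Complex.norm_I, one_mul, Finset.mul_sum]
  exact Finset.sum_congr rfl fun a _ => by ring

variable [DecidableEq ι]

theorem hermC_single (A : Matrix ι ι ℂ) (j k : ι) :
    hermC A (Pi.single j 1) (Pi.single k 1) = A j k := by
  unfold hermC
  rw [Finset.sum_eq_single j, Finset.sum_eq_single k]
  · simp
  · intro b _ hb; simp [hb]
  · simp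
  · intro b _ hb; simp [Pi.single_apply, hb]
  · simp

/-- A unitary frame `f` of the Hermitian inner product with Gram matrix `A`. -/
structure IsFrame (A : Matrix ι ι ℂ) (f : ι → ι → ℂ) : Prop where
  orth : ∀ a b, hermC A (f a) (f b) = if a = b then 1 else 0
  trace : ∀ B : Matrix ι ι ℂ, ∑ a, hermC B (f a) (f a) = (A⁻¹ * B).trace
  expand : ∀ v : ι → ℂ, v = ∑ a, conj (hermC A (f a) v) • f a
  det : ‖(Matrix.of f).det‖ ^ 2 * A.det.re = 1

open scoped MatrixOrder ComplexOrder in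
-- Factor `A = Cᴴ C` and put `Q = C⁻¹`; then `Qᴴ A Q = 1` and `Q Qᴴ = A⁻¹`. The frame consists of
-- the conjugated columns of `Q`, the conjugation being due to `hermC` being linear in its first
-- argument. All four properties are read off from these two identities.
theorem exists_isFrame {A : Matrix ι ι ℂ} (hA : A.PosDef) : ∃ f, IsFrame A f := by
  obtain ⟨C, hC⟩ : ∃ C : Matrix ι ι ℂ, A = Cᴴ * C :=
    CStarAlgebra.nonneg_iff_eq_star_mul_self.mp hA.posSemidef.nonneg
  have hAu : IsUnit A.det := (Matrix.isUnit_iff_isUnit_det A).mp hA.isUnit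
  have hCu : IsUnit C.det := by
    rw [hC, det_mul] at hAu; exact isUnit_of_mul_isUnit_right hAu
  set Q := C⁻¹ with hQ
  have hQQ : Q * Qᴴ = A⁻¹ := by
    rw [hC, Matrix.mul_inv_rev, hQ, Matrix.conjTranspose_nonsing_inv]
  have hQAQ : Qᴴ * A * Q = 1 := by
    have h1 : C * Q = 1 := Matrix.mul_nonsing_inv C hCu
    have h2 : Qᴴ * Cᴴ = 1 := by rw [← Matrix.conjTranspose_mul, h1, conjTranspose_one]
    calc Qᴴ * A * Q = (Qᴴ * Cᴴ) * (C * Q) := by rw [hC]; simp only [Matrix.mul_assoc]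
      _ = 1 := by rw [h1, h2, Matrix.one_mul]
  have hQQe : ∀ k j, ∑ a, Q k a * conj (Q j a) = A⁻¹ k j := fun k j => by
    rw [← hQQ, Matrix.mul_apply]; rfl
  refine ⟨fun a j => conj (Q j a), ?_, ?_, ?_, ?_⟩
  · intro a b
    have h := congrFun (congrFun hQAQ a) b
    rw [Matrix.one_apply] at h
    rw [← h, Matrix.mul_apply]
    simp only [Matrix.mul_apply, Finset.sum_mul, hermC, Complex.conj_conj, conjTranspose_apply]
    rw [Finset.sum_comm]
    refine Finset.sum_congr rfl fun j _ => Finset.sum_congr rfl fun k _ => ?_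
    simp only [RCLike.star_def]; ring
  · intro B
    simp only [hermC, Matrix.trace, Matrix.diag_apply, Matrix.mul_apply, Complex.conj_conj]
    rw [Finset.sum_comm]
    simp only [← hQQe, Finset.sum_mul]
    rw [Finset.sum_comm]
    rw [Finset.sum_comm]
    conv_rhs => rw [Finset.sum_comm]
    refine Finset.sum_congr rfl fun j _ => ?_
    rw [Finset.sum_comm]
    refine Finset.sum_congr rfl fun k _ => Finset.sum_congr rfl fun a _ => ?_
    ring
  · intro v
    ext j
    simp only [Finset.sum_apply, Pi.smul_apply, smul_eq_mul, hermC, map_sum, map_mul,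
      Complex.conj_conj, Finset.sum_mul]
    have hcA : ∀ l k, conj (A l k) = A k l := fun l k => by rw [← hA.isHermitian.apply k l]; rfl
    rw [Finset.sum_comm]
    have h1 : ∀ l, (∑ a, ∑ k, conj (A l k) * Q l a * v k * conj (Q j a))
        = ∑ k, v k * (A k l * A⁻¹ l j) := fun l => by
      rw [Finset.sum_comm]
      refine Finset.sum_congr rfl fun k _ => ?_
      rw [← hQQe, Finset.mul_sum, Finset.mul_sum]
      refine Finset.sum_congr rfl fun a _ => ?_
      rw [hcA]; ring
    simp only [h1]
    rw [Finset.sum_comm]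
    simp only [← Finset.mul_sum, ← Matrix.mul_apply, Matrix.mul_nonsing_inv A hAu, Matrix.one_apply]
    simp
  · have h1 : (Matrix.of fun a j => conj (Q j a)) = Qᴴ := by ext a j; rfl
    rw [h1]
    have h2 : Qᴴ.det * A.det * Q.det = 1 := by rw [← det_mul, ← det_mul, hQAQ, det_one]
    have h3 : Q.det = conj (Qᴴ.det) := by rw [det_conjTranspose]; simp
    rw [h3] at h2
    have h4 : ((‖Qᴴ.det‖ ^ 2 : ℝ) : ℂ) * A.det = 1 := by
      rw [← h2, ← Complex.normSq_eq_norm_sq, Complex.normSq_eq_conj_mul_self]; ring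
    have h5 := congrArg Complex.re h4
    rwa [Complex.re_ofReal_mul, Complex.one_re] at h5

/-- Expansion of a real linear functional in a unitary frame. -/
theorem IsFrame.frameSum_linear {A : Matrix ι ι ℂ} {f : ι → ι → ℂ} (hf : IsFrame A f)
    (l : (ι → ℂ) →L[ℝ] ℝ) (X : ι → ℂ) :
    frameSum f (fun v => l v * (hermC A v X).re) = l X := by
  conv_rhs => rw [hf.expand X, map_sum]
  refine Finset.sum_congr rfl fun a _ => ?_
  set c := hermC A (f a) X
  -- The real coefficients `Re c` and `-Im c` are the real parts of the pairings of `f a` and `√-1 f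
  -- a` with `X`, which are the weights in the sum.
  have e : conj c • f a = c.re • f a + (-c.im) • (Complex.I • f a) := by
    ext j
    simp only [Pi.smul_apply, Pi.add_apply, smul_eq_mul, Complex.real_smul]
    apply Complex.ext <;> simp
  simp only [e, map_add, map_smul, hermC_smul_left, smul_eq_mul, Complex.mul_re, Complex.I_re,
    Complex.I_im]
  ring

end HermitianAlgebra

end HermitianMA

namespace HermitianMA

/-! ### Uniform bounds for Hermitian matrices and frames by compactness; the derivative of the
determinant. -/

section MatrixBounds

open Matrix ComplexConjugate Set

variable {ι : Type*} [Fintype ι]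

theorem continuous_hermQuad :
    Continuous fun p : (ι → ι → ℂ) × (ι → ℂ) => hermQuad (Matrix.of p.1) p.2 := by
  unfold hermQuad
  simp only [Matrix.of_apply]
  fun_prop

theorem continuous_hermQuad_left (ξ : ι → ℂ) :
    Continuous fun A : ι → ι → ℂ => hermQuad (Matrix.of A) ξ := by
  unfold hermQuad
  simp only [Matrix.of_apply]
  fun_prop

theorem continuous_det_of [DecidableEq ι] :
    Continuous fun A : ι → ι → ℂ => (Matrix.of A).det :=
  Continuous.matrix_det (continuous_id : Continuous fun A : Matrix ι ι ℂ => A)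

/-- Polarization: the three values of the quadratic form at `v + w`, `v`, `w` contribute `4κ + κ +
κ` to twice the real part. -/
theorem abs_re_hermC_le {A : Matrix ι ι ℂ} (hA : A.IsHermitian) {κ : ℝ}
    (hκ : ∀ ξ, |hermQuad A ξ| ≤ κ * ‖ξ‖ ^ 2) (hκ0 : 0 ≤ κ) (v w : ι → ℂ) (hv : ‖v‖ ≤ 1)
    (hw : ‖w‖ ≤ 1) : |(hermC A v w).re| ≤ 3 * κ := by
  have h1 : hermQuad A (v + w) = hermQuad A v + hermQuad A w + 2 * (hermC A v w).re := by
    have := congrArg Complex.re (hermC_conj_symm hA v w)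
    rw [Complex.conj_re] at this
    simp only [hermQuad_eq, hermC_add_left, hermC_add_right, Complex.add_re, ← this]
    ring
  have hvw : ‖v + w‖ ≤ 2 := (norm_add_le _ _).trans (by linarith)
  have b1 := abs_le.mp (hκ (v + w))
  have b2 := abs_le.mp (hκ v)
  have b3 := abs_le.mp (hκ w)
  have n1 : κ * ‖v + w‖ ^ 2 ≤ κ * 4 := by
    apply mul_le_mul_of_nonneg_left _ hκ0
    nlinarith [norm_nonneg (v + w)]
  have n2 : κ * ‖v‖ ^ 2 ≤ κ * 1 := by
    apply mul_le_mul_of_nonneg_left _ hκ0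
    nlinarith [norm_nonneg v]
  have n3 : κ * ‖w‖ ^ 2 ≤ κ * 1 := by
    apply mul_le_mul_of_nonneg_left _ hκ0
    nlinarith [norm_nonneg w]
  rw [abs_le]; constructor <;> linarith

/-- Replacing `w` by `√-1 w` exchanges the imaginary part for a real part, so polarization covers
both. -/
theorem norm_hermC_le_of_quad {A : Matrix ι ι ℂ} (hA : A.IsHermitian) {κ : ℝ}
    (hκ : ∀ ξ, |hermQuad A ξ| ≤ κ * ‖ξ‖ ^ 2) (hκ0 : 0 ≤ κ) (v w : ι → ℂ) (hv : ‖v‖ ≤ 1)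
    (hw : ‖w‖ ≤ 1) : ‖hermC A v w‖ ≤ 6 * κ := by
  have h1 := abs_re_hermC_le hA hκ hκ0 v w hv hw
  have h2 := abs_re_hermC_le hA hκ hκ0 v (Complex.I • w) hv (by simpa [norm_smul] using hw)
  rw [hermC_smul_right] at h2
  have e : (conj Complex.I * hermC A v w).re = (hermC A v w).im := by simp
  rw [e] at h2
  refine (Complex.norm_le_abs_re_add_abs_im _).trans (by linarith)

theorem isCompact_hermitian_bounded (κ : ℝ) :
    IsCompact {A : ι → ι → ℂ | (Matrix.of A).IsHermitian ∧ ∀ j k, ‖A j k‖ ≤ κ} := by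
  refine Metric.isCompact_of_isClosed_isBounded ?_ ?_
  · have : {A : ι → ι → ℂ | (Matrix.of A).IsHermitian ∧ ∀ j k, ‖A j k‖ ≤ κ} =
        ⋂ j, ⋂ k, ({A : ι → ι → ℂ | conj (A j k) = A k j} ∩ {A : ι → ι → ℂ | ‖A j k‖ ≤ κ}) := by
      ext A
      simp only [mem_ofPred_eq, mem_iInter, mem_inter_iff]
      refine ⟨fun h j k => ⟨?_, h.2 j k⟩, fun h => ⟨?_, fun j k => (h j k).2⟩⟩
      · have := h.1.apply k j; simpa using this
      · ext j k; simpa using (h k j).1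
    rw [this]
    refine isClosed_iInter fun j => isClosed_iInter fun k => ?_
    have hc : Continuous fun A : ι → ι → ℂ => A j k := by fun_prop
    have hc' : Continuous fun A : ι → ι → ℂ => A k j := by fun_prop
    exact (isClosed_eq (Complex.continuous_conj.comp hc) hc').inter
      (isClosed_le hc.norm continuous_const)
  · refine (Metric.isBounded_closedBall (x := (0 : ι → ι → ℂ)) (r := max κ 0)).subset ?_
    rintro A ⟨-, h⟩
    rw [mem_closedBall_zero_iff]
    refine (pi_norm_le_iff_of_nonneg (le_max_right _ _)).mpr fun j =>
      (pi_norm_le_iff_of_nonneg (le_max_right _ _)).mpr fun k => (h j k).trans (le_max_left _ _)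

variable [DecidableEq ι]

open scoped ComplexOrder in
/-- Hermitian matrices with bounded entries and determinant bounded away from zero which are
nonnegative are uniformly positive. -/
theorem exists_hermQuad_lower {c : ℝ} (hc : 0 < c) (κ : ℝ) :
    ∃ ε > 0, ∀ A : Matrix ι ι ℂ, A.IsHermitian → (∀ ξ, ξ ≠ 0 → 0 < hermQuad A ξ) →
      (∀ j k, ‖A j k‖ ≤ κ) → c ≤ ‖A.det‖ → ∀ ξ, ε * ‖ξ‖ ^ 2 ≤ hermQuad A ξ := by
  -- Positivity is relaxed to semidefiniteness so that the set is closed; the lower bound on the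
  -- determinant restores definiteness.
  set T : Set (ι → ι → ℂ) := {A | (Matrix.of A).IsHermitian ∧ ∀ j k, ‖A j k‖ ≤ κ} ∩
    ({A | ∀ ξ, 0 ≤ hermQuad (Matrix.of A) ξ} ∩ {A | c ≤ ‖(Matrix.of A).det‖}) with hT
  have hTc : IsCompact T := by
    refine (isCompact_hermitian_bounded κ).inter_right (IsClosed.inter ?_ ?_)
    · simp only [ofPred_forall]
      exact isClosed_iInter fun ξ => isClosed_le continuous_const (continuous_hermQuad_left ξ)
    · exact isClosed_le continuous_const continuous_det_of.norm
  have hKc : IsCompact (T ×ˢ Metric.sphere (0 : ι → ℂ) 1) := hTc.prod (isCompact_sphere _ _)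
  have hpos : ∀ p ∈ T ×ˢ Metric.sphere (0 : ι → ℂ) 1, 0 < hermQuad (Matrix.of p.1) p.2 := by
    rintro ⟨A, ξ⟩ ⟨⟨⟨hH, -⟩, hQ, hd⟩, hξ⟩
    have hξ0 : ξ ≠ 0 := by
      rintro rfl; simp at hξ
    have hps : (Matrix.of A).PosSemidef := by
      refine Matrix.PosSemidef.of_dotProduct_mulVec_nonneg hH fun x => ?_
      have e : star x ⬝ᵥ (Matrix.of A *ᵥ x) = hermC (Matrix.of A) (star x) (star x) := by
        simp only [dotProduct, mulVec, hermC, Finset.mul_sum, Pi.star_apply]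
        refine Finset.sum_congr rfl fun j _ => Finset.sum_congr rfl fun k _ => ?_
        simp; ring
      rw [e, Complex.le_def]
      exact ⟨hQ _, (hermC_self_im hH _).symm⟩
    have hpd := (hps.posDef_iff_det_ne_zero).mpr (by
      intro h0; simp only [mem_ofPred_eq] at hd; rw [h0] at hd; simp at hd; linarith)
    have := (Matrix.posDef_iff_dotProduct_mulVec.mp hpd).2 (x := star ξ) (by simpa using hξ0)
    have e : star (star ξ) ⬝ᵥ (Matrix.of A *ᵥ (star ξ)) = hermC (Matrix.of A) ξ ξ := by
      simp only [dotProduct, mulVec, hermC, Finset.mul_sum, Pi.star_apply, star_star]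
      refine Finset.sum_congr rfl fun j _ => Finset.sum_congr rfl fun k _ => ?_
      simp; ring
    rw [e, Complex.lt_def] at this
    exact this.1
  obtain ⟨ε, hε, hle⟩ : ∃ ε > 0, ∀ p ∈ T ×ˢ Metric.sphere (0 : ι → ℂ) 1,
      ε ≤ hermQuad (Matrix.of p.1) p.2 :=
    hKc.exists_forall_le' continuous_hermQuad.continuousOn hpos
  refine ⟨ε, hε, fun A hH hQ hb hd ξ => ?_⟩
  by_cases hξ : ξ = 0
  · subst hξ; simp [hermQuad]
  have hn : 0 < ‖ξ‖ := norm_pos_iff.mpr hξ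
  -- By homogeneity the minimum over the unit sphere controls every nonzero vector.
  have h1 := hle (A, (‖ξ‖⁻¹ : ℂ) • ξ) ⟨⟨⟨hH, hb⟩, fun η => ?_, hd⟩, ?_⟩
  · simp only at h1
    have e : hermQuad A ((‖ξ‖⁻¹ : ℂ) • ξ) = ‖ξ‖⁻¹ ^ 2 * hermQuad A ξ := by
      rw [hermQuad_eq, hermC_smul_left, hermC_smul_right, hermQuad_eq, ← mul_assoc,
        ← Complex.ofReal_inv, Complex.conj_ofReal, ← Complex.ofReal_mul, Complex.re_ofReal_mul]
      ring
    have h2 : ε ≤ ‖ξ‖⁻¹ ^ 2 * hermQuad A ξ := by rw [← e]; exact h1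
    calc ε * ‖ξ‖ ^ 2 ≤ ‖ξ‖⁻¹ ^ 2 * hermQuad A ξ * ‖ξ‖ ^ 2 := by gcongr
      _ = hermQuad A ξ := by field_simp
  · by_cases h : η = 0
    · subst h; simp [hermQuad]
    · exact (hQ η h).le
  · rw [mem_sphere_zero_iff_norm, norm_smul]
    simp [hn.ne']

/-- A real linear functional bounded away from zero on a fixed vector is bounded away from zero on
bounded frames with determinant bounded away from zero. -/
theorem exists_frameSum_lower {c μ : ℝ} (hc : 0 < c) (hμ : 0 < μ) (κ R : ℝ) (X : ι → ℂ) :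
    ∃ ε > 0, ∀ (f : ι → ι → ℂ) (l : (ι → ℂ) →L[ℝ] ℝ), (∑ a, ‖f a‖ ^ 2) ≤ R →
      c ≤ ‖(Matrix.of f).det‖ → ‖l‖ ≤ κ → μ ≤ |l X| → ε ≤ frameSum f (fun v => l v ^ 2) := by
  set T : Set ((ι → ι → ℂ) × ((ι → ℂ) →L[ℝ] ℝ)) :=
    ({p | (∑ a, ‖p.1 a‖ ^ 2) ≤ R} ∩ {p | c ≤ ‖(Matrix.of p.1).det‖}) ∩
      ({p | ‖p.2‖ ≤ κ} ∩ {p | μ ≤ |p.2 X|})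
  have hcont : Continuous fun p : (ι → ι → ℂ) × ((ι → ℂ) →L[ℝ] ℝ) =>
      frameSum p.1 (fun v => p.2 v ^ 2) := by
    unfold frameSum; fun_prop
  have hTc : IsCompact T := by
    refine Metric.isCompact_of_isClosed_isBounded ?_ ?_
    · have h1 : Continuous fun p : (ι → ι → ℂ) × ((ι → ℂ) →L[ℝ] ℝ) => ∑ a, ‖p.1 a‖ ^ 2 := by
        fun_prop
      have h2 : Continuous fun p : (ι → ι → ℂ) × ((ι → ℂ) →L[ℝ] ℝ) => |p.2 X| := by fun_prop
      exact ((isClosed_le h1 continuous_const).inter (isClosed_le continuous_const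
        (continuous_det_of.comp continuous_fst).norm)).inter
        ((isClosed_le continuous_snd.norm continuous_const).inter
          (isClosed_le continuous_const h2))
    · refine ((Metric.isBounded_closedBall (x := (0 : ι → ι → ℂ)) (r := 1 + R)).prod
        (Metric.isBounded_closedBall (x := (0 : (ι → ℂ) →L[ℝ] ℝ)) (r := κ))).subset ?_
      rintro ⟨f, l⟩ ⟨⟨h1, -⟩, h2, -⟩
      simp only [mem_ofPred_eq] at h1 h2
      refine ⟨?_, by simpa using h2⟩
      have h0 : 0 ≤ R := le_trans (by positivity) h1
      rw [mem_closedBall_zero_iff]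
      refine (pi_norm_le_iff_of_nonneg (by linarith)).mpr fun a => ?_
      have h3 : ‖f a‖ ^ 2 ≤ R := le_trans (Finset.single_le_sum (f := fun a => ‖f a‖ ^ 2)
        (fun _ _ => by positivity) (Finset.mem_univ a)) h1
      nlinarith [norm_nonneg (f a), sq_nonneg (‖f a‖ - 1)]
  have hpos : ∀ p ∈ T, 0 < frameSum p.1 (fun v => p.2 v ^ 2) := by
    rintro ⟨f, l⟩ ⟨⟨-, hd⟩, -, hl⟩
    simp only [mem_ofPred_eq] at hd hl ⊢
    refine lt_of_le_of_ne (frameSum_nonneg f fun v => sq_nonneg _) fun h0 => ?_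
    -- If the sum vanished, `l` would vanish on all `f a` and `√-1 f a`. These span over `ℝ` because
    -- the determinant is nonzero, contradicting `μ ≤ |l X|`.
    have hz : ∀ a, l (f a) = 0 ∧ l (Complex.I • f a) = 0 := by
      intro a
      have := (Finset.sum_eq_zero_iff_of_nonneg (fun a _ =>
        add_nonneg (sq_nonneg (l (f a))) (sq_nonneg (l (Complex.I • f a))))).mp h0.symm a
        (Finset.mem_univ a)
      constructor <;> nlinarith [sq_nonneg (l (f a)), sq_nonneg (l (Complex.I • f a))]
    have hu : IsUnit (Matrix.of f).det := by
      rw [isUnit_iff_ne_zero]; intro h; rw [h] at hd; simp at hd; linarith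
    have hX : X = ∑ a, (X ᵥ* (Matrix.of f)⁻¹) a • f a := by
      have h1 : (X ᵥ* (Matrix.of f)⁻¹) ᵥ* Matrix.of f = X := by
        rw [vecMul_vecMul, Matrix.nonsing_inv_mul _ hu, vecMul_one]
      conv_lhs => rw [← h1]
      ext j
      simp [vecMul, dotProduct]
    have : l X = 0 := by
      rw [hX, map_sum]
      refine Finset.sum_eq_zero fun a _ => ?_
      set z := (X ᵥ* (Matrix.of f)⁻¹) a
      have e : z • f a = z.re • f a + z.im • (Complex.I • f a) := by
        ext j
        simp only [Pi.smul_apply, Pi.add_apply, smul_eq_mul, Complex.real_smul]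
        apply Complex.ext <;> simp <;> ring
      rw [e, map_add, map_smul, map_smul, (hz a).1, (hz a).2]; simp
    rw [this] at hl; simp at hl; linarith
  obtain ⟨ε, hε, hle⟩ := hTc.exists_forall_le' hcont.continuousOn hpos
  exact ⟨ε, hε, fun f l h1 h2 h3 h4 => hle (f, l) ⟨⟨h1, h2⟩, h3, h4⟩⟩

theorem norm_det_le (A : Matrix ι ι ℂ) {κ : ℝ} (hA : ∀ j k, ‖A j k‖ ≤ κ) :
    ‖A.det‖ ≤ (Fintype.card ι).factorial • κ ^ Fintype.card ι :=
  Matrix.det_le (abv := NormedField.toAbsoluteValue ℂ) hA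

/-- The derivative of the determinant along a matrix valued map. -/
theorem fderivWithin_det {E : Type*} [NormedAddCommGroup E] [NormedSpace ℝ E] {S : Set E} {q : E}
    (hS : UniqueDiffWithinAt ℝ S q) {G : E → ι → ι → ℂ} (hG : DifferentiableWithinAt ℝ G S q)
    (hu : IsUnit (Matrix.of (G q)).det) (e : E) :
    fderivWithin ℝ (fun x => (Matrix.of (G x)).det) S q e =
      (Matrix.of (G q)).det * ((Matrix.of (G q))⁻¹ * Matrix.of (fderivWithin ℝ G S q e)).trace := by
  have hd : Differentiable ℝ fun A : ι → ι → ℂ => (Matrix.of A).det := by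
    simp only [Matrix.det_apply, Matrix.of_apply]
    fun_prop
  have h1 := (hd (G q)).hasFDerivAt.comp_hasFDerivWithinAt q hG.hasFDerivWithinAt
  have h1' := h1.fderivWithin hS
  have h2 : fderivWithin ℝ (fun x => (Matrix.of (G x)).det) S q e =
      fderiv ℝ (fun A : ι → ι → ℂ => (Matrix.of A).det) (G q) (fderivWithin ℝ G S q e) := by
    rw [show (fun x => (Matrix.of (G x)).det) = (fun A : ι → ι → ℂ => (Matrix.of A).det) ∘ G
      from rfl, h1']; rfl
  rw [h2]
  set B := fderivWithin ℝ G S q e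
  have h3 : HasDerivAt (fun s : ℝ => (Matrix.of (G q + s • B)).det)
      (fderiv ℝ (fun A : ι → ι → ℂ => (Matrix.of A).det) (G q) B) 0 := by
    have hγ : HasDerivAt (fun s : ℝ => G q + s • B) B 0 := by
      have := ((hasDerivAt_id (0 : ℝ)).smul_const B).const_add (G q)
      rwa [one_smul] at this
    have := (hd (G q + (0 : ℝ) • B)).hasFDerivAt.comp_hasDerivAt (0 : ℝ) hγ
    simp only [zero_smul, add_zero] at this
    exact this
  set A := Matrix.of (G q)
  -- By the chain rule only the derivative along the line `G q + s B` is needed. After factoring out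
  -- `A` the determinant is `det (1 + s A⁻¹ B)`, a polynomial in `s` whose linear coefficient is the
  -- trace.
  have h4 : ∀ s : ℝ, (Matrix.of (G q + s • B)).det =
      A.det * (1 + (A⁻¹ * Matrix.of B).trace * s + (det (1 + (Polynomial.X : Polynomial ℂ) •
        (A⁻¹ * Matrix.of B).map Polynomial.C)).divX.divX.eval (s : ℂ) * (s : ℂ) ^ 2) := by
    intro s
    rw [← Matrix.det_one_add_smul, ← Matrix.det_mul, Matrix.mul_add, Matrix.mul_one,
      Matrix.mul_smul, ← Matrix.mul_assoc, Matrix.mul_nonsing_inv A hu, Matrix.one_mul]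
    congr 1
  have h5 : HasDerivAt (fun s : ℝ => (Matrix.of (G q + s • B)).det)
      (A.det * (A⁻¹ * Matrix.of B).trace) 0 := by
    simp only [h4]
    set p := (det (1 + (Polynomial.X : Polynomial ℂ) •
        (A⁻¹ * Matrix.of B).map Polynomial.C)).divX.divX
    have hs : HasDerivAt (fun s : ℝ => (s : ℂ)) 1 0 := Complex.ofRealCLM.hasDerivAt
    have hp : HasDerivAt (fun s : ℝ => p.eval (s : ℂ)) (p.derivative.eval ((0 : ℝ) : ℂ) * 1) 0 :=
      (p.hasDerivAt _).comp (0 : ℝ) hs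
    have := (((hs.const_mul (A⁻¹ * Matrix.of B).trace).const_add 1).add
      (hp.mul (hs.pow 2))).const_mul A.det
    refine HasDerivAt.congr_deriv (f' := _) this ?_
    simp
  exact h3.unique h5

end MatrixBounds

/-! ### The corner entry of a matrix from its determinant. -/

section Corner

open Matrix

open scoped ComplexOrder in
/-- A bound for the corner entry of a matrix in terms of its determinant, the positivity of the
complementary minor and bounds for the other entries. -/
theorem exists_corner_bound (m : ℕ) {c : ℝ} (hc : 0 < c) (κ : ℝ) :
    ∃ C : ℝ, ∀ A : Matrix (Fin (m + 1)) (Fin (m + 1)) ℂ, A.IsHermitian →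
      (∀ ξ : Fin m → ℂ, c * ∑ α, ‖ξ α‖ ^ 2 ≤
        hermQuad (A.submatrix Fin.castSucc Fin.castSucc) ξ) →
      (∀ j k, ¬ (j = Fin.last m ∧ k = Fin.last m) → ‖A j k‖ ≤ κ) → ‖A.det‖ ≤ κ →
      ‖A (Fin.last m) (Fin.last m)‖ ≤ C := by
  -- The candidates for the complementary block form a compact set of positive definite matrices, so
  -- their determinants stay away from zero.
  set T : Set (Fin m → Fin m → ℂ) := {A | (Matrix.of A).IsHermitian ∧ ∀ j k, ‖A j k‖ ≤ κ} ∩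
    {A | ∀ ξ : Fin m → ℂ, c * ∑ α, ‖ξ α‖ ^ 2 ≤ hermQuad (Matrix.of A) ξ}
  have hTc : IsCompact T := by
    refine (isCompact_hermitian_bounded κ).inter_right ?_
    simp only [Set.ofPred_forall]
    exact isClosed_iInter fun ξ => isClosed_le continuous_const (continuous_hermQuad_left ξ)
  have hpos : ∀ A ∈ T, 0 < ‖(Matrix.of A).det‖ := by
    rintro A ⟨⟨hH, -⟩, hQ⟩
    have hpd := posDef_of_hermQuad_pos hH fun ξ hξ => lt_of_lt_of_le (by
      obtain ⟨j, hj⟩ := Function.ne_iff.mp hξ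
      refine mul_pos hc (Finset.sum_pos' (fun _ _ => by positivity) ⟨j, Finset.mem_univ _, ?_⟩)
      have : 0 < ‖ξ j‖ := norm_pos_iff.mpr hj
      positivity) (hQ ξ)
    exact norm_pos_iff.mpr ((Matrix.isUnit_iff_isUnit_det _).mp hpd.isUnit).ne_zero
  obtain ⟨ε, hε, hle⟩ := hTc.exists_forall_le' (f := fun A => ‖(Matrix.of A).det‖)
    continuous_det_of.norm.continuousOn hpos
  set D : ℝ := m.factorial • κ ^ m
  refine ⟨(κ + m * (κ * D)) / ε, fun A hH hQ hb hd => ?_⟩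
  have hsub : ε ≤ ‖(A.submatrix Fin.castSucc Fin.castSucc).det‖ := by
    refine hle (fun j k => A j.castSucc k.castSucc) ⟨⟨hH.submatrix _, fun j k => hb _ _ ?_⟩, hQ⟩
    exact fun h => (Fin.castSucc_lt_last j).ne h.1
  -- In the expansion along the last row, the corner entry occurs only in the term with the
  -- complementary minor: the other minors omit the last row and therefore consist of controlled
  -- entries.
  have hexp := Matrix.det_succ_row A (Fin.last m)
  rw [Fin.sum_univ_castSucc] at hexp
  simp only [Fin.succAbove_last] at hexp
  have hminor : ∀ j : Fin m, ‖(A.submatrix Fin.castSucc j.castSucc.succAbove).det‖ ≤ D := by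
    intro j
    have := norm_det_le (A.submatrix Fin.castSucc j.castSucc.succAbove) (κ := κ)
      fun i k => hb _ _ fun h => (Fin.castSucc_lt_last i).ne h.1
    simpa [D] using this
  have hsum : ‖∑ j : Fin m, (-1 : ℂ) ^ ((Fin.last m : ℕ) + (j.castSucc : ℕ)) *
      A (Fin.last m) j.castSucc * (A.submatrix Fin.castSucc j.castSucc.succAbove).det‖
      ≤ m * (κ * D) := by
    refine (norm_sum_le _ _).trans ?_
    have : ∀ j ∈ Finset.univ, ‖(-1 : ℂ) ^ ((Fin.last m : ℕ) + ((j : Fin m).castSucc : ℕ)) *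
      A (Fin.last m) j.castSucc * (A.submatrix Fin.castSucc j.castSucc.succAbove).det‖ ≤ κ * D := by
      intro j _
      have h1 := hb (Fin.last m) j.castSucc fun h => (Fin.castSucc_lt_last j).ne h.2
      rw [norm_mul, norm_mul, norm_pow, norm_neg, norm_one, one_pow, one_mul]
      exact mul_le_mul h1 (hminor j) (norm_nonneg _) ((norm_nonneg _).trans h1)
    simpa using Finset.sum_le_card_nsmul _ _ _ this
  have hfin : A (Fin.last m) (Fin.last m) * (A.submatrix Fin.castSucc Fin.castSucc).det =
      A.det - ∑ j : Fin m, (-1 : ℂ) ^ ((Fin.last m : ℕ) + (j.castSucc : ℕ)) *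
      A (Fin.last m) j.castSucc * (A.submatrix Fin.castSucc j.castSucc.succAbove).det := by
    rw [hexp, ← two_mul, pow_mul]; simp
  have h3 : ‖A (Fin.last m) (Fin.last m)‖ * ‖(A.submatrix Fin.castSucc Fin.castSucc).det‖
      ≤ κ + m * (κ * D) := by
    rw [← norm_mul, hfin]
    exact (norm_sub_le _ _).trans (add_le_add hd hsum)
  rw [le_div_iff₀ hε]
  exact (mul_le_mul_of_nonneg_left hsub (norm_nonneg _)).trans h3

end Corner

end HermitianMA

namespace HermitianMA

set_option linter.unusedSectionVars false

/-! ### The Levi form of a real bilinear form. -/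

section Levi

open Matrix ComplexConjugate

variable {ι : Type*} [Fintype ι]

/-- The Levi form of the real bilinear form `B`. -/
noncomputable def levC (B : (ι → ℂ) →L[ℝ] (ι → ℂ) →L[ℝ] ℝ) (v w : ι → ℂ) : ℂ :=
  (((B v w + B (Complex.I • v) (Complex.I • w) : ℝ) : ℂ) +
    Complex.I * ((B v (Complex.I • w) - B (Complex.I • v) w : ℝ) : ℂ)) / 4

theorem re_levC (B : (ι → ℂ) →L[ℝ] (ι → ℂ) →L[ℝ] ℝ) (v w : ι → ℂ) :
    (levC B v w).re = (B v w + B (Complex.I • v) (Complex.I • w)) / 4 := by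
  have : levC B v w = (((B v w + B (Complex.I • v) (Complex.I • w)) / 4 : ℝ) : ℂ) +
    (((B v (Complex.I • w) - B (Complex.I • v) w) / 4 : ℝ) : ℂ) * Complex.I := by
    unfold levC; push_cast; ring
  rw [this]; simp

variable [DecidableEq ι]

/-- The Levi matrix of the real bilinear form `B`. -/
noncomputable def levMat (B : (ι → ℂ) →L[ℝ] (ι → ℂ) →L[ℝ] ℝ) : Matrix ι ι ℂ :=
  Matrix.of fun j k => levC B (Pi.single j 1) (Pi.single k 1)

/-- The combination in `levC` is exactly the complex linear, conjugate linear part of `B`, so it is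
determined by the standard basis. The divisor 4 comes from the two halves in `∂/∂z_j` and `∂/∂z̄_k`.
-/
theorem hermC_levMat (B : (ι → ℂ) →L[ℝ] (ι → ℂ) →L[ℝ] ℝ) (v w : ι → ℂ) :
    hermC (levMat B) v w = levC B v w := by
  have dec : ∀ (c : ℂ) (v : ι → ℂ), c • v = c.re • v + c.im • (Complex.I • v) := fun c v => by
    ext j
    simp only [Pi.smul_apply, Pi.add_apply, smul_eq_mul, Complex.real_smul]
    apply Complex.ext <;> simp <;> ring
  have hII : ∀ v : ι → ℂ, Complex.I • Complex.I • v = -v := fun v => by rw [smul_smul]; simp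
  refine (sesq_expand (h := levC B) ?_ ?_ ?_ ?_ v w).symm
  · intro v v' w
    simp only [levC, smul_add, map_add, _root_.add_apply]
    push_cast; ring
  · intro c v w
    have e : Complex.I • c • v = c.re • (Complex.I • v) - c.im • v := by
      rw [dec c v, smul_add, smul_comm Complex.I c.re, smul_comm Complex.I c.im, hII]; simp
      abel
    simp only [levC, e]
    rw [dec c v]
    simp only [map_add, map_sub, map_smul, _root_.add_apply,
      _root_.sub_apply, _root_.smul_apply, smul_eq_mul]
    conv_rhs => rw [← Complex.re_add_im c]
    apply Complex.ext <;> simp <;> ring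
  · intro v w w'
    simp only [levC, smul_add, map_add]
    push_cast; ring
  · intro c v w
    have e : Complex.I • c • w = c.re • (Complex.I • w) - c.im • w := by
      rw [dec c w, smul_add, smul_comm Complex.I c.re, smul_comm Complex.I c.im, hII]; simp
      abel
    simp only [levC, e]
    rw [dec c w]
    simp only [map_add, map_sub, map_smul, smul_eq_mul]
    have hc : conj c = (c.re : ℂ) - c.im * Complex.I := by
      apply Complex.ext <;> simp
    rw [hc]
    apply Complex.ext <;> simp <;> ring

theorem hermQuad_levMat (B : (ι → ℂ) →L[ℝ] (ι → ℂ) →L[ℝ] ℝ) (v : ι → ℂ) :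
    hermQuad (levMat B) v = (B v v + B (Complex.I • v) (Complex.I • v)) / 4 := by
  rw [hermQuad_eq, hermC_levMat, re_levC]

theorem isHermitian_levMat {B : (ι → ℂ) →L[ℝ] (ι → ℂ) →L[ℝ] ℝ} (hB : ∀ v w, B v w = B w v) :
    (levMat B).IsHermitian := by
  ext j k
  simp only [conjTranspose_apply, levMat, Matrix.of_apply, levC, RCLike.star_def, map_div₀, map_add,
    map_mul, Complex.conj_ofReal, Complex.conj_I]
  rw [hB (Pi.single k 1) (Pi.single j 1), hB (Complex.I • Pi.single k 1) (Complex.I • Pi.single j 1),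
    hB (Pi.single k 1) (Complex.I • Pi.single j 1), hB (Complex.I • Pi.single k 1) (Pi.single j 1)]
  have h4 : conj (4 : ℂ) = 4 := Complex.conj_ofNat 4
  rw [h4]; push_cast; ring

/-- This identifies the frame sum of a Hessian with the linearized operator: if `f` is a unitary
frame of `G`, `IsFrame.trace` makes the right hand side four times the trace of `G⁻¹` times the Levi
matrix. -/
theorem frameSum_quad (f : ι → ι → ℂ) (B : (ι → ℂ) →L[ℝ] (ι → ℂ) →L[ℝ] ℝ) :
    frameSum f (fun v => B v v) = 4 * ∑ a, hermQuad (levMat B) (f a) := by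
  simp only [frameSum, Finset.mul_sum, hermQuad_levMat]
  exact Finset.sum_congr rfl fun a _ => by ring

theorem abs_frameSum_quad_le (f : ι → ι → ℂ) (B : (ι → ℂ) →L[ℝ] (ι → ℂ) →L[ℝ] ℝ) {L : ℝ}
    (hB : ‖B‖ ≤ L) : |frameSum f (fun v => B v v)| ≤ 2 * L * ∑ a, ‖f a‖ ^ 2 := by
  have := abs_frameSum_le f (F := fun v => B v v) (G := fun v => L * ‖v‖ ^ 2) fun v => by
    refine (B.le_opNorm₂ v v).trans ?_
    rw [mul_assoc, ← sq]
    exact mul_le_mul_of_nonneg_right hB (by positivity)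
  rw [frameSum_mul, frameSum_norm_sq] at this
  linarith

end Levi

/-! ### The local Dirichlet problem, the differentiated equation and the cross terms. -/

section LocalStructures

open Set Filter Topology Matrix

variable {ι : Type*} [Fintype ι]

/-- A domain with smooth boundary `{ρ = 0}` (contained in the domain), in terms of derivatives
within the domain. -/
structure BoundaryDomain {E : Type*} [NormedAddCommGroup E] [NormedSpace ℝ E]
    (S : Set E) (ρ : E → ℝ) : Prop where
  uniqueDiff : UniqueDiffOn ℝ S
  subset_closure : S ⊆ closure (interior S)
  smooth : ContDiffOn ℝ ∞ ρ S
  nonneg : ∀ q ∈ S, 0 ≤ ρ q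
  mem_nhds : ∀ q ∈ S, 0 < ρ q → S ∈ 𝓝 q
  inward : ∀ q ∈ S, ρ q = 0 → ∀ f : E → ℝ, DifferentiableWithinAt ℝ f S q → IsLocalMinOn f S q →
    ∀ v, 0 < dd S v ρ q → 0 ≤ dd S v f q
  tangent : ∀ q ∈ S, ρ q = 0 → ∀ f : E → ℝ, DifferentiableWithinAt ℝ f S q →
    (∀ᶠ x in 𝓝[S] q, ρ x = 0 → f x = f q) → ∀ v, dd S v ρ q = 0 → dd S v f q = 0
  exists_compact : ∀ q ∈ S, ∃ r > 0, IsCompact (S ∩ Metric.closedBall q r)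

variable [DecidableEq ι]

/-- A solution of `det (X + u_{jk̄}) = R` on the domain `S` together with the bounds, in terms of
the single constant `κ`, on which the boundary estimates depend. -/
structure LocalSol (S : Set (ι → ℂ)) (ρ φ us : (ι → ℂ) → ℝ) (κ : ℝ) (u : (ι → ℂ) → ℝ)
    (X : (ι → ℂ) → ι → ι → ℂ) (R : (ι → ℂ) → ℝ) : Prop where
  smooth : ContDiffOn ℝ 3 u S
  smooth_X : ContDiffOn ℝ 1 X S
  smooth_R : ContDiffOn ℝ 1 R S
  herm : ∀ q ∈ S, (Matrix.of (X q)).IsHermitian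
  norm_X : ∀ q ∈ S, ‖X q‖ ≤ κ
  norm_dX : ∀ q ∈ S, ‖fderivWithin ℝ X S q‖ ≤ κ
  pos : ∀ q ∈ S, ∀ ξ, ξ ≠ 0 → 0 < hermQuad (Matrix.of (X q) + levMat (D2 S u q)) ξ
  det_eq : ∀ q ∈ S, (Matrix.of (X q) + levMat (D2 S u q)).det = (R q : ℂ)
  le_R : ∀ q ∈ S, κ⁻¹ ≤ R q
  R_le : ∀ q ∈ S, R q ≤ κ
  norm_dR : ∀ q ∈ S, ‖fderivWithin ℝ R S q‖ ≤ κ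
  boundary : ∀ q ∈ S, ρ q = 0 → u q = φ q
  lower : ∀ q ∈ S, us q ≤ u q
  sub_pos : ∀ q ∈ S, ∀ ξ, κ⁻¹ * ‖ξ‖ ^ 2 ≤ hermQuad (Matrix.of (X q) + levMat (D2 S us q)) ξ
  norm_du : ∀ q ∈ S, ‖fderivWithin ℝ u S q‖ ≤ κ

variable {S : Set (ι → ℂ)} {ρ φ us u : (ι → ℂ) → ℝ} {κ : ℝ} {X : (ι → ℂ) → ι → ι → ℂ}
  {R : (ι → ℂ) → ℝ} {q : ι → ℂ}

theorem LocalSol.isHermitian (hs : LocalSol S ρ φ us κ u X R) (hD : BoundaryDomain S ρ)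
    (hq : q ∈ S) : (Matrix.of (X q) + levMat (D2 S u q)).IsHermitian :=
  (hs.herm q hq).add (isHermitian_levMat fun v w =>
    D2_symm hD.uniqueDiff hD.subset_closure (hs.smooth.of_le (by norm_num)) hq v w)

theorem LocalSol.exists_frame (hs : LocalSol S ρ φ us κ u X R) (hD : BoundaryDomain S ρ)
    (hq : q ∈ S) : ∃ f, IsFrame (Matrix.of (X q) + levMat (D2 S u q)) f :=
  exists_isFrame (posDef_of_hermQuad_pos (hs.isHermitian hD hq) (hs.pos q hq))

theorem LocalSol.norm_X_apply (hs : LocalSol S ρ φ us κ u X R) (hq : q ∈ S) (j k : ι) :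
    ‖X q j k‖ ≤ κ :=
  ((norm_le_pi_norm _ k).trans (norm_le_pi_norm _ j)).trans (hs.norm_X q hq)

/-- Derivatives commute: the derivative of the Hessian is the Hessian of the derivative. -/
theorem fderivWithin_levMat {E : Type*} [NormedAddCommGroup E] [NormedSpace ℝ E] {S : Set E}
    {u : E → ℝ} {q : E} (hS : UniqueDiffOn ℝ S) (hcl : S ⊆ closure (interior S))
    (hu : ContDiffOn ℝ 3 u S) (hq : q ∈ S) (e v t : E) :
    fderivWithin ℝ (D2 S u) S q e v t = D2 S (dd S e u) q v t := by
  have h2 : ContDiffOn ℝ 2 u S := hu.of_le (by norm_num)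
  have hD2 : ContDiffOn ℝ 1 (D2 S u) S :=
    (contDiffOn_fderivWithin hS hu (k := 2) (by norm_num)).fderivWithin hS (m := 1) (by norm_num)
  have hdt : ContDiffOn ℝ 2 (dd S t u) S := contDiffOn_dd hS hu (by norm_num) t
  have hde : ContDiffOn ℝ 2 (dd S e u) S := contDiffOn_dd hS hu (by norm_num) e
  have h1 : fderivWithin ℝ (D2 S u) S q e v t = dd S e (fun x => D2 S u x v t) q := by
    unfold dd
    have hd := hD2.differentiableOn (by norm_num) q hq
    have hA : fderivWithin ℝ (fun x => D2 S u x v) S q e = fderivWithin ℝ (D2 S u) S q e v := by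
      rw [fderivWithin_clm_apply (hS q hq) hd (differentiableWithinAt_const v)]; simp
    rw [fderivWithin_clm_apply (hS q hq) (hd.clm_apply (differentiableWithinAt_const v))
      (differentiableWithinAt_const t)]
    simp [hA]
  rw [h1, dd_congr (w' := dd S v (dd S t u)) (fun x hx => D2_apply hS h2 hx v t) hq,
    dd_comm hS hcl hdt hq, dd_congr (w' := dd S t (dd S e u)) (fun x hx => dd_comm hS hcl h2 hx e t) hq,
    D2_apply hS hde hq]

/-- The differentiated equation. -/
theorem LocalSol.frameSum_deriv_le (hs : LocalSol S ρ φ us κ u X R) (hD : BoundaryDomain S ρ)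
    (hκ : 1 ≤ κ) (hq : q ∈ S) {f : ι → ι → ℂ}
    (hf : IsFrame (Matrix.of (X q) + levMat (D2 S u q)) f) (e : ι → ℂ) :
    |frameSum f (fun v => D2 S (dd S e u) q v v)| ≤
      4 * ((Fintype.card ι) ^ 2 + 1) * κ ^ 2 * ‖e‖ * (1 + ∑ a, ‖f a‖ ^ 2) := by
  have hS := hD.uniqueDiff
  set σ := ∑ a, ‖f a‖ ^ 2
  have hσ : 0 ≤ σ := Finset.sum_nonneg fun _ _ => by positivity
  set Lm : (ι → ℂ) → ι → ι → ℂ := fun x j k => levMat (D2 S u x) j k with hLm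
  have hD2 : ContDiffOn ℝ 1 (D2 S u) S :=
    (contDiffOn_fderivWithin hS hs.smooth (k := 2) (by norm_num)).fderivWithin hS (m := 1)
      (by norm_num)
  have hD2d := hD2.differentiableOn (by norm_num) q hq
  have hcoef : ∀ v t, HasFDerivWithinAt (fun x => D2 S u x v t)
      (((fderivWithin ℝ (D2 S u) S q).flip v).flip t) S q := fun v t => by
    have h1 := hD2d.hasFDerivWithinAt.clm_apply (hasFDerivWithinAt_const v q S)
    have h2 := h1.clm_apply (hasFDerivWithinAt_const t q S)
    refine h2.congr_fderiv ?_
    ext e; simp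
  -- The derivative of the Levi matrix is written out so that, once third derivatives are commuted,
  -- its value at `e` is visibly the Levi matrix of the Hessian of `u_e`.
  have hLd : HasFDerivWithinAt Lm (ContinuousLinearMap.pi fun j => ContinuousLinearMap.pi fun k =>
      (4 : ℂ)⁻¹ • (Complex.ofRealCLM ∘L (((fderivWithin ℝ (D2 S u) S q).flip (Pi.single j 1)).flip
          (Pi.single k 1) + ((fderivWithin ℝ (D2 S u) S q).flip (Complex.I • Pi.single j 1)).flip
          (Complex.I • Pi.single k 1)) + Complex.I • (Complex.ofRealCLM ∘L
          (((fderivWithin ℝ (D2 S u) S q).flip (Pi.single j 1)).flip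
          (Complex.I • Pi.single k 1) - ((fderivWithin ℝ (D2 S u) S q).flip
          (Complex.I • Pi.single j 1)).flip (Pi.single k 1))))) S q := by
    refine hasFDerivWithinAt_pi.mpr fun j => hasFDerivWithinAt_pi.mpr fun k => ?_
    have h1 := Complex.ofRealCLM.hasFDerivAt.comp_hasFDerivWithinAt q
      ((hcoef (Pi.single j 1) (Pi.single k 1)).add
        (hcoef (Complex.I • Pi.single j 1) (Complex.I • Pi.single k 1)))
    have h2 := Complex.ofRealCLM.hasFDerivAt.comp_hasFDerivWithinAt q
      ((hcoef (Pi.single j 1) (Complex.I • Pi.single k 1)).sub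
        (hcoef (Complex.I • Pi.single j 1) (Pi.single k 1)))
    have h3 := (h1.add (h2.const_smul Complex.I)).const_smul (4 : ℂ)⁻¹
    refine h3.congr_of_eventuallyEq (.of_forall fun x => ?_) ?_ <;>
    · simp [levMat, levC]
      ring
  have hXd := hs.smooth_X.differentiableOn (by norm_num) q hq
  set G : (ι → ℂ) → ι → ι → ℂ := fun x => X x + Lm x with hG
  have hGd : HasFDerivWithinAt G _ S q := hXd.hasFDerivWithinAt.add hLd
  have hGe : Matrix.of (fderivWithin ℝ G S q e) =
      Matrix.of (fderivWithin ℝ X S q e) + levMat (D2 S (dd S e u) q) := by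
    rw [hGd.fderivWithin (hS q hq)]
    ext j k
    simp only [Matrix.of_apply, Matrix.add_apply, _root_.add_apply, Pi.add_apply,
      ContinuousLinearMap.pi_apply, _root_.smul_apply, ContinuousLinearMap.comp_apply,
      _root_.sub_apply, ContinuousLinearMap.flip_apply, levMat, levC,
      fderivWithin_levMat hS hD.subset_closure hs.smooth hq, Complex.ofRealCLM_apply, smul_eq_mul]
    ring
  have hGq : Matrix.of (G q) = Matrix.of (X q) + levMat (D2 S u q) := rfl
  have hRq : 0 < R q := lt_of_lt_of_le (by positivity) (hs.le_R q hq)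
  have hdet := fderivWithin_det (hS q hq) hGd.differentiableWithinAt (by
    rw [hGq, hs.det_eq q hq, isUnit_iff_ne_zero]; exact_mod_cast hRq.ne') e
  have hdet' : fderivWithin ℝ (fun x => (Matrix.of (G x)).det) S q e = ((dd S e R q : ℝ) : ℂ) := by
    have h1 : EqOn (fun x => (Matrix.of (G x)).det) (fun x => (R x : ℂ)) S :=
      fun x hx => hs.det_eq x hx
    rw [fderivWithin_congr h1 (h1 hq)]
    have h2 := Complex.ofRealCLM.hasFDerivAt.comp_hasFDerivWithinAt q
      (hs.smooth_R.differentiableOn (by norm_num) q hq).hasFDerivWithinAt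
    have h3 := h2.fderivWithin (hS q hq)
    change fderivWithin ℝ (⇑Complex.ofRealCLM ∘ R) S q e = _
    rw [h3]; simp [dd]
  -- The equation now reads `R_e = R (tr G⁻¹ X_e + tr G⁻¹ Lev(u_e))`, and both traces are sums over
  -- the frame.
  rw [hdet', hGq, hs.det_eq q hq, ← hf.trace, hGe] at hdet
  simp only [hermC_add_mat, Finset.sum_add_distrib] at hdet
  have hre := congrArg Complex.re hdet
  rw [Complex.re_ofReal_mul, Complex.ofReal_re, Complex.add_re, Complex.re_sum, Complex.re_sum] at hre
  simp only [← hermQuad_eq] at hre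
  rw [frameSum_quad]
  set T := ∑ a, hermQuad (levMat (D2 S (dd S e u) q)) (f a)
  have hXb : |∑ a, hermQuad (Matrix.of (fderivWithin ℝ X S q e)) (f a)|
      ≤ (Fintype.card ι) ^ 2 * (κ * ‖e‖) * σ := by
    refine (Finset.abs_sum_le_sum_abs _ _).trans ?_
    rw [Finset.mul_sum]
    refine Finset.sum_le_sum fun a _ => abs_hermQuad_le _ (fun j k => ?_) _
    exact ((norm_le_pi_norm _ k).trans (norm_le_pi_norm _ j)).trans
      ((ContinuousLinearMap.le_opNorm _ _).trans
        (mul_le_mul_of_nonneg_right (hs.norm_dX q hq) (norm_nonneg _)))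
  have hT : T = (dd S e R q) / R q - ∑ a, hermQuad (Matrix.of (fderivWithin ℝ X S q e)) (f a) := by
    field_simp; linarith
  have hdR : |dd S e R q / R q| ≤ κ ^ 2 * ‖e‖ := by
    rw [abs_div, abs_of_pos hRq, div_le_iff₀ hRq]
    have h1 : |dd S e R q| ≤ κ * ‖e‖ := (ContinuousLinearMap.le_opNorm _ _).trans
        (mul_le_mul_of_nonneg_right (hs.norm_dR q hq) (norm_nonneg _))
    have h2 : κ * κ⁻¹ = 1 := mul_inv_cancel₀ (by positivity)
    have h3 := mul_le_mul_of_nonneg_left (hs.le_R q hq) (by positivity : 0 ≤ κ ^ 2 * ‖e‖)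
    calc |dd S e R q| ≤ κ * ‖e‖ := h1
      _ = κ ^ 2 * ‖e‖ * κ⁻¹ := by rw [sq]; linear_combination (-κ * ‖e‖) * h2
      _ ≤ _ := h3
  rw [abs_mul, abs_of_pos (by norm_num : (0 : ℝ) < 4), hT]
  have h4 : |dd S e R q / R q - ∑ a, hermQuad (Matrix.of (fderivWithin ℝ X S q e)) (f a)|
      ≤ κ ^ 2 * ‖e‖ + (Fintype.card ι) ^ 2 * (κ * ‖e‖) * σ :=
    (abs_sub _ _).trans (add_le_add hdR hXb)
  have h5 : κ * ‖e‖ ≤ κ ^ 2 * ‖e‖ := by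
    apply mul_le_mul_of_nonneg_right _ (norm_nonneg _); nlinarith
  have h6 : ((Fintype.card ι : ℝ)) ^ 2 * (κ * ‖e‖) * σ ≤ (Fintype.card ι) ^ 2 * (κ ^ 2 * ‖e‖) * σ := by
    gcongr
  have h7 : 0 ≤ κ ^ 2 * ‖e‖ := by positivity
  nlinarith [mul_nonneg h7 hσ, mul_nonneg h7 (by positivity : (0 : ℝ) ≤ (Fintype.card ι : ℝ) ^ 2)]

/-- The cross terms `∑ l(f) u_{f v₀}` are controlled by the derivatives of `u_{√-1 v₀} - a u_{v₀}`. -/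
theorem exists_cross_bound (v0 : ι → ℂ) (κ κ1 L : ℝ) {η : ℝ} (hη : 0 < η) :
    ∃ C : ℝ, 0 ≤ C ∧ ∀ (A : Matrix ι ι ℂ) (B : (ι → ℂ) →L[ℝ] (ι → ℂ) →L[ℝ] ℝ) (f : ι → ι → ℂ),
      IsFrame (A + levMat B) f → (∀ j k, ‖A j k‖ ≤ κ) →
      ∀ (l p : (ι → ℂ) →L[ℝ] ℝ) (a : ℝ) (e : (ι → ℂ) → ℝ), ‖l‖ ≤ L → |a| ≤ L →
      (∀ v, |e v| ≤ κ1 * ‖v‖) → (∀ v, B v (Complex.I • v0) = p v + a * B v v0 + e v) →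
      |frameSum f (fun v => l v * B v v0)| ≤
        C * (1 + ∑ b, ‖f b‖ ^ 2) + η * frameSum f (fun v => p v ^ 2) := by
  set n2 : ℝ := (Fintype.card ι : ℝ) ^ 2
  refine ⟨4 * |L| * ‖v0‖ * (1 + |L|) + 2 * (|L| * ((4 * (n2 * |κ| * ‖v0‖) + |κ1|) * (1 + |L|))) + L ^ 2 / η,
    by positivity, ?_⟩
  intro A B f hf hA l p a e hl ha he hB
  set σ := ∑ b, ‖f b‖ ^ 2
  have hσ : 0 ≤ σ := Finset.sum_nonneg fun _ _ => by positivity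
  have hL : 0 ≤ L := (norm_nonneg l).trans hl
  rw [abs_of_nonneg hL]
  set Q := frameSum f (fun v => p v ^ 2)
  set x : (ι → ℂ) → ℝ := fun v => B v v0
  have hII : ∀ v : ι → ℂ, Complex.I • Complex.I • v = -v := fun v => by rw [smul_smul]; simp
  -- The Levi form supplies a relation free of unknown second derivatives on its right hand side:
  -- the pairing with the full matrix is summed exactly by the frame, and `A` is bounded.
  have hid : ∀ v, x v + B (Complex.I • v) (Complex.I • v0) =
      4 * (hermC (A + levMat B) v v0).re - 4 * (hermC A v v0).re := fun v => by
    rw [hermC_add_mat, Complex.add_re, hermC_levMat, re_levC]; ring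
  -- The Levi relation at `v` and at `√-1 v`, with the derivatives towards `√-1 v0` eliminated by
  -- the hypothesis on `B`, is a linear system for `x v` and `x (√-1 v)` with determinant `1 + a²`.
  have hx : ∀ v, (1 + a ^ 2) * x v = 4 * (hermC (A + levMat B) v v0).re
      - a * (4 * (hermC (A + levMat B) v (-Complex.I • v0)).re)
      + (-4 * (hermC A v v0).re + a * (4 * (hermC A v (-Complex.I • v0)).re)
        - e (Complex.I • v) - a * e v) + (-p (Complex.I • v) - a * p v) := fun v => by
    have h1 := hid v
    have h2 := hid (Complex.I • v)
    rw [hII, map_neg, _root_.neg_apply, hB v] at h2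
    rw [hB (Complex.I • v)] at h1
    have h3 : ∀ M : Matrix ι ι ℂ, hermC M (Complex.I • v) v0 = hermC M v (-Complex.I • v0) :=
      fun M => by rw [hermC_smul_left, hermC_smul_right]; simp
    rw [h3, h3] at h2
    simp only [x] at h1 h2 ⊢
    linear_combination h1 - a * h2
  set main : (ι → ℂ) → ℝ := fun v => -4 * (hermC A v v0).re +
    a * (4 * (hermC A v (-Complex.I • v0)).re) - e (Complex.I • v) - a * e v with hmain
  -- `IsFrame.frameSum_linear` evaluates the pairings with the full matrix to `l v0` and `l (-√-1
  -- v0)`, which are bounded independently of `σ`.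
  have hsplit : (1 + a ^ 2) * frameSum f (fun v => l v * x v) =
      4 * l v0 - 4 * a * l (-Complex.I • v0) + frameSum f (fun v => l v * main v)
      + frameSum f (fun v => l v * (-p (Complex.I • v) - a * p v)) := by
    rw [← hf.frameSum_linear l v0, ← hf.frameSum_linear l (-Complex.I • v0), ← frameSum_mul,
      ← frameSum_mul, ← frameSum_mul, ← frameSum_sub, ← frameSum_add, ← frameSum_add]
    congr 1; funext v
    linear_combination l v * hx v
  have hmb : ∀ v, |main v| ≤ (4 * (n2 * |κ| * ‖v0‖) + |κ1|) * (1 + L) * ‖v‖ := fun v => by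
    have hA' : ∀ w : ι → ℂ, ‖w‖ = ‖v0‖ → |(hermC A v w).re| ≤ n2 * |κ| * ‖v0‖ * ‖v‖ := fun w hw =>
      (Complex.abs_re_le_norm _).trans ((norm_hermC_le A
        (fun j k => (hA j k).trans (le_abs_self κ)) v w).trans (le_of_eq (by rw [hw]; ring)))
    have a1 := abs_le.mp (hA' v0 rfl)
    have a2 := hA' (-Complex.I • v0) (by rw [norm_smul]; simp)
    have a3 : |e (Complex.I • v)| ≤ |κ1| * ‖v‖ := (he _).trans (by
      rw [norm_smul]; simp only [Complex.norm_I, one_mul]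
      exact mul_le_mul_of_nonneg_right (le_abs_self _) (norm_nonneg _))
    have a4 : |e v| ≤ |κ1| * ‖v‖ := (he _).trans
      (mul_le_mul_of_nonneg_right (le_abs_self _) (norm_nonneg _))
    have a5 : |a * (4 * (hermC A v (-Complex.I • v0)).re)| ≤ L * (4 * (n2 * |κ| * ‖v0‖ * ‖v‖)) := by
      rw [abs_mul, abs_mul, abs_of_pos (by norm_num : (0 : ℝ) < 4)]
      gcongr
    have a6 : |a * e v| ≤ L * (|κ1| * ‖v‖) := by
      rw [abs_mul]; gcongr
    rw [abs_le] at a3 a5 a6 ⊢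
    simp only [hmain]
    constructor <;> nlinarith
  have b1 : |l v0| ≤ L * ‖v0‖ := (l.le_opNorm _).trans (by gcongr)
  have b2 : |a * l (-Complex.I • v0)| ≤ L * (L * ‖v0‖) := by
    rw [abs_mul]
    refine mul_le_mul ha ((l.le_opNorm _).trans ?_) (abs_nonneg _) hL
    rw [norm_smul]; simp; gcongr
  have b3 : |frameSum f (fun v => l v * main v)| ≤
      L * ((4 * (n2 * |κ| * ‖v0‖) + |κ1|) * (1 + L)) * (2 * σ) := by
    rw [← frameSum_norm_sq, ← frameSum_mul]
    refine abs_frameSum_le f fun v => ?_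
    rw [abs_mul]
    calc |l v| * |main v| ≤ (L * ‖v‖) * ((4 * (n2 * |κ| * ‖v0‖) + |κ1|) * (1 + L) * ‖v‖) :=
          mul_le_mul ((l.le_opNorm _).trans (by gcongr)) (hmb v) (abs_nonneg _) (by positivity)
      _ = _ := by ring
  -- Weighted Cauchy inequality. The sum of squares of `p` appears with the factor `1 + a²`, which
  -- cancels against the same factor on the left, so the final coefficient is exactly `η`.
  have b4 : |frameSum f (fun v => l v * (-p (Complex.I • v) - a * p v))| ≤
      L ^ 2 / η * σ + (1 + a ^ 2) * (η * Q) := by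
    have e1 : frameSum f (fun v => L ^ 2 / (2 * η) * ‖v‖ ^ 2 +
        (η * p (Complex.I • v) ^ 2 + η * a ^ 2 * p v ^ 2)) =
        L ^ 2 / η * σ + (1 + a ^ 2) * (η * Q) := by
      rw [frameSum_add, frameSum_add, frameSum_mul, frameSum_mul, frameSum_mul, frameSum_norm_sq,
        frameSum_rot f (F := fun v => p v ^ 2) (fun v => by simp)]
      field_simp; ring
    rw [← e1]
    refine abs_frameSum_le f fun v => ?_
    have h1 : |l v| ≤ L * ‖v‖ := (l.le_opNorm _).trans (by gcongr)
    set y := -p (Complex.I • v) - a * p v with hy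
    have h2 : |l v * y| ≤ L ^ 2 / (2 * η) * ‖v‖ ^ 2 + η / 2 * y ^ 2 := by
      have h3 : |l v * y| ≤ L * ‖v‖ * |y| := by rw [abs_mul]; gcongr
      have h4 : 0 ≤ (L * ‖v‖ - η * |y|) ^ 2 / (2 * η) := by positivity
      have h5 : (L * ‖v‖ - η * |y|) ^ 2 / (2 * η) =
        L ^ 2 / (2 * η) * ‖v‖ ^ 2 + η / 2 * y ^ 2 - L * ‖v‖ * |y| := by
        rw [← sq_abs y]; field_simp; ring
      linarith
    have h6 : y ^ 2 ≤ 2 * p (Complex.I • v) ^ 2 + 2 * (a ^ 2 * p v ^ 2) := by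
      rw [hy]; nlinarith [sq_nonneg (p (Complex.I • v) - a * p v)]
    nlinarith
  have hQ : 0 ≤ Q := frameSum_nonneg f fun v => sq_nonneg _
  set Fx := frameSum f (fun v => l v * x v)
  have key : (1 + a ^ 2) * |Fx| ≤ 4 * (L * ‖v0‖) + 4 * (L * (L * ‖v0‖)) +
      L * ((4 * (n2 * |κ| * ‖v0‖) + |κ1|) * (1 + L)) * (2 * σ) + (L ^ 2 / η * σ + (1 + a ^ 2) * (η * Q)) := by
    rw [← abs_of_pos (by positivity : 0 < 1 + a ^ 2), ← abs_mul, hsplit,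
      abs_of_pos (by positivity : 0 < 1 + a ^ 2)]
    rw [abs_le] at b1 b2 b3 b4 ⊢
    constructor <;> linarith
  set W := L * ((4 * (n2 * |κ| * ‖v0‖) + |κ1|) * (1 + L))
  have hW : 0 ≤ W := by positivity
  have hLη : 0 ≤ L ^ 2 / η := by positivity
  set Z := 4 * L * ‖v0‖ * (1 + L) + 2 * W + L ^ 2 / η
  have hZ : 0 ≤ Z := by positivity
  have k2 : 4 * (L * ‖v0‖) + 4 * (L * (L * ‖v0‖)) + W * (2 * σ) + L ^ 2 / η * σ ≤ Z * (1 + σ) := by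
    have h8 : 0 ≤ 4 * L * ‖v0‖ * (1 + L) := by positivity
    simp only [Z]
    nlinarith [mul_nonneg h8 hσ]
  have k3 : (1 + a ^ 2) * |Fx| ≤ (1 + a ^ 2) * (Z * (1 + σ) + η * Q) := by
    have : 0 ≤ a ^ 2 * (Z * (1 + σ)) := by positivity
    nlinarith
  exact le_of_mul_le_mul_left k3 (by positivity)

end LocalStructures

end HermitianMA

namespace HermitianMA

/-! ### Local `C²` bounds. -/

section Bounds

open Set Filter Topology

variable {E V : Type*} [NormedAddCommGroup E] [NormedSpace ℝ E] [NormedAddCommGroup V]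
  [NormedSpace ℝ V] {S U : Set E} {a : E → V} {L : ℝ}

/-- The `C²` norm of `a` on `S ∩ U` is at most `L`. -/
def C2Bound (S U : Set E) (L : ℝ) (a : E → V) : Prop :=
  ∀ q ∈ S, q ∈ U → ‖a q‖ ≤ L ∧ ‖fderivWithin ℝ a S q‖ ≤ L ∧ ‖D2 S a q‖ ≤ L

theorem C2Bound.mono {U' : Set E} {L' : ℝ} (h : C2Bound S U L a) (hU : U' ⊆ U) (hL : L ≤ L') :
    C2Bound S U' L' a := fun q hq hq' =>
  ⟨(h q hq (hU hq')).1.trans hL, (h q hq (hU hq')).2.1.trans hL, (h q hq (hU hq')).2.2.trans hL⟩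

theorem C2Bound.dd_le (h : C2Bound S U L a) {q : E} (hq : q ∈ S) (hq' : q ∈ U) (v : E) :
    ‖dd S v a q‖ ≤ L * ‖v‖ :=
  (ContinuousLinearMap.le_opNorm _ _).trans
    (mul_le_mul_of_nonneg_right (h q hq hq').2.1 (norm_nonneg _))

/-- Parameters such as a direction `t`, a vector `ξ` or the number `m0` enter the coefficients
through a linear functional applied to a fixed function. Bounds uniform in the parameter then only
need the norm of the functional. -/
theorem C2Bound.clm_comp (hS : UniqueDiffOn ℝ S) (ha : ContDiffOn ℝ 2 a S) (h : C2Bound S U L a)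
    {W : Type*} [NormedAddCommGroup W] [NormedSpace ℝ W] (l : V →L[ℝ] W) {c : ℝ} (hl : ‖l‖ ≤ c) :
    C2Bound S U (c * L) (fun x => l (a x)) := by
  have h1 : EqOn (fderivWithin ℝ (fun x => l (a x)) S)
      (fun x => ContinuousLinearMap.compL ℝ E V W l (fderivWithin ℝ a S x)) S := fun x hx =>
    (l.hasFDerivAt.comp_hasFDerivWithinAt x
      (ha.differentiableOn (by norm_num) x hx).hasFDerivWithinAt).fderivWithin (hS x hx)
  intro q hq hqU
  have hc : 0 ≤ c := (norm_nonneg l).trans hl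
  obtain ⟨b0, b1, b2⟩ := h q hq hqU
  have hL : 0 ≤ L := (norm_nonneg _).trans b0
  refine ⟨(l.le_opNorm _).trans (mul_le_mul hl b0 (norm_nonneg _) hc), ?_, ?_⟩
  · rw [h1 hq]
    exact (ContinuousLinearMap.opNorm_comp_le _ _).trans (mul_le_mul hl b1 (norm_nonneg _) hc)
  · unfold D2
    rw [fderivWithin_congr h1 (h1 hq)]
    have h2 := (ContinuousLinearMap.compL ℝ E V W l).hasFDerivAt.comp_hasFDerivWithinAt q
      ((contDiffOn_fderivWithin hS ha (k := 1) (by norm_num)).differentiableOn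
        (by norm_num) q hq).hasFDerivWithinAt
    have h3 := h2.fderivWithin (hS q hq)
    change ‖fderivWithin ℝ (⇑(ContinuousLinearMap.compL ℝ E V W l) ∘ fderivWithin ℝ a S) S q‖ ≤ _
    rw [h3]
    refine (ContinuousLinearMap.opNorm_comp_le _ _).trans (mul_le_mul ?_ b2 (norm_nonneg _) hc)
    refine ContinuousLinearMap.opNorm_le_bound _ hc fun B => ?_
    exact (ContinuousLinearMap.opNorm_comp_le _ _).trans
      (mul_le_mul_of_nonneg_right hl (norm_nonneg _))

theorem exists_C2Bound (hS : UniqueDiffOn ℝ S) (ha : ContDiffOn ℝ 2 a S) {p : E} (hp : p ∈ S) :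
    ∃ L, ∃ r > 0, C2Bound S (Metric.ball p r) L a := by
  have h0 := ha.continuousOn.norm p hp
  have h1 := (contDiffOn_fderivWithin hS ha (k := 1) (by norm_num)).continuousOn.norm p hp
  have h2 : ContinuousWithinAt (fun q => ‖D2 S a q‖) S p :=
    (continuous_norm (E := E →L[ℝ] E →L[ℝ] V)).continuousAt.comp_continuousWithinAt
      (f := D2 S a) (continuousOn_D2 hS ha p hp)
  set L := max ‖a p‖ (max ‖fderivWithin ℝ a S p‖ ‖D2 S a p‖) + 1
  have e0 : ∀ᶠ q in 𝓝[S] p, ‖a q‖ < L := h0.eventually_lt_const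
    (lt_of_le_of_lt (le_max_left _ _) (lt_add_one _))
  have e1 : ∀ᶠ q in 𝓝[S] p, ‖fderivWithin ℝ a S q‖ < L := h1.eventually_lt_const
    (lt_of_le_of_lt ((le_max_left _ _).trans (le_max_right _ _)) (lt_add_one _))
  have e2 : ∀ᶠ q in 𝓝[S] p, ‖D2 S a q‖ < L := h2.eventually_lt_const
    (lt_of_le_of_lt ((le_max_right _ _).trans (le_max_right _ _)) (lt_add_one _))
  obtain ⟨r, hr, h⟩ := Metric.mem_nhdsWithin_iff.mp (e0.and (e1.and e2))
  refine ⟨L, r, hr, fun q hq hq' => ?_⟩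
  have := h ⟨hq', hq⟩
  exact ⟨this.1.le, this.2.1.le, this.2.2.le⟩

end Bounds

/-! ### A smooth squared distance. -/

section SquaredDistance

open ComplexConjugate

variable {ι : Type*} [Fintype ι]

/-- The squared Euclidean distance to `p`. -/
noncomputable def sqDist (p q : ι → ℂ) : ℝ := ∑ j, ‖q j - p j‖ ^ 2

theorem hasFDerivAt_sqDist (p q : ι → ℂ) :
    HasFDerivAt (sqDist p) (∑ j, (2 : ℝ) • (innerSL ℝ (q j - p j)).comp
      (ContinuousLinearMap.proj (R := ℝ) (φ := fun _ : ι => ℂ) j)) q := by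
  unfold sqDist
  refine HasFDerivAt.fun_sum fun j _ => ?_
  have h : HasFDerivAt (fun q : ι → ℂ => q j - p j)
    (ContinuousLinearMap.proj (R := ℝ) (φ := fun _ : ι => ℂ) j) q :=
    (ContinuousLinearMap.proj (R := ℝ) (φ := fun _ : ι => ℂ) j).hasFDerivAt.sub_const (p j)
  exact h.norm_sq.congr_fderiv (by ext; simp [two_smul])

theorem contDiff_sqDist (p : ι → ℂ) {k : ℕ∞ω} : ContDiff ℝ k (sqDist p) := by
  unfold sqDist
  refine ContDiff.sum fun j _ => ContDiff.norm_sq ℝ ?_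
  exact (contDiff_apply ℝ ℂ j).sub contDiff_const

theorem D2_sqDist {S : Set (ι → ℂ)} (hS : UniqueDiffOn ℝ S) {q : ι → ℂ} (hq : q ∈ S)
    (p v : ι → ℂ) : D2 S (sqDist p) q v v ≤ 2 * Fintype.card ι * ‖v‖ ^ 2 := by
  have h1 : ∀ x ∈ S, dd S v (sqDist p) x = ∑ j, 2 * inner ℝ (x j - p j) (v j) := fun x hx => by
    unfold dd
    rw [(hasFDerivAt_sqDist p x).hasFDerivWithinAt.fderivWithin (hS x hx)]
    simp only [_root_.sum_apply, _root_.smul_apply, ContinuousLinearMap.comp_apply,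
      ContinuousLinearMap.proj_apply, innerSL_apply_apply, smul_eq_mul]
  have h2 : HasFDerivAt (fun x : ι → ℂ => ∑ j, 2 * inner ℝ (x j - p j) (v j))
      (∑ j, (2 : ℝ) • ((innerSL ℝ).flip (v j)).comp
        (ContinuousLinearMap.proj (R := ℝ) (φ := fun _ : ι => ℂ) j)) q := by
    refine HasFDerivAt.fun_sum fun j _ => ?_
    have h : HasFDerivAt (fun q : ι → ℂ => q j - p j)
      (ContinuousLinearMap.proj (R := ℝ) (φ := fun _ : ι => ℂ) j) q :=
      (ContinuousLinearMap.proj (R := ℝ) (φ := fun _ : ι => ℂ) j).hasFDerivAt.sub_const (p j)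
    exact ((((innerSL ℝ).flip (v j)).hasFDerivAt (x := q j - p j)).comp q h).const_mul 2
  rw [D2_apply hS (contDiff_sqDist p).contDiffOn hq, dd_congr h1 hq]
  unfold dd
  rw [h2.hasFDerivWithinAt.fderivWithin (hS q hq)]
  simp only [_root_.sum_apply, _root_.smul_apply,
    ContinuousLinearMap.comp_apply, ContinuousLinearMap.proj_apply,
    ContinuousLinearMap.flip_apply, innerSL_apply_apply, smul_eq_mul, real_inner_self_eq_norm_sq]
  calc ∑ j, 2 * ‖v j‖ ^ 2 ≤ ∑ _j : ι, 2 * ‖v‖ ^ 2 := by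
        gcongr with j; exact norm_le_pi_norm v j
    _ = _ := by simp; ring

theorem dd_sqDist_self {S : Set (ι → ℂ)} (hS : UniqueDiffOn ℝ S) {p : ι → ℂ} (hp : p ∈ S)
    (v : ι → ℂ) : dd S v (sqDist p) p = 0 := by
  unfold dd
  rw [(hasFDerivAt_sqDist p p).hasFDerivWithinAt.fderivWithin (hS p hp)]
  simp

theorem sqDist_nonneg (p q : ι → ℂ) : 0 ≤ sqDist p q := Finset.sum_nonneg fun _ _ => by positivity

theorem sqDist_self (p : ι → ℂ) : sqDist p p = 0 := by simp [sqDist]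

/-- The norm on `ι → ℂ` is the supremum norm, which is not smooth. The Euclidean square replaces it
in the comparison function, and this inequality keeps it large on spheres of the supremum norm. -/
theorem dist_sq_le_sqDist (p q : ι → ℂ) : dist q p ^ 2 ≤ sqDist p q := by
  have h : dist q p ≤ √(sqDist p q) := by
    refine (dist_pi_le_iff (Real.sqrt_nonneg _)).mpr fun j => Real.le_sqrt_of_sq_le ?_
    rw [dist_eq_norm]
    exact Finset.single_le_sum (f := fun j => ‖q j - p j‖ ^ 2) (fun _ _ => by positivity)
      (Finset.mem_univ j)
  calc dist q p ^ 2 ≤ √(sqDist p q) ^ 2 := by gcongr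
    _ = _ := Real.sq_sqrt (sqDist_nonneg p q)

end SquaredDistance

/-! ### First order expressions under the linearized operator, and the barrier. -/

section Barrier

open Set Filter Topology Matrix

set_option linter.unusedSectionVars false

variable {ι : Type*} [Fintype ι] [DecidableEq ι]
variable {S : Set (ι → ℂ)} {ρ φ us u : (ι → ℂ) → ℝ} {κ : ℝ} {X : (ι → ℂ) → ι → ι → ℂ}
  {R : (ι → ℂ) → ℝ} {q : ι → ℂ} {v0 : ι → ℂ}

/-- A first order expression `u_t + a u_{v₀} + b` in `u`. -/
noncomputable def firstOrder (S : Set (ι → ℂ)) (v0 : ι → ℂ) (u : (ι → ℂ) → ℝ) (t : ι → ℂ)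
    (a b : (ι → ℂ) → ℝ) (q : ι → ℂ) : ℝ := dd S t u q + a q * dd S v0 u q + b q

theorem contDiffOn_firstOrder (hS : UniqueDiffOn ℝ S) (hu : ContDiffOn ℝ 3 u S) (t : ι → ℂ)
    {a b : (ι → ℂ) → ℝ} (ha : ContDiffOn ℝ 2 a S) (hb : ContDiffOn ℝ 2 b S) :
    ContDiffOn ℝ 2 (firstOrder S v0 u t a b) S :=
  ((contDiffOn_dd hS hu (by norm_num) t).add
    (ha.mul (contDiffOn_dd hS hu (by norm_num) v0))).add hb

theorem dd_firstOrder (hS : UniqueDiffOn ℝ S) (hu : ContDiffOn ℝ 3 u S) (t : ι → ℂ)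
    {a b : (ι → ℂ) → ℝ} (ha : ContDiffOn ℝ 2 a S) (hb : ContDiffOn ℝ 2 b S) (hq : q ∈ S)
    (v : ι → ℂ) : dd S v (firstOrder S v0 u t a b) q =
      D2 S u q v t + a q * D2 S u q v v0 + dd S v0 u q * dd S v a q + dd S v b q := by
  have h1 : ContDiffOn ℝ 1 (dd S t u) S := contDiffOn_dd hS hu (by norm_num) t
  have h2 : ContDiffOn ℝ 1 (dd S v0 u) S := contDiffOn_dd hS hu (by norm_num) v0
  have ha1 := ha.of_le (m := 1) (by norm_num)
  have hb1 := hb.of_le (m := 1) (by norm_num)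
  have hu2 := hu.of_le (m := 2) (by norm_num)
  unfold firstOrder
  rw [dd_add hS (h1.add (ha1.mul h2)) hb1 hq, dd_add hS h1 (ha1.mul h2) hq, dd_mul hS ha1 h2 hq,
    D2_apply hS hu2 hq, D2_apply hS hu2 hq]
  ring

/-- The third derivatives occur as Hessians of derivatives of `u`, which the differentiated equation
controls. The only term needing a new idea is the product of `da` with the unknown second
derivatives `D2 S u q v v0`. -/
theorem D2_firstOrder (hS : UniqueDiffOn ℝ S) (hu : ContDiffOn ℝ 3 u S) (t : ι → ℂ)
    {a b : (ι → ℂ) → ℝ} (ha : ContDiffOn ℝ 2 a S) (hb : ContDiffOn ℝ 2 b S) (hq : q ∈ S)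
    (v : ι → ℂ) : D2 S (firstOrder S v0 u t a b) q v v =
      D2 S (dd S t u) q v v + a q * D2 S (dd S v0 u) q v v + dd S v0 u q * D2 S a q v v
      + 2 * (fderivWithin ℝ a S q v * D2 S u q v v0) + D2 S b q v v := by
  have h1 : ContDiffOn ℝ 2 (dd S t u) S := contDiffOn_dd hS hu (by norm_num) t
  have h2 : ContDiffOn ℝ 2 (dd S v0 u) S := contDiffOn_dd hS hu (by norm_num) v0
  have hu2 := hu.of_le (m := 2) (by norm_num)
  unfold firstOrder
  rw [D2_add hS (h1.add (ha.mul h2)) hb hq, D2_add hS h1 (ha.mul h2) hq, _root_.add_apply,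
    _root_.add_apply, _root_.add_apply, _root_.add_apply, D2_mul hS ha h2 hq, D2_apply hS hu2 hq]
  change _ = _ + _ + _ + 2 * (dd S v a q * _) + _
  ring

/-- Bound for the linearized operator on first order expressions. -/
theorem exists_frameSum_firstOrder_bound (v0 : ι → ℂ) {κ : ℝ} (hκ : 1 ≤ κ) (L : ℝ) {η : ℝ}
    (hη : 0 < η) : ∃ C : ℝ, 0 ≤ C ∧ ∀ (S U : Set (ι → ℂ)) (ρ φ us : (ι → ℂ) → ℝ)
      (u : (ι → ℂ) → ℝ) (X : (ι → ℂ) → ι → ι → ℂ) (R : (ι → ℂ) → ℝ),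
      BoundaryDomain S ρ → LocalSol S ρ φ us κ u X R → ∀ (t : ι → ℂ) (a b aP bP : (ι → ℂ) → ℝ),
      ContDiffOn ℝ 2 a S → ContDiffOn ℝ 2 b S → ContDiffOn ℝ 2 aP S → ContDiffOn ℝ 2 bP S →
      C2Bound S U L a → C2Bound S U L b → C2Bound S U L aP → C2Bound S U L bP → ‖t‖ ≤ L →
      ∀ q ∈ S, q ∈ U → ∀ f, IsFrame (Matrix.of (X q) + levMat (D2 S u q)) f →
      |frameSum f (fun v => D2 S (firstOrder S v0 u t a b) q v v)| ≤ C * (1 + ∑ i, ‖f i‖ ^ 2) +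
        η * frameSum f (fun v => fderivWithin ℝ (firstOrder S v0 u (Complex.I • v0) aP bP) S q v ^ 2) := by
  -- Half of `η`, because the cross term carries the coefficient 2.
  obtain ⟨C1, hC1, hcross⟩ := exists_cross_bound v0 κ (L * (κ * ‖v0‖) + L) L (half_pos hη)
  set n1 : ℝ := 4 * ((Fintype.card ι : ℝ) ^ 2 + 1) * κ ^ 2
  have hκ0 : 0 < κ := by linarith
  refine ⟨n1 * |L| + |L| * (n1 * ‖v0‖) + 2 * (κ * ‖v0‖ * |L|) + 2 * C1 + 2 * |L|, by positivity, ?_⟩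
  intro S U ρ φ us u X R hD hs t a b aP bP ha hb haP hbP ha' hb' haP' hbP' ht q hq hqU f hf
  have hS := hD.uniqueDiff
  have hL : 0 ≤ L := (norm_nonneg t).trans ht
  rw [abs_of_nonneg hL]
  set σ := ∑ b, ‖f b‖ ^ 2
  have hσ : 0 ≤ σ := Finset.sum_nonneg fun _ _ => by positivity
  set P := firstOrder S v0 u (Complex.I • v0) aP bP
  set Q := frameSum f (fun v => fderivWithin ℝ P S q v ^ 2)
  have hduv0 : |dd S v0 u q| ≤ κ * ‖v0‖ := (ContinuousLinearMap.le_opNorm _ _).trans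
    (mul_le_mul_of_nonneg_right (hs.norm_du q hq) (norm_nonneg _))
  -- The relation required on `D2 S u q v (√-1 v0)` is the formula for the differential of `P`,
  -- solved for that second derivative; hence `-aP` as coefficient and the lower order terms of `dP`
  -- as error.
  have hc := hcross (Matrix.of (X q)) (D2 S u q) f hf (hs.norm_X_apply hq) (fderivWithin ℝ a S q)
    (fderivWithin ℝ P S q) (-aP q) (fun v => -(dd S v0 u q * dd S v aP q + dd S v bP q))
    (ha' q hq hqU).2.1 (by rw [abs_neg]; exact (haP' q hq hqU).1) (fun v => by
      rw [abs_neg]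
      refine (abs_add_le _ _).trans ?_
      rw [abs_mul, add_mul]
      refine add_le_add ?_ (hbP'.dd_le hq hqU v)
      calc |dd S v0 u q| * |dd S v aP q| ≤ (κ * ‖v0‖) * (L * ‖v‖) :=
            mul_le_mul hduv0 (haP'.dd_le hq hqU v) (abs_nonneg _) (by positivity)
        _ = _ := by ring) (fun v => by
      have := dd_firstOrder (v0 := v0) hS hs.smooth (Complex.I • v0) haP hbP hq v
      change fderivWithin ℝ P S q v = _ at this
      rw [this]; ring)
  have e : frameSum f (fun v => D2 S (firstOrder S v0 u t a b) q v v) =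
      frameSum f (fun v => D2 S (dd S t u) q v v) + a q * frameSum f (fun v => D2 S (dd S v0 u) q v v)
      + dd S v0 u q * frameSum f (fun v => D2 S a q v v)
      + 2 * frameSum f (fun v => fderivWithin ℝ a S q v * D2 S u q v v0)
      + frameSum f (fun v => D2 S b q v v) := by
    simp only [← frameSum_mul, ← frameSum_add]
    congr 1; funext v
    exact D2_firstOrder hS hs.smooth t ha hb hq v
  have h1 := hs.frameSum_deriv_le hD hκ hq hf t
  have h2 := hs.frameSum_deriv_le hD hκ hq hf v0
  have h3 := abs_frameSum_quad_le f (D2 S a q) (ha' q hq hqU).2.2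
  have h4 := abs_frameSum_quad_le f (D2 S b q) (hb' q hq hqU).2.2
  have g1 : |frameSum f (fun v => D2 S (dd S t u) q v v)| ≤ n1 * L * (1 + σ) := h1.trans (by gcongr)
  have g2 : |a q * frameSum f (fun v => D2 S (dd S v0 u) q v v)| ≤ L * (n1 * ‖v0‖ * (1 + σ)) := by
    rw [abs_mul]; exact mul_le_mul (ha' q hq hqU).1 h2 (abs_nonneg _) hL
  have g3 : |dd S v0 u q * frameSum f (fun v => D2 S a q v v)| ≤ (κ * ‖v0‖) * (2 * L * σ) := by
    rw [abs_mul]; exact mul_le_mul hduv0 h3 (abs_nonneg _) (by positivity)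
  rw [e]
  have hm : 0 ≤ κ * ‖v0‖ * L := by positivity
  have g3' : (κ * ‖v0‖) * (2 * L * σ) ≤ 2 * (κ * ‖v0‖ * L) * (1 + σ) := by nlinarith
  have g4' : 2 * L * σ ≤ 2 * L * (1 + σ) := by nlinarith
  rw [abs_le] at g1 g2 g3 hc h4 ⊢
  constructor <;> nlinarith

/-- The barrier `(u - us) + τ ρ - N ρ²` is strictly superharmonic for the linearized operator. -/
theorem exists_barrier (hD : BoundaryDomain S ρ) (hv0 : ∀ q ∈ S, 0 < dd S v0 ρ q)
    (hus : ContDiffOn ℝ 2 us S) (hκ : 1 ≤ κ) {p : ι → ℂ} (hp : p ∈ S) (hρp : ρ p = 0) :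
    ∃ r > 0, ∃ τ > 0, ∃ N > 0, ∃ ε > 0, ∀ q ∈ S, q ∈ Metric.ball p r →
      0 ≤ τ * ρ q - N * (ρ q * ρ q) ∧ ∀ u X R, LocalSol S ρ φ us κ u X R →
      ∀ f, IsFrame (Matrix.of (X q) + levMat (D2 S u q)) f →
      frameSum f (fun v => D2 S (fun x => (u x - us x) + (τ * ρ x - N * (ρ x * ρ x))) q v v) ≤
        -ε * (1 + ∑ i, ‖f i‖ ^ 2) := by
  have hS := hD.uniqueDiff
  have hκ0 : 0 < κ := by linarith
  have hρ2 : ContDiffOn ℝ 2 ρ S := hD.smooth.of_le (by norm_cast)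
  obtain ⟨L, r1, hr1, hL⟩ := exists_C2Bound hS hρ2 hp
  have hL0 : 0 ≤ L := (abs_nonneg _).trans (hL p hp (Metric.mem_ball_self hr1)).1
  set n : ℝ := (Fintype.card ι : ℝ)
  -- Threshold for `σ`: beyond it the subsolution term `2 κ⁻¹ σ` alone exceeds `4n + 1`.
  set Rb : ℝ := κ * (4 * n + 1) / 2
  set μ := dd S v0 ρ p / 2
  have hμ : 0 < μ := half_pos (hv0 p hp)
  obtain ⟨ε1, hε1, hfr⟩ := exists_frameSum_lower (ι := ι) (inv_pos.mpr hκ0) hμ L Rb v0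
  -- Below the threshold the sum of `(dρ)²` is at least `ε1`, and this `N` makes `2 N ε1 = 4n + 1`.
  set N := (4 * n + 1) / (2 * ε1)
  have hN : 0 < N := by positivity
  -- Small enough for the Hessian of `τ ρ` to cost at most `κ⁻¹ σ`.
  set τ := κ⁻¹ / (2 * L + 1)
  have hτ : 0 < τ := by positivity
  have e1 : ∀ᶠ q in 𝓝[S] p, μ < dd S v0 ρ q :=
    ((contDiffOn_dd hS hρ2 (k := 1) (by norm_num) v0).continuousOn p hp).eventually_const_lt
      (half_lt_self (hv0 p hp))
  -- Here `τ - 2 N ρ` is positive, which gives both the nonnegativity of `τ ρ - N ρ²` and the sign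
  -- needed in the Hessian estimate.
  have e2 : ∀ᶠ q in 𝓝[S] p, ρ q < τ / (2 * N) :=
    (hρ2.continuousOn p hp).eventually_lt_const (by rw [hρp]; positivity)
  obtain ⟨r2, hr2, h2⟩ := Metric.mem_nhdsWithin_iff.mp (e1.and e2)
  refine ⟨min r1 r2, lt_min hr1 hr2, τ, hτ, N, hN, min κ⁻¹ 1, lt_min (by positivity) one_pos,
    fun q hq hqb => ?_⟩
  have hqb1 := Metric.ball_subset_ball (min_le_left _ _) hqb
  obtain ⟨hq1, hq2⟩ := h2 ⟨Metric.ball_subset_ball (min_le_right _ _) hqb, hq⟩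
  have hρ0 := hD.nonneg q hq
  rw [lt_div_iff₀ (by positivity)] at hq2
  refine ⟨by nlinarith, fun u X R hs f hf => ?_⟩
  set σ := ∑ b, ‖f b‖ ^ 2
  have hσ : 0 ≤ σ := Finset.sum_nonneg fun _ _ => by positivity
  have hu2 : ContDiffOn ℝ 2 u S := hs.smooth.of_le (by norm_num)
  set Q := frameSum f (fun v => fderivWithin ℝ ρ S q v ^ 2)
  have hQ : 0 ≤ Q := frameSum_nonneg f fun v => sq_nonneg _
  have hsplit : frameSum f
      (fun v => D2 S (fun x => (u x - us x) + (τ * ρ x - N * (ρ x * ρ x))) q v v) =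
      frameSum f (fun v => D2 S u q v v) - frameSum f (fun v => D2 S us q v v) +
      ((τ - 2 * N * ρ q) * frameSum f (fun v => D2 S ρ q v v) - 2 * N * Q) := by
    simp only [Q, ← frameSum_mul, ← frameSum_sub, ← frameSum_add]
    congr 1; funext v
    rw [D2_add hS (hu2.sub hus) ((contDiffOn_const.mul hρ2).sub
      (contDiffOn_const.mul (hρ2.mul hρ2))) hq, D2_sub hS hu2 hus hq,
      D2_sub hS (contDiffOn_const.mul hρ2) (contDiffOn_const.mul (hρ2.mul hρ2)) hq,
      D2_const_mul hS hρ2 hq, D2_const_mul hS (hρ2.mul hρ2) hq]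
    simp only [_root_.add_apply, _root_.sub_apply, _root_.smul_apply, smul_eq_mul,
      D2_mul hS hρ2 hρ2 hq]
    simp only [dd]
    ring
  -- On a unitary frame the form of the solution equals 1, while that of the subsolution is at least
  -- `κ⁻¹ ‖f a‖²`; the common term `X` drops out of the difference.
  have hlev : frameSum f (fun v => D2 S u q v v) - frameSum f (fun v => D2 S us q v v) ≤
      4 * n - 4 * κ⁻¹ * σ := by
    rw [frameSum_quad, frameSum_quad]
    have h1 : ∀ a, hermQuad (levMat (D2 S u q)) (f a) - hermQuad (levMat (D2 S us q)) (f a) ≤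
        1 - κ⁻¹ * ‖f a‖ ^ 2 := fun a => by
      have h3 := hs.sub_pos q hq (f a)
      have h4 : hermQuad (Matrix.of (X q) + levMat (D2 S u q)) (f a) = 1 := by
        rw [hermQuad_eq, hf.orth]; simp
      rw [hermQuad_add_mat] at h3 h4
      linarith
    have h5 := Finset.sum_le_sum fun (a : ι) (_ : a ∈ Finset.univ) => h1 a
    rw [Finset.sum_sub_distrib, Finset.sum_sub_distrib, ← Finset.mul_sum] at h5
    simp only [Finset.sum_const, Finset.card_univ, nsmul_eq_mul, mul_one] at h5
    linarith
  have hρ' : (τ - 2 * N * ρ q) * frameSum f (fun v => D2 S ρ q v v) ≤ κ⁻¹ * σ := by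
    have h3 := (le_abs_self _).trans (abs_frameSum_quad_le f (D2 S ρ q) (hL q hq hqb1).2.2)
    have h4 : 0 ≤ τ - 2 * N * ρ q := by linarith
    have h5 : τ - 2 * N * ρ q ≤ τ := by
      have : 0 ≤ 2 * N * ρ q := by positivity
      linarith
    have h6 : τ * (2 * L) ≤ κ⁻¹ := by
      simp only [τ]; rw [div_mul_eq_mul_div, div_le_iff₀ (by positivity)]
      have : 0 < κ⁻¹ := by positivity
      nlinarith
    calc _ ≤ (τ - 2 * N * ρ q) * (2 * L * σ) := mul_le_mul_of_nonneg_left h3 h4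
      _ ≤ τ * (2 * L * σ) := mul_le_mul_of_nonneg_right h5 (by positivity)
      _ = τ * (2 * L) * σ := by ring
      _ ≤ _ := mul_le_mul_of_nonneg_right h6 hσ
  rw [hsplit]
  have hmain : 4 * n + 1 ≤ 2 * κ⁻¹ * σ + 2 * N * Q := by
    by_cases hc : σ ≤ Rb
    -- `|det f|² det G = 1` and `det G ≤ κ`, while `κ⁻¹ ≤ 1`.
    · have hdet : κ⁻¹ ≤ ‖(Matrix.of f).det‖ := by
        have h3 := hf.det
        rw [hs.det_eq q hq, Complex.ofReal_re] at h3
        have hR := hs.R_le q hq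
        by_contra hlt
        push Not at hlt
        have h4 : κ⁻¹ ≤ 1 := inv_le_one_of_one_le₀ hκ
        have h5 : ‖(Matrix.of f).det‖ ^ 2 < κ⁻¹ := by
          nlinarith [norm_nonneg (Matrix.of f).det]
        have h6 : ‖(Matrix.of f).det‖ ^ 2 * R q ≤ ‖(Matrix.of f).det‖ ^ 2 * κ :=
          mul_le_mul_of_nonneg_left hR (by positivity)
        have h7 : ‖(Matrix.of f).det‖ ^ 2 * κ < κ⁻¹ * κ := mul_lt_mul_of_pos_right h5 hκ0
        rw [inv_mul_cancel₀ hκ0.ne'] at h7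
        linarith
      have h3 := hfr f (fderivWithin ℝ ρ S q) hc hdet (hL q hq hqb1).2.1
        (hq1.le.trans (le_abs_self _))
      have h4 : 2 * N * ε1 = 4 * n + 1 := by simp only [N]; field_simp
      have h5 : 2 * N * ε1 ≤ 2 * N * Q := by gcongr
      have : 0 ≤ 2 * κ⁻¹ * σ := by positivity
      linarith
    · push Not at hc
      have h3 : 2 * κ⁻¹ * Rb = 4 * n + 1 := by simp only [Rb]; field_simp
      have h4 : 2 * κ⁻¹ * Rb ≤ 2 * κ⁻¹ * σ := by gcongr
      have : 0 ≤ 2 * N * Q := by positivity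
      linarith
  have hε : min κ⁻¹ 1 * (1 + σ) ≤ 1 + κ⁻¹ * σ := by
    rw [mul_add, mul_one]
    exact add_le_add (min_le_right _ _) (mul_le_mul_of_nonneg_right (min_le_left _ _) hσ)
  linarith

end Barrier

end HermitianMA

namespace HermitianMA

/-! ### The comparison function, and Hessians of functions vanishing on the boundary. -/

section BoundaryGradient

open Set Filter Topology Matrix

set_option linter.unusedSectionVars false

variable {ι : Type*} [Fintype ι] [DecidableEq ι]
variable {S : Set (ι → ℂ)} {ρ φ us u : (ι → ℂ) → ℝ} {κ : ℝ} {X : (ι → ℂ) → ι → ι → ℂ}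
  {R : (ι → ℂ) → ℝ} {q : ι → ℂ} {v0 : ι → ℂ}

theorem LocalSol.dd_le (hs : LocalSol S ρ φ us κ u X R) (hq : q ∈ S) (v : ι → ℂ) :
    |dd S v u q| ≤ κ * ‖v‖ :=
  (ContinuousLinearMap.le_opNorm _ _).trans
    (mul_le_mul_of_nonneg_right (hs.norm_du q hq) (norm_nonneg _))

theorem LocalSol.abs_firstOrder_le (hs : LocalSol S ρ φ us κ u X R) (hq : q ∈ S)
    {U : Set (ι → ℂ)} (hqU : q ∈ U) {L : ℝ} {t : ι → ℂ} {a b : (ι → ℂ) → ℝ} (ha : C2Bound S U L a)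
    (hb : C2Bound S U L b) :
    |firstOrder S v0 u t a b q| ≤ κ * ‖t‖ + L * (κ * ‖v0‖) + L := by
  have hL : 0 ≤ L := (norm_nonneg _).trans (ha q hq hqU).1
  refine (abs_add_le _ _).trans (add_le_add ((abs_add_le _ _).trans (add_le_add (hs.dd_le hq t) ?_))
    (hb q hq hqU).1)
  rw [abs_mul]
  exact mul_le_mul (ha q hq hqU).1 (hs.dd_le hq v0) (abs_nonneg _) hL

/-- One sided bound at the boundary for the normal derivative of first order expressions which are
nonnegative on the boundary and vanish at the given point. -/
theorem exists_boundary_gradient_bound (hD : BoundaryDomain S ρ) (hv0 : ∀ q ∈ S, 0 < dd S v0 ρ q)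
    (hus : ContDiffOn ℝ 2 us S) (hub : ∀ q ∈ S, ρ q = 0 → us q = φ q) (hκ : 1 ≤ κ) {p : ι → ℂ}
    (hp : p ∈ S) (hρp : ρ p = 0) :
    ∃ r0 > 0, ∀ r, 0 < r → r ≤ r0 → ∀ L : ℝ, ∃ C : ℝ, ∀ u X R, LocalSol S ρ φ us κ u X R →
      ∀ (t : ι → ℂ) (a b aP bP : (ι → ℂ) → ℝ),
      ContDiffOn ℝ 2 a S → ContDiffOn ℝ 2 b S → ContDiffOn ℝ 2 aP S → ContDiffOn ℝ 2 bP S →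
      C2Bound S (Metric.ball p r) L a → C2Bound S (Metric.ball p r) L b →
      C2Bound S (Metric.ball p r) L aP → C2Bound S (Metric.ball p r) L bP → ‖t‖ ≤ L →
      (∀ q ∈ S, q ∈ Metric.ball p r → ρ q = 0 →
        firstOrder S v0 u (Complex.I • v0) aP bP q = 0) →
      (∀ q ∈ S, q ∈ Metric.ball p r → ρ q = 0 → 0 ≤ firstOrder S v0 u t a b q) →
      ∀ p' ∈ S, p' ∈ Metric.ball p (r / 2) → ρ p' = 0 → firstOrder S v0 u t a b p' = 0 →
      -C ≤ dd S v0 (firstOrder S v0 u t a b) p' := by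
  have hS := hD.uniqueDiff
  have hκ0 : 0 < κ := by linarith
  have hρ2 : ContDiffOn ℝ 2 ρ S := hD.smooth.of_le (by norm_cast)
  obtain ⟨r1, hr1, τ, hτ, N, hN, ε, hε, hbar⟩ := exists_barrier (φ := φ) hD hv0 hus hκ hp hρp
  obtain ⟨Lus, r2, hr2, hLus⟩ := exists_C2Bound hS hus hp
  obtain ⟨Lρ, r3, hr3, hLρ⟩ := exists_C2Bound hS hρ2 hp
  obtain ⟨r4, hr4, hcomp⟩ := hD.exists_compact p hp
  refine ⟨min (min r1 r2) (min r3 r4), by positivity, ?_⟩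
  intro r hr hrle L
  have hrr1 : r ≤ r1 := hrle.trans ((min_le_left _ _).trans (min_le_left _ _))
  have hrr2 : r ≤ r2 := hrle.trans ((min_le_left _ _).trans (min_le_right _ _))
  have hrr3 : r ≤ r3 := hrle.trans ((min_le_right _ _).trans (min_le_left _ _))
  have hrr4 : r ≤ r4 := hrle.trans ((min_le_right _ _).trans (min_le_right _ _))
  set MP := κ * ‖v0‖ + |L| * (κ * ‖v0‖) + |L|
  have hMP : 0 ≤ MP := by positivity
  set MG := κ * |L| + |L| * (κ * ‖v0‖) + |L|
  have hMG : 0 ≤ MG := by positivity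
  -- With this choice the sums of `(dP)²` generated by `G` and by `P` times its Hessian total at
  -- most three quarters of one such sum, whereas `-P²` supplies two with the good sign.
  set η : ℝ := 1 / (4 * (MP + 1))
  have hη : 0 < η := by positivity
  obtain ⟨C1, hC1, hfo⟩ := exists_frameSum_firstOrder_bound v0 hκ (max |L| ‖v0‖) hη
  -- On the sphere of radius `r / 4` the quadratic term outweighs `G - P²`.
  set B := (MP ^ 2 + MG) / (r / 4) ^ 2
  have hB : 0 ≤ B := by positivity
  set n : ℝ := (Fintype.card ι : ℝ)
  have hn : 0 ≤ n := by positivity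
  -- The barrier has to dominate the quadratic term, the part of `2 P` times the operator on `P` not
  -- absorbed by `(dP)²`, the operator on `G`, and one unit more for strictness.
  set A := (4 * n * B + 2 * MP * C1 + C1 + 1) / ε
  have hA : 0 ≤ A := by positivity
  have hLus0 : 0 ≤ Lus := (norm_nonneg _).trans (hLus p hp (Metric.mem_ball_self hr2)).1
  have hLρ0 : 0 ≤ Lρ := (norm_nonneg _).trans (hLρ p hp (Metric.mem_ball_self hr3)).1
  refine ⟨A * ((κ + Lus + τ * Lρ) * ‖v0‖), ?_⟩
  intro u X R hs t a b aP bP ha hb haP hbP ha' hb' haP' hbP' ht hP0 hG0 p' hp' hpp' hρp' hGp'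
  have hu2 : ContDiffOn ℝ 2 u S := hs.smooth.of_le (by norm_num)
  set G := firstOrder S v0 u t a b
  set P := firstOrder S v0 u (Complex.I • v0) aP bP
  have hG2 : ContDiffOn ℝ 2 G S := contDiffOn_firstOrder hS hs.smooth t ha hb
  have hP2 : ContDiffOn ℝ 2 P S := contDiffOn_firstOrder hS hs.smooth _ haP hbP
  set v : (ι → ℂ) → ℝ := fun x => (u x - us x) + (τ * ρ x - N * (ρ x * ρ x)) with hv
  have hρv : ContDiffOn ℝ 2 (fun x => τ * ρ x - N * (ρ x * ρ x)) S :=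
    (contDiffOn_const.mul hρ2).sub (contDiffOn_const.mul (hρ2.mul hρ2))
  have hv2 : ContDiffOn ℝ 2 v S := (hu2.sub hus).add hρv
  have hsq2 : ContDiffOn ℝ 2 (sqDist p') S := (contDiff_sqDist p').contDiffOn
  -- The term `-P²` costs nothing at the boundary, where `P` vanishes, and nothing in the first
  -- derivative at `p'`. Inside it contributes `-2 ∑ (dP)²`, the only source able to absorb the
  -- cross terms.
  set Ψ : (ι → ℂ) → ℝ := fun x => (A * v x + B * sqDist p' x) + (G x - P x * P x) with hΨ
  have hAB2 : ContDiffOn ℝ 2 (fun x => A * v x + B * sqDist p' x) S :=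
    (contDiffOn_const.mul hv2).add (contDiffOn_const.mul hsq2)
  have hGP2 : ContDiffOn ℝ 2 (fun x => G x - P x * P x) S := hG2.sub (hP2.mul hP2)
  have hΨ2 : ContDiffOn ℝ 2 Ψ S := hAB2.add hGP2
  have hLabs : ∀ {a : (ι → ℂ) → ℝ}, C2Bound S (Metric.ball p r) L a →
      C2Bound S (Metric.ball p r) |L| a := fun h => h.mono subset_rfl (le_abs_self L)
  have hLmax : ∀ {a : (ι → ℂ) → ℝ}, C2Bound S (Metric.ball p r) L a →
      C2Bound S (Metric.ball p r) (max |L| ‖v0‖) a := fun h =>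
    h.mono subset_rfl ((le_abs_self L).trans (le_max_left _ _))
  have hPb : ∀ q ∈ S, q ∈ Metric.ball p r → |P q| ≤ MP := fun q hq hqb => by
    have := hs.abs_firstOrder_le (v0 := v0) (t := Complex.I • v0) hq hqb (hLabs haP')
      (hLabs hbP')
    rwa [norm_smul, Complex.norm_I, one_mul] at this
  have hGb : ∀ q ∈ S, q ∈ Metric.ball p r → |G q| ≤ MG := fun q hq hqb => by
    have := hs.abs_firstOrder_le (v0 := v0) (t := t) hq hqb (hLabs ha') (hLabs hb')
    refine this.trans ?_
    simp only [MG]; gcongr; exact ht.trans (le_abs_self L)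
  have hvnn : ∀ q ∈ S, q ∈ Metric.ball p r → 0 ≤ v q := fun q hq hqb => by
    have h1 := (hbar q hq (Metric.ball_subset_ball hrr1 hqb)).1
    have h2 := hs.lower q hq
    simp only [hv]; linarith
  have hball : Metric.closedBall p' (r / 4) ⊆ Metric.ball p r := fun q hq => by
    rw [Metric.mem_closedBall] at hq
    rw [Metric.mem_ball] at hpp' ⊢
    calc dist q p ≤ dist q p' + dist p' p := dist_triangle _ _ _
      _ < r := by linarith
  set Kc := S ∩ Metric.closedBall p' (r / 4)
  have hKc : IsCompact Kc := by
    have : Kc = (S ∩ Metric.closedBall p r4) ∩ Metric.closedBall p' (r / 4) := by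
      ext q
      refine ⟨fun h => ⟨⟨h.1, ?_⟩, h.2⟩, fun h => ⟨h.1.1, h.2⟩⟩
      exact Metric.ball_subset_closedBall (Metric.ball_subset_ball hrr4 (hball h.2))
    rw [this]
    exact hcomp.inter_right Metric.isClosed_closedBall
  have hpK : p' ∈ Kc := ⟨hp', Metric.mem_closedBall_self (by positivity)⟩
  -- negativity of the operator in the interior
  have hop : ∀ q ∈ S, q ∈ Metric.ball p r → ∀ f,
      IsFrame (Matrix.of (X q) + levMat (D2 S u q)) f →
      frameSum f (fun w => D2 S Ψ q w w) < 0 := by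
    intro q hq hqb f hf
    set σ := ∑ b, ‖f b‖ ^ 2
    have hσ : 0 ≤ σ := Finset.sum_nonneg fun _ _ => by positivity
    set Q := frameSum f (fun w => fderivWithin ℝ P S q w ^ 2)
    have hQ : 0 ≤ Q := frameSum_nonneg f fun w => sq_nonneg _
    have hsplit : frameSum f (fun w => D2 S Ψ q w w) =
        A * frameSum f (fun w => D2 S v q w w) + B * frameSum f (fun w => D2 S (sqDist p') q w w)
        + (frameSum f (fun w => D2 S G q w w) -
          (2 * P q * frameSum f (fun w => D2 S P q w w) + 2 * Q)) := by
      simp only [Q, ← frameSum_mul, ← frameSum_sub, ← frameSum_add]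
      congr 1; funext w
      rw [D2_add hS hAB2 hGP2 hq, D2_add hS (contDiffOn_const.mul hv2) (contDiffOn_const.mul hsq2) hq,
        D2_const_mul hS hv2 hq, D2_const_mul hS hsq2 hq, D2_sub hS hG2 (hP2.mul hP2) hq]
      simp only [_root_.add_apply, _root_.sub_apply, _root_.smul_apply, smul_eq_mul,
        D2_mul hS hP2 hP2 hq]
      simp only [dd]
      ring
    have b1 := (hbar q hq (Metric.ball_subset_ball hrr1 hqb)).2 u X R hs f hf
    have b2 : frameSum f (fun w => D2 S (sqDist p') q w w) ≤ 4 * n * σ := by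
      have := frameSum_mono f (F := fun w => D2 S (sqDist p') q w w)
        (G := fun w => 2 * n * ‖w‖ ^ 2) fun w => D2_sqDist hS hq p' w
      rw [frameSum_mul, frameSum_norm_sq] at this
      linarith
    have b3 := (le_abs_self _).trans (hfo S (Metric.ball p r) ρ φ us u X R hD hs t a b aP bP ha hb haP
      hbP (hLmax ha') (hLmax hb') (hLmax haP') (hLmax hbP')
      (ht.trans ((le_abs_self L).trans (le_max_left _ _))) q hq hqb f hf)
    have b4 := hfo S (Metric.ball p r) ρ φ us u X R hD hs (Complex.I • v0) aP bP aP bP haP hbP haP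
      hbP (hLmax haP') (hLmax hbP') (hLmax haP') (hLmax hbP')
      (by rw [norm_smul, Complex.norm_I, one_mul]; exact le_max_right _ _) q hq hqb f hf
    have b5 : |P q * frameSum f (fun w => D2 S P q w w)| ≤ MP * (C1 * (1 + σ) + η * Q) := by
      rw [abs_mul]
      exact mul_le_mul (hPb q hq hqb) b4 (abs_nonneg _) hMP
    have b6 := (abs_le.mp b5).1
    have hη1 : MP * η ≤ 1 / 4 := by
      simp only [η]; rw [mul_one_div, div_le_iff₀ (by positivity)]; linarith
    have hη2 : η ≤ 1 / 4 := by
      simp only [η]; rw [div_le_div_iff₀ (by positivity) (by norm_num)]; linarith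
    have hη1Q : MP * η * Q ≤ 1 / 4 * Q := mul_le_mul_of_nonneg_right hη1 hQ
    have hη2Q : η * Q ≤ 1 / 4 * Q := mul_le_mul_of_nonneg_right hη2 hQ
    have hAε : A * ε = 4 * n * B + 2 * MP * C1 + C1 + 1 := by simp only [A]; field_simp
    have c1 : A * frameSum f (fun w => D2 S v q w w) ≤ -(4 * n * B + 2 * MP * C1 + C1 + 1) * (1 + σ) := by
      calc _ ≤ A * (-ε * (1 + σ)) := mul_le_mul_of_nonneg_left b1 hA
        _ = -(A * ε) * (1 + σ) := by ring
        _ = _ := by rw [hAε]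
    have c2 : B * frameSum f (fun w => D2 S (sqDist p') q w w) ≤ 4 * n * B * (1 + σ) := by
      calc _ ≤ B * (4 * n * σ) := mul_le_mul_of_nonneg_left b2 hB
        _ ≤ B * (4 * n * (1 + σ)) := by gcongr; linarith
        _ = _ := by ring
    rw [hsplit]
    linarith
  -- the minimum of `Ψ` is nonnegative
  obtain ⟨q0, hq0K, hq0min⟩ := hKc.exists_isMinOn ⟨p', hpK⟩ (hΨ2.continuousOn.mono inter_subset_left)
  have hq0S := hq0K.1
  have hq0b := hball hq0K.2
  have hΨ0 : 0 ≤ Ψ q0 := by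
    by_contra hneg
    push Not at hneg
    have hA1 : 0 ≤ A * v q0 := mul_nonneg hA (hvnn q0 hq0S hq0b)
    have hB1 : 0 ≤ B * sqDist p' q0 := mul_nonneg hB (sqDist_nonneg _ _)
    -- A negative minimum is impossible in each position: on the boundary `P = 0` and `G ≥ 0`; at an
    -- interior point the second derivative test contradicts `hop`; on the sphere the choice of `B`
    -- applies.
    by_cases hρ0 : ρ q0 = 0
    · have h1 := hP0 q0 hq0S hq0b hρ0
      have h2 := hG0 q0 hq0S hq0b hρ0
      have : Ψ q0 = (A * v q0 + B * sqDist p' q0) + (G q0 - P q0 * P q0) := rfl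
      change P q0 = 0 at h1
      rw [h1] at this
      change 0 ≤ G q0 at h2
      linarith
    have hρpos : 0 < ρ q0 := lt_of_le_of_ne (hD.nonneg q0 hq0S) (Ne.symm hρ0)
    rcases (Metric.mem_closedBall.mp hq0K.2).lt_or_eq with hlt | heq
    · have hSn := hD.mem_nhds q0 hq0S hρpos
      have hKn : Kc ∈ 𝓝 q0 := inter_mem hSn
        (mem_of_superset (Metric.isOpen_ball.mem_nhds (Metric.mem_ball.mpr hlt))
          Metric.ball_subset_closedBall)
      have hloc : IsLocalMin Ψ q0 := hq0min.isLocalMin hKn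
      obtain ⟨f, hf⟩ := hs.exists_frame hD hq0S
      have h1 := hop q0 hq0S hq0b f hf
      have h2 : 0 ≤ frameSum f (fun w => D2 S Ψ q0 w w) := frameSum_nonneg f fun w =>
        D2_nonneg_of_isLocalMin hSn (hΨ2 q0 hq0S) hloc w
      linarith
    · have h1 := dist_sq_le_sqDist p' q0
      rw [heq] at h1
      have h2 : MP ^ 2 + MG ≤ B * sqDist p' q0 := by
        calc MP ^ 2 + MG = B * (r / 4) ^ 2 := by simp only [B]; field_simp
          _ ≤ _ := mul_le_mul_of_nonneg_left h1 hB
      have h3 := abs_le.mp (hGb q0 hq0S hq0b)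
      have h4 : P q0 * P q0 ≤ MP ^ 2 := by
        have := hPb q0 hq0S hq0b
        rw [← sq, ← sq_abs]; gcongr
      have : Ψ q0 = (A * v q0 + B * sqDist p' q0) + (G q0 - P q0 * P q0) := rfl
      linarith
  have hpb : p' ∈ Metric.ball p r := hball hpK.2
  have hPp : P p' = 0 := hP0 p' hp' hpb hρp'
  have hvp : v p' = 0 := by
    simp only [hv, hρp', hs.boundary p' hp' hρp', hub p' hp' hρp']; ring
  have hΨp : Ψ p' = 0 := by
    change (A * v p' + B * sqDist p' p') + (G p' - P p' * P p') = 0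
    rw [hvp, sqDist_self, hPp, hGp']; ring
  have hlocal : IsLocalMinOn Ψ S p' := by
    have : ∀ᶠ q in 𝓝[S] p', q ∈ Kc := by
      filter_upwards [self_mem_nhdsWithin, mem_nhdsWithin_of_mem_nhds
        (Metric.closedBall_mem_nhds p' (by positivity : 0 < r / 4))] with q h1 h2 using ⟨h1, h2⟩
    filter_upwards [this] with q hq
    rw [hΨp]
    exact hΨ0.trans (hq0min hq)
  -- `Ψ` attains its minimum 0 at `p'`, so its inward derivative is nonnegative. The derivatives of
  -- the squared distance, of `P²` and of `ρ²` vanish there, leaving only `A v` and `G`.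
  have hfin := hD.inward p' hp' hρp' Ψ (hΨ2.differentiableOn (by norm_num) p' hp') hlocal v0
    (hv0 p' hp')
  have ofle : ∀ {w : (ι → ℂ) → ℝ}, ContDiffOn ℝ 2 w S → ContDiffOn ℝ 1 w S :=
    fun h => h.of_le (by norm_num)
  rw [dd_add hS (ofle hAB2) (ofle hGP2) hp', dd_add hS (ofle (contDiffOn_const.mul hv2))
    (ofle (contDiffOn_const.mul hsq2)) hp', dd_const_mul hS (ofle hv2) hp',
    dd_const_mul hS (ofle hsq2) hp', dd_sqDist_self hS hp', dd_sub hS (ofle hG2)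
    (ofle (hP2.mul hP2)) hp', dd_mul hS (ofle hP2) (ofle hP2) hp', hPp,
    dd_add hS (ofle (hu2.sub hus)) (ofle hρv) hp', dd_sub hS (ofle hu2) (ofle hus) hp',
    dd_sub hS (ofle (contDiffOn_const.mul hρ2)) (ofle (contDiffOn_const.mul (hρ2.mul hρ2))) hp',
    dd_const_mul hS (ofle hρ2) hp', dd_const_mul hS (ofle (hρ2.mul hρ2)) hp',
    dd_mul hS (ofle hρ2) (ofle hρ2) hp', hρp'] at hfin
  have k1 := (abs_le.mp (hs.dd_le hp' v0)).2
  have k2 := (abs_le.mp (hLus.dd_le hp' (Metric.ball_subset_ball hrr2 hpb) v0)).1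
  have k3 := (abs_le.mp (hLρ.dd_le hp' (Metric.ball_subset_ball hrr3 hpb) v0)).2
  have k4 : dd S v0 u p' - dd S v0 us p' + τ * dd S v0 ρ p' ≤ (κ + Lus + τ * Lρ) * ‖v0‖ := by
    have : τ * dd S v0 ρ p' ≤ τ * (Lρ * ‖v0‖) := mul_le_mul_of_nonneg_left k3 hτ.le
    linarith
  have k5 := mul_le_mul_of_nonneg_left k4 hA
  linarith

/-- Second tangential derivatives of a function vanishing on the boundary. -/
theorem D2_tangent (hD : BoundaryDomain S ρ) (hv0 : ∀ q ∈ S, 0 < dd S v0 ρ q) {w : (ι → ℂ) → ℝ}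
    (hw : ContDiffOn ℝ 2 w S) (hw0 : ∀ q ∈ S, ρ q = 0 → w q = 0) (hq : q ∈ S) (hρq : ρ q = 0)
    {a b : ι → ℂ} (ha : dd S a ρ q = 0) (hb : dd S b ρ q = 0) :
    D2 S w q b a = dd S v0 w q / dd S v0 ρ q * D2 S ρ q b a := by
  have hS := hD.uniqueDiff
  have hρ2 : ContDiffOn ℝ 2 ρ S := hD.smooth.of_le (by norm_cast)
  have hzero : ∀ x ∈ S, ρ x = 0 → ∀ v, dd S v ρ x = 0 → dd S v w x = 0 := fun x hx hρx v hv =>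
    hD.tangent x hx hρx w (hw.differentiableOn (by norm_num) x hx) (by
      filter_upwards [self_mem_nhdsWithin] with y hy hρy
      rw [hw0 y hy hρy, hw0 x hx hρx]) v hv
  -- Along the boundary `dw` is a multiple of `dρ`, so this determinant vanishes there. Its
  -- derivative along the tangent vector `b`, at a point where `w` and `ρ` have zero derivative
  -- along `a`, is the claimed identity.
  set F : (ι → ℂ) → ℝ := fun x => dd S a w x * dd S v0 ρ x - dd S a ρ x * dd S v0 w x with hF
  have hF0 : ∀ x ∈ S, ρ x = 0 → F x = 0 := by
    intro x hx hρx
    have h0 := (hv0 x hx).ne'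
    have h1 := hzero x hx hρx (a + (-(dd S a ρ x / dd S v0 ρ x)) • v0) (by
      rw [dd_vec_add, dd_vec_smul, smul_eq_mul]; field_simp; ring)
    rw [dd_vec_add, dd_vec_smul, smul_eq_mul] at h1
    field_simp at h1
    simp only [hF]; linarith
  have c1 := contDiffOn_dd hS hw (k := 1) (by norm_num) a
  have c2 := contDiffOn_dd hS hρ2 (k := 1) (by norm_num) v0
  have c3 := contDiffOn_dd hS hρ2 (k := 1) (by norm_num) a
  have c4 := contDiffOn_dd hS hw (k := 1) (by norm_num) v0
  have hF1 : ContDiffOn ℝ 1 F S := (c1.mul c2).sub (c3.mul c4)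
  have h := hD.tangent q hq hρq F (hF1.differentiableOn (by norm_num) q hq) (by
      filter_upwards [self_mem_nhdsWithin] with y hy hρy
      rw [hF0 y hy hρy, hF0 q hq hρq]) b hb
  rw [dd_sub hS (c1.mul c2) (c3.mul c4) hq, dd_mul hS c1 c2 hq, dd_mul hS c3 c4 hq, ha,
    hzero q hq hρq a ha, ← D2_apply hS hw hq, ← D2_apply hS hρ2 hq b a] at h
  have h0 := (hv0 q hq).ne'
  field_simp
  linarith

end BoundaryGradient

end HermitianMA

namespace HermitianMA

/-! ### Second derivatives with a tangential direction. -/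

section TangentialBounds

open Set Filter Topology Matrix

set_option linter.unusedSectionVars false

variable {ι : Type*} [Fintype ι] [DecidableEq ι]
variable {S : Set (ι → ℂ)} {ρ φ us u : (ι → ℂ) → ℝ} {κ : ℝ} {X : (ι → ℂ) → ι → ι → ℂ}
  {R : (ι → ℂ) → ℝ} {q p : ι → ℂ} {v0 : ι → ℂ}

/-- The functional `a` for which `t + a(t) v₀` is tangent to the level sets of `ρ`. -/
noncomputable def tanCoeff (S : Set (ι → ℂ)) (v0 : ι → ℂ) (ρ : (ι → ℂ) → ℝ) (q : ι → ℂ) :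
    (ι → ℂ) →L[ℝ] ℝ :=
  -((dd S v0 ρ q)⁻¹ • fderivWithin ℝ ρ S q)

/-- The functional sending `t` to minus the derivative of `φ` along `t + a(t) v₀`. -/
noncomputable def tanData (S : Set (ι → ℂ)) (v0 : ι → ℂ) (ρ φ : (ι → ℂ) → ℝ) (q : ι → ℂ) :
    (ι → ℂ) →L[ℝ] ℝ :=
  -(fderivWithin ℝ φ S q + dd S v0 φ q • tanCoeff S v0 ρ q)

theorem dd_add_tanCoeff (h : dd S v0 ρ q ≠ 0) (t : ι → ℂ) :
    dd S (t + tanCoeff S v0 ρ q t • v0) ρ q = 0 := by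
  rw [dd_vec_add, dd_vec_smul]
  simp only [tanCoeff, _root_.neg_apply, _root_.smul_apply, smul_eq_mul]
  change _ + -((dd S v0 ρ q)⁻¹ * dd S t ρ q) * _ = _
  field_simp; ring

theorem tanCoeff_eq_zero {t : ι → ℂ} (h : dd S t ρ q = 0) : tanCoeff S v0 ρ q t = 0 := by
  simp only [tanCoeff, _root_.neg_apply, _root_.smul_apply, smul_eq_mul]
  change -((dd S v0 ρ q)⁻¹ * dd S t ρ q) = 0
  rw [h]; ring

theorem contDiffOn_tanCoeff (hD : BoundaryDomain S ρ) (hv0 : ∀ q ∈ S, 0 < dd S v0 ρ q) :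
    ContDiffOn ℝ 2 (tanCoeff S v0 ρ) S := by
  have hρ3 : ContDiffOn ℝ 3 ρ S := hD.smooth.of_le (by norm_cast)
  exact (((contDiffOn_dd hD.uniqueDiff hρ3 (k := 2) (by norm_num) v0).inv
    fun q hq => (hv0 q hq).ne').smul
    (contDiffOn_fderivWithin hD.uniqueDiff hρ3 (k := 2) (by norm_num))).neg

theorem contDiffOn_tanData (hD : BoundaryDomain S ρ) (hv0 : ∀ q ∈ S, 0 < dd S v0 ρ q)
    (hφ : ContDiffOn ℝ ∞ φ S) : ContDiffOn ℝ 2 (tanData S v0 ρ φ) S := by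
  have hφ3 : ContDiffOn ℝ 3 φ S := hφ.of_le (by norm_cast)
  exact ((contDiffOn_fderivWithin hD.uniqueDiff hφ3 (k := 2) (by norm_num)).add
    ((contDiffOn_dd hD.uniqueDiff hφ3 (k := 2) (by norm_num) v0).smul
      (contDiffOn_tanCoeff hD hv0))).neg

theorem LocalSol.dd_sub_eq_zero (hs : LocalSol S ρ φ us κ u X R) (hD : BoundaryDomain S ρ)
    (hφ : ContDiffOn ℝ ∞ φ S) (hq : q ∈ S) (hρq : ρ q = 0) {v : ι → ℂ} (hv : dd S v ρ q = 0) :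
    dd S v u q = dd S v φ q := by
  have hu1 : ContDiffOn ℝ 1 u S := hs.smooth.of_le (by norm_num)
  have hφ1 : ContDiffOn ℝ 1 φ S := hφ.of_le (by norm_cast)
  have h1 := hD.tangent q hq hρq (fun x => u x - φ x)
    ((hu1.sub hφ1).differentiableOn (by norm_num) q hq) (by
      filter_upwards [self_mem_nhdsWithin] with y hy hρy
      rw [hs.boundary y hy hρy, hs.boundary q hq hρq]; ring) v hv
  rw [dd_sub hD.uniqueDiff hu1 hφ1 hq] at h1
  linarith

/-- On the boundary `t + a(t) v0` is tangent, and `u` and `φ` have the same tangential derivatives.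
This produces the first order expressions of the method: `P` for `t = √-1 v0`, and the functions
whose normal derivatives are the mixed second derivatives for general `t`. -/
theorem LocalSol.firstOrder_tan_eq_zero (hs : LocalSol S ρ φ us κ u X R)
    (hD : BoundaryDomain S ρ) (hv0 : ∀ q ∈ S, 0 < dd S v0 ρ q) (hφ : ContDiffOn ℝ ∞ φ S)
    (hq : q ∈ S) (hρq : ρ q = 0) (t : ι → ℂ) :
    firstOrder S v0 u t (fun x => tanCoeff S v0 ρ x t) (fun x => tanData S v0 ρ φ x t) q = 0 := by
  have h := hs.dd_sub_eq_zero hD hφ hq hρq (dd_add_tanCoeff (hv0 q hq).ne' t)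
  rw [dd_vec_add, dd_vec_smul, dd_vec_add, dd_vec_smul] at h
  simp only [firstOrder, tanData, _root_.neg_apply, _root_.add_apply, _root_.smul_apply,
    smul_eq_mul] at h ⊢
  change dd S t u q + _ + -(dd S t φ q + _) = 0
  linarith

theorem norm_apply_le (t : ι → ℂ) {L : ℝ} (ht : ‖t‖ ≤ L) :
    ‖ContinuousLinearMap.apply ℝ ℝ t‖ ≤ L :=
  ContinuousLinearMap.opNorm_le_bound _ ((norm_nonneg t).trans ht) fun f => by
    rw [ContinuousLinearMap.apply_apply, mul_comm]
    exact (f.le_opNorm t).trans (mul_le_mul_of_nonneg_left ht (norm_nonneg f))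

/-- Boundary estimate for the mixed tangential-normal second derivatives. -/
theorem exists_mixed_bound (hD : BoundaryDomain S ρ) (hv0 : ∀ q ∈ S, 0 < dd S v0 ρ q)
    (hφ : ContDiffOn ℝ ∞ φ S) (hus : ContDiffOn ℝ 2 us S) (hub : ∀ q ∈ S, ρ q = 0 → us q = φ q)
    (hκ : 1 ≤ κ) (hp : p ∈ S) (hρp : ρ p = 0) :
    ∃ r > 0, ∃ C : ℝ, 0 ≤ C ∧ ∀ u X R, LocalSol S ρ φ us κ u X R → ∀ p' ∈ S,
      p' ∈ Metric.ball p r → ρ p' = 0 → ∀ t, ‖t‖ ≤ 1 →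
      |D2 S u p' v0 (t + tanCoeff S v0 ρ p' t • v0)| ≤ C := by
  have hS := hD.uniqueDiff
  have hA := contDiffOn_tanCoeff hD hv0
  have hB := contDiffOn_tanData hD hv0 hφ
  obtain ⟨r0, hr0, hgrad⟩ := exists_boundary_gradient_bound hD hv0 hus hub hκ hp hρp
  obtain ⟨LA, r1, hr1, hLA⟩ := exists_C2Bound hS hA hp
  obtain ⟨LB, r2, hr2, hLB⟩ := exists_C2Bound hS hB hp
  set r := min r0 (min r1 r2)
  have hr : 0 < r := by positivity
  set L1 := max |LA| |LB|
  have hL1 : 0 ≤ L1 := (abs_nonneg _).trans (le_max_left _ _)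
  have hLA' : C2Bound S (Metric.ball p r) L1 (tanCoeff S v0 ρ) := hLA.mono
    (Metric.ball_subset_ball ((min_le_right _ _).trans (min_le_left _ _)))
    ((le_abs_self _).trans (le_max_left _ _))
  have hLB' : C2Bound S (Metric.ball p r) L1 (tanData S v0 ρ φ) := hLB.mono
    (Metric.ball_subset_ball ((min_le_right _ _).trans (min_le_right _ _)))
    ((le_abs_self _).trans (le_max_right _ _))
  set L := (1 + ‖v0‖) * L1 + 1
  have eval : ∀ t, ‖t‖ ≤ 1 + ‖v0‖ → ∀ F : (ι → ℂ) → (ι → ℂ) →L[ℝ] ℝ, ContDiffOn ℝ 2 F S →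
      C2Bound S (Metric.ball p r) L1 F → ContDiffOn ℝ 2 (fun x => F x t) S ∧
      C2Bound S (Metric.ball p r) L (fun x => F x t) := fun t ht F hF hFb =>
    ⟨hF.clm_apply contDiffOn_const,
      (hFb.clm_comp hS hF (ContinuousLinearMap.apply ℝ ℝ t) (norm_apply_le t ht)).mono subset_rfl
        (by simp only [L]; linarith)⟩
  obtain ⟨C, hC⟩ := hgrad r hr (min_le_left _ _) L
  have hL0 : 0 ≤ L := by positivity
  set C' := |C| + κ * ‖v0‖ * (L * ‖v0‖) + L * ‖v0‖
  have hκ0 : 0 ≤ κ := by linarith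
  refine ⟨r / 2, by positivity, C', by positivity, ?_⟩
  intro u X R hs p' hp' hpb hρp' 
  have hpr : p' ∈ Metric.ball p r := Metric.ball_subset_ball (by linarith) hpb
  have hIv : ‖Complex.I • v0‖ ≤ 1 + ‖v0‖ := by rw [norm_smul]; simp
  -- The derivative of the first order expression along `v0` is this second derivative up to terms
  -- involving only first derivatives of `u` and the coefficients.
  have key : ∀ t, ‖t‖ ≤ 1 → -C' ≤ D2 S u p' v0 (t + tanCoeff S v0 ρ p' t • v0) := by
    intro t ht
    have ht' : ‖t‖ ≤ 1 + ‖v0‖ := by linarith [norm_nonneg v0]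
    obtain ⟨a1, a2⟩ := eval t ht' _ hA hLA'
    obtain ⟨b1, b2⟩ := eval t ht' _ hB hLB'
    obtain ⟨c1, c2⟩ := eval _ hIv _ hA hLA'
    obtain ⟨d1, d2⟩ := eval _ hIv _ hB hLB'
    have h := hC u X R hs t _ _ _ _ a1 b1 c1 d1 a2 b2 c2 d2
      (by have : 0 ≤ (1 + ‖v0‖) * L1 := by positivity
          simp only [L]; linarith)
      (fun q hq _ hρq => hs.firstOrder_tan_eq_zero hD hv0 hφ hq hρq _)
      (fun q hq _ hρq => (hs.firstOrder_tan_eq_zero hD hv0 hφ hq hρq _).ge)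
      p' hp' hpb hρp' (hs.firstOrder_tan_eq_zero hD hv0 hφ hp' hρp' _)
    rw [dd_firstOrder hS hs.smooth t a1 b1 hp'] at h
    have e1 := a2.dd_le hp' hpr v0
    have e2 := b2.dd_le hp' hpr v0
    rw [Real.norm_eq_abs] at e1 e2
    have e3 : |dd S v0 u p' * dd S v0 (fun x => tanCoeff S v0 ρ x t) p'|
        ≤ κ * ‖v0‖ * (L * ‖v0‖) := by
      rw [abs_mul]; exact mul_le_mul (hs.dd_le hp' v0) e1 (abs_nonneg _) (by positivity)
    rw [map_add, map_smul, smul_eq_mul]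
    simp only [C']
    linarith [(abs_le.mp e3).2, (abs_le.mp e2).2, le_abs_self C]
  intro t ht
  refine abs_le.mpr ⟨key t ht, ?_⟩
  -- The expression vanishes identically on the boundary and is linear in `t`, so changing the sign
  -- of `t` supplies the opposite bound.
  have := key (-t) (by rwa [norm_neg])
  rw [map_neg, neg_smul, ← neg_add, map_neg] at this
  linarith

theorem abs_bilin_le_of_unit {E : Type*} [NormedAddCommGroup E] [NormedSpace ℝ E]
    (B : E →L[ℝ] E →L[ℝ] ℝ) (P : E → Prop) (hP : ∀ (c : ℝ) v, P v → P (c • v)) {C : ℝ}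
    (h : ∀ v w, P v → ‖v‖ ≤ 1 → ‖w‖ ≤ 1 → |B v w| ≤ C) (v w : E) (hv : P v) :
    |B v w| ≤ C * ‖v‖ * ‖w‖ := by
  by_cases hv0 : v = 0
  · simp [hv0]
  by_cases hw0 : w = 0
  · simp [hw0]
  have h1 := h (‖v‖⁻¹ • v) (‖w‖⁻¹ • w) (hP _ _ hv)
    (by rw [norm_smul, norm_inv, norm_norm, inv_mul_cancel₀ (norm_ne_zero_iff.mpr hv0)])
    (by rw [norm_smul, norm_inv, norm_norm, inv_mul_cancel₀ (norm_ne_zero_iff.mpr hw0)])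
  have pv : 0 < ‖v‖ := norm_pos_iff.mpr hv0
  have pw : 0 < ‖w‖ := norm_pos_iff.mpr hw0
  rw [map_smul, map_smul, _root_.smul_apply, smul_eq_mul, smul_eq_mul, abs_mul, abs_mul,
    abs_of_pos (inv_pos.mpr pv), abs_of_pos (inv_pos.mpr pw)] at h1
  field_simp at h1
  linarith

/-- Boundary estimate for the second derivatives with at least one tangential direction. -/
theorem exists_tangential_bound (hD : BoundaryDomain S ρ) (hv0 : ∀ q ∈ S, 0 < dd S v0 ρ q)
    (hφ : ContDiffOn ℝ ∞ φ S) (hus : ContDiffOn ℝ 2 us S) (hub : ∀ q ∈ S, ρ q = 0 → us q = φ q)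
    (hκ : 1 ≤ κ) (hp : p ∈ S) (hρp : ρ p = 0) :
    ∃ r > 0, ∃ C : ℝ, 0 ≤ C ∧ ∀ u X R, LocalSol S ρ φ us κ u X R → ∀ p' ∈ S,
      p' ∈ Metric.ball p r → ρ p' = 0 → ∀ v w, dd S v ρ p' = 0 →
      |D2 S u p' v w| ≤ C * ‖v‖ * ‖w‖ := by
  have hS := hD.uniqueDiff
  have hκ0 : 0 ≤ κ := by linarith
  have hρ2 : ContDiffOn ℝ 2 ρ S := hD.smooth.of_le (by norm_cast)
  have hφ2 : ContDiffOn ℝ 2 φ S := hφ.of_le (by norm_cast)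
  obtain ⟨r0, hr0, C0, hC0, hmix⟩ := exists_mixed_bound hD hv0 hφ hus hub hκ hp hρp
  obtain ⟨LA, r1, hr1, hLA⟩ := exists_C2Bound hS (contDiffOn_tanCoeff hD hv0) hp
  obtain ⟨Lφ, r2, hr2, hLφ⟩ := exists_C2Bound hS hφ2 hp
  -- the coefficient in `D2_tangent`
  have hinv : ContDiffOn ℝ 2 (fun q => (dd S v0 ρ q)⁻¹) S :=
    (contDiffOn_dd hS (hD.smooth.of_le (m := 3) (by norm_cast)) (by norm_num) v0).inv
      fun q hq => (hv0 q hq).ne'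
  obtain ⟨Li, r3, hr3, hLi⟩ := exists_C2Bound hS hinv hp
  obtain ⟨Lρ, r4, hr4, hLρ⟩ := exists_C2Bound hS hρ2 hp
  have hA0 : 0 ≤ LA := (norm_nonneg _).trans (hLA p hp (Metric.mem_ball_self hr1)).1
  have hφ0 : 0 ≤ Lφ := (norm_nonneg _).trans (hLφ p hp (Metric.mem_ball_self hr2)).1
  have hi0 : 0 ≤ Li := (norm_nonneg _).trans (hLi p hp (Metric.mem_ball_self hr3)).1
  have hρ0 : 0 ≤ Lρ := (norm_nonneg _).trans (hLρ p hp (Metric.mem_ball_self hr4)).1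
  set CT := (κ * ‖v0‖ + Lφ * ‖v0‖) * Li * (Lρ * (1 + LA * ‖v0‖)) + Lφ * (1 + LA * ‖v0‖)
  have hCT : 0 ≤ CT := by positivity
  refine ⟨min (min r0 r1) (min (min r2 r3) r4), by positivity, CT + LA * C0, by positivity, ?_⟩
  intro u X R hs p' hp' hpb hρp' v w hv
  have m0 : p' ∈ Metric.ball p r0 := Metric.ball_subset_ball
    ((min_le_left _ _).trans (min_le_left _ _)) hpb
  have m1 : p' ∈ Metric.ball p r1 := Metric.ball_subset_ball
    ((min_le_left _ _).trans (min_le_right _ _)) hpb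
  have m2 : p' ∈ Metric.ball p r2 := Metric.ball_subset_ball
    ((min_le_right _ _).trans ((min_le_left _ _).trans (min_le_left _ _))) hpb
  have m3 : p' ∈ Metric.ball p r3 := Metric.ball_subset_ball
    ((min_le_right _ _).trans ((min_le_left _ _).trans (min_le_right _ _))) hpb
  have m4 : p' ∈ Metric.ball p r4 := Metric.ball_subset_ball
    ((min_le_right _ _).trans (min_le_right _ _)) hpb
  have hu2 : ContDiffOn ℝ 2 u S := hs.smooth.of_le (by norm_num)
  refine abs_bilin_le_of_unit (D2 S u p') (fun v => dd S v ρ p' = 0)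
    (fun c v hv => by rw [dd_vec_smul, hv, smul_zero]) ?_ v w hv
  intro v w hv hv1 hw1
  set A := tanCoeff S v0 ρ p'
  have hAw : |A w| ≤ LA := by
    calc |A w| ≤ ‖A‖ * ‖w‖ := A.le_opNorm w
      _ ≤ LA * 1 := mul_le_mul (hLA p' hp' m1).1 hw1 (norm_nonneg _) hA0
      _ = LA := mul_one _
  have hT : ‖w + A w • v0‖ ≤ 1 + LA * ‖v0‖ := by
    refine (norm_add_le _ _).trans (add_le_add hw1 ?_)
    rw [norm_smul]
    exact mul_le_mul_of_nonneg_right hAw (norm_nonneg _)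
  -- Splitting `w` into a tangential vector and a multiple of `v0` leaves a doubly tangential
  -- derivative and a mixed one.
  have hdec : D2 S u p' v w = D2 S u p' v (w + A w • v0) - A w * D2 S u p' v0 v := by
    rw [D2_symm hS hD.subset_closure hu2 hp' v0 v, map_add, map_smul, smul_eq_mul]; ring
  have hmixv : |D2 S u p' v0 v| ≤ C0 := by
    have := hmix u X R hs p' hp' m0 hρp' v hv1
    rwa [tanCoeff_eq_zero hv, zero_smul, add_zero] at this
  have hbil : ∀ {f : (ι → ℂ) → ℝ} {L : ℝ}, ‖D2 S f p'‖ ≤ L → 0 ≤ L →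
      |D2 S f p' v (w + A w • v0)| ≤ L * (1 + LA * ‖v0‖) := fun {f} {L} hf hL => by
    refine ((D2 S f p').le_opNorm₂ _ _).trans ?_
    calc _ ≤ L * 1 * (1 + LA * ‖v0‖) := by
          refine mul_le_mul (mul_le_mul hf hv1 (norm_nonneg _) hL) hT (norm_nonneg _) (by positivity)
      _ = _ := by ring
  -- For two tangential directions the Hessian of `u - φ` is determined by its normal derivative,
  -- already bounded through the gradient.
  have htan := D2_tangent hD hv0 (hu2.sub hφ2) (fun q hq hρq => by
    rw [hs.boundary q hq hρq]; ring) hp' hρp' (dd_add_tanCoeff (hv0 p' hp').ne' w) hv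
  rw [D2_sub hS hu2 hφ2 hp', dd_sub hS (hu2.of_le (by norm_num)) (hφ2.of_le (by norm_num)) hp',
    _root_.sub_apply, _root_.sub_apply, sub_eq_iff_eq_add, div_eq_mul_inv] at htan
  have hTb : |D2 S u p' v (w + A w • v0)| ≤ CT := by
    rw [htan]
    refine (abs_add_le _ _).trans (add_le_add ?_ (hbil (hLφ p' hp' m2).2.2 hφ0))
    rw [abs_mul, abs_mul]
    refine mul_le_mul (mul_le_mul ((abs_sub _ _).trans (add_le_add (hs.dd_le hp' v0) ?_))
      (hLi p' hp' m3).1 (abs_nonneg _) (by positivity)) (hbil (hLρ p' hp' m4).2.2 hρ0)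
      (abs_nonneg _) (by positivity)
    exact hLφ.dd_le hp' m2 v0
  rw [hdec]
  refine (abs_sub _ _).trans (add_le_add hTb ?_)
  rw [abs_mul]
  exact mul_le_mul hAw hmixv (abs_nonneg _) hA0

end TangentialBounds

end HermitianMA

namespace HermitianMA

/-! ### The projection to complex tangent vectors. -/

section HorizontalProjection

open Set Filter Topology Matrix ComplexConjugate

set_option linter.unusedSectionVars false

variable {ι : Type*} [Fintype ι] [DecidableEq ι]
variable {S : Set (ι → ℂ)} {ρ : (ι → ℂ) → ℝ} {q p : ι → ℂ} {v0 : ι → ℂ}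

/-- The complex linear form `2 ∂ρ`. -/
noncomputable def dC (S : Set (ι → ℂ)) (ρ : (ι → ℂ) → ℝ) (q ξ : ι → ℂ) : ℂ :=
  ((dd S ξ ρ q : ℝ) : ℂ) - Complex.I * ((dd S (Complex.I • ξ) ρ q : ℝ) : ℂ)

theorem dC_re (ξ : ι → ℂ) : (dC S ρ q ξ).re = dd S ξ ρ q := by simp [dC]

theorem dC_im (ξ : ι → ℂ) : (dC S ρ q ξ).im = -dd S (Complex.I • ξ) ρ q := by simp [dC]

theorem smul_eq_re_im (c : ℂ) (v : ι → ℂ) : c • v = c.re • v + c.im • (Complex.I • v) := by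
  ext j
  simp only [Pi.smul_apply, Pi.add_apply, smul_eq_mul, Complex.real_smul]
  apply Complex.ext <;> simp
  ring

theorem dC_add (v w : ι → ℂ) : dC S ρ q (v + w) = dC S ρ q v + dC S ρ q w := by
  simp only [dC, smul_add, dd_vec_add]; push_cast; ring

theorem dC_smul (c : ℂ) (v : ι → ℂ) : dC S ρ q (c • v) = c * dC S ρ q v := by
  have e : Complex.I • c • v = (-c.im) • v + c.re • (Complex.I • v) := by
    rw [smul_smul, smul_eq_re_im]; simp
  simp only [dC, e]
  rw [smul_eq_re_im c v]
  simp only [dd_vec_add, dd_vec_smul, smul_eq_mul]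
  apply Complex.ext <;> simp

/-- The complex linear projection along `v₀` to the complex tangent space of the level sets. -/
noncomputable def horProj (S : Set (ι → ℂ)) (v0 : ι → ℂ) (ρ : (ι → ℂ) → ℝ) (q ξ : ι → ℂ) :
    ι → ℂ :=
  ξ - (dC S ρ q ξ / dC S ρ q v0) • v0

theorem horProj_add (v w : ι → ℂ) :
    horProj S v0 ρ q (v + w) = horProj S v0 ρ q v + horProj S v0 ρ q w := by
  simp only [horProj, dC_add, add_div, add_smul]; abel

theorem horProj_smul (c : ℂ) (v : ι → ℂ) : horProj S v0 ρ q (c • v) = c • horProj S v0 ρ q v := by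
  simp only [horProj, dC_smul, mul_div_assoc, mul_smul, smul_sub]

theorem horProj_tangent (h : dd S v0 ρ q ≠ 0) (ξ : ι → ℂ) :
    dd S (horProj S v0 ρ q ξ) ρ q = 0 ∧ dd S (Complex.I • horProj S v0 ρ q ξ) ρ q = 0 := by
  have h0 : dC S ρ q v0 ≠ 0 := fun h' => h (by rw [← dC_re, h']; rfl)
  have h1 : dC S ρ q (horProj S v0 ρ q ξ) = 0 := by
    rw [horProj, sub_eq_add_neg, ← neg_smul, dC_add, dC_smul]; field_simp; ring
  refine ⟨by rw [← dC_re, h1]; rfl, ?_⟩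
  have := dC_im (S := S) (ρ := ρ) (q := q) (horProj S v0 ρ q ξ)
  rw [h1] at this; simpa using this.symm

theorem horProj_eq_self {ξ : ι → ℂ} (h1 : dd S ξ ρ q = 0) (h2 : dd S (Complex.I • ξ) ρ q = 0) :
    horProj S v0 ρ q ξ = ξ := by
  simp [horProj, dC, h1, h2]

/-- The matrix of the form `M` composed with the projection to the complex tangent space. -/
noncomputable def horMat (S : Set (ι → ℂ)) (v0 : ι → ℂ) (ρ : (ι → ℂ) → ℝ)
    (M : (ι → ℂ) → ι → ι → ℂ) (q : ι → ℂ) : ι → ι → ℂ :=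
  fun j k => hermC (Matrix.of (M q)) (horProj S v0 ρ q (Pi.single j 1))
    (horProj S v0 ρ q (Pi.single k 1))

/-- A Hermitian form composed with a complex linear projection is again sesquilinear. The vector `ξ`
then enters only through evaluation, and the `C²` bounds concern a matrix function independent of
`ξ`. -/
theorem hermQuad_horMat (M : (ι → ℂ) → ι → ι → ℂ) (ξ : ι → ℂ) :
    hermQuad (Matrix.of (horMat S v0 ρ M q)) ξ =
      hermQuad (Matrix.of (M q)) (horProj S v0 ρ q ξ) := by
  rw [hermQuad_eq, hermQuad_eq]
  congr 1
  refine (sesq_expand (h := fun v w => hermC (Matrix.of (M q)) (horProj S v0 ρ q v)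
    (horProj S v0 ρ q w)) ?_ ?_ ?_ ?_ ξ ξ).symm
  · intro v v' w; rw [horProj_add, hermC_add_left]
  · intro c v w; rw [horProj_smul, hermC_smul_left]
  · intro v w w'; rw [horProj_add, hermC_add_right]
  · intro c v w; rw [horProj_smul, hermC_smul_right]

theorem contDiffOn_horProj (hD : BoundaryDomain S ρ) (hv0 : ∀ q ∈ S, 0 < dd S v0 ρ q)
    (ξ : ι → ℂ) : ContDiffOn ℝ 2 (fun q => horProj S v0 ρ q ξ) S := by
  have hρ3 : ContDiffOn ℝ 3 ρ S := hD.smooth.of_le (by norm_cast)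
  have h1 : ∀ v, ContDiffOn ℝ 2 (fun q => dC S ρ q v) S := fun v =>
    (Complex.ofRealCLM.contDiff.comp_contDiffOn
      (contDiffOn_dd hD.uniqueDiff hρ3 (k := 2) (by norm_num) v)).sub
    (contDiffOn_const.mul (Complex.ofRealCLM.contDiff.comp_contDiffOn
      (contDiffOn_dd hD.uniqueDiff hρ3 (k := 2) (by norm_num) (Complex.I • v))))
  have h2 : ∀ q ∈ S, dC S ρ q v0 ≠ 0 := fun q hq h' =>
    (hv0 q hq).ne' (by rw [← dC_re, h']; rfl)
  refine ContDiffOn.sub (f := fun _ => ξ) contDiffOn_const ?_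
  have h3 : ContDiffOn ℝ 2 (fun q => dC S ρ q ξ / dC S ρ q v0) S := by
    simp only [div_eq_mul_inv]
    exact (h1 ξ).mul ((h1 v0).inv h2)
  exact h3.smul (contDiffOn_const (c := v0))

theorem contDiffOn_horMat (hD : BoundaryDomain S ρ) (hv0 : ∀ q ∈ S, 0 < dd S v0 ρ q)
    {M : (ι → ℂ) → ι → ι → ℂ} (hM : ContDiffOn ℝ 2 M S) :
    ContDiffOn ℝ 2 (horMat S v0 ρ M) S := by
  refine contDiffOn_pi.mpr fun j => contDiffOn_pi.mpr fun k => ?_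
  unfold horMat hermC
  refine ContDiffOn.sum fun a _ => ContDiffOn.sum fun b _ => ?_
  have hp := fun j : ι => contDiffOn_horProj hD hv0 (Pi.single j (1 : ℂ))
  exact ((contDiffOn_pi.mp (contDiffOn_pi.mp hM a) b).mul (contDiffOn_pi.mp (hp j) a)).mul
    (Complex.conjCLE.contDiff.comp_contDiffOn (contDiffOn_pi.mp (hp k) b))

/-- Evaluation of a matrix, as a Hermitian form, on a vector. -/
noncomputable def quadEval (ξ : ι → ℂ) : (ι → ι → ℂ) →L[ℝ] ℝ :=
  LinearMap.mkContinuous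
    { toFun := fun A => hermQuad (Matrix.of A) ξ
      map_add' := fun A B => hermQuad_add_mat (Matrix.of A) (Matrix.of B) ξ
      map_smul' := fun c A => by
        simp only [hermQuad, Matrix.of_apply, Pi.smul_apply, Complex.real_smul, RingHom.id_apply,
          smul_eq_mul, mul_assoc, ← Finset.mul_sum]
        rw [Complex.re_ofReal_mul] }
    ((Fintype.card ι) ^ 2 * ‖ξ‖ ^ 2) fun A => by
      refine (abs_hermQuad_le _ (κ := ‖A‖) (fun j k =>
        (norm_le_pi_norm _ k).trans (norm_le_pi_norm _ j)) ξ).trans (le_of_eq (by ring))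

theorem quadEval_apply (ξ : ι → ℂ) (A : ι → ι → ℂ) :
    quadEval ξ A = hermQuad (Matrix.of A) ξ := rfl

theorem norm_quadEval_le (ξ : ι → ℂ) : ‖quadEval ξ‖ ≤ (Fintype.card ι) ^ 2 * ‖ξ‖ ^ 2 :=
  LinearMap.mkContinuous_norm_le _ (by positivity) _

theorem contDiffOn_levMat_D2 {w : (ι → ℂ) → ℝ} (hS : UniqueDiffOn ℝ S)
    (hw : ContDiffOn ℝ ∞ w S) {k : ℕ} :
    ContDiffOn ℝ k (fun q => (fun i j => levMat (D2 S w q) i j : ι → ι → ℂ)) S := by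
  have hD2 : ContDiffOn ℝ k (D2 S w) S :=
    (contDiffOn_fderivWithin hS (hw.of_le (m := ((k + 1 + 1 : ℕ) : ℕ∞ω)) (by exact_mod_cast le_top))
      (k := ((k + 1 : ℕ) : ℕ∞ω)) (by norm_cast)).fderivWithin hS (by norm_cast)
  have h1 : ∀ v t, ContDiffOn ℝ k (fun x => D2 S w x v t) S := fun v t =>
    (hD2.clm_apply contDiffOn_const).clm_apply contDiffOn_const
  have h2 : ∀ {f : (ι → ℂ) → ℝ}, ContDiffOn ℝ k f S → ContDiffOn ℝ k (fun x => (f x : ℂ)) S :=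
    fun hf => Complex.ofRealCLM.contDiff.comp_contDiffOn hf
  refine contDiffOn_pi.mpr fun i => contDiffOn_pi.mpr fun j => ?_
  simp only [levMat, levC, Matrix.of_apply]
  exact ((h2 ((h1 _ _).add (h1 _ _))).add (contDiffOn_const.mul (h2 ((h1 _ _).sub (h1 _ _))))).mul
    contDiffOn_const

end HorizontalProjection

end HermitianMA

namespace HermitianMA

/-! ### Lower bound for the solution on complex tangent vectors at a minimum point. -/

section TangentialLowerBound

open Set Filter Topology Matrix

set_option linter.unusedSectionVars false

variable {ι : Type*} [Fintype ι] [DecidableEq ι]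
variable {S : Set (ι → ℂ)} {ρ φ us u : (ι → ℂ) → ℝ} {κ : ℝ} {X : (ι → ℂ) → ι → ι → ℂ}
  {R : (ι → ℂ) → ℝ} {q p : ι → ℂ} {v0 : ι → ℂ}

/-- Levi forms of functions vanishing on the boundary, on complex tangent vectors. -/
theorem hermQuad_levMat_tangent (hD : BoundaryDomain S ρ) (hv0 : ∀ q ∈ S, 0 < dd S v0 ρ q)
    {w : (ι → ℂ) → ℝ} (hw : ContDiffOn ℝ 2 w S) (hw0 : ∀ q ∈ S, ρ q = 0 → w q = 0) (hq : q ∈ S)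
    (hρq : ρ q = 0) {ξ : ι → ℂ} (h1 : dd S ξ ρ q = 0) (h2 : dd S (Complex.I • ξ) ρ q = 0) :
    hermQuad (levMat (D2 S w q)) ξ =
      dd S v0 w q / dd S v0 ρ q * hermQuad (levMat (D2 S ρ q)) ξ := by
  rw [hermQuad_levMat, hermQuad_levMat, D2_tangent hD hv0 hw hw0 hq hρq h1 h1,
    D2_tangent hD hv0 hw hw0 hq hρq h2 h2]
  ring

/-- An upper bound for the double normal derivative bounds the whole Hessian from above. -/
theorem quad_le_of_normal_le {B : (ι → ℂ) →L[ℝ] (ι → ℂ) →L[ℝ] ℝ} (hB : ∀ v w, B v w = B w v)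
    {A l : (ι → ℂ) →L[ℝ] ℝ} {C LA N : ℝ} (hC : 0 ≤ C) (hN : 0 ≤ N)
    (htan : ∀ v w, l v = 0 → |B v w| ≤ C * ‖v‖ * ‖w‖)
    (hA : ‖A‖ ≤ LA) (hl : ∀ w, l (w + A w • v0) = 0) (hn : B v0 v0 ≤ N) (w : ι → ℂ) :
    B w w ≤ (C * (1 + LA * ‖v0‖) * (1 + LA * ‖v0‖ + 2 * LA * ‖v0‖) + LA ^ 2 * N) * ‖w‖ ^ 2 := by
  have hLA : 0 ≤ LA := (norm_nonneg _).trans hA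
  set T := w + A w • v0
  have hAw : |A w| ≤ LA * ‖w‖ := (A.le_opNorm w).trans (mul_le_mul_of_nonneg_right hA (norm_nonneg _))
  have hT : ‖T‖ ≤ (1 + LA * ‖v0‖) * ‖w‖ := by
    refine (norm_add_le _ _).trans ?_
    rw [norm_smul, Real.norm_eq_abs]
    nlinarith [mul_le_mul_of_nonneg_right hAw (norm_nonneg v0)]
  have hw : w = T - A w • v0 := by simp [T]
  -- Only the last term involves the double normal derivative, and its coefficient is a square.
  -- Hence a one-sided bound for `B v0 v0` suffices for a one-sided bound of the Hessian.
  have e : B w w = B T T - 2 * (A w * B T v0) + A w ^ 2 * B v0 v0 := by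
    conv_lhs => rw [hw]
    simp only [map_sub, map_smul, _root_.sub_apply, _root_.smul_apply, smul_eq_mul]
    rw [hB v0 T]; ring
  have b1 : B T T ≤ C * ((1 + LA * ‖v0‖) * ‖w‖) * ((1 + LA * ‖v0‖) * ‖w‖) :=
    (le_abs_self _).trans ((htan T T (hl w)).trans (by gcongr))
  have b2 : |A w * B T v0| ≤ (LA * ‖w‖) * (C * ((1 + LA * ‖v0‖) * ‖w‖) * ‖v0‖) := by
    rw [abs_mul]
    exact mul_le_mul hAw ((htan T v0 (hl w)).trans (by gcongr)) (abs_nonneg _) (by positivity)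
  have b3 : A w ^ 2 * B v0 v0 ≤ (LA * ‖w‖) ^ 2 * N := by
    calc A w ^ 2 * B v0 v0 ≤ A w ^ 2 * N := mul_le_mul_of_nonneg_left hn (sq_nonneg _)
      _ ≤ _ := by
        refine mul_le_mul_of_nonneg_right ?_ hN
        rw [← sq_abs (A w)]; gcongr
  rw [e]
  linarith [(abs_le.mp b2).1]

/-- Where the complex tangential part of the solution is small, the Levi form of the defining
function is negative. -/
theorem LocalSol.levi_defining_le (hs : LocalSol S ρ φ us κ u X R) (hD : BoundaryDomain S ρ)
    (hv0 : ∀ q ∈ S, 0 < dd S v0 ρ q) (hus : ContDiffOn ℝ 2 us S)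
    (hub : ∀ q ∈ S, ρ q = 0 → us q = φ q) (hκ : 0 < κ) (hp : p ∈ S) (hρp : ρ p = 0) {ξ : ι → ℂ}
    (hξ : ‖ξ‖ = 1) (hξ1 : dd S ξ ρ p = 0) (hξ2 : dd S (Complex.I • ξ) ρ p = 0)
    (hsmall : hermQuad (Matrix.of (X p) + levMat (D2 S u p)) ξ < κ⁻¹ / 2) {Mw : ℝ}
    (hwb : dd S v0 u p - dd S v0 us p ≤ Mw) :
    κ⁻¹ / 2 ≤ Mw * (-(hermQuad (levMat (D2 S ρ p)) ξ / dd S v0 ρ p)) := by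
  have hS := hD.uniqueDiff
  have hu2 : ContDiffOn ℝ 2 u S := hs.smooth.of_le (by norm_num)
  have hw := hermQuad_levMat_tangent hD hv0 (hus.sub hu2) (fun q hq hρq => by
    rw [hs.boundary q hq hρq, hub q hq hρq]; ring) hp hρp hξ1 hξ2
  rw [D2_sub hS hus hu2 hp, dd_sub hS (hus.of_le (by norm_num)) (hu2.of_le (by norm_num)) hp] at hw
  have hlin : hermQuad (levMat (D2 S us p - D2 S u p)) ξ =
      hermQuad (levMat (D2 S us p)) ξ - hermQuad (levMat (D2 S u p)) ξ := by
    simp only [hermQuad_levMat, _root_.sub_apply]; ring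
  have hsub := hs.sub_pos p hp ξ
  rw [hξ, hermQuad_add_mat] at hsub
  rw [hermQuad_add_mat] at hsmall
  -- `u - us` is nonnegative and vanishes at `p`, so its inward derivative has a sign.
  have hwneg : dd S v0 us p - dd S v0 u p ≤ 0 := by
    have := hD.inward p hp hρp (fun x => u x - us x)
      ((hu2.sub hus).differentiableOn (by norm_num) p hp) (by
        filter_upwards [self_mem_nhdsWithin] with y hy
        have := hs.lower y hy
        rw [hs.boundary p hp hρp, hub p hp hρp]; linarith) v0 (hv0 p hp)
    rw [dd_sub hS (hu2.of_le (by norm_num)) (hus.of_le (by norm_num)) hp] at this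
    linarith
  rw [hlin] at hw
  set y := -(hermQuad (levMat (D2 S ρ p)) ξ / dd S v0 ρ p)
  have hy : hermQuad (levMat (D2 S us p)) ξ - hermQuad (levMat (D2 S u p)) ξ =
      (dd S v0 u p - dd S v0 us p) * y := by
    rw [hw]; simp only [y]; field_simp; ring
  -- The subsolution form is at least `κ⁻¹` on the unit vector and the solution form less than half
  -- of that. The difference is carried entirely by the Levi form of `ρ`, because `us - u` vanishes
  -- on the boundary.
  have hprod : κ⁻¹ / 2 ≤ (dd S v0 u p - dd S v0 us p) * y := by
    rw [← hy]; linarith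
  have hi : 0 < κ⁻¹ := by positivity
  have hy0 : 0 ≤ y := by
    by_contra hneg
    push Not at hneg
    nlinarith [mul_nonneg (by linarith : 0 ≤ dd S v0 u p - dd S v0 us p) (neg_nonneg.mpr hneg.le)]
  exact hprod.trans (mul_le_mul_of_nonneg_right hwb hy0)

/-- Bounds for the Hessian of the solution from below, given the bounds from above. -/
theorem exists_lower_of_hessian_le (hκ : 0 < κ) {H : ℝ} (hH : 0 ≤ H) :
    ∃ ε > 0, ∀ (S : Set (ι → ℂ)) (ρ φ us u : (ι → ℂ) → ℝ) (X : (ι → ℂ) → ι → ι → ℂ)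
      (R : (ι → ℂ) → ℝ), BoundaryDomain S ρ → LocalSol S ρ φ us κ u X R → ∀ p ∈ S,
      (∀ w, D2 S u p w w ≤ H * ‖w‖ ^ 2) →
      ∀ ζ, ε * ‖ζ‖ ^ 2 ≤ hermQuad (Matrix.of (X p) + levMat (D2 S u p)) ζ := by
  set K := (Fintype.card ι : ℝ) ^ 2 * κ + H / 2
  have hK : 0 ≤ K := by positivity
  obtain ⟨ε, hε, hlow⟩ := exists_hermQuad_lower (ι := ι) (inv_pos.mpr hκ) (6 * K)
  refine ⟨ε, hε, fun S ρ φ us u X R hD hs p hp hHess => ?_⟩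
  -- Positivity of the form supplies the lower bound, so an upper bound on the Hessian bounds all
  -- matrix entries; with the determinant bounded below this gives uniform positivity.
  have hGup : ∀ ζ, |hermQuad (Matrix.of (X p) + levMat (D2 S u p)) ζ| ≤ K * ‖ζ‖ ^ 2 := by
    intro ζ
    have hnn : 0 ≤ hermQuad (Matrix.of (X p) + levMat (D2 S u p)) ζ := by
      by_cases hζ : ζ = 0
      · simp [hζ, hermQuad]
      · exact (hs.pos p hp ζ hζ).le
    rw [abs_of_nonneg hnn, hermQuad_add_mat, hermQuad_levMat]
    have h1 := (le_abs_self _).trans (abs_hermQuad_le (Matrix.of (X p)) (κ := κ)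
      (fun j k => hs.norm_X_apply hp j k) ζ)
    have h2 := hHess ζ
    have h3 := hHess (Complex.I • ζ)
    rw [norm_smul, Complex.norm_I, one_mul] at h3
    simp only [K]; linarith
  have hGh := hs.isHermitian hD hp
  exact hlow _ hGh (hs.pos p hp) (fun j k => by
    rw [← hermC_single (Matrix.of (X p) + levMat (D2 S u p)) j k]
    exact norm_hermC_le_of_quad hGh hGup hK _ _ (by simp [Pi.norm_single]) (by simp [Pi.norm_single]))
    (by
      rw [hs.det_eq p hp, Complex.norm_real, Real.norm_eq_abs]
      exact (hs.le_R p hp).trans (le_abs_self _))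

/-- On the boundary, the form of the solution restricted to complex tangent vectors is affine in
the normal derivative of the solution. -/
theorem LocalSol.hermQuad_horProj (hs : LocalSol S ρ φ us κ u X R) (hD : BoundaryDomain S ρ)
    (hv0 : ∀ q ∈ S, 0 < dd S v0 ρ q) (hφ : ContDiffOn ℝ ∞ φ S) (hq : q ∈ S) (hρq : ρ q = 0)
    (ξ : ι → ℂ) :
    hermQuad (Matrix.of (X q) + levMat (D2 S u q)) (horProj S v0 ρ q ξ) =
      hermQuad (Matrix.of (X q)) (horProj S v0 ρ q ξ) +
      hermQuad (levMat (D2 S φ q)) (horProj S v0 ρ q ξ) + (dd S v0 u q - dd S v0 φ q) *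
        ((dd S v0 ρ q)⁻¹ * hermQuad (levMat (D2 S ρ q)) (horProj S v0 ρ q ξ)) := by
  have hS := hD.uniqueDiff
  have hu2 : ContDiffOn ℝ 2 u S := hs.smooth.of_le (by norm_num)
  have hφ2 : ContDiffOn ℝ 2 φ S := hφ.of_le (by norm_cast)
  have hne := (hv0 q hq).ne'
  obtain ⟨z1, z2⟩ := horProj_tangent (ρ := ρ) (S := S) hne ξ
  set ζ := horProj S v0 ρ q ξ
  have hlev := hermQuad_levMat_tangent hD hv0 (hu2.sub hφ2) (fun q hq hρq => by
    rw [hs.boundary q hq hρq]; ring) hq hρq z1 z2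
  rw [D2_sub hS hu2 hφ2 hq, dd_sub hS (hu2.of_le (by norm_num)) (hφ2.of_le (by norm_num)) hq] at hlev
  have hlin : hermQuad (levMat (D2 S u q - D2 S φ q)) ζ =
      hermQuad (levMat (D2 S u q)) ζ - hermQuad (levMat (D2 S φ q)) ζ := by
    simp only [hermQuad_levMat, _root_.sub_apply]; ring
  rw [hlin] at hlev
  rw [hermQuad_add_mat, sub_eq_iff_eq_add.mp hlev]
  field_simp; ring

set_option maxHeartbeats 1000000 in
/-- The boundary estimate for the complex tangential part of the solution: at a minimum point of
the tangential part relative to the metric `gM`, it is bounded below by a positive constant. -/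
theorem exists_tangential_lower_bound (hD : BoundaryDomain S ρ) (hv0 : ∀ q ∈ S, 0 < dd S v0 ρ q)
    (hφ : ContDiffOn ℝ ∞ φ S) (hus : ContDiffOn ℝ 2 us S) (hub : ∀ q ∈ S, ρ q = 0 → us q = φ q)
    (hκ : 1 ≤ κ) {XB gM : (ι → ℂ) → ι → ι → ℂ} (hXB : ContDiffOn ℝ 2 XB S)
    (hgM : ContDiffOn ℝ 2 gM S) {γ : ℝ} (hγ : 0 < γ)
    (hgpos : ∀ q ∈ S, ∀ ξ, γ * ‖ξ‖ ^ 2 ≤ hermQuad (Matrix.of (gM q)) ξ)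
    (hp : p ∈ S) (hρp : ρ p = 0) :
    ∃ r > 0, ∃ c0 > 0, ∀ u X R, LocalSol S ρ φ us κ u X R →
      (∀ q ∈ S, ρ q = 0 → X q = XB q) → ∀ p' ∈ S, p' ∈ Metric.ball p r → ρ p' = 0 →
      ∀ (m0 : ℝ) (ξ : ι → ℂ), ‖ξ‖ = 1 → dd S ξ ρ p' = 0 → dd S (Complex.I • ξ) ρ p' = 0 →
      hermQuad (Matrix.of (X p') + levMat (D2 S u p')) ξ =
        m0 * hermQuad (Matrix.of (gM p')) ξ →
      (∀ q ∈ S, ρ q = 0 → ∀ ζ, dd S ζ ρ q = 0 → dd S (Complex.I • ζ) ρ q = 0 →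
        m0 * hermQuad (Matrix.of (gM q)) ζ ≤
          hermQuad (Matrix.of (X q) + levMat (D2 S u q)) ζ) → c0 ≤ m0 := by
  have hS := hD.uniqueDiff
  have hκ0 : 0 < κ := by linarith
  have hρ2 : ContDiffOn ℝ 2 ρ S := hD.smooth.of_le (by norm_cast)
  have hφ2 : ContDiffOn ℝ 2 φ S := hφ.of_le (by norm_cast)
  set n : ℝ := (Fintype.card ι : ℝ) ^ 2
  have hn : 0 ≤ n := by positivity
  -- the coefficients of the first order expressions
  set VA : (ι → ℂ) → ι → ι → ℂ := fun q => (dd S v0 ρ q)⁻¹ •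
    horMat S v0 ρ (fun q i j => levMat (D2 S ρ q) i j) q with hVA
  -- On the boundary the form of the solution on projected vectors is `VB + u_{v0} VA`. All unknown
  -- dependence sits in `u_{v0}`, since there `X` equals the known `XB` and `u` equals `φ`.
  set VB : (ι → ℂ) → ι → ι → ℂ := fun q =>
    horMat S v0 ρ (fun q => XB q + fun i j => levMat (D2 S φ q) i j) q - dd S v0 φ q • VA q with hVB
  set VG : (ι → ℂ) → ι → ι → ℂ := horMat S v0 ρ gM with hVG
  have cVA : ContDiffOn ℝ 2 VA S := ((contDiffOn_dd hS (hD.smooth.of_le (m := 3) (by norm_cast))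
    (by norm_num) v0).inv fun q hq => (hv0 q hq).ne').smul
    (contDiffOn_horMat hD hv0 (contDiffOn_levMat_D2 (k := 2) hS hD.smooth))
  have cVB : ContDiffOn ℝ 2 VB S := (contDiffOn_horMat hD hv0
    (hXB.add (contDiffOn_levMat_D2 (k := 2) hS hφ))).sub
    ((contDiffOn_dd hS (hφ.of_le (m := 3) (by norm_cast)) (by norm_num) v0).smul cVA)
  have cVG : ContDiffOn ℝ 2 VG S := contDiffOn_horMat hD hv0 hgM
  have cV : ContDiffOn ℝ 2 (fun q => (VB q, VG q)) S := cVB.prodMk cVG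
  have hA := contDiffOn_tanCoeff hD hv0
  have hB := contDiffOn_tanData hD hv0 hφ
  obtain ⟨r0, hr0, hgrad⟩ := exists_boundary_gradient_bound hD hv0 hus hub hκ hp hρp
  obtain ⟨r1, hr1, Ct, hCt, htan⟩ := exists_tangential_bound hD hv0 hφ hus hub hκ hp hρp
  obtain ⟨LA, r2, hr2, hLA⟩ := exists_C2Bound hS hA hp
  obtain ⟨LB, r3, hr3, hLB⟩ := exists_C2Bound hS hB hp
  obtain ⟨L1, r4, hr4, hL1⟩ := exists_C2Bound hS cVA hp
  obtain ⟨L2, r5, hr5, hL2⟩ := exists_C2Bound hS cV hp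
  obtain ⟨Lus, r6, hr6, hLus⟩ := exists_C2Bound hS hus hp
  obtain ⟨Lg, r7, hr7, hLg⟩ := exists_C2Bound hS hgM hp
  set r := min (min (min r0 r1) (min r2 r3)) (min (min r4 r5) (min r6 r7))
  have hr : 0 < r := by positivity
  have q0 : r ≤ r0 := (min_le_left _ _).trans ((min_le_left _ _).trans (min_le_left _ _))
  have q1 : r ≤ r1 := (min_le_left _ _).trans ((min_le_left _ _).trans (min_le_right _ _))
  have q2 : r ≤ r2 := (min_le_left _ _).trans ((min_le_right _ _).trans (min_le_left _ _))
  have q3 : r ≤ r3 := (min_le_left _ _).trans ((min_le_right _ _).trans (min_le_right _ _))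
  have q4 : r ≤ r4 := (min_le_right _ _).trans ((min_le_left _ _).trans (min_le_left _ _))
  have q5 : r ≤ r5 := (min_le_right _ _).trans ((min_le_left _ _).trans (min_le_right _ _))
  have q6 : r ≤ r6 := (min_le_right _ _).trans ((min_le_right _ _).trans (min_le_left _ _))
  have q7 : r ≤ r7 := (min_le_right _ _).trans ((min_le_right _ _).trans (min_le_right _ _))
  have pos : ∀ {V : Type _} [NormedAddCommGroup V] [NormedSpace ℝ V] {f : (ι → ℂ) → V} {L r' : ℝ},
      0 < r' → C2Bound S (Metric.ball p r') L f → 0 ≤ L := fun hr' h =>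
    (norm_nonneg _).trans (h p hp (Metric.mem_ball_self hr')).1
  have hLA0 := pos hr2 hLA
  have hLB0 := pos hr3 hLB
  have hL10 := pos hr4 hL1
  have hL20 := pos hr5 hL2
  have hLus0 : 0 ≤ Lus := (norm_nonneg _).trans (hLus p hp (Metric.mem_ball_self hr6)).1
  have hLg0 := pos hr7 hLg
  -- Bound for `m0` in the only case that needs work, when the form of the solution at `ξ` is below
  -- `κ⁻¹ / 2`; it makes the coefficient bounds independent of `m0`.
  set Mb : ℝ := κ⁻¹ / (2 * γ)
  have hMb : 0 ≤ Mb := by positivity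
  set L := ‖v0‖ * LA + ‖v0‖ * LB + n * L1 + (n + Mb * n) * L2
  have hL0 : 0 ≤ L := by positivity
  obtain ⟨C, hC⟩ := hgrad r hr q0 L
  set C' := |C| + κ * ‖v0‖ * (L * ‖v0‖) + L * ‖v0‖
  have hC' : 0 ≤ C' := by positivity
  set Mw := (κ + Lus) * ‖v0‖ + 1
  have hMw : 0 < Mw := by positivity
  -- The slope satisfies `-a ≥ κ⁻¹ / (2 Mw)`, and the gradient bound gives `-a u_{v0 v0} ≤ C'`.
  set N := C' * (2 * κ * Mw)
  have hN : 0 ≤ N := by positivity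
  set H := (Ct * (1 + LA * ‖v0‖) * (1 + LA * ‖v0‖ + 2 * LA * ‖v0‖) + LA ^ 2 * N)
  have hH : 0 ≤ H := by positivity
  obtain ⟨ε, hε, hlow⟩ := exists_lower_of_hessian_le (ι := ι) hκ0 hH
  -- Upper bound for the metric at the unit vector `ξ`, converting a bound for the form at `ξ` into
  -- one for `m0`.
  set D := n * Lg + 1
  have hDp : 0 < D := by positivity
  refine ⟨r / 2, by positivity, min ε (κ⁻¹ / 2) / D, by positivity, ?_⟩
  intro u X R hs hX p' hp' hpb hρp' m0 ξ hξ hξ1 hξ2 hm0 hmin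
  have hpr : p' ∈ Metric.ball p r := Metric.ball_subset_ball (by linarith) hpb
  have hu2 : ContDiffOn ℝ 2 u S := hs.smooth.of_le (by norm_num)
  have hρ0 := hv0 p' hp'
  set Gm := Matrix.of (X p') + levMat (D2 S u p') with hGm
  have hξ0 : ξ ≠ 0 := fun h => by rw [h, norm_zero] at hξ; norm_num at hξ
  have hgξ : 0 < hermQuad (Matrix.of (gM p')) ξ := by
    have := hgpos p' hp' ξ; rw [hξ] at this; linarith
  have hm0pos : 0 < m0 := by
    have := hs.pos p' hp' ξ hξ0
    rw [hm0] at this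
    exact pos_of_mul_pos_left this hgξ.le
  have hgD : hermQuad (Matrix.of (gM p')) ξ ≤ D := by
    have h1 := (le_abs_self _).trans (abs_hermQuad_le (Matrix.of (gM p')) (κ := Lg) (fun j k =>
      ((norm_le_pi_norm _ k).trans (norm_le_pi_norm _ j)).trans
        (hLg p' hp' (Metric.ball_subset_ball q7 hpr)).1) ξ)
    rw [hξ] at h1; simp only [D]; linarith
  suffices hsuff : min ε (κ⁻¹ / 2) ≤ hermQuad Gm ξ by
    rw [div_le_iff₀ hDp]
    rw [hm0] at hsuff
    exact hsuff.trans (mul_le_mul_of_nonneg_left hgD hm0pos.le)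
  by_cases hcase : κ⁻¹ / 2 ≤ hermQuad Gm ξ
  · exact (min_le_right _ _).trans hcase
  push Not at hcase
  refine (min_le_left _ _).trans ?_
  have hm0b : m0 ≤ Mb := by
    have h1 := hgpos p' hp' ξ
    rw [hξ] at h1
    rw [hm0] at hcase
    simp only [Mb]
    rw [le_div_iff₀ (by positivity)]
    nlinarith [mul_le_mul_of_nonneg_left h1 hm0pos.le]
  -- the Levi form of `ρ` is strictly negative
  have hlevρ : κ⁻¹ / 2 ≤ Mw * (-(hermQuad (levMat (D2 S ρ p')) ξ / dd S v0 ρ p')) :=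
    hs.levi_defining_le hD hv0 hus hub hκ0 hp' hρp' hξ hξ1 hξ2 hcase (by
      have k1 := (abs_le.mp (hs.dd_le hp' v0)).2
      have k2 := (abs_le.mp (hLus.dd_le hp' (Metric.ball_subset_ball q6 hpr) v0)).1
      simp only [Mw]; linarith)
  -- the first order expression
  set l := quadEval ξ with hl
  have hln : ‖l‖ ≤ n := by
    have := norm_quadEval_le ξ
    rw [hξ] at this; simpa [n] using this
  -- The zeroth order coefficient, evaluation of `VB` minus `m0` times evaluation of `VG`, is a
  -- single functional of bounded norm applied to a fixed function.
  set l2 : (ι → ι → ℂ) × (ι → ι → ℂ) →L[ℝ] ℝ :=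
    l ∘L ContinuousLinearMap.fst ℝ _ _ - m0 • (l ∘L ContinuousLinearMap.snd ℝ _ _) with hl2
  have hl2n : ‖l2‖ ≤ n + Mb * n := by
    refine (norm_sub_le _ _).trans (add_le_add ?_ ?_)
    · refine (ContinuousLinearMap.opNorm_comp_le _ _).trans ?_
      calc ‖l‖ * ‖ContinuousLinearMap.fst ℝ (ι → ι → ℂ) (ι → ι → ℂ)‖ ≤ n * 1 :=
            mul_le_mul hln (ContinuousLinearMap.norm_fst_le _ _ _) (norm_nonneg _) hn
        _ = n := mul_one n
    · rw [norm_smul, Real.norm_eq_abs, abs_of_pos hm0pos]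
      refine mul_le_mul hm0b ((ContinuousLinearMap.opNorm_comp_le _ _).trans ?_) (norm_nonneg _) hMb
      calc ‖l‖ * ‖ContinuousLinearMap.snd ℝ (ι → ι → ℂ) (ι → ι → ℂ)‖ ≤ n * 1 :=
            mul_le_mul hln (ContinuousLinearMap.norm_snd_le _ _ _) (norm_nonneg _) hn
        _ = n := mul_one n
  set a : (ι → ℂ) → ℝ := fun q => l (VA q) with ha_def
  set b : (ι → ℂ) → ℝ := fun q => l2 (VB q, VG q) with hb_def
  have ha : ContDiffOn ℝ 2 a S := l.contDiff.comp_contDiffOn cVA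
  have hb : ContDiffOn ℝ 2 b S := l2.contDiff.comp_contDiffOn cV
  have t1 : 0 ≤ ‖v0‖ * LA := by positivity
  have t2 : 0 ≤ ‖v0‖ * LB := by positivity
  have t3 : 0 ≤ n * L1 := by positivity
  have t4 : 0 ≤ (n + Mb * n) * L2 := by positivity
  have ha' : C2Bound S (Metric.ball p r) L a :=
    (hL1.clm_comp hS cVA l hln).mono (Metric.ball_subset_ball q4) (by simp only [L]; linarith)
  have hb' : C2Bound S (Metric.ball p r) L b :=
    (hL2.clm_comp hS cV l2 hl2n).mono (Metric.ball_subset_ball q5) (by simp only [L]; linarith)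
  have hIv : ‖Complex.I • v0‖ ≤ ‖v0‖ := by rw [norm_smul]; simp
  -- On the boundary this second order quantity coincides with a first order expression, for which
  -- the gradient bound is available. The identity is neither claimed nor needed inside.
  have hfirst : ∀ q ∈ S, ρ q = 0 → firstOrder S v0 u 0 a b q =
      hermQuad (Matrix.of (X q) + levMat (D2 S u q)) (horProj S v0 ρ q ξ) -
        m0 * hermQuad (Matrix.of (gM q)) (horProj S v0 ρ q ξ) := by
    intro q hq hρq
    have hmain := hs.hermQuad_horProj hD hv0 hφ hq hρq ξ
    set ζ := horProj S v0 ρ q ξ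
    have ea : a q = (dd S v0 ρ q)⁻¹ * hermQuad (levMat (D2 S ρ q)) ζ := by
      simp only [ha_def, hVA, map_smul, smul_eq_mul, hl, quadEval_apply, hermQuad_horMat]
      rfl
    have eb : b q = hermQuad (Matrix.of (XB q)) ζ + hermQuad (levMat (D2 S φ q)) ζ -
        dd S v0 φ q * a q - m0 * hermQuad (Matrix.of (gM q)) ζ := by
      simp only [hb_def, hl2, _root_.sub_apply, _root_.smul_apply, ContinuousLinearMap.comp_apply,
        ContinuousLinearMap.coe_fst', ContinuousLinearMap.coe_snd', hVB, map_sub, map_smul,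
        smul_eq_mul, hVG]
      simp only [hl, quadEval_apply, hermQuad_horMat]
      rw [← hermQuad_add_mat]
      rfl
    have e0 : dd S 0 u q = 0 := by simp [dd]
    rw [hmain, firstOrder, e0, eb, ea, hX q hq hρq]
    ring
  have hproj : horProj S v0 ρ p' ξ = ξ := horProj_eq_self hξ1 hξ2
  obtain ⟨c1, c2⟩ : ContDiffOn ℝ 2 (fun x => tanCoeff S v0 ρ x (Complex.I • v0)) S ∧
      C2Bound S (Metric.ball p r) L (fun x => tanCoeff S v0 ρ x (Complex.I • v0)) :=
    ⟨hA.clm_apply contDiffOn_const, (hLA.clm_comp hS hA (ContinuousLinearMap.apply ℝ ℝ _)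
      (norm_apply_le _ hIv)).mono (Metric.ball_subset_ball q2) (by simp only [L]; linarith)⟩
  obtain ⟨d1, d2⟩ : ContDiffOn ℝ 2 (fun x => tanData S v0 ρ φ x (Complex.I • v0)) S ∧
      C2Bound S (Metric.ball p r) L (fun x => tanData S v0 ρ φ x (Complex.I • v0)) :=
    ⟨hB.clm_apply contDiffOn_const, (hLB.clm_comp hS hB (ContinuousLinearMap.apply ℝ ℝ _)
      (norm_apply_le _ hIv)).mono (Metric.ball_subset_ball q3) (by simp only [L]; linarith)⟩
  -- The direction `t` is zero: only `a u_{v0} + b` occurs. Minimality of `m0` gives nonnegativity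
  -- on the boundary, and equality at `p'` gives the zero.
  have h := hC u X R hs 0 a b _ _ ha hb c1 d1 ha' hb' c2 d2 (by rwa [norm_zero])
    (fun q hq _ hρq => hs.firstOrder_tan_eq_zero hD hv0 hφ hq hρq _)
    (fun q hq _ hρq => by
      obtain ⟨z1, z2⟩ := horProj_tangent (ρ := ρ) (S := S) (hv0 q hq).ne' ξ
      rw [hfirst q hq hρq]
      linarith [hmin q hq hρq _ z1 z2])
    p' hp' hpb hρp' (by rw [hfirst p' hp' hρp', hproj]; linarith)
  rw [dd_firstOrder hS hs.smooth 0 ha hb hp', map_zero] at h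
  have hap : a p' = hermQuad (levMat (D2 S ρ p')) ξ / dd S v0 ρ p' := by
    simp only [ha_def, hVA, map_smul, smul_eq_mul, hl, quadEval_apply, hermQuad_horMat, hproj]
    rw [div_eq_inv_mul]; rfl
  rw [← hap] at hlevρ
  have e1 := ha'.dd_le hp' hpr v0
  have e2 := hb'.dd_le hp' hpr v0
  rw [Real.norm_eq_abs] at e1 e2
  have e3 : |dd S v0 u p' * dd S v0 a p'| ≤ κ * ‖v0‖ * (L * ‖v0‖) := by
    rw [abs_mul]; exact mul_le_mul (hs.dd_le hp' v0) e1 (abs_nonneg _) (by positivity)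
  -- The leading term of the bounded normal derivative is `a(p') u_{v0 v0}`. With `a(p')` strictly
  -- negative, its lower bound is an upper bound for `u_{v0 v0}`.
  have hnorm : D2 S u p' v0 v0 ≤ N := by
    have h5 : -a p' * D2 S u p' v0 v0 ≤ C' := by
      simp only [C']
      linarith [(abs_le.mp e3).2, (abs_le.mp e2).2, le_abs_self C]
    by_contra hcon
    push Not at hcon
    have hpos := hN.trans_lt hcon
    have h6 : Mw * (-a p' * D2 S u p' v0 v0) ≤ Mw * C' := mul_le_mul_of_nonneg_left h5 hMw.le
    have h7 := mul_le_mul_of_nonneg_right hlevρ hpos.le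
    have h8 : κ * (κ⁻¹ / 2 * D2 S u p' v0 v0) ≤ κ * (Mw * C') :=
      mul_le_mul_of_nonneg_left (h7.trans (by linarith)) hκ0.le
    have h9 : κ * (κ⁻¹ / 2 * D2 S u p' v0 v0) = D2 S u p' v0 v0 / 2 := by field_simp
    rw [h9] at h8
    simp only [N] at hcon
    linarith
  have hsym := fun v w => D2_symm hS hD.subset_closure hu2 hp' v w
  have hHess : ∀ w, D2 S u p' w w ≤ H * ‖w‖ ^ 2 := quad_le_of_normal_le (v0 := v0)
    (l := fderivWithin ℝ ρ S p') hsym hCt hN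
    (fun v w hv => htan u X R hs p' hp' (Metric.ball_subset_ball q1 hpr) hρp' v w hv)
    (hLA p' hp' (Metric.ball_subset_ball q2 hpr)).1 (fun w => dd_add_tanCoeff hρ0.ne' w) hnorm
  have hfin := hlow S ρ φ us u X R hD hs p' hp' hHess ξ
  rwa [hξ, one_pow, mul_one] at hfin

end TangentialLowerBound

end HermitianMA

namespace HermitianMA

/-! ### Images of half space domains have the properties of a boundary domain. -/

section HalfSpaceChart

open Set Filter Topology

set_option linter.unusedSectionVars false

variable {E F : Type*} [NormedAddCommGroup E] [NormedSpace ℝ E] [FiniteDimensional ℝ E]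
  [NormedAddCommGroup F] [NormedSpace ℝ F] [FiniteDimensional ℝ F]

/-- `Z` is a diffeomorphism, with inverse `k`, of the relatively open subset `T` of the half space
`{0 ≤ l}` onto `S`. -/
structure HalfSpaceChart (l : E →L[ℝ] ℝ) (T : Set E) (Z : E → F) (S : Set F) (k : F → E) :
    Prop where
  nontrivial : ∃ e0, 0 < l e0
  halfspace : ∀ y ∈ T, 0 ≤ l y
  mem_nhds : ∀ y ∈ T, T ∈ 𝓝[{y | 0 ≤ l y}] y
  smooth : ContDiffOn ℝ ∞ Z T
  bijective : ∀ y ∈ T, Function.Bijective (fderivWithin ℝ Z T y)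
  mapsTo : MapsTo Z T S
  mapsTo_symm : MapsTo k S T
  left_inv : ∀ y ∈ T, k (Z y) = y
  right_inv : ∀ q ∈ S, Z (k q) = q
  continuous_symm : ContinuousOn k S

variable {l : E →L[ℝ] ℝ} {T : Set E} {Z : E → F} {S : Set F} {k : F → E}

namespace HalfSpaceChart

theorem nhdsWithin_eq (h : HalfSpaceChart l T Z S k) {y : E} (hy : y ∈ T) :
    𝓝[T] y = 𝓝[{y | 0 ≤ l y}] y :=
  le_antisymm (nhdsWithin_mono _ h.halfspace) (nhdsWithin_le_iff.mpr (h.mem_nhds y hy))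

theorem uniqueDiffOn_source (h : HalfSpaceChart l T Z S k) : UniqueDiffOn ℝ T := by
  intro y hy
  refine (uniqueDiffWithinAt_congr (h.nhdsWithin_eq hy)).mpr ?_
  refine uniqueDiffOn_convex ?_ ?_ y (h.halfspace y hy)
  · exact convex_halfSpace_ge l.toLinearMap.isLinear 0
  · obtain ⟨e0, he0⟩ := h.nontrivial
    refine ⟨e0, mem_interior_iff_mem_nhds.mpr ?_⟩
    filter_upwards [(isOpen_lt continuous_const l.continuous).mem_nhds he0] with y hy'
    exact hy'.le

theorem image_eq (h : HalfSpaceChart l T Z S k) : Z '' T = S :=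
  Subset.antisymm h.mapsTo.image_subset fun q hq => ⟨k q, h.mapsTo_symm hq, h.right_inv q hq⟩

/-- The derivative of the chart as an equivalence. -/
noncomputable def derivEquiv (h : HalfSpaceChart l T Z S k) {y : E} (hy : y ∈ T) : E ≃L[ℝ] F :=
  (LinearEquiv.ofBijective (fderivWithin ℝ Z T y).toLinearMap (h.bijective y hy)).toContinuousLinearEquiv

theorem coe_derivEquiv (h : HalfSpaceChart l T Z S k) {y : E} (hy : y ∈ T) :
    (h.derivEquiv hy : E →L[ℝ] F) = fderivWithin ℝ Z T y := by
  ext v; rfl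

theorem hasFDerivWithinAt (h : HalfSpaceChart l T Z S k) {y : E} (hy : y ∈ T) :
    HasFDerivWithinAt Z (h.derivEquiv hy : E →L[ℝ] F) T y := by
  rw [coe_derivEquiv]
  exact (h.smooth.differentiableOn (by simp) y hy).hasFDerivWithinAt

theorem uniqueDiffOn (h : HalfSpaceChart l T Z S k) : UniqueDiffOn ℝ S := by
  rw [← h.image_eq]
  rintro _ ⟨y, hy, rfl⟩
  exact (h.hasFDerivWithinAt hy).uniqueDiffWithinAt_of_continuousLinearEquiv _
    (h.uniqueDiffOn_source y hy)

theorem tendsto_symm (h : HalfSpaceChart l T Z S k) {q : F} (hq : q ∈ S) :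
    Tendsto k (𝓝[S] q) (𝓝[T] (k q)) :=
  tendsto_nhdsWithin_iff.mpr ⟨h.continuous_symm q hq,
    eventually_of_mem self_mem_nhdsWithin fun _ hx => h.mapsTo_symm hx⟩

theorem hasFDerivWithinAt_symm (h : HalfSpaceChart l T Z S k) {q : F} (hq : q ∈ S) :
    HasFDerivWithinAt k ((h.derivEquiv (h.mapsTo_symm hq)).symm : F →L[ℝ] E) S q :=
  HasFDerivWithinAt.of_local_left_inverse (h.tendsto_symm hq)
    (h.hasFDerivWithinAt (h.mapsTo_symm hq)) hq
    (eventually_of_mem self_mem_nhdsWithin h.right_inv)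

theorem fderivWithin_symm (h : HalfSpaceChart l T Z S k) {q : F} (hq : q ∈ S) :
    fderivWithin ℝ k S q = (fderivWithin ℝ Z T (k q)).inverse := by
  rw [(h.hasFDerivWithinAt_symm hq).fderivWithin (h.uniqueDiffOn q hq),
    ← h.coe_derivEquiv (h.mapsTo_symm hq), ContinuousLinearMap.inverse_equiv]

/-- The derivative of `k` is the inverse of the derivative of `Z` evaluated along `k`, so each order
of smoothness of `k` yields the next. -/
theorem contDiffOn_symm (h : HalfSpaceChart l T Z S k) : ContDiffOn ℝ ∞ k S := by
  refine contDiffOn_infty.mpr fun n => ?_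
  induction n with
  | zero => exact contDiffOn_zero.mpr h.continuous_symm
  | succ n ih =>
    have hZ : ContDiffOn ℝ n (fderivWithin ℝ Z T) T :=
      contDiffOn_fderivWithin h.uniqueDiffOn_source h.smooth (by exact_mod_cast le_top)
    have hcomp : ContDiffOn ℝ n (fun q => (fderivWithin ℝ Z T (k q)).inverse) S := by
      intro q hq
      have h1 : ContDiffAt ℝ n ContinuousLinearMap.inverse (fderivWithin ℝ Z T (k q)) := by
        rw [← h.coe_derivEquiv (h.mapsTo_symm hq)]
        exact contDiffAt_map_inverse _
      exact h1.comp_contDiffWithinAt q ((hZ.comp ih h.mapsTo_symm) q hq)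
    have := (contDiffOn_succ_iff_fderivWithin (n := (n : ℕ∞ω)) h.uniqueDiffOn (f := k)).mpr
      ⟨fun q hq => (h.hasFDerivWithinAt_symm hq).differentiableWithinAt, by simp,
        hcomp.congr fun q hq => h.fderivWithin_symm hq⟩
    exact_mod_cast this

theorem mem_nhds_of_pos (h : HalfSpaceChart l T Z S k) {y : E} (hy : y ∈ T) (hl : 0 < l y) :
    T ∈ 𝓝 y := by
  have h1 := h.mem_nhds y hy
  have h2 : {y | 0 ≤ l y} ∈ 𝓝 y := by
    filter_upwards [(isOpen_lt continuous_const l.continuous).mem_nhds hl] with y hy'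
    exact hy'.le
  rwa [nhdsWithin_eq_nhds.mpr h2] at h1

/-- Away from `{l = 0}` the chart is differentiable in a full neighbourhood and the inverse function
theorem makes it open. -/
theorem image_mem_nhds (h : HalfSpaceChart l T Z S k) {q : F} (hq : q ∈ S) (hl : 0 < l (k q)) :
    S ∈ 𝓝 q := by
  have hy := h.mapsTo_symm hq
  have hn := h.mem_nhds_of_pos hy hl
  have hc : ContDiffAt ℝ ∞ Z (k q) := h.smooth.contDiffAt hn
  have hs : HasStrictFDerivAt Z (h.derivEquiv hy : E →L[ℝ] F) (k q) := by
    rw [h.coe_derivEquiv, fderivWithin_of_mem_nhds hn]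
    exact hc.hasStrictFDerivAt (by simp)
  have := hs.map_nhds_eq_of_equiv
  rw [h.right_inv q hq] at this
  rw [← this, ← h.image_eq]
  exact image_mem_map hn

theorem eventually_line (h : HalfSpaceChart l T Z S k) {y w : E} (hy : y ∈ T)
    (hw : ∀ᶠ t : ℝ in 𝓝[>] 0, 0 ≤ l (y + t • w)) : ∀ᶠ t : ℝ in 𝓝[>] 0, y + t • w ∈ T := by
  have hc : Tendsto (fun t : ℝ => y + t • w) (𝓝[>] 0) (𝓝[{y | 0 ≤ l y}] y) := by
    refine tendsto_nhdsWithin_iff.mpr ⟨?_, hw⟩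
    have : Continuous fun t : ℝ => y + t • w := by fun_prop
    have h2 := this.tendsto 0
    simp only [zero_smul, add_zero] at h2
    exact h2.mono_left nhdsWithin_le_nhds
  exact hc (h.mem_nhds y hy)

/-- Moving the preimage along `e0` into `{0 < l}` approaches any point by interior points of the
image. -/
theorem subset_closure (h : HalfSpaceChart l T Z S k) : S ⊆ closure (interior S) := by
  intro q hq
  obtain ⟨e0, he0⟩ := h.nontrivial
  have hy := h.mapsTo_symm hq
  have hpos : ∀ t : ℝ, 0 < t → 0 < l (k q + t • e0) := fun t ht => by
    rw [map_add, map_smul, smul_eq_mul]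
    have := h.halfspace _ hy
    positivity
  have hT := h.eventually_line hy (w := e0)
    (eventually_of_mem self_mem_nhdsWithin fun t ht => (hpos t ht).le)
  have hlim : Tendsto (fun t : ℝ => Z (k q + t • e0)) (𝓝[>] 0) (𝓝 q) := by
    have h1 : Tendsto (fun t : ℝ => k q + t • e0) (𝓝[>] 0) (𝓝[T] (k q)) := by
      refine tendsto_nhdsWithin_iff.mpr ⟨?_, hT⟩
      have : Continuous fun t : ℝ => k q + t • e0 := by fun_prop
      have h2 := this.tendsto 0
      simp only [zero_smul, add_zero] at h2
      exact h2.mono_left nhdsWithin_le_nhds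
    have h2 := (h.smooth.continuousOn (k q) hy).tendsto.comp h1
    rwa [h.right_inv q hq] at h2
  refine mem_closure_of_tendsto hlim ?_
  filter_upwards [hT, self_mem_nhdsWithin] with t ht ht0
  refine mem_interior_iff_mem_nhds.mpr (h.image_mem_nhds (h.mapsTo ht) ?_)
  rw [h.left_inv _ ht]
  exact hpos t ht0

theorem mem_posTangentCone (h : HalfSpaceChart l T Z S k) {y w : E} (hy : y ∈ T)
    (hw : 0 ≤ l w) : ∃ ε : ℝ, 0 < ε ∧ ε • w ∈ posTangentConeAt T y := by
  have hev : ∀ᶠ z in 𝓝[{y | 0 ≤ l y}] y, z ∈ T := h.mem_nhds y hy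
  obtain ⟨r, hr, hball⟩ := Metric.mem_nhdsWithin_iff.mp hev
  have hseg : ∃ ε : ℝ, 0 < ε ∧ ε * ‖w‖ < r := by
    refine ⟨r / (2 * (‖w‖ + 1)), by positivity, ?_⟩
    rw [div_mul_eq_mul_div, div_lt_iff₀ (by positivity)]
    nlinarith [norm_nonneg w]
  obtain ⟨ε, hε, hεr⟩ := hseg
  refine ⟨ε, hε, ?_⟩
  · refine mem_posTangentConeAt_of_segment_subset ?_
    rintro z hz
    rw [segment_eq_image'] at hz
    obtain ⟨θ, ⟨h0, h1⟩, rfl⟩ := hz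
    refine hball ⟨?_, ?_⟩
    · rw [Metric.mem_ball, dist_eq_norm]
      simp only [add_sub_cancel_left]
      rw [norm_smul, norm_smul, Real.norm_eq_abs, Real.norm_eq_abs, abs_of_nonneg h0, abs_of_pos hε]
      have : 0 ≤ ε * ‖w‖ := by positivity
      nlinarith
    · change 0 ≤ l _
      simp only [add_sub_cancel_left, map_add, map_smul, smul_eq_mul]
      have := h.halfspace y hy
      positivity

/-- Every condition is pulled back by `Z` to the half space, where it is elementary: inward
directions lie, after scaling, in the tangent cone, and tangential directions span lines staying in
`{l = 0}`. -/
theorem boundaryDomain (h : HalfSpaceChart l T Z S k) : BoundaryDomain S fun q => l (k q) where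
  uniqueDiff := h.uniqueDiffOn
  subset_closure := h.subset_closure
  smooth := l.contDiff.comp_contDiffOn h.contDiffOn_symm
  nonneg q hq := h.halfspace _ (h.mapsTo_symm hq)
  mem_nhds q hq hl := h.image_mem_nhds hq hl
  inward q hq hρ f hf hmin v hv := by
    have hy := h.mapsTo_symm hq
    have hk := h.hasFDerivWithinAt_symm hq
    set D := h.derivEquiv hy
    have hdρ : dd S v (fun q => l (k q)) q = l (D.symm v) := by
      have := (l.hasFDerivAt.comp_hasFDerivWithinAt q hk).fderivWithin (h.uniqueDiffOn q hq)
      exact congrArg (fun L : F →L[ℝ] ℝ => L v) this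
    rw [hdρ] at hv
    have hfd := hf.hasFDerivWithinAt
    rw [← h.right_inv q hq] at hfd
    have hcomp := hfd.comp (k q) (h.hasFDerivWithinAt hy) h.mapsTo
    have hlim : Tendsto Z (𝓝[T] (k q)) (𝓝[S] q) := by
      have := tendsto_nhdsWithin_iff.mpr ⟨h.smooth.continuousOn (k q) hy,
        eventually_of_mem self_mem_nhdsWithin h.mapsTo⟩
      rwa [h.right_inv q hq] at this
    have hmin' : IsLocalMinOn (f ∘ Z) T (k q) := by
      have := hlim.eventually hmin
      filter_upwards [this] with y hy'
      simpa [h.right_inv q hq] using hy'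
    obtain ⟨ε, hε, hcone⟩ := h.mem_posTangentCone hy hv.le
    have := hmin'.hasFDerivWithinAt_nonneg hcomp hcone
    rw [map_smul, smul_eq_mul] at this
    have := nonneg_of_mul_nonneg_right this hε
    simpa [dd, D, h.right_inv q hq] using this
  tangent q hq hρ f hf hconst v hv := by
    have hy := h.mapsTo_symm hq
    have hk := h.hasFDerivWithinAt_symm hq
    set D := h.derivEquiv hy
    have hdρ : dd S v (fun q => l (k q)) q = l (D.symm v) := by
      have := (l.hasFDerivAt.comp_hasFDerivWithinAt q hk).fderivWithin (h.uniqueDiffOn q hq)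
      exact congrArg (fun L : F →L[ℝ] ℝ => L v) this
    rw [hdρ] at hv
    set w := D.symm v
    have hlw : ∀ t : ℝ, l (k q + t • w) = 0 := fun t => by
      rw [map_add, map_smul, hv, hρ]; simp
    -- This straight line stays in the boundary hyperplane, so `f ∘ Z` is constant along it near
    -- `0`. The derivative of `f` along `v` is the derivative of that constant.
    set c : ℝ → E := fun t => k q + t • w with hc
    have hc0 : c 0 = k q := by simp [hc]
    have hclim : Tendsto c (𝓝 0) (𝓝[T] (k q)) := by
      rw [h.nhdsWithin_eq hy]
      refine tendsto_nhdsWithin_iff.mpr ⟨?_, .of_forall fun t => (hlw t).ge⟩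
      have h1 : Continuous c := by fun_prop
      have h2 := h1.tendsto 0
      rwa [hc0] at h2
    have hcT : ∀ᶠ t in 𝓝 0, c t ∈ T := (tendsto_nhdsWithin_iff.mp hclim).2
    have hlim : Tendsto Z (𝓝[T] (k q)) (𝓝[S] q) := by
      have := tendsto_nhdsWithin_iff.mpr ⟨h.smooth.continuousOn (k q) hy,
        eventually_of_mem self_mem_nhdsWithin h.mapsTo⟩
      rwa [h.right_inv q hq] at this
    have hfd := hf.hasFDerivWithinAt
    rw [← h.right_inv q hq] at hfd
    have hcomp := hfd.comp (k q) (h.hasFDerivWithinAt hy) h.mapsTo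
    have hcd : HasDerivAt c w 0 := by
      have := ((hasDerivAt_id (0 : ℝ)).smul_const w).const_add (k q)
      rw [one_smul] at this
      exact this
    have hcomp' : HasFDerivWithinAt (f ∘ Z) ((fderivWithin ℝ f S (Z (k q))).comp
      (D : E →L[ℝ] F)) T (c 0) := by rw [hc0]; rwa [h.right_inv q hq] at hcomp ⊢
    have hcurve := hcomp'.comp_hasDerivWithinAt (s := c ⁻¹' T) 0 hcd.hasDerivWithinAt
      (fun t ht => ht)
    have hcurve' := hcurve.hasDerivAt hcT
    have hzero : HasDerivAt ((f ∘ Z) ∘ c) 0 0 := by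
      refine (hasDerivAt_const (0 : ℝ) (f q)).congr_of_eventuallyEq ?_
      filter_upwards [(hlim.comp hclim).eventually hconst, hcT] with t ht htT
      refine ht ?_
      simp only [Function.comp_apply]
      rw [h.left_inv _ htT, hlw]
    have := hcurve'.unique hzero
    simpa [dd, w, D, h.right_inv q hq] using this
  exists_compact q hq := by
    have hy := h.mapsTo_symm hq
    obtain ⟨r1, hr1, hball⟩ := Metric.mem_nhdsWithin_iff.mp (h.mem_nhds _ hy)
    set K1 : Set E := {y | 0 ≤ l y} ∩ Metric.closedBall (k q) (r1 / 2)
    have hK1T : K1 ⊆ T := fun y hy' => hball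
      ⟨Metric.closedBall_subset_ball (by linarith) hy'.2, hy'.1⟩
    have hK1 : IsCompact K1 := (isCompact_closedBall (k q) (r1 / 2)).inter_left
      (isClosed_le continuous_const l.continuous)
    have hZK : IsCompact (Z '' K1) := hK1.image_of_continuousOn (h.smooth.continuousOn.mono hK1T)
    have hev : ∀ᶠ x in 𝓝[S] q, k x ∈ Metric.closedBall (k q) (r1 / 2) :=
      h.continuous_symm q hq (Metric.closedBall_mem_nhds _ (by positivity))
    obtain ⟨r2, hr2, hball2⟩ := Metric.mem_nhdsWithin_iff.mp hev
    refine ⟨r2 / 2, by positivity, ?_⟩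
    have : S ∩ Metric.closedBall q (r2 / 2) = Z '' K1 ∩ Metric.closedBall q (r2 / 2) := by
      refine Subset.antisymm (fun x hx => ⟨⟨k x, ⟨h.halfspace _ (h.mapsTo_symm hx.1), ?_⟩,
        h.right_inv x hx.1⟩, hx.2⟩) fun x hx => ⟨?_, hx.2⟩
      · exact hball2 ⟨Metric.closedBall_subset_ball (by linarith) hx.2, hx.1⟩
      · obtain ⟨y, hy', rfl⟩ := hx.1
        exact h.mapsTo (hK1T hy')
    rw [this]
    exact hZK.inter_right Metric.isClosed_closedBall

end HalfSpaceChart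

end HalfSpaceChart

end HermitianMA

namespace HermitianMA

/-! ### Holomorphic coordinates on a manifold with boundary. -/

section HolomorphicCoordinates

open Set Filter Topology

set_option linter.unusedSectionVars false

variable {m : ℕ} {M : Type*} [TopologicalSpace M]
  [ChartedSpace (EuclideanHalfSpace (2 * m + 2)) M] [IsManifold (𝓡∂ (2 * m + 2)) ∞ M]
  {J : EndoField m M} {z : PartialEquiv M (Fin (m + 1) → ℂ)}

theorem IsHolCoord.hasMFDerivAt (hz : IsHolCoord J z) {x : M} (hx : x ∈ z.source) :
    HasMFDerivAt (𝓡∂ (2 * m + 2)) 𝓘(ℝ, Fin (m + 1) → ℂ) z x (realDiff (m := m) z x) :=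
  ((hz.smooth.mdifferentiableOn (by simp) x hx).mdifferentiableAt
    (hz.open_source.mem_nhds hx)).hasMFDerivAt

theorem finrank_real_eq : Module.finrank ℝ (EuclideanSpace ℝ (Fin (2 * m + 2))) =
    Module.finrank ℝ (Fin (m + 1) → ℂ) := by
  rw [finrank_euclideanSpace_fin, Module.finrank_pi_fintype]
  simp [Complex.finrank_real_complex]
  ring

theorem IsHolCoord.bijective_realDiff (hz : IsHolCoord J z) {x : M} (hx : x ∈ z.source) :
    Function.Bijective (realDiff (m := m) z x) := by
  refine ⟨hz.injective_diff x hx, ?_⟩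
  let L : EuclideanSpace ℝ (Fin (2 * m + 2)) →ₗ[ℝ] (Fin (m + 1) → ℂ) :=
    (realDiff (m := m) z x).toLinearMap
  exact (LinearMap.injective_iff_surjective_of_finrank_eq_finrank (f := L) finrank_real_eq).mp
    (hz.injective_diff x hx)

/-- Read in a half space chart of the manifold, the coordinates are a diffeomorphism onto their
image. Bijectivity of the differential comes from injectivity and equality of real dimensions. -/
theorem IsHolCoord.halfSpaceChart (hz : IsHolCoord J z) {p : M}
    (hsub : z.source ⊆ (chartAt (EuclideanHalfSpace (2 * m + 2)) p).source) :
    HalfSpaceChart (EuclideanSpace.proj (𝕜 := ℝ) (0 : Fin (2 * m + 2)))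
      (extChartAt (𝓡∂ (2 * m + 2)) p '' z.source)
      (fun y => z ((extChartAt (𝓡∂ (2 * m + 2)) p).symm y)) z.target
      (fun q => extChartAt (𝓡∂ (2 * m + 2)) p (z.symm q)) := by
  set e := extChartAt (𝓡∂ (2 * m + 2)) p with he
  have hsub' : z.source ⊆ e.source := by rwa [he, extChartAt_source]
  have hrange : range (𝓡∂ (2 * m + 2)) =
      {y | 0 ≤ EuclideanSpace.proj (𝕜 := ℝ) (0 : Fin (2 * m + 2)) y} :=
    range_modelWithCornersEuclideanHalfSpace _
  have hleft : ∀ x ∈ z.source, e.symm (e x) = x := fun x hx => e.left_inv (hsub' hx)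
  have hT : e '' z.source ⊆ e.target := by
    rintro _ ⟨x, hx, rfl⟩; exact e.map_source (hsub' hx)
  have hmaps : MapsTo e.symm (e '' z.source) z.source := by
    rintro _ ⟨x, hx, rfl⟩; rwa [hleft x hx]
  have hnhds : ∀ x ∈ z.source, e '' z.source ∈ 𝓝[range (𝓡∂ (2 * m + 2))] (e x) := fun x hx => by
    rw [← map_extChartAt_nhds' (hsub' hx)]
    exact image_mem_map (hz.open_source.mem_nhds hx)
  refine ⟨⟨EuclideanSpace.single 0 1, by simp⟩, ?_, ?_, ?_, ?_, ?_, ?_, ?_, ?_, ?_⟩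
  · rintro _ ⟨x, hx, rfl⟩
    have : e x ∈ range (𝓡∂ (2 * m + 2)) := extChartAt_target_subset_range p (e.map_source (hsub' hx))
    rwa [hrange] at this
  · rintro _ ⟨x, hx, rfl⟩
    rw [← hrange]; exact hnhds x hx
  · exact (hz.smooth.comp ((contMDiffOn_extChartAt_symm p).mono hT) hmaps).contDiffOn
  · rintro _ ⟨x, hx, rfl⟩
    have h1 : HasMFDerivWithinAt 𝓘(ℝ, EuclideanSpace ℝ (Fin (2 * m + 2))) (𝓡∂ (2 * m + 2)) e.symm
        (e '' z.source) (e x) (mfderivWithin 𝓘(ℝ, EuclideanSpace ℝ (Fin (2 * m + 2)))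
          (𝓡∂ (2 * m + 2)) e.symm (range (𝓡∂ (2 * m + 2))) (e x)) :=
      (mdifferentiableWithinAt_extChartAt_symm (e.map_source (hsub' hx))).hasMFDerivWithinAt.mono
        (hT.trans (extChartAt_target_subset_range p))
    have h2 := hz.hasMFDerivAt hx
    rw [← hleft x hx] at h2
    have h3 := h2.comp_hasMFDerivWithinAt (e x) h1
    let L : EuclideanSpace ℝ (Fin (2 * m + 2)) →L[ℝ] (Fin (m + 1) → ℂ) :=
      (realDiff (m := m) z (e.symm (e x))).comp (mfderivWithin 𝓘(ℝ, EuclideanSpace ℝ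
        (Fin (2 * m + 2))) (𝓡∂ (2 * m + 2)) e.symm (range (𝓡∂ (2 * m + 2))) (e x))
    have h4 : HasFDerivWithinAt (z ∘ e.symm) L (e '' z.source) (e x) :=
      hasMFDerivWithinAt_iff_hasFDerivWithinAt.mp h3
    have hud : UniqueDiffWithinAt ℝ (e '' z.source) (e x) := by
      refine ((𝓡∂ (2 * m + 2)).uniqueDiffOn (e x)
        (extChartAt_target_subset_range p (e.map_source (hsub' hx)))).mono_nhds ?_
      exact nhdsWithin_le_iff.mpr (hnhds x hx)
    have h5 := h4.fderivWithin hud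
    change Function.Bijective (fderivWithin ℝ (z ∘ e.symm) (e '' z.source) (e x))
    rw [h5]
    refine (hz.bijective_realDiff (x := e.symm (e x)) (by rwa [hleft x hx])).comp ?_
    obtain ⟨L', hL'⟩ := isInvertible_mfderivWithin_extChartAt_symm (I := 𝓡∂ (2 * m + 2)) (x := p)
      (e.map_source (hsub' hx))
    rw [← hL']; exact L'.bijective
  · exact fun y hy => z.map_source (hmaps hy)
  · exact fun q hq => mem_image_of_mem _ (z.map_target hq)
  · rintro _ ⟨x, hx, rfl⟩
    simp only [hleft x hx, z.left_inv hx]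
  · intro q hq
    simp only [hleft _ (z.map_target hq), z.right_inv hq]
  · exact ((continuousOn_extChartAt p).mono (by rwa [extChartAt_source])).comp hz.continuous_symm
      fun q hq => z.map_target hq

/-- The restriction of a partial equivalence to a subset of its source. -/
theorem IsHolCoord.restr (hz : IsHolCoord J z) {U : Set M} (hU : IsOpen U) :
    IsHolCoord J (z.restr U) where
  open_source := by rw [PartialEquiv.restr_source]; exact hz.open_source.inter hU
  smooth := hz.smooth.mono (by rw [PartialEquiv.restr_source]; exact inter_subset_left)
  continuous_symm := hz.continuous_symm.mono (by
    rw [PartialEquiv.restr_target]; exact inter_subset_left)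
  injective_diff x hx := hz.injective_diff x (by rw [PartialEquiv.restr_source] at hx; exact hx.1)
  complex_linear x hx := hz.complex_linear x (by rw [PartialEquiv.restr_source] at hx; exact hx.1)

theorem IsHolCoord.restr_target_mem_nhdsWithin (hz : IsHolCoord J z) {U : Set M} (hU : IsOpen U)
    {q : Fin (m + 1) → ℂ} (hq : q ∈ z.target) (hqU : z.symm q ∈ U) :
    (z.restr U).target ∈ 𝓝[z.target] q := by
  rw [PartialEquiv.restr_target]
  exact inter_mem self_mem_nhdsWithin (hz.continuous_symm q hq (hU.mem_nhds hqU))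

/-- Around every point of its domain, a coordinate system restricts to one contained in a chart. -/
theorem exists_restr_source_subset {q : Fin (m + 1) → ℂ} (hq : q ∈ z.target) :
    ∃ U : Set M, IsOpen U ∧ z.symm q ∈ U ∧ q ∈ (z.restr U).target ∧
      (z.restr U).source ⊆ (chartAt (EuclideanHalfSpace (2 * m + 2)) (z.symm q)).source := by
  refine ⟨_, (chartAt (EuclideanHalfSpace (2 * m + 2)) (z.symm q)).open_source,
    mem_chart_source _ _, ?_, ?_⟩
  · rw [PartialEquiv.restr_target]
    exact ⟨hq, mem_chart_source (EuclideanHalfSpace (2 * m + 2)) (z.symm q)⟩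
  · rw [PartialEquiv.restr_source]; exact inter_subset_right

theorem IsHolCoord.uniqueDiffOn (hz : IsHolCoord J z) : UniqueDiffOn ℝ z.target := fun q hq => by
  obtain ⟨U, hU, hqU, hqt, hs⟩ := exists_restr_source_subset hq
  exact ((hz.restr hU).halfSpaceChart hs).uniqueDiffOn q hqt |>.mono (by
    rw [PartialEquiv.restr_target]; exact inter_subset_left)

theorem IsHolCoord.subset_closure (hz : IsHolCoord J z) :
    z.target ⊆ closure (interior z.target) := fun q hq => by
  obtain ⟨U, hU, hqU, hqt, hs⟩ := exists_restr_source_subset hq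
  exact closure_mono (interior_mono (by rw [PartialEquiv.restr_target]; exact inter_subset_left))
    (((hz.restr hU).halfSpaceChart hs).subset_closure hqt)

/-- The definition requires only continuity of the inverse coordinates; smoothness is local and
follows from `HalfSpaceChart.contDiffOn_symm`. -/
theorem IsHolCoord.contMDiffOn_symm (hz : IsHolCoord J z) :
    ContMDiffOn 𝓘(ℝ, Fin (m + 1) → ℂ) (𝓡∂ (2 * m + 2)) ∞ z.symm z.target := fun q hq => by
  obtain ⟨U, hU, hqU, hqt, hs⟩ := exists_restr_source_subset hq
  have hch := (hz.restr hU).halfSpaceChart hs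
  refine ContMDiffWithinAt.mono_of_mem_nhdsWithin ?_ (hz.restr_target_mem_nhdsWithin hU hq hqU)
  set e := extChartAt (𝓡∂ (2 * m + 2)) (z.symm q)
  have hsrc : ∀ q' ∈ (z.restr U).target, z.symm q' ∈ e.source := fun q' hq' => by
    rw [extChartAt_source]; exact hs ((z.restr U).map_target hq')
  have h1 : ContMDiffOn 𝓘(ℝ, Fin (m + 1) → ℂ) (𝓡∂ (2 * m + 2)) ∞
      (e.symm ∘ fun q' => e (z.symm q')) (z.restr U).target :=
    (contMDiffOn_extChartAt_symm (z.symm q)).comp hch.contDiffOn_symm.contMDiffOn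
      fun q' hq' => e.map_source (hsrc q' hq')
  exact (h1.congr fun q' hq' => (e.left_inv (hsrc q' hq')).symm) q hqt

theorem IsHolCoord.contDiffOn (hz : IsHolCoord J z) {F : Type*} [NormedAddCommGroup F]
    [NormedSpace ℝ F] {f : M → F} {W : Set M} {n : ℕ∞} (hf : ContMDiffOn (𝓡∂ (2 * m + 2)) 𝓘(ℝ, F) n f W)
    (hW : z.source ⊆ W) : ContDiffOn ℝ n (fun q => f (z.symm q)) z.target :=
  (hf.comp (hz.contMDiffOn_symm.of_le (by exact_mod_cast le_top)) fun q hq => hW (z.map_target hq)).contDiffOn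

/-- The derivative of a function in terms of its derivative in coordinates. -/
theorem IsHolCoord.mfderiv_eq (hz : IsHolCoord J z) {F : Type*} [NormedAddCommGroup F]
    [NormedSpace ℝ F] {f : M → F} {x : M} (hx : x ∈ z.source)
    (hf : DifferentiableWithinAt ℝ (fun q => f (z.symm q)) z.target (z x))
    (v : TangentSpace (𝓡∂ (2 * m + 2)) x) :
    mfderiv (𝓡∂ (2 * m + 2)) 𝓘(ℝ, F) f x v =
      fderivWithin ℝ (fun q => f (z.symm q)) z.target (z x) (realDiff (m := m) z x v) := by
  have h1 := hasMFDerivWithinAt_iff_hasFDerivWithinAt.mpr hf.hasFDerivWithinAt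
  have h2 := h1.comp x ((hz.hasMFDerivAt hx).hasMFDerivWithinAt (s := z.source))
    fun y hy => z.map_source hy
  have h3 := h2.hasMFDerivAt (hz.open_source.mem_nhds hx)
  have h4 : HasMFDerivAt (𝓡∂ (2 * m + 2)) 𝓘(ℝ, F) f x _ := h3.congr_of_eventuallyEq (by
    filter_upwards [hz.open_source.mem_nhds hx] with y hy
    simp [z.left_inv hy])
  rw [h4.mfderiv]; rfl

theorem IsHolCoord.dirDeriv_eq (hz : IsHolCoord J z) {f : M → ℝ} {x : M} (hx : x ∈ z.source)
    (hf : DifferentiableWithinAt ℝ (fun q => f (z.symm q)) z.target (z x))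
    (v : TangentSpace (𝓡∂ (2 * m + 2)) x) :
    dirDeriv f x v = dd z.target (realDiff (m := m) z x v) (fun q => f (z.symm q)) (z x) :=
  hz.mfderiv_eq hx hf v

/-- The differential of the coordinates as an equivalence. -/
theorem IsHolCoord.isInvertible_realDiff (hz : IsHolCoord J z) {x : M} (hx : x ∈ z.source) :
    (realDiff (m := m) z x).IsInvertible := by
  let L : EuclideanSpace ℝ (Fin (2 * m + 2)) →L[ℝ] (Fin (m + 1) → ℂ) := realDiff (m := m) z x
  exact ⟨(LinearEquiv.ofBijective L.toLinearMap
    (hz.bijective_realDiff hx)).toContinuousLinearEquiv, by ext v; rfl⟩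

theorem IsHolCoord.realDiff_coordVec (hz : IsHolCoord J z) {x : M} (hx : x ∈ z.source)
    (c : Fin (m + 1) → ℂ) : realDiff (m := m) z x (coordVec z x c) = c := by
  obtain ⟨L, hL⟩ := hz.isInvertible_realDiff hx
  rw [coordVec, ← hL, ContinuousLinearMap.inverse_equiv]
  exact L.apply_symm_apply c

theorem IsHolCoord.coordVec_realDiff (hz : IsHolCoord J z) {x : M} (hx : x ∈ z.source)
    (v : TangentSpace (𝓡∂ (2 * m + 2)) x) : coordVec z x (realDiff (m := m) z x v) = v :=
  hz.injective_diff x hx (hz.realDiff_coordVec hx _)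

theorem coordVec_add (x : M) (c c' : Fin (m + 1) → ℂ) :
    coordVec z x (c + c') = coordVec z x c + coordVec z x c' := map_add _ c c'

theorem coordVec_smul (x : M) (r : ℝ) (c : Fin (m + 1) → ℂ) :
    coordVec z x (r • c) = r • coordVec z x c := map_smul _ r c

theorem IsHolCoord.J_coordVec (hz : IsHolCoord J z) {x : M} (hx : x ∈ z.source)
    (c : Fin (m + 1) → ℂ) : J x (coordVec z x c) = coordVec z x (Complex.I • c) :=
  hz.injective_diff x hx (by
    rw [hz.complex_linear x hx, hz.realDiff_coordVec hx, hz.realDiff_coordVec hx])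

theorem IsHolCoord.J_J (hz : IsHolCoord J z) {x : M} (hx : x ∈ z.source)
    (v : TangentSpace (𝓡∂ (2 * m + 2)) x) : J x (J x v) = -v :=
  hz.injective_diff x hx (by
    rw [hz.complex_linear x hx, hz.complex_linear x hx, smul_smul, map_neg]; simp)

/-- The vector field with constant coordinate representation is the derivative of the inverse
coordinates. -/
theorem IsHolCoord.mfderivWithin_symm_apply (hz : IsHolCoord J z) {q : Fin (m + 1) → ℂ}
    (hq : q ∈ z.target) (c : Fin (m + 1) → ℂ) :
    mfderivWithin 𝓘(ℝ, Fin (m + 1) → ℂ) (𝓡∂ (2 * m + 2)) z.symm z.target q c =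
      coordVec z (z.symm q) c := by
  refine hz.injective_diff _ (z.map_target hq) ?_
  rw [hz.realDiff_coordVec (z.map_target hq)]
  have h1 := (hz.contMDiffOn_symm.mdifferentiableOn (by simp) q hq).hasMFDerivWithinAt
  have h2 := (hz.hasMFDerivAt (z.map_target hq)).comp_hasMFDerivWithinAt q h1
  let L : (Fin (m + 1) → ℂ) →L[ℝ] (Fin (m + 1) → ℂ) := (realDiff (m := m) z (z.symm q)).comp
    (mfderivWithin 𝓘(ℝ, Fin (m + 1) → ℂ) (𝓡∂ (2 * m + 2)) z.symm z.target q)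
  have h3 : HasFDerivWithinAt (z ∘ z.symm) L z.target q :=
    hasMFDerivWithinAt_iff_hasFDerivWithinAt.mp h2
  have h4 : HasFDerivWithinAt (z ∘ z.symm) (ContinuousLinearMap.id ℝ (Fin (m + 1) → ℂ)) z.target q :=
    (hasFDerivWithinAt_id q z.target).congr (fun y hy => z.right_inv hy) (z.right_inv hq)
  exact congrArg (fun A : (Fin (m + 1) → ℂ) →L[ℝ] (Fin (m + 1) → ℂ) => A c)
    ((hz.uniqueDiffOn q hq).eq h3 h4)

end HolomorphicCoordinates

end HermitianMA

namespace HermitianMA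

/-! ### Coordinate expressions of `χ`, the metric and the Levi form. -/

section CoordinateExpressions

open Set Filter Topology Matrix ComplexConjugate

set_option linter.unusedSectionVars false

variable {m : ℕ} {M : Type*} [TopologicalSpace M]
  [ChartedSpace (EuclideanHalfSpace (2 * m + 2)) M]
  {J : EndoField m M} {z : PartialEquiv M (Fin (m + 1) → ℂ)}

theorem single_I (j : Fin (m + 1)) :
    (Pi.single j Complex.I : Fin (m + 1) → ℂ) = Complex.I • Pi.single j 1 := by
  rw [← Pi.single_smul']; simp

theorem dd_ofReal {E : Type*} [NormedAddCommGroup E] [NormedSpace ℝ E] {S : Set E}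
    (hS : UniqueDiffOn ℝ S) {f : E → ℝ} (hf : ContDiffOn ℝ 1 f S) {q : E} (hq : q ∈ S) (v : E) :
    dd S v (fun x => (f x : ℂ)) q = ((dd S v f q : ℝ) : ℂ) := by
  have h := Complex.ofRealCLM.hasFDerivAt.comp_hasFDerivWithinAt q
    (hf.differentiableOn (by norm_num) q hq).hasFDerivWithinAt
  exact congrArg (fun L : E →L[ℝ] ℂ => L v) (h.fderivWithin (hS q hq))

theorem dd_complex {E : Type*} [NormedAddCommGroup E] [NormedSpace ℝ E] {S : Set E}
    (hS : UniqueDiffOn ℝ S) {f g : E → ℝ} (hf : ContDiffOn ℝ 1 f S) (hg : ContDiffOn ℝ 1 g S)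
    {q : E} (hq : q ∈ S) (v : E) :
    dd S v (fun x => ((f x : ℂ) + Complex.I * (g x : ℂ)) / 2) q =
      (((dd S v f q : ℝ) : ℂ) + Complex.I * ((dd S v g q : ℝ) : ℂ)) / 2 := by
  have h1 := Complex.ofRealCLM.hasFDerivAt.comp_hasFDerivWithinAt q
    (hf.differentiableOn (by norm_num) q hq).hasFDerivWithinAt
  have h2 := Complex.ofRealCLM.hasFDerivAt.comp_hasFDerivWithinAt q
    (hg.differentiableOn (by norm_num) q hq).hasFDerivWithinAt
  have h3 := (h1.add (h2.const_smul Complex.I)).const_smul (2⁻¹ : ℂ)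
  have h4 : HasFDerivWithinAt (fun x => ((f x : ℂ) + Complex.I * (g x : ℂ)) / 2) _ S q :=
    h3.congr (fun x _ => by simp [div_eq_inv_mul]) (by simp [div_eq_inv_mul])
  have h5 := congrArg (fun L : E →L[ℝ] ℂ => L v) (h4.fderivWithin (hS q hq))
  refine h5.trans ?_
  simp [dd, div_eq_inv_mul]
  ring

variable [IsManifold (𝓡∂ (2 * m + 2)) ∞ M]

theorem IsHolCoord.coordDeriv_ofReal (hz : IsHolCoord J z) {u : M → ℝ}
    (hu : ContDiffOn ℝ 1 (fun q => u (z.symm q)) z.target) {x : M} (hx : x ∈ z.source)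
    (c : Fin (m + 1) → ℂ) : coordDeriv z (fun y => (u y : ℂ)) c x =
      ((dd z.target c (fun q => u (z.symm q)) (z x) : ℝ) : ℂ) :=
  dd_ofReal hz.uniqueDiffOn hu (z.map_source hx) c

theorem IsHolCoord.dZbar_ofReal (hz : IsHolCoord J z) {u : M → ℝ}
    (hu : ContDiffOn ℝ 1 (fun q => u (z.symm q)) z.target) {x : M} (hx : x ∈ z.source)
    (k : Fin (m + 1)) : dZbar z (fun y => (u y : ℂ)) k x =
      (((dd z.target (Pi.single k 1) (fun q => u (z.symm q)) (z x) : ℝ) : ℂ) + Complex.I *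
        ((dd z.target (Complex.I • Pi.single k 1) (fun q => u (z.symm q)) (z x) : ℝ) : ℂ)) / 2 := by
  rw [dZbar, hz.coordDeriv_ofReal hu hx, hz.coordDeriv_ofReal hu hx, single_I]

theorem IsHolCoord.dZ_ofReal (hz : IsHolCoord J z) {u : M → ℝ}
    (hu : ContDiffOn ℝ 1 (fun q => u (z.symm q)) z.target) {x : M} (hx : x ∈ z.source)
    (k : Fin (m + 1)) : dZ z (fun y => (u y : ℂ)) k x =
      (((dd z.target (Pi.single k 1) (fun q => u (z.symm q)) (z x) : ℝ) : ℂ) - Complex.I *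
        ((dd z.target (Complex.I • Pi.single k 1) (fun q => u (z.symm q)) (z x) : ℝ) : ℂ)) / 2 := by
  rw [dZ, hz.coordDeriv_ofReal hu hx, hz.coordDeriv_ofReal hu hx, single_I]

theorem IsHolCoord.leviCoeff_eq (hz : IsHolCoord J z) {u : M → ℝ}
    (hu : ContDiffOn ℝ 2 (fun q => u (z.symm q)) z.target) {x : M} (hx : x ∈ z.source)
    (j k : Fin (m + 1)) :
    leviCoeff z u x j k = levMat (D2 z.target (fun q => u (z.symm q)) (z x)) j k := by
  have hS := hz.uniqueDiffOn
  have hu1 : ContDiffOn ℝ 1 (fun q => u (z.symm q)) z.target := hu.of_le (by norm_num)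
  have hq := z.map_source hx
  have key : ∀ c, coordDeriv z (fun y => dZbar z (fun q => (u q : ℂ)) k y) c x =
      (((D2 z.target (fun q => u (z.symm q)) (z x) c (Pi.single k 1) : ℝ) : ℂ) + Complex.I *
        ((D2 z.target (fun q => u (z.symm q)) (z x) c (Complex.I • Pi.single k 1) : ℝ) : ℂ)) / 2 := by
    intro c
    rw [D2_apply hS hu hq, D2_apply hS hu hq,
      ← dd_complex hS (contDiffOn_dd hS hu (by norm_num) _) (contDiffOn_dd hS hu (by norm_num) _) hq]
    refine dd_congr (fun q hq => ?_) hq c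
    change dZbar z (fun q => (u q : ℂ)) k (z.symm q) = _
    rw [hz.dZbar_ofReal hu1 (z.map_target hq), z.right_inv hq]
  rw [leviCoeff, dZ, key, key, single_I, levMat, Matrix.of_apply, levC]
  push_cast
  linear_combination (-Complex.I_sq * (((D2 z.target (fun q => u (z.symm q)) (z x)
    (Complex.I • Pi.single j 1) (Complex.I • Pi.single k 1) : ℝ) : ℂ) / 4))

theorem IsHolCoord.chiUMatrix_eq (hz : IsHolCoord J z) (χ : ℝ → BilinField m M) {u : M → ℝ}
    (hu : ContDiffOn ℝ 2 (fun q => u (z.symm q)) z.target) {x : M} (hx : x ∈ z.source) :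
    chiUMatrix χ u z x = Matrix.of (formCoeff (fun y v w => χ (u y) y v w) z x) +
      levMat (D2 z.target (fun q => u (z.symm q)) (z x)) := by
  ext j k
  simp only [chiUMatrix, Matrix.of_apply, Matrix.add_apply, hz.leviCoeff_eq hu hx]

/-- The sesquilinear form of the coefficients of a real `(1,1)`-form, without coordinates. -/
theorem IsHolCoord.hermC_formCoeff (hz : IsHolCoord J z) {x : M} (hx : x ∈ z.source)
    {η : ∀ x : M, TangentSpace (𝓡∂ (2 * m + 2)) x → TangentSpace (𝓡∂ (2 * m + 2)) x → ℝ}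
    (B : TangentSpace (𝓡∂ (2 * m + 2)) x →ₗ[ℝ] TangentSpace (𝓡∂ (2 * m + 2)) x →ₗ[ℝ] ℝ)
    (hη : ∀ v w, η x v w = B v w) (hB : ∀ v w, B (J x v) (J x w) = B v w)
    (a b : Fin (m + 1) → ℂ) :
    hermC (Matrix.of (formCoeff η z x)) a b =
      ((B (coordVec z x a) (J x (coordVec z x b)) : ℝ) : ℂ) -
        Complex.I * ((B (coordVec z x a) (coordVec z x b) : ℝ) : ℂ) := by
  set h : (Fin (m + 1) → ℂ) → (Fin (m + 1) → ℂ) → ℂ := fun a b =>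
    ((B (coordVec z x a) (J x (coordVec z x b)) : ℝ) : ℂ) -
        Complex.I * ((B (coordVec z x a) (coordVec z x b) : ℝ) : ℂ) with hh
  have e1 : Matrix.of (formCoeff η z x) =
      Matrix.of fun j k => h (Pi.single j 1) (Pi.single k 1) := by
    ext j k
    simp only [Matrix.of_apply, formCoeff, hη, coordX, coordY, hh, single_I, hz.J_coordVec hx]
  -- Complex scalars on coordinates act through `J` on tangent vectors, so `J`-invariance of `B` is
  -- what makes the expression sesquilinear.
  have hsm : ∀ (c : ℂ) (a : Fin (m + 1) → ℂ),
      coordVec z x (c • a) = c.re • coordVec z x a + c.im • J x (coordVec z x a) := fun c a => by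
    rw [smul_eq_re_im, coordVec_add, coordVec_smul, coordVec_smul, hz.J_coordVec hx]
  have hBJ : ∀ v w, B (J x v) w = -B v (J x w) := fun v w => by
    rw [← hB (J x v) w, hz.J_J hx, map_neg]; rfl
  rw [e1]
  refine (sesq_expand (h := h) ?_ ?_ ?_ ?_ a b).symm
  · intro v v' w
    simp only [hh, coordVec_add, map_add, LinearMap.add_apply]; push_cast; ring
  · intro c v w
    simp only [hh, hsm, map_add, map_smul, LinearMap.add_apply, LinearMap.smul_apply, hBJ,
      hz.J_J hx, map_neg, smul_eq_mul]
    conv_rhs => rw [← Complex.re_add_im c]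
    push_cast
    linear_combination ((c.im : ℂ) * ((B (coordVec z x v) (coordVec z x w) : ℝ) : ℂ)) * Complex.I_sq
  · intro v w w'
    simp only [hh, coordVec_add, map_add]; push_cast; ring
  · intro c v w
    simp only [hh, hsm, map_add, map_smul, hz.J_J hx, map_neg, smul_eq_mul, smul_neg]
    have hc : conj c = (c.re : ℂ) - c.im * Complex.I := by
      apply Complex.ext <;> simp
    rw [hc]
    push_cast
    linear_combination (-(c.im : ℂ) * ((B (coordVec z x v) (coordVec z x w) : ℝ) : ℂ)) * Complex.I_sq

/-- A continuous bilinear form as a linear map. -/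
noncomputable def bilinOf (χ : ℝ → BilinField m M) (s : ℝ) (x : M) :
    TangentSpace (𝓡∂ (2 * m + 2)) x →ₗ[ℝ] TangentSpace (𝓡∂ (2 * m + 2)) x →ₗ[ℝ] ℝ :=
  LinearMap.mk₂ ℝ (fun v w => χ s x v w) (fun _ _ _ => by rw [map_add]; rfl)
    (fun _ _ _ => by rw [map_smul]; rfl) (fun _ _ _ => map_add _ _ _) (fun _ _ _ => map_smul _ _ _)

/-- The form `(v, w) ↦ -g(v, J w)`. -/
noncomputable def kahlerOf (J : EndoField m M) (g : RMetric m M) (x : M) :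
    TangentSpace (𝓡∂ (2 * m + 2)) x →ₗ[ℝ] TangentSpace (𝓡∂ (2 * m + 2)) x →ₗ[ℝ] ℝ :=
  LinearMap.mk₂ ℝ (fun v w => -g.inner x v (J x w))
    (fun _ _ _ => by rw [map_add, _root_.add_apply]; ring)
    (fun _ _ _ => by rw [map_smul, _root_.smul_apply, smul_eq_mul, smul_eq_mul]; ring)
    (fun _ _ _ => by rw [map_add, map_add]; ring)
    (fun _ _ _ => by rw [map_smul, map_smul, smul_eq_mul, smul_eq_mul]; ring)

theorem IsHolCoord.hermC_chi (hz : IsHolCoord J z) {χ : ℝ → BilinField m M}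
    (hχ : ∀ s, IsReal11 J (χ s)) (u : M → ℝ) {x : M} (hx : x ∈ z.source)
    (a b : Fin (m + 1) → ℂ) :
    hermC (Matrix.of (formCoeff (fun y v w => χ (u y) y v w) z x)) a b =
      ((χ (u x) x (coordVec z x a) (J x (coordVec z x b)) : ℝ) : ℂ) -
        Complex.I * ((χ (u x) x (coordVec z x a) (coordVec z x b) : ℝ) : ℂ) :=
  hz.hermC_formCoeff hx (bilinOf χ (u x) x) (fun _ _ => rfl) (fun v w => (hχ (u x)).2 x v w) a b

theorem IsHolCoord.hermC_gMatrix (hz : IsHolCoord J z) {g : RMetric m M}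
    (hg : IsHermitianMetric J g) {x : M} (hx : x ∈ z.source) (a b : Fin (m + 1) → ℂ) :
    hermC (gMatrix J g z x) a b = ((g.inner x (coordVec z x a) (coordVec z x b) : ℝ) : ℂ) +
      Complex.I * ((g.inner x (coordVec z x a) (J x (coordVec z x b)) : ℝ) : ℂ) := by
  have := hz.hermC_formCoeff hx (η := fun y v w => - g.inner y v (J y w)) (kahlerOf J g x)
    (fun _ _ => rfl) (fun v w => congrArg Neg.neg (hg x v (J x w))) a b
  refine this.trans ?_
  simp only [kahlerOf, LinearMap.mk₂_apply, hz.J_J hx, map_neg]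
  push_cast; ring

theorem IsHolCoord.hermQuad_gMatrix (hz : IsHolCoord J z) {g : RMetric m M}
    (hg : IsHermitianMetric J g) {x : M} (hx : x ∈ z.source) (a : Fin (m + 1) → ℂ) :
    hermQuad (gMatrix J g z x) a = g.inner x (coordVec z x a) (coordVec z x a) := by
  rw [hermQuad_eq, hz.hermC_gMatrix hg hx]; simp

theorem isHermitian_of_hermC {ι : Type*} [Fintype ι] [DecidableEq ι] {A : Matrix ι ι ℂ}
    (h : ∀ v w, conj (hermC A v w) = hermC A w v) : A.IsHermitian := by
  ext j k
  rw [conjTranspose_apply, ← hermC_single A k j, ← hermC_single A j k,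
    ← h (Pi.single k 1) (Pi.single j 1)]; rfl

theorem IsHolCoord.isHermitian_chi (hz : IsHolCoord J z) {χ : ℝ → BilinField m M}
    (hχ : ∀ s, IsReal11 J (χ s)) (u : M → ℝ) {x : M} (hx : x ∈ z.source) :
    (Matrix.of (formCoeff (fun y v w => χ (u y) y v w) z x)).IsHermitian := by
  refine isHermitian_of_hermC fun v w => ?_
  have hanti : ∀ v w, χ (u x) x v w = -χ (u x) x w v := fun v w => by
    have h0 := (hχ (u x)).1 x (v + w)
    rw [map_add, map_add, _root_.add_apply, _root_.add_apply, (hχ (u x)).1, (hχ (u x)).1] at h0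
    linarith
  have hJ : ∀ v w, χ (u x) x v (J x w) = χ (u x) x w (J x v) := fun v w => by
    rw [hanti v, ← (hχ (u x)).2 x (J x w) v, hz.J_J hx, map_neg, _root_.neg_apply, neg_neg]
  rw [hz.hermC_chi hχ u hx, hz.hermC_chi hχ u hx, hJ, hanti (coordVec z x v)]
  simp [sub_eq_add_neg]

theorem IsHolCoord.isHermitian_gMatrix (hz : IsHolCoord J z) {g : RMetric m M}
    (hg : IsHermitianMetric J g) {x : M} (hx : x ∈ z.source) : (gMatrix J g z x).IsHermitian := by
  refine isHermitian_of_hermC fun v w => ?_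
  have hJ : ∀ v w, g.inner x v (J x w) = -g.inner x w (J x v) := fun v w => by
    rw [← hg x v (J x w), hz.J_J hx, map_neg, g.symm]
  rw [hz.hermC_gMatrix hg hx, hz.hermC_gMatrix hg hx, hJ (coordVec z x v), g.symm]
  simp

end CoordinateExpressions

end HermitianMA

namespace HermitianMA

/-! ### Smoothness of the coefficients. -/

section SmoothCoefficients

open Set Filter Topology Matrix Bundle

set_option linter.unusedSectionVars false

variable {m : ℕ} {M : Type*} [TopologicalSpace M]
  [ChartedSpace (EuclideanHalfSpace (2 * m + 2)) M] [IsManifold (𝓡∂ (2 * m + 2)) ∞ M]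
  {J : EndoField m M} {z : PartialEquiv M (Fin (m + 1) → ℂ)}

theorem IsHolCoord.contMDiffOn_coordVec (hz : IsHolCoord J z) (a : Fin (m + 1) → ℂ) :
    ContMDiffOn 𝓘(ℝ, Fin (m + 1) → ℂ) (𝓡∂ (2 * m + 2)).tangent ∞
      (fun q => (⟨z.symm q, coordVec z (z.symm q) a⟩ : TangentBundle (𝓡∂ (2 * m + 2)) M)) z.target := by
  have h1 := hz.contMDiffOn_symm.contMDiffOn_tangentMapWithin (m := ∞) (by simp)
    hz.uniqueDiffOn.uniqueMDiffOn
  have h2 : ContMDiffOn 𝓘(ℝ, Fin (m + 1) → ℂ) 𝓘(ℝ, Fin (m + 1) → ℂ).tangent ∞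
      (fun q => (⟨q, a⟩ : TangentBundle 𝓘(ℝ, Fin (m + 1) → ℂ) (Fin (m + 1) → ℂ))) z.target :=
    contMDiffOn_vectorSpace_iff_contDiffOn.mpr (contDiffOn_const (c := a))
  refine (h1.comp h2 fun q hq => hq).congr fun q hq => ?_
  simp only [Function.comp_apply, tangentMapWithin]
  rw [hz.mfderivWithin_symm_apply hq]

/-- Smoothness of the coefficients of a smooth family of bilinear forms. -/
theorem IsHolCoord.contDiffOn_family (hz : IsHolCoord J z) {χ : ℝ → BilinField m M}
    (hχ : SmoothFamily χ) (a b : Fin (m + 1) → ℂ) :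
    ContDiffOn ℝ ∞ (fun q : (Fin (m + 1) → ℂ) × ℝ => χ q.2 (z.symm q.1)
      (coordVec z (z.symm q.1) a) (coordVec z (z.symm q.1) b)) (z.target ×ˢ univ) := by
  have hfst : ContMDiffOn 𝓘(ℝ, (Fin (m + 1) → ℂ) × ℝ) 𝓘(ℝ, Fin (m + 1) → ℂ) ∞
      (fun q : (Fin (m + 1) → ℂ) × ℝ => q.1) (z.target ×ˢ univ) := contDiff_fst.contDiffOn.contMDiffOn
  have hmaps : MapsTo (fun q : (Fin (m + 1) → ℂ) × ℝ => q.1) (z.target ×ˢ univ) z.target :=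
    fun q hq => hq.1
  have hv := fun a => (hz.contMDiffOn_coordVec a).comp hfst hmaps
  have hb := hz.contMDiffOn_symm.comp hfst hmaps
  have hsnd : ContMDiffOn 𝓘(ℝ, (Fin (m + 1) → ℂ) × ℝ) 𝓘(ℝ, ℝ) ∞
      (fun q : (Fin (m + 1) → ℂ) × ℝ => q.2) (z.target ×ˢ univ) := contDiff_snd.contDiffOn.contMDiffOn
  have hψ := ContMDiff.comp_contMDiffOn (n := ∞) hχ (hb.prodMk hsnd)
  intro q hq
  -- The value is viewed as a section of the trivial line bundle, so that smooth bilinear sections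
  -- can be applied to smooth vector fields.
  have : ContMDiffWithinAt 𝓘(ℝ, (Fin (m + 1) → ℂ) × ℝ) ((𝓡∂ (2 * m + 2)).prod 𝓘(ℝ, ℝ)) ∞
      (fun q : (Fin (m + 1) → ℂ) × ℝ => TotalSpace.mk' ℝ (E := Bundle.Trivial M ℝ) (z.symm q.1)
        (χ q.2 (z.symm q.1) (coordVec z (z.symm q.1) a) (coordVec z (z.symm q.1) b)))
      (z.target ×ˢ univ) q := by
    apply ContMDiffWithinAt.clm_bundle_apply₂ (F₁ := EuclideanSpace ℝ (Fin (2 * m + 2)))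
      (F₂ := EuclideanSpace ℝ (Fin (2 * m + 2)))
      (E₁ := fun x : M => TangentSpace (𝓡∂ (2 * m + 2)) x)
      (E₂ := fun x : M => TangentSpace (𝓡∂ (2 * m + 2)) x)
    · exact hψ q hq
    · exact hv a q hq
    · exact hv b q hq
  simp only [contMDiffWithinAt_totalSpace] at this
  exact contMDiffWithinAt_iff_contDiffWithinAt.mp this.2

/-- As a family constant in `s`, the metric falls under the same smoothness statement as `χ`. -/
theorem SmoothFamily.metric (g : RMetric m M) : SmoothFamily (m := m) (M := M) fun _ => g.inner :=
  g.contMDiff.comp contMDiff_fst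

theorem IsHolCoord.contDiffOn_metric (hz : IsHolCoord J z) (g : RMetric m M)
    (a b : Fin (m + 1) → ℂ) :
    ContDiffOn ℝ ∞ (fun q => g.inner (z.symm q)
      (coordVec z (z.symm q) a) (coordVec z (z.symm q) b)) z.target := by
  have h := hz.contDiffOn_family (SmoothFamily.metric g) a b
  exact h.comp (g := fun q : (Fin (m + 1) → ℂ) × ℝ => g.inner (z.symm q.1)
      (coordVec z (z.symm q.1) a) (coordVec z (z.symm q.1) b)) (f := fun q => (q, (0 : ℝ)))
    (contDiff_id.prodMk contDiff_const).contDiffOn fun q hq => ⟨hq, mem_univ _⟩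

theorem contDiffOn_ofReal_comp {E : Type*} [NormedAddCommGroup E] [NormedSpace ℝ E] {S : Set E}
    {f : E → ℝ} {n : ℕ∞ω} (hf : ContDiffOn ℝ n f S) : ContDiffOn ℝ n (fun x => (f x : ℂ)) S :=
  Complex.ofRealCLM.contDiff.comp_contDiffOn hf

/-- The coefficients of `χ(·, s)` in the coordinates `z`. -/
noncomputable def chiCoeff (χ : ℝ → BilinField m M) (z : PartialEquiv M (Fin (m + 1) → ℂ))
    (q : (Fin (m + 1) → ℂ) × ℝ) : Fin (m + 1) → Fin (m + 1) → ℂ :=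
  formCoeff (fun y v w => χ q.2 y v w) z (z.symm q.1)

/-- The coefficients of the metric in the coordinates `z`. -/
noncomputable def metricCoeff (J : EndoField m M) (g : RMetric m M)
    (z : PartialEquiv M (Fin (m + 1) → ℂ)) (q : Fin (m + 1) → ℂ) : Fin (m + 1) → Fin (m + 1) → ℂ :=
  fun j k => gMatrix J g z (z.symm q) j k

theorem IsHolCoord.contDiffOn_chiCoeff (hz : IsHolCoord J z) {χ : ℝ → BilinField m M}
    (hχ : SmoothFamily χ) : ContDiffOn ℝ ∞ (chiCoeff χ z) (z.target ×ˢ univ) :=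
  contDiffOn_pi.mpr fun _ => contDiffOn_pi.mpr fun _ =>
    (contDiffOn_ofReal_comp (hz.contDiffOn_family hχ _ _)).sub
      (contDiffOn_const.mul (contDiffOn_ofReal_comp (hz.contDiffOn_family hχ _ _)))

theorem IsHolCoord.contDiffOn_metricCoeff (hz : IsHolCoord J z) (g : RMetric m M) :
    ContDiffOn ℝ ∞ (metricCoeff J g z) z.target := by
  refine contDiffOn_pi.mpr fun j => contDiffOn_pi.mpr fun k => ?_
  have h : ∀ a b, ContDiffOn ℝ ∞ (fun q => ((-g.inner (z.symm q) (coordVec z (z.symm q) a)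
      (J (z.symm q) (coordVec z (z.symm q) b)) : ℝ) : ℂ)) z.target := fun a b =>
    contDiffOn_ofReal_comp ((hz.contDiffOn_metric g a (Complex.I • b)).neg.congr fun q hq => by
      rw [hz.J_coordVec (z.map_target hq)])
  exact (h _ _).sub (contDiffOn_const.mul (h _ _))

end SmoothCoefficients

end HermitianMA

namespace HermitianMA

/-! ### Coordinates with a defining function of the boundary. -/

section AdaptedCharts

open Set Filter Topology Matrix

set_option linter.unusedSectionVars false

variable {m : ℕ} {M : Type*} [TopologicalSpace M]
  [ChartedSpace (EuclideanHalfSpace (2 * m + 2)) M] [IsManifold (𝓡∂ (2 * m + 2)) ∞ M]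
  {J : EndoField m M} {z : PartialEquiv M (Fin (m + 1) → ℂ)}

/-- Being an interior point can be tested in any chart of the atlas, not only in the preferred chart
at `x`. A single coordinate function therefore cuts out the boundary throughout the chart domain. -/
theorem mem_boundary_iff {p x : M}
    (hx : x ∈ (chartAt (EuclideanHalfSpace (2 * m + 2)) p).source) :
    x ∈ (𝓡∂ (2 * m + 2)).boundary M ↔ extChartAt (𝓡∂ (2 * m + 2)) p x 0 = 0 := by
  have hx' : x ∈ (extChartAt (𝓡∂ (2 * m + 2)) p).source := by rwa [extChartAt_source]
  have hint := (𝓡∂ (2 * m + 2)).isInteriorPoint_iff_of_mem_atlas (n := ∞) (by simp)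
    (chart_mem_atlas (EuclideanHalfSpace (2 * m + 2)) p) hx
  have hb : x ∈ (𝓡∂ (2 * m + 2)).boundary M ↔ ¬ (𝓡∂ (2 * m + 2)).IsInteriorPoint x := by
    rw [(𝓡∂ (2 * m + 2)).isInteriorPoint_iff_not_isBoundaryPoint, not_not]; rfl
  change _ ↔ extChartAt (𝓡∂ (2 * m + 2)) p x ∈ interior (extChartAt (𝓡∂ (2 * m + 2)) p).target at hint
  set e := extChartAt (𝓡∂ (2 * m + 2)) p
  have hmem : e x ∈ range (𝓡∂ (2 * m + 2)) := extChartAt_target_subset_range p (e.map_source hx')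
  have h0 : 0 ≤ e x 0 := by
    rw [range_modelWithCornersEuclideanHalfSpace] at hmem; exact hmem
  rw [hb, hint]
  constructor
  · intro h
    by_contra hne
    have hpos : 0 < e x 0 := lt_of_le_of_ne h0 (Ne.symm hne)
    refine h (mem_interior_iff_mem_nhds.mpr ?_)
    have h1 := extChartAt_target_mem_nhdsWithin' (I := 𝓡∂ (2 * m + 2)) hx'
    have h2 : range (𝓡∂ (2 * m + 2)) ∈ 𝓝 (e x) := by
      rw [← mem_interior_iff_mem_nhds, interior_range_modelWithCornersEuclideanHalfSpace]
      exact hpos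
    rwa [nhdsWithin_eq_nhds.mpr h2] at h1
  · intro h h'
    have := interior_mono (extChartAt_target_subset_range p) h'
    rw [interior_range_modelWithCornersEuclideanHalfSpace] at this
    have h3 : 0 < e x 0 := this
    exact h3.ne' h

/-- Coordinates near the boundary together with a defining function of the boundary. -/
structure AdaptedChart (J : EndoField m M) (z : PartialEquiv M (Fin (m + 1) → ℂ))
    (ρ : (Fin (m + 1) → ℂ) → ℝ) : Prop where
  holCoord : IsHolCoord J z
  boundaryDomain : BoundaryDomain z.target ρ
  boundary_iff : ∀ x ∈ z.source, x ∈ (𝓡∂ (2 * m + 2)).boundary M ↔ ρ (z x) = 0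
  tangent_iff : ∀ x ∈ z.source, x ∈ (𝓡∂ (2 * m + 2)).boundary M →
    ∀ v : TangentSpace (𝓡∂ (2 * m + 2)) x,
      bdryDiff x v = 0 ↔ dd z.target (realDiff (m := m) z x v) ρ (z x) = 0
  exists_transversal : ∀ x ∈ z.source, x ∈ (𝓡∂ (2 * m + 2)).boundary M →
    ∃ v0, 0 < dd z.target v0 ρ (z x)

/-- The differential of the chart is invertible, so some tangent vector has first coordinate 1. -/
theorem exists_bdryDiff_ne_zero (x : M) :
    ∃ v : TangentSpace (𝓡∂ (2 * m + 2)) x, bdryDiff x v ≠ 0 := by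
  obtain ⟨L, hL⟩ := isInvertible_mfderiv_extChartAt (I := 𝓡∂ (2 * m + 2))
    (mem_extChartAt_source (I := 𝓡∂ (2 * m + 2)) x)
  have h1 : HasMFDerivAt (𝓡∂ (2 * m + 2)) 𝓘(ℝ, EuclideanSpace ℝ (Fin (2 * m + 2)))
      (extChartAt (𝓡∂ (2 * m + 2)) x) x (mfderiv (𝓡∂ (2 * m + 2))
        𝓘(ℝ, EuclideanSpace ℝ (Fin (2 * m + 2))) (extChartAt (𝓡∂ (2 * m + 2)) x) x) :=
    (mdifferentiableAt_extChartAt (mem_chart_source _ x)).hasMFDerivAt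
  let P : EuclideanSpace ℝ (Fin (2 * m + 2)) →L[ℝ] ℝ := EuclideanSpace.proj 0
  have h2 : HasMFDerivAt 𝓘(ℝ, EuclideanSpace ℝ (Fin (2 * m + 2))) 𝓘(ℝ, ℝ) P
      (extChartAt (𝓡∂ (2 * m + 2)) x x) P := hasMFDerivAt_iff_hasFDerivAt.mpr P.hasFDerivAt
  have h3 := h2.comp x h1
  let w : TangentSpace 𝓘(ℝ, EuclideanSpace ℝ (Fin (2 * m + 2))) (extChartAt (𝓡∂ (2 * m + 2)) x x) :=
    (EuclideanSpace.single 0 1 : EuclideanSpace ℝ (Fin (2 * m + 2)))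
  have hw : L (L.symm w) = w := L.apply_symm_apply w
  refine ⟨L.symm w, ?_⟩
  have h4 : bdryDiff x = fun v : TangentSpace (𝓡∂ (2 * m + 2)) x =>
      P (mfderiv (𝓡∂ (2 * m + 2)) 𝓘(ℝ, EuclideanSpace ℝ (Fin (2 * m + 2)))
        (extChartAt (𝓡∂ (2 * m + 2)) x) x v) := by
    funext v
    unfold bdryDiff dirDeriv
    exact congrArg (fun A : EuclideanSpace ℝ (Fin (2 * m + 2)) →L[ℝ] ℝ => A v) h3.mfderiv
  rw [h4, ← hL]
  have h5 : P (L (L.symm w)) = P (EuclideanSpace.single 0 1) := congrArg P hw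
  intro h6
  have h7 := h5.symm.trans h6
  simp [P] at h7

/-- `bdryDiff` uses a different chart at every point, `ρ` one fixed chart. Both functions vanish on
the boundary, so the kernel of `dρ` lies in that of `bdryDiff`; since `bdryDiff` is nonzero, the two
kernels are the same hyperplane. -/
theorem IsHolCoord.adaptedChart (hz : IsHolCoord J z) {p : M}
    (hsub : z.source ⊆ (chartAt (EuclideanHalfSpace (2 * m + 2)) p).source) :
    AdaptedChart J z (fun q => extChartAt (𝓡∂ (2 * m + 2)) p (z.symm q) 0) := by
  have hD : BoundaryDomain z.target (fun q => extChartAt (𝓡∂ (2 * m + 2)) p (z.symm q) 0) :=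
    (hz.halfSpaceChart hsub).boundaryDomain
  have hbi : ∀ x ∈ z.source, x ∈ (𝓡∂ (2 * m + 2)).boundary M ↔
      extChartAt (𝓡∂ (2 * m + 2)) p (z.symm (z x)) 0 = 0 := fun x hx => by
    rw [z.left_inv hx, mem_boundary_iff (hsub hx)]
  set ρ : (Fin (m + 1) → ℂ) → ℝ := fun q => extChartAt (𝓡∂ (2 * m + 2)) p (z.symm q) 0
  -- comparison of `ρ` with the first coordinate of the preferred chart at `x`
  have main : ∀ x ∈ z.source, x ∈ (𝓡∂ (2 * m + 2)).boundary M →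
      ∃ A : (Fin (m + 1) → ℂ) →L[ℝ] ℝ, (∀ v : TangentSpace (𝓡∂ (2 * m + 2)) x,
        bdryDiff x v = A (realDiff (m := m) z x v)) ∧
        ∀ w, dd z.target w ρ (z x) = 0 → A w = 0 := by
    intro x hx hxb
    have hq := z.map_source hx
    set f : (Fin (m + 1) → ℂ) → ℝ := fun q => extChartAt (𝓡∂ (2 * m + 2)) x (z.symm q) 0 with hf
    have hfd : DifferentiableWithinAt ℝ f z.target (z x) := by
      have h1 : ContMDiffAt (𝓡∂ (2 * m + 2)) 𝓘(ℝ, EuclideanSpace ℝ (Fin (2 * m + 2))) ∞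
          (extChartAt (𝓡∂ (2 * m + 2)) x) (z.symm (z x)) := by
        rw [z.left_inv hx]; exact contMDiffAt_extChartAt (I := 𝓡∂ (2 * m + 2)) (n := ∞) (x := x)
      have h2 := (h1.comp_contMDiffWithinAt (z x) (hz.contMDiffOn_symm (z x) hq)).contDiffWithinAt
      exact (EuclideanSpace.proj (𝕜 := ℝ) (0 : Fin (2 * m + 2))).differentiableAt.comp_differentiableWithinAt
        (z x) (h2.differentiableWithinAt (by simp))
    refine ⟨fderivWithin ℝ f z.target (z x), fun v => ?_, fun w hw => ?_⟩
    · exact hz.dirDeriv_eq (f := fun y => extChartAt (𝓡∂ (2 * m + 2)) x y 0) hx hfd v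
    · refine hD.tangent (z x) hq ((hbi x hx).mp hxb) f hfd ?_ w hw
      have hev : ∀ᶠ q in 𝓝[z.target] (z x),
          z.symm q ∈ (chartAt (EuclideanHalfSpace (2 * m + 2)) x).source := by
        refine hz.continuous_symm (z x) hq ?_
        rw [z.left_inv hx]
        exact (chartAt _ x).open_source.mem_nhds (mem_chart_source _ x)
      filter_upwards [hev, self_mem_nhdsWithin] with q h1 h2 h3
      have h4 : z.symm q ∈ (𝓡∂ (2 * m + 2)).boundary M :=
        (hbi _ (z.map_target h2)).mpr (by rw [z.right_inv h2]; exact h3)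
      simp only [hf, z.left_inv hx]
      rw [(mem_boundary_iff h1).mp h4, (mem_boundary_iff (mem_chart_source _ x)).mp hxb]
  refine ⟨hz, hD, hbi, ?_, ?_⟩
  · intro x hx hxb v
    obtain ⟨A, hA, hker⟩ := main x hx hxb
    refine ⟨fun hv => ?_, fun hv => by rw [hA, hker _ hv]⟩
    obtain ⟨v1, hv1⟩ := exists_bdryDiff_ne_zero (m := m) x
    set w1 := realDiff (m := m) z x v1
    set w := realDiff (m := m) z x v
    have hρ1 : dd z.target w1 ρ (z x) ≠ 0 := fun h => hv1 (by rw [hA, hker _ h])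
    -- Correcting `w` by a multiple of the transversal `w1` puts it into the kernel of `dρ`, hence
    -- into that of `A`; as `A w = 0` already, the multiple must be zero.
    have h1 := hker (w + (-(dd z.target w ρ (z x) / dd z.target w1 ρ (z x))) • w1) (by
      rw [dd_vec_add, dd_vec_smul, smul_eq_mul]; field_simp; ring)
    rw [map_add, map_smul, ← hA, ← hA, hv, zero_add, smul_eq_mul, neg_mul, neg_eq_zero,
      mul_eq_zero, div_eq_zero_iff] at h1
    rcases h1 with (h1 | h1) | h1
    · exact h1
    · exact absurd h1 hρ1
    · exact absurd h1 hv1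
  · intro x hx hxb
    obtain ⟨A, hA, hker⟩ := main x hx hxb
    obtain ⟨v1, hv1⟩ := exists_bdryDiff_ne_zero (m := m) x
    set w1 := realDiff (m := m) z x v1
    have hρ1 : dd z.target w1 ρ (z x) ≠ 0 := fun h => hv1 (by rw [hA, hker _ h])
    rcases lt_or_gt_of_ne hρ1 with h | h
    · refine ⟨-w1, ?_⟩
      have : dd z.target (-w1) ρ (z x) = -dd z.target w1 ρ (z x) := map_neg _ _
      rw [this]; linarith
    · exact ⟨w1, h⟩

end AdaptedCharts

end HermitianMA

namespace HermitianMA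

/-! ### Restriction to smaller domains and composition with a graph. -/

section Restriction

open Set Filter Topology

set_option linter.unusedSectionVars false

variable {E V : Type*} [NormedAddCommGroup E] [NormedSpace ℝ E] [NormedAddCommGroup V]
  [NormedSpace ℝ V] {S S' : Set E} {q : E}

theorem fderivWithin_subset' (hsub : S' ⊆ S) (hS' : UniqueDiffOn ℝ S') {w : E → V}
    (hw : ContDiffOn ℝ 1 w S) (hq : q ∈ S') : fderivWithin ℝ w S' q = fderivWithin ℝ w S q :=
  fderivWithin_subset hsub (hS' q hq) (hw.differentiableOn (by norm_num) q (hsub hq))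

/-- This allows bounds obtained on a compact part of a large chart to be used in a restriction of
that chart. -/
theorem D2_subset (hsub : S' ⊆ S) (hS : UniqueDiffOn ℝ S) (hS' : UniqueDiffOn ℝ S') {w : E → V}
    (hw : ContDiffOn ℝ 2 w S) (hq : q ∈ S') : D2 S' w q = D2 S w q := by
  have h1 : EqOn (fderivWithin ℝ w S') (fderivWithin ℝ w S) S' := fun x hx =>
    fderivWithin_subset' hsub hS' (hw.of_le (by norm_num)) hx
  unfold D2
  rw [fderivWithin_congr h1 (h1 hq)]
  exact fderivWithin_subset' hsub hS' (contDiffOn_fderivWithin hS hw (by norm_num)) hq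

theorem fderivWithin_graph (hsub : S' ⊆ S) (hS' : UniqueDiffOn ℝ S') {F : E × ℝ → V}
    (hF : ContDiffOn ℝ 1 F (S ×ˢ univ)) {u : E → ℝ} (hu : DifferentiableWithinAt ℝ u S' q)
    (hq : q ∈ S') : fderivWithin ℝ (fun x => F (x, u x)) S' q =
      (fderivWithin ℝ F (S ×ˢ univ) (q, u q)).comp
        ((ContinuousLinearMap.id ℝ E).prod (fderivWithin ℝ u S' q)) := by
  have h1 := (hF.differentiableOn (by norm_num) (q, u q) ⟨hsub hq, mem_univ _⟩).hasFDerivWithinAt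
  have h2 := (hasFDerivWithinAt_id q S').prodMk hu.hasFDerivWithinAt
  have hm : MapsTo (fun x => (x, u x)) S' (S ×ˢ univ) := fun x hx => ⟨hsub hx, mem_univ _⟩
  exact (HasFDerivWithinAt.comp (f := fun x => (x, u x)) q h1 h2 hm).fderivWithin (hS' q hq)

theorem deriv_slice {F : E × ℝ → V} (hF : ContDiffOn ℝ 1 F (S ×ˢ univ)) (hq : q ∈ S) (s : ℝ) :
    deriv (fun t => F (q, t)) s = fderivWithin ℝ F (S ×ˢ univ) (q, s) (0, 1) := by
  have h1 := (hF.differentiableOn (by norm_num) (q, s) ⟨hq, mem_univ _⟩).hasFDerivWithinAt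
  have h2 : HasDerivWithinAt (fun t : ℝ => (q, t)) ((0 : E), (1 : ℝ)) univ s :=
    (hasDerivWithinAt_const s univ q).prodMk (hasDerivWithinAt_id s univ)
  have h3 := h1.comp_hasDerivWithinAt s h2 fun t _ => ⟨hq, mem_univ _⟩
  rw [hasDerivWithinAt_univ] at h3
  exact h3.deriv

theorem contDiffOn_graph (hsub : S' ⊆ S) {n : ℕ∞ω} {F : E × ℝ → V}
    (hF : ContDiffOn ℝ n F (S ×ˢ univ)) {u : E → ℝ} (hu : ContDiffOn ℝ n u S') :
    ContDiffOn ℝ n (fun x => F (x, u x)) S' :=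
  hF.comp (contDiffOn_id.prodMk hu) fun _ hx => ⟨hsub hx, mem_univ _⟩

/-- Bounds for `F (x, u x)` and its derivative in terms of bounds for `u` and its derivative. -/
theorem exists_graph_bound (hS : UniqueDiffOn ℝ S) {F : E × ℝ → V}
    (hF : ContDiffOn ℝ 1 F (S ×ˢ univ)) {Q : Set E} (hQ : IsCompact Q) (hQS : Q ⊆ S) (K κ : ℝ) :
    ∃ C, ∀ S' ⊆ Q, UniqueDiffOn ℝ S' → ∀ u : E → ℝ, ContDiffOn ℝ 1 u S' → ∀ q ∈ S', |u q| ≤ K →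
      ‖fderivWithin ℝ u S' q‖ ≤ κ → ‖F (q, u q)‖ ≤ C ∧
        ‖fderivWithin ℝ (fun x => F (x, u x)) S' q‖ ≤ C := by
  have hT : IsCompact (Q ×ˢ Icc (-K) K) := hQ.prod isCompact_Icc
  have hTS : Q ×ˢ Icc (-K) K ⊆ S ×ˢ univ := prod_mono hQS (subset_univ _)
  obtain ⟨C1, hC1⟩ := hT.exists_bound_of_continuousOn (hF.continuousOn.mono hTS)
  obtain ⟨C2, hC2⟩ := hT.exists_bound_of_continuousOn
    (((contDiffOn_fderivWithin (hS.prod uniqueDiffOn_univ) hF (k := 0) (by norm_num)).continuousOn).mono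
      hTS)
  refine ⟨max C1 (C2 * (1 + κ)), fun S' hS'Q hS' u hu q hq huK hdu => ?_⟩
  have hmem : (q, u q) ∈ Q ×ˢ Icc (-K) K := ⟨hS'Q hq, abs_le.mp huK⟩
  refine ⟨(hC1 _ hmem).trans (le_max_left _ _), le_trans ?_ (le_max_right _ _)⟩
  rw [fderivWithin_graph (hS'Q.trans hQS) hS' hF (hu.differentiableOn (by norm_num) q hq) hq]
  have hκ : 0 ≤ κ := (norm_nonneg _).trans hdu
  have hC20 : 0 ≤ C2 := (norm_nonneg _).trans (hC2 _ hmem)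
  refine (ContinuousLinearMap.opNorm_comp_le _ _).trans
    (mul_le_mul (hC2 _ hmem) ?_ (norm_nonneg _) hC20)
  refine ContinuousLinearMap.opNorm_le_bound _ (by positivity) fun v => ?_
  have h1 : ‖fderivWithin ℝ u S' q v‖ ≤ κ * ‖v‖ := (ContinuousLinearMap.le_opNorm _ _).trans
    (mul_le_mul_of_nonneg_right hdu (norm_nonneg _))
  refine max_le ?_ ?_
  · change ‖v‖ ≤ _
    nlinarith [norm_nonneg v, mul_nonneg hκ (norm_nonneg v)]
  · exact h1.trans (by nlinarith [norm_nonneg v])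

theorem hermQuad_real_smul {ι : Type*} [Fintype ι] (A : Matrix ι ι ℂ) (r : ℝ) (ξ : ι → ℂ) :
    hermQuad A (r • ξ) = r ^ 2 * hermQuad A ξ := by
  have : r • ξ = (r : ℂ) • ξ := by ext; simp
  rw [this, hermQuad_eq, hermC_smul_left, hermC_smul_right, hermQuad_eq, Complex.conj_ofReal,
    Complex.re_ofReal_mul, Complex.re_ofReal_mul]
  ring

/-- A continuous family of positive Hermitian forms on a compact set is uniformly positive. -/
theorem exists_hermQuad_lower_of_compact {ι : Type*} [Fintype ι] {Q : Set E} (hQ : IsCompact Q)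
    {A : E → ι → ι → ℂ} (hA : ContinuousOn A Q)
    (hpos : ∀ q ∈ Q, ∀ ξ, ξ ≠ 0 → 0 < hermQuad (Matrix.of (A q)) ξ) :
    ∃ ε > 0, ∀ q ∈ Q, ∀ ξ, ε * ‖ξ‖ ^ 2 ≤ hermQuad (Matrix.of (A q)) ξ := by
  have hT : IsCompact (Q ×ˢ Metric.sphere (0 : ι → ℂ) 1) := hQ.prod (isCompact_sphere _ _)
  have hc : ContinuousOn (fun p : E × (ι → ℂ) => hermQuad (Matrix.of (A p.1)) p.2)
      (Q ×ˢ Metric.sphere (0 : ι → ℂ) 1) :=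
    (continuous_hermQuad (ι := ι)).comp_continuousOn (f := fun p : E × (ι → ℂ) => (A p.1, p.2))
      ((ContinuousOn.comp (f := fun p : E × (ι → ℂ) => p.1) hA continuousOn_fst
        fun p hp => hp.1).prodMk continuousOn_snd)
  have hex : ∃ ε > 0, ∀ p ∈ Q ×ˢ Metric.sphere (0 : ι → ℂ) 1,
      ε ≤ hermQuad (Matrix.of (A p.1)) p.2 := by
    rcases (Q ×ˢ Metric.sphere (0 : ι → ℂ) 1).eq_empty_or_nonempty with he | hne
    · exact ⟨1, one_pos, by simp [he]⟩
    · obtain ⟨p, hp, hmin⟩ := hT.exists_isMinOn hne hc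
      refine ⟨_, hpos p.1 hp.1 p.2 ?_, fun p' hp' => hmin hp'⟩
      rintro h0
      have := hp.2
      simp [h0] at this
  obtain ⟨ε, hε, hle⟩ := hex
  refine ⟨ε, hε, fun q hq ξ => ?_⟩
  rcases eq_or_ne ξ 0 with rfl | hξ
  · simp [hermQuad]
  · have h1 := hle (q, ‖ξ‖⁻¹ • ξ) ⟨hq, by simp [norm_smul, hξ]⟩
    simp only [hermQuad_real_smul] at h1
    have h2 : 0 < ‖ξ‖ ^ 2 := by positivity
    rw [inv_pow, ← div_eq_inv_mul, le_div_iff₀ h2] at h1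
    exact h1

end Restriction

/-! ### Relatively compact adapted charts. -/

section SmallCharts

open Set Filter Topology Matrix

set_option linter.unusedSectionVars false

variable {m : ℕ} {M : Type*} [TopologicalSpace M]
  [ChartedSpace (EuclideanHalfSpace (2 * m + 2)) M] [IsManifold (𝓡∂ (2 * m + 2)) ∞ M]
  {J : EndoField m M}

/-- Around every boundary point there are adapted coordinates whose image is relatively compact in
the image of larger coordinates. -/
theorem IsComplexStructure.exists_adaptedChart (hJ : IsComplexStructure J) {W : Set M}
    (hW : IsOpen W) {p : M} (hpW : p ∈ W) (hp : p ∈ (𝓡∂ (2 * m + 2)).boundary M) :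
    ∃ (z0 : PartialEquiv M (Fin (m + 1) → ℂ)) (U : Set M) (ρ : (Fin (m + 1) → ℂ) → ℝ)
      (v0 : Fin (m + 1) → ℂ) (Q : Set (Fin (m + 1) → ℂ)), IsHolCoord J z0 ∧ z0.source ⊆ W ∧
      IsCompact Q ∧ Q ⊆ z0.target ∧ (z0.restr U).target ⊆ Q ∧ p ∈ (z0.restr U).source ∧
      AdaptedChart J (z0.restr U) ρ ∧ ∀ q ∈ (z0.restr U).target,
        0 < dd (z0.restr U).target v0 ρ q := by
  obtain ⟨z1, hz1, hp1⟩ := hJ p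
  set U1 : Set M := W ∩ (chartAt (EuclideanHalfSpace (2 * m + 2)) p).source with hU1
  have hU1o : IsOpen U1 := hW.inter (chartAt _ p).open_source
  have hz0 := hz1.restr hU1o
  set z0 := z1.restr U1
  have hp0 : p ∈ z0.source := by
    rw [PartialEquiv.restr_source]; exact ⟨hp1, hpW, mem_chart_source _ p⟩
  have hsub : z0.source ⊆ U1 := by rw [PartialEquiv.restr_source]; exact inter_subset_right
  have had := hz0.adaptedChart (p := p) (hsub.trans inter_subset_right)
  set ρ : (Fin (m + 1) → ℂ) → ℝ := fun q => extChartAt (𝓡∂ (2 * m + 2)) p (z0.symm q) 0 with hρ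
  obtain ⟨v0, hv0⟩ := had.exists_transversal p hp0 hp
  have hS := had.boundaryDomain.uniqueDiff
  have hq0 := z0.map_source hp0
  have hcont : ContinuousOn (dd z0.target v0 ρ) z0.target :=
    (contDiffOn_dd hS had.boundaryDomain.smooth (k := 0) (by norm_num) v0).continuousOn
  obtain ⟨r1, hr1, hK⟩ := had.boundaryDomain.exists_compact _ hq0
  have hev : ∀ᶠ q in 𝓝[z0.target] (z0 p), 0 < dd z0.target v0 ρ q :=
    (hcont _ hq0).eventually (lt_mem_nhds hv0)
  obtain ⟨r2, hr2, hball⟩ := Metric.mem_nhdsWithin_iff.mp hev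
  -- Inside `r1` the closed ball in the target is compact; inside `r2` the vector `v0` remains
  -- transversal to the level sets of `ρ`.
  set r := min r1 r2
  have hr : 0 < r := lt_min hr1 hr2
  set U : Set M := z0.source ∩ z0 ⁻¹' Metric.ball (z0 p) r with hU
  have hUo : IsOpen U := hz0.smooth.continuousOn.isOpen_inter_preimage hz0.open_source
    Metric.isOpen_ball
  have htar : ∀ q ∈ (z0.restr U).target, q ∈ z0.target ∧ q ∈ Metric.ball (z0 p) r := fun q hq => by
    rw [PartialEquiv.restr_target] at hq
    refine ⟨hq.1, ?_⟩
    have := hq.2.2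
    rwa [mem_preimage, z0.right_inv hq.1] at this
  have hsub' : (z0.restr U).source ⊆ (chartAt (EuclideanHalfSpace (2 * m + 2)) p).source := by
    rw [PartialEquiv.restr_source]
    exact (inter_subset_left.trans hsub).trans inter_subset_right
  have had' : AdaptedChart J (z0.restr U) ρ := (hz0.restr hUo).adaptedChart hsub'
  refine ⟨z0, U, ρ, v0, z0.target ∩ Metric.closedBall (z0 p) r1, hz0,
    hsub.trans inter_subset_left, hK, inter_subset_left, fun q hq => ?_, ?_, had', fun q hq => ?_⟩
  · exact ⟨(htar q hq).1, Metric.ball_subset_closedBall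
      (Metric.ball_subset_ball (min_le_left _ _) (htar q hq).2)⟩
  · rw [PartialEquiv.restr_source]
    exact ⟨hp0, hp0, Metric.mem_ball_self hr⟩
  · have h1 : dd (z0.restr U).target v0 ρ q = dd z0.target v0 ρ q :=
      congrArg (fun A : (Fin (m + 1) → ℂ) →L[ℝ] ℝ => A v0)
        (fderivWithin_subset' (fun x hx => (htar x hx).1) had'.boundaryDomain.uniqueDiff
          (had.boundaryDomain.smooth.of_le (by norm_cast)) hq)
    rw [h1]
    exact hball ⟨Metric.ball_subset_ball (min_le_right _ _) (htar q hq).2, (htar q hq).1⟩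

end SmallCharts

end HermitianMA

namespace HermitianMA

/-! ### Positivity and bounds of the metric; the class of solutions. -/

section BoundedSolutions

open Set Filter Topology Matrix ComplexOrder

set_option linter.unusedSectionVars false

variable {m : ℕ} {M : Type*} [TopologicalSpace M]
  [ChartedSpace (EuclideanHalfSpace (2 * m + 2)) M] [IsManifold (𝓡∂ (2 * m + 2)) ∞ M]
  {J : EndoField m M} {z : PartialEquiv M (Fin (m + 1) → ℂ)}

theorem IsHolCoord.contDiffOn_prod (hz : IsHolCoord J z) {ψ : M → ℝ → ℝ}
    (hψ : ContMDiff ((𝓡∂ (2 * m + 2)).prod 𝓘(ℝ, ℝ)) 𝓘(ℝ, ℝ) ∞ (fun q : M × ℝ => ψ q.1 q.2)) :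
    ContDiffOn ℝ ∞ (fun q : (Fin (m + 1) → ℂ) × ℝ => ψ (z.symm q.1) q.2) (z.target ×ˢ univ) := by
  have hfst : ContMDiffOn 𝓘(ℝ, (Fin (m + 1) → ℂ) × ℝ) 𝓘(ℝ, Fin (m + 1) → ℂ) ∞
      (fun q : (Fin (m + 1) → ℂ) × ℝ => q.1) (z.target ×ˢ univ) := contDiff_fst.contDiffOn.contMDiffOn
  have hsnd : ContMDiffOn 𝓘(ℝ, (Fin (m + 1) → ℂ) × ℝ) 𝓘(ℝ, ℝ) ∞
      (fun q : (Fin (m + 1) → ℂ) × ℝ => q.2) (z.target ×ˢ univ) := contDiff_snd.contDiffOn.contMDiffOn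
  have hmaps : MapsTo (fun q : (Fin (m + 1) → ℂ) × ℝ => q.1) (z.target ×ˢ univ) z.target :=
    fun q hq => hq.1
  have h1 := (hz.contMDiffOn_symm.comp hfst hmaps).prodMk hsnd
  exact (hψ.comp_contMDiffOn h1).contDiffOn

/-- The determinant of the metric in the coordinates `z`. -/
noncomputable def detCoeff (J : EndoField m M) (g : RMetric m M)
    (z : PartialEquiv M (Fin (m + 1) → ℂ)) (q : Fin (m + 1) → ℂ) : ℝ :=
  (gMatrix J g z (z.symm q)).det.re

theorem IsHolCoord.contDiffOn_detCoeff (hz : IsHolCoord J z) (g : RMetric m M) :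
    ContDiffOn ℝ ∞ (detCoeff J g z) z.target := by
  have h1 : ContDiff ℝ ∞ fun A : Fin (m + 1) → Fin (m + 1) → ℂ => (Matrix.of A).det := by
    simp only [Matrix.det_apply, Matrix.of_apply]
    fun_prop
  exact Complex.reCLM.contDiff.comp_contDiffOn (h1.comp_contDiffOn (hz.contDiffOn_metricCoeff g))

theorem IsHolCoord.coordVec_ne_zero (hz : IsHolCoord J z) {x : M} (hx : x ∈ z.source)
    {a : Fin (m + 1) → ℂ} (ha : a ≠ 0) : coordVec z x a ≠ 0 := fun h => ha (by
  rw [← hz.realDiff_coordVec hx a, h, map_zero])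

theorem IsHolCoord.hermQuad_gMatrix_pos (hz : IsHolCoord J z) {g : RMetric m M}
    (hg : IsHermitianMetric J g) {x : M} (hx : x ∈ z.source) (a : Fin (m + 1) → ℂ) (ha : a ≠ 0) :
    0 < hermQuad (gMatrix J g z x) a := by
  rw [hz.hermQuad_gMatrix hg hx]
  exact g.pos x _ (hz.coordVec_ne_zero hx ha)

theorem IsHolCoord.posDef_gMatrix (hz : IsHolCoord J z) {g : RMetric m M}
    (hg : IsHermitianMetric J g) {x : M} (hx : x ∈ z.source) : (gMatrix J g z x).PosDef :=
  posDef_of_hermQuad_pos (hz.isHermitian_gMatrix hg hx) (hz.hermQuad_gMatrix_pos hg hx)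

theorem det_eq_ofReal_re {ι : Type*} [Fintype ι] [DecidableEq ι] {A : Matrix ι ι ℂ}
    (hA : A.IsHermitian) : A.det = (A.det.re : ℂ) := by
  have h := Matrix.det_conjTranspose A
  rw [hA.eq] at h
  exact (Complex.conj_eq_iff_re.mp h.symm).symm

theorem IsHolCoord.detCoeff_pos (hz : IsHolCoord J z) {g : RMetric m M}
    (hg : IsHermitianMetric J g) {q : Fin (m + 1) → ℂ} (hq : q ∈ z.target) : 0 < detCoeff J g z q :=
  (Complex.pos_iff.mp (hz.posDef_gMatrix hg (z.map_target hq)).det_pos).1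

theorem IsHolCoord.exists_metric_bounds (hz : IsHolCoord J z) {g : RMetric m M}
    (hg : IsHermitianMetric J g) {Q : Set (Fin (m + 1) → ℂ)} (hQ : IsCompact Q)
    (hQz : Q ⊆ z.target) : ∃ γ > 0, ∃ C, ∀ q ∈ Q,
      (∀ ξ, γ * ‖ξ‖ ^ 2 ≤ hermQuad (Matrix.of (metricCoeff J g z q)) ξ) ∧
      ‖metricCoeff J g z q‖ ≤ C ∧ ‖fderivWithin ℝ (metricCoeff J g z) z.target q‖ ≤ C ∧
      γ ≤ detCoeff J g z q ∧ detCoeff J g z q ≤ C ∧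
      ‖fderivWithin ℝ (detCoeff J g z) z.target q‖ ≤ C := by
  have hS := hz.uniqueDiffOn
  have hm := hz.contDiffOn_metricCoeff g
  have hd := hz.contDiffOn_detCoeff g
  obtain ⟨γ1, hγ1, h1⟩ := exists_hermQuad_lower_of_compact hQ (hm.continuousOn.mono hQz)
    fun q hq ξ hξ => hz.hermQuad_gMatrix_pos hg (z.map_target (hQz hq)) ξ hξ
  obtain ⟨C1, h2⟩ := hQ.exists_bound_of_continuousOn (hm.continuousOn.mono hQz)
  obtain ⟨C2, h3⟩ := hQ.exists_bound_of_continuousOn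
    (((contDiffOn_fderivWithin hS hm (k := 0) (by norm_num)).continuousOn).mono hQz)
  obtain ⟨C3, h4⟩ := hQ.exists_bound_of_continuousOn (hd.continuousOn.mono hQz)
  obtain ⟨C4, h5⟩ := hQ.exists_bound_of_continuousOn
    (((contDiffOn_fderivWithin hS hd (k := 0) (by norm_num)).continuousOn).mono hQz)
  obtain ⟨γ2, hγ2, h6⟩ : ∃ γ > 0, ∀ q ∈ Q, γ ≤ detCoeff J g z q := by
    rcases Q.eq_empty_or_nonempty with rfl | hne
    · exact ⟨1, one_pos, by simp⟩
    · obtain ⟨q0, hq0, hmin⟩ := hQ.exists_isMinOn hne (hd.continuousOn.mono hQz)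
      exact ⟨_, hz.detCoeff_pos hg (hQz hq0), fun q hq => hmin hq⟩
  refine ⟨min γ1 γ2, lt_min hγ1 hγ2, max (max C1 C2) (max C3 C4), fun q hq => ⟨fun ξ => ?_, ?_, ?_,
    ?_, ?_, ?_⟩⟩
  · exact (mul_le_mul_of_nonneg_right (min_le_left _ _) (by positivity)).trans (h1 q hq ξ)
  · exact (h2 q hq).trans ((le_max_left _ _).trans (le_max_left _ _))
  · exact (h3 q hq).trans ((le_max_right _ _).trans (le_max_left _ _))
  · exact (min_le_right _ _).trans (h6 q hq)
  · exact (le_abs_self _).trans ((h4 q hq).trans ((le_max_left _ _).trans (le_max_right _ _)))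
  · exact (h5 q hq).trans ((le_max_right _ _).trans (le_max_right _ _))

/-- The pairs `(ψ, u)` for which the boundary estimates hold with uniform constants. -/
structure BoundedSolution (J : EndoField m M) (g : RMetric m M) (χ : ℝ → BilinField m M)
    (φ usub : M → ℝ) (K lam Lam : ℝ) (ψ : M → ℝ → ℝ) (u : M → ℝ) : Prop where
  psiBound : PsiBound g ψ K lam Lam
  isSolution : IsSolution J g χ ψ φ u
  lower : ∀ x, usub x ≤ u x
  c1Bound : C1Bound g u K

section

variable {g : RMetric m M} {χ : ℝ → BilinField m M} {φ usub : M → ℝ} {K lam Lam : ℝ}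
  {ψ : M → ℝ → ℝ} {u : M → ℝ}

theorem C1Bound.abs_le (h : C1Bound g u K) (x : M) : |u x| ≤ K := by
  obtain ⟨r, hr, hle, -⟩ := h x; linarith

theorem C1Bound.abs_dirDeriv_le (h : C1Bound g u K) (x : M) (v : TangentSpace (𝓡∂ (2 * m + 2)) x) :
    |dirDeriv u x v| ≤ 2 * K * Real.sqrt (g.inner x v v) := by
  obtain ⟨r, hr, hle, hd⟩ := h x
  refine (hd v).trans (mul_le_mul_of_nonneg_right ?_ (Real.sqrt_nonneg _))
  linarith [abs_nonneg (u x)]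

theorem PsiBound.nonneg (h : PsiBound g ψ K lam Lam) (hu : C1Bound g u K) (x : M) : 0 ≤ Lam :=
  (abs_nonneg _).trans (h.deriv_s x (u x) (hu.abs_le x))

theorem IsHolCoord.sqrt_inner_le (hz : IsHolCoord J z) (hg : IsHermitianMetric J g) {C : ℝ}
    {q : Fin (m + 1) → ℂ} (hq : q ∈ z.target) (hC : ‖metricCoeff J g z q‖ ≤ C)
    (a : Fin (m + 1) → ℂ) : Real.sqrt (g.inner (z.symm q) (coordVec z (z.symm q) a)
      (coordVec z (z.symm q) a)) ≤ ((m + 1) ^ 2 * C + 1) * ‖a‖ := by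
  have hC0 : 0 ≤ C := (norm_nonneg _).trans hC
  rw [← hz.hermQuad_gMatrix hg (z.map_target hq)]
  have h1 := abs_hermQuad_le (gMatrix J g z (z.symm q)) (κ := C) (fun j k =>
    ((norm_le_pi_norm (metricCoeff J g z q j) k).trans (norm_le_pi_norm _ j)).trans hC) a
  rw [Fintype.card_fin] at h1
  push_cast at h1
  refine Real.sqrt_le_iff.mpr ⟨by positivity, (le_abs_self _).trans (h1.trans ?_)⟩
  rw [mul_pow]
  refine mul_le_mul_of_nonneg_right ?_ (by positivity)
  -- The constant is `t + 1` rather than `√t`: `t ≤ (t + 1)²` for `t ≥ 0`.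
  nlinarith [mul_nonneg (by positivity : (0:ℝ) ≤ ((m:ℝ) + 1) ^ 2) hC0]

end

end BoundedSolutions

end HermitianMA

namespace HermitianMA

/-! ### First derivative bounds and positivity of the subsolution in coordinates. -/

section LocalSolutions

open Set Filter Topology Matrix

set_option linter.unusedSectionVars false

variable {m : ℕ} {M : Type*} [TopologicalSpace M]
  [ChartedSpace (EuclideanHalfSpace (2 * m + 2)) M] [IsManifold (𝓡∂ (2 * m + 2)) ∞ M]
  {J : EndoField m M} {z z0 : PartialEquiv M (Fin (m + 1) → ℂ)}
  {g : RMetric m M} {χ : ℝ → BilinField m M} {φ usub : M → ℝ} {K lam Lam : ℝ}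
  {ψ : M → ℝ → ℝ} {u : M → ℝ}

theorem IsHolCoord.norm_du_le (hz : IsHolCoord J z) (hu : ContMDiff (𝓡∂ (2 * m + 2)) 𝓘(ℝ, ℝ) 4 u)
    (hK : C1Bound g u K) {c : ℝ} {q : Fin (m + 1) → ℂ} (hq : q ∈ z.target)
    (hc : ∀ a, Real.sqrt (g.inner (z.symm q) (coordVec z (z.symm q) a)
      (coordVec z (z.symm q) a)) ≤ c * ‖a‖) (hc0 : 0 ≤ c) :
    ‖fderivWithin ℝ (fun q => u (z.symm q)) z.target q‖ ≤ 2 * K * c := by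
  have hK0 : 0 ≤ K := (abs_nonneg _).trans (hK.abs_le (z.symm q))
  have hû := hz.contDiffOn (n := 4) hu.contMDiffOn (subset_univ _)
  refine ContinuousLinearMap.opNorm_le_bound _ (by positivity) fun a => ?_
  have h1 := hz.dirDeriv_eq (f := u) (z.map_target hq)
    (hû.differentiableOn (by norm_num) _ (z.map_source (z.map_target hq))) (coordVec z (z.symm q) a)
  rw [hz.realDiff_coordVec (z.map_target hq), z.right_inv hq] at h1
  change ‖dd z.target a (fun q => u (z.symm q)) q‖ ≤ _
  rw [← h1, Real.norm_eq_abs, mul_assoc]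
  exact (hK.abs_dirDeriv_le _ _).trans (mul_le_mul_of_nonneg_left (hc a) (by positivity))

theorem IsHolCoord.abs_fderiv_psi_le (hz : IsHolCoord J z) (hψ : PsiBound g ψ K lam Lam) {c : ℝ}
    {q : Fin (m + 1) → ℂ} (hq : q ∈ z.target) {s : ℝ} (hs : |s| ≤ K)
    (hc : ∀ a, Real.sqrt (g.inner (z.symm q) (coordVec z (z.symm q) a)
      (coordVec z (z.symm q) a)) ≤ c * ‖a‖) (hLam : 0 ≤ Lam) (a : Fin (m + 1) → ℂ) (b : ℝ) :
    |fderivWithin ℝ (fun q : (Fin (m + 1) → ℂ) × ℝ => ψ (z.symm q.1) q.2) (z.target ×ˢ univ) (q, s)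
      (a, b)| ≤ Lam * (c * ‖a‖) + Lam * |b| := by
  have hF := hz.contDiffOn_prod hψ.smooth
  set F := fun q : (Fin (m + 1) → ℂ) × ℝ => ψ (z.symm q.1) q.2 with hFdef
  have hF1 : ContDiffOn ℝ 1 F (z.target ×ˢ univ) := hF.of_le (by norm_cast)
  have hS := hz.uniqueDiffOn
  have hslice : ContDiffOn ℝ 1 (fun q => ψ (z.symm q) s) z.target :=
    contDiffOn_graph Subset.rfl hF1 (contDiffOn_const (c := s))
  have h1 : |fderivWithin ℝ F (z.target ×ˢ univ) (q, s) (a, 0)| ≤ Lam * (c * ‖a‖) := by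
    have e1 := hz.dirDeriv_eq (f := fun y => ψ y s) (z.map_target hq)
      (hslice.differentiableOn (by norm_num) _ (z.map_source (z.map_target hq)))
      (coordVec z (z.symm q) a)
    rw [hz.realDiff_coordVec (z.map_target hq), z.right_inv hq] at e1
    have e2 := fderivWithin_graph Subset.rfl hS hF1 (u := fun _ => s)
      (differentiableWithinAt_const s) hq
    have e3 : dd z.target a (fun q => ψ (z.symm q) s) q =
        fderivWithin ℝ F (z.target ×ˢ univ) (q, s) (a, 0) := by
      have := congrArg (fun A : (Fin (m + 1) → ℂ) →L[ℝ] ℝ => A a) e2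
      simpa [dd] using this
    rw [← e3, ← e1]
    exact (hψ.deriv_x _ s hs _).trans (mul_le_mul_of_nonneg_left (hc a) hLam)
  have h2 : |fderivWithin ℝ F (z.target ×ˢ univ) (q, s) (0, 1)| ≤ Lam := by
    rw [← deriv_slice hF1 hq s]
    exact hψ.deriv_s (z.symm q) s hs
  have h3 : ((a, b) : (Fin (m + 1) → ℂ) × ℝ) = (a, 0) + b • (0, 1) := by ext <;> simp
  rw [h3, map_add, map_smul, smul_eq_mul]
  refine (abs_add_le _ _).trans (add_le_add h1 ?_)
  rw [abs_mul, mul_comm]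
  exact mul_le_mul_of_nonneg_right h2 (abs_nonneg _)

/-- `χ(·, u)` in the coordinates `z`. -/
noncomputable def localForm (χ : ℝ → BilinField m M) (z : PartialEquiv M (Fin (m + 1) → ℂ))
    (u : M → ℝ) (q : Fin (m + 1) → ℂ) : Fin (m + 1) → Fin (m + 1) → ℂ :=
  chiCoeff χ z (q, u (z.symm q))

/-- The right hand side of the equation in the coordinates `z`. -/
noncomputable def localRhs (J : EndoField m M) (g : RMetric m M) (ψ : M → ℝ → ℝ)
    (z : PartialEquiv M (Fin (m + 1) → ℂ)) (u : M → ℝ) (q : Fin (m + 1) → ℂ) : ℝ :=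
  ψ (z.symm q) (u (z.symm q)) * detCoeff J g z q

theorem IsHolCoord.chiUMatrix_symm (hz : IsHolCoord J z) (χ : ℝ → BilinField m M)
    (hu : ContDiffOn ℝ 2 (fun q => u (z.symm q)) z.target) {q : Fin (m + 1) → ℂ}
    (hq : q ∈ z.target) : chiUMatrix χ u z (z.symm q) =
      Matrix.of (localForm χ z u q) + levMat (D2 z.target (fun q => u (z.symm q)) q) := by
  rw [hz.chiUMatrix_eq χ hu (z.map_target hq), z.right_inv hq]; rfl

/-- The subsolution is admissible for `χ(·, us)`, but the barrier needs positivity with `χ(·, u)`.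
As `us ≤ u`, monotonicity passes from one to the other. -/
theorem chiCoeff_mono (hz : IsHolCoord J z) (hχ : ∀ s, IsReal11 J (χ s)) (hmono : MonotoneFamily J χ)
    {q : Fin (m + 1) → ℂ} (hq : q ∈ z.target) {s t : ℝ} (hst : s ≤ t) (ξ : Fin (m + 1) → ℂ) :
    hermQuad (Matrix.of (chiCoeff χ z (q, s))) ξ ≤ hermQuad (Matrix.of (chiCoeff χ z (q, t))) ξ := by
  have h := fun s => congrArg Complex.re (hz.hermC_chi hχ (fun _ => s) (z.map_target hq) ξ ξ)
  have h' : ∀ s, hermQuad (Matrix.of (chiCoeff χ z (q, s))) ξ =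
      χ s (z.symm q) (coordVec z (z.symm q) ξ) (J (z.symm q) (coordVec z (z.symm q) ξ)) := fun s => by
    rw [hermQuad_eq]
    refine (h s).trans ?_
    simp
  rw [h', h']
  exact hmono s t hst _ _

theorem IsHolCoord.continuousOn_chiUCoeff (hz : IsHolCoord J z) (hχ : SmoothFamily χ)
    (hu2 : ContDiffOn ℝ 2 (fun q => u (z.symm q)) z.target) :
    ContinuousOn (fun q => fun j k => localForm χ z u q j k +
      levMat (D2 z.target (fun q => u (z.symm q)) q) j k) z.target := by
  have hS := hz.uniqueDiffOn
  have h1 : ContinuousOn (localForm χ z u) z.target :=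
    (contDiffOn_graph Subset.rfl ((hz.contDiffOn_chiCoeff hχ).of_le
      (by norm_cast : (2 : ℕ∞ω) ≤ ∞)) hu2).continuousOn
  have h2 := continuousOn_D2 hS hu2
  have h3 : ∀ v w, ContinuousOn (fun q => D2 z.target (fun q => u (z.symm q)) q v w) z.target :=
    fun v w => (h2.clm_apply continuousOn_const).clm_apply continuousOn_const
  refine continuousOn_pi.mpr fun j => continuousOn_pi.mpr fun k => ?_
  have h4 := continuousOn_pi.mp (continuousOn_pi.mp h1 j) k
  refine h4.add ?_
  simp only [levMat, levC, Matrix.of_apply]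
  refine ContinuousOn.div_const (ContinuousOn.add ?_ (continuousOn_const.mul ?_)) _
  · exact Complex.continuous_ofReal.comp_continuousOn ((h3 _ _).add (h3 _ _))
  · exact Complex.continuous_ofReal.comp_continuousOn ((h3 _ _).sub (h3 _ _))

theorem IsHolCoord.exists_subsolution_bound (hz : IsHolCoord J z) (hχ : SmoothFamily χ)
    {W : Set M} (hzW : z.source ⊆ W)
    (hus : ContMDiffOn (𝓡∂ (2 * m + 2)) 𝓘(ℝ, ℝ) 2 usub W) (husp : AdmissibleOn J χ usub W)
    {Q : Set (Fin (m + 1) → ℂ)} (hQ : IsCompact Q) (hQz : Q ⊆ z.target) :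
    ∃ ε > 0, ∀ q ∈ Q, ∀ ξ, ε * ‖ξ‖ ^ 2 ≤ hermQuad (Matrix.of (localForm χ z usub q) +
      levMat (D2 z.target (fun q => usub (z.symm q)) q)) ξ := by
  have hS := hz.uniqueDiffOn
  have hu2 : ContDiffOn ℝ 2 (fun q => usub (z.symm q)) z.target := hz.contDiffOn (n := 2) hus hzW
  have hc := hz.continuousOn_chiUCoeff hχ hu2
  refine exists_hermQuad_lower_of_compact hQ (hc.mono hQz) fun q hq ξ hξ => ?_
  have h := husp z hz _ (z.map_target (hQz hq)) (hzW (z.map_target (hQz hq))) ξ hξ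
  rw [hz.chiUMatrix_symm χ hu2 (hQz hq)] at h
  exact h

end LocalSolutions

end HermitianMA

namespace HermitianMA

/-! ### From global solutions to local ones with uniform constants. -/

section LocalSolutionBounds

open Set Filter Topology Matrix ComplexOrder

set_option linter.unusedSectionVars false

variable {m : ℕ} {M : Type*} [TopologicalSpace M]
  [ChartedSpace (EuclideanHalfSpace (2 * m + 2)) M] [IsManifold (𝓡∂ (2 * m + 2)) ∞ M]
  {J : EndoField m M} {z z0 : PartialEquiv M (Fin (m + 1) → ℂ)}
  {g : RMetric m M} {χ : ℝ → BilinField m M} {φ usub : M → ℝ} {K lam Lam : ℝ}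
  {ψ : M → ℝ → ℝ} {u : M → ℝ}

theorem BoundedSolution.contDiffOn (hs : BoundedSolution J g χ φ usub K lam Lam ψ u)
    (hz : IsHolCoord J z) : ContDiffOn ℝ 4 (fun q => u (z.symm q)) z.target :=
  hz.contDiffOn (n := 4) hs.isSolution.contMDiff.contMDiffOn (subset_univ _)

theorem BoundedSolution.norm_fderivWithin_rhs_le (hs : BoundedSolution J g χ φ usub K lam Lam ψ u)
    (hz : IsHolCoord J z) {c d κ : ℝ} {q : Fin (m + 1) → ℂ} (hq : q ∈ z.target)
    (hc : ∀ a, Real.sqrt (g.inner (z.symm q) (coordVec z (z.symm q) a)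
      (coordVec z (z.symm q) a)) ≤ c * ‖a‖) (hc0 : 0 ≤ c)
    (hdu : ‖fderivWithin ℝ (fun q => u (z.symm q)) z.target q‖ ≤ κ)
    (hd : |detCoeff J g z q| ≤ d) (hd' : ‖fderivWithin ℝ (detCoeff J g z) z.target q‖ ≤ d)
    (hlam : 0 < lam) :
    ContDiffOn ℝ 1 (localRhs J g ψ z u) z.target ∧
    ‖fderivWithin ℝ (localRhs J g ψ z u) z.target q‖ ≤ Lam * d + d * (Lam * c + Lam * κ) := by
  have hLam : 0 ≤ Lam := hs.psiBound.nonneg hs.c1Bound (z.symm q)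
  have hS := hz.uniqueDiffOn
  have hF1 : ContDiffOn ℝ 1 (fun q : (Fin (m + 1) → ℂ) × ℝ => ψ (z.symm q.1) q.2)
    (z.target ×ˢ univ) := (hz.contDiffOn_prod hs.psiBound.smooth).of_le (by norm_cast)
  have hu1 : ContDiffOn ℝ 1 (fun q => u (z.symm q)) z.target := (hs.contDiffOn hz).of_le (by norm_num)
  have hψ1 : ContDiffOn ℝ 1 (fun q => ψ (z.symm q) (u (z.symm q))) z.target :=
    contDiffOn_graph Subset.rfl hF1 hu1
  have hd1 : ContDiffOn ℝ 1 (detCoeff J g z) z.target := (hz.contDiffOn_detCoeff g).of_le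
    (by norm_cast)
  refine ⟨hψ1.mul hd1, ?_⟩
  have hd0 : 0 ≤ d := (abs_nonneg _).trans hd
  have hκ0 : 0 ≤ κ := (norm_nonneg _).trans hdu
  have hK := hs.c1Bound.abs_le (z.symm q)
  refine ContinuousLinearMap.opNorm_le_bound _ (by positivity) fun a => ?_
  have h1 := dd_mul hS hψ1 hd1 hq a
  have h2 : |dd z.target a (fun q => ψ (z.symm q) (u (z.symm q))) q| ≤
      (Lam * c + Lam * κ) * ‖a‖ := by
    have e := fderivWithin_graph Subset.rfl hS hF1 (hu1.differentiableOn (by norm_num) q hq) hq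
    have e' := congrArg (fun A : (Fin (m + 1) → ℂ) →L[ℝ] ℝ => A a) e
    change dd z.target a (fun q => ψ (z.symm q) (u (z.symm q))) q = _ at e'
    rw [e']
    refine (hz.abs_fderiv_psi_le hs.psiBound hq hK hc hLam a _).trans ?_
    have h3 : |fderivWithin ℝ (fun q => u (z.symm q)) z.target q a| ≤ κ * ‖a‖ :=
      (ContinuousLinearMap.le_opNorm _ _).trans (mul_le_mul_of_nonneg_right hdu (norm_nonneg _))
    exact (add_le_add le_rfl (mul_le_mul_of_nonneg_left h3 hLam)).trans (le_of_eq (by ring))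
  have h4 : |dd z.target a (detCoeff J g z) q| ≤ d * ‖a‖ :=
    (ContinuousLinearMap.le_opNorm _ _).trans (mul_le_mul_of_nonneg_right hd' (norm_nonneg _))
  have h5 : |ψ (z.symm q) (u (z.symm q))| ≤ Lam := by
    rw [abs_of_pos (hlam.trans_le (hs.psiBound.lower _ _ hK))]
    exact hs.psiBound.upper _ _ hK
  change |dd z.target a (localRhs J g ψ z u) q| ≤ _
  change dd z.target a (localRhs J g ψ z u) q = _ at h1
  rw [h1]
  refine (abs_add_le _ _).trans ?_
  rw [abs_mul, abs_mul]
  have h6 := mul_le_mul h5 h4 (abs_nonneg _) hLam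
  have h7 := mul_le_mul hd h2 (abs_nonneg _) hd0
  nlinarith

/-- Bounded solutions are local solutions in small coordinates, with uniform constants. -/
theorem exists_localSol (hz0 : IsHolCoord J z0) {W : Set M} (hzW : z0.source ⊆ W)
    {Q : Set (Fin (m + 1) → ℂ)} (hQ : IsCompact Q) (hQz : Q ⊆ z0.target)
    {ρ : (Fin (m + 1) → ℂ) → ℝ} (hz : AdaptedChart J z ρ) (hmap : (z : M → Fin (m + 1) → ℂ) = z0)
    (hsymm : (z.symm : (Fin (m + 1) → ℂ) → M) = z0.symm) (hzQ : z.target ⊆ Q)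
    (hg : IsHermitianMetric J g) (hχ : SmoothFamily χ) (hχt : ∀ s, IsReal11 J (χ s))
    (hmono : MonotoneFamily J χ) (hus : ContMDiffOn (𝓡∂ (2 * m + 2)) 𝓘(ℝ, ℝ) 2 usub W)
    (husp : AdmissibleOn J χ usub W) (K Lam : ℝ) (hlam : 0 < lam) :
    ∃ κ ≥ 1, ∃ γ > 0, (∀ q ∈ z.target,
        (∀ ξ, γ * ‖ξ‖ ^ 2 ≤ hermQuad (Matrix.of (metricCoeff J g z q)) ξ) ∧
        ‖fderivWithin ℝ (metricCoeff J g z) z.target q‖ ≤ κ) ∧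
      ∀ ψ u, BoundedSolution J g χ φ usub K lam Lam ψ u →
        LocalSol z.target ρ (fun q => φ (z.symm q)) (fun q => usub (z.symm q)) κ
          (fun q => u (z.symm q)) (localForm χ z u) (localRhs J g ψ z u) := by
  have hh := hz.holCoord
  have hS0 := hz0.uniqueDiffOn
  have hS := hh.uniqueDiffOn
  have hsub : z.target ⊆ z0.target := hzQ.trans hQz
  -- The small chart uses the same coordinate maps, so its coefficients are those of the large chart
  -- and their bounds come from the compact set `Q`.
  have hmc : metricCoeff J g z = metricCoeff J g z0 := by
    funext q j k
    simp only [metricCoeff, gMatrix, formCoeff, coordX, coordY, coordVec, hmap]; rw [hsymm]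
  have hdc : detCoeff J g z = detCoeff J g z0 := by
    funext q
    change (Matrix.of (metricCoeff J g z q)).det.re = (Matrix.of (metricCoeff J g z0 q)).det.re
    rw [hmc]
  have hcc : chiCoeff χ z = chiCoeff χ z0 := by
    funext q j k
    simp only [chiCoeff, formCoeff, coordX, coordY, coordVec, hmap]; rw [hsymm]
  obtain ⟨γ, hγ, C, hmet⟩ := hz0.exists_metric_bounds hg hQ hQz
  obtain ⟨ε, hε, hsubp⟩ := hz0.exists_subsolution_bound hχ hzW hus husp hQ hQz
  have hchi1 : ContDiffOn ℝ 1 (chiCoeff χ z0) (z0.target ×ˢ univ) :=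
    (hz0.contDiffOn_chiCoeff hχ).of_le (by norm_cast)
  set c : ℝ := (m + 1) ^ 2 * |C| + 1 with hcdef
  have hc1 : 1 ≤ c := by rw [hcdef]; nlinarith [mul_nonneg (sq_nonneg ((m : ℝ) + 1)) (abs_nonneg C)]
  -- `2 * K * c` bounds the coordinate differential of `u`: the 2 stems from the normalization of
  -- `|∇u|`, and `c` compares lengths for `g` with the supremum norm.
  obtain ⟨B, hB⟩ := exists_graph_bound hS0 hchi1 hQ hQz K (2 * K * c)
  set r1 := Lam * C + C * (Lam * c + Lam * (2 * K * c)) with hr1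
  -- A single constant larger than all upper bounds and larger than the inverses of all lower
  -- bounds.
  set κ := 1 + |C| + |B| + |2 * K * c| + |r1| + |Lam * C| + ε⁻¹ + (lam * γ)⁻¹ with hκ
  have hε' : 0 < ε⁻¹ := by positivity
  have hlg : 0 < (lam * γ)⁻¹ := by positivity
  have n1 := abs_nonneg C
  have n2 := abs_nonneg B
  have n3 := abs_nonneg (2 * K * c)
  have n4 := abs_nonneg r1
  have n5 := abs_nonneg (Lam * C)
  have l1 := le_abs_self C
  have l2 := le_abs_self B
  have l3 := le_abs_self (2 * K * c)
  have l4 := le_abs_self r1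
  have l5 := le_abs_self (Lam * C)
  have hκ1 : 1 ≤ κ := by linarith
  refine ⟨κ, hκ1, γ, hγ, fun q hq => ⟨fun ξ => ?_, ?_⟩, fun ψ u hs => ?_⟩
  · rw [hmc]; exact (hmet q (hzQ hq)).1 ξ
  · rw [hmc, fderivWithin_subset' hsub hS ((hz0.contDiffOn_metricCoeff g).of_le (by norm_cast)) hq]
    exact (hmet q (hzQ hq)).2.2.1.trans (by linarith)
  have hu4 := hs.contDiffOn hh
  have hu1 : ContDiffOn ℝ 1 (fun q => u (z.symm q)) z.target := hu4.of_le (by norm_num)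
  have hu2 : ContDiffOn ℝ 2 (fun q => u (z.symm q)) z.target := hu4.of_le (by norm_num)
  have hK : ∀ q, |u (z.symm q)| ≤ K := fun q => hs.c1Bound.abs_le _
  have hLam : z.target.Nonempty → 0 ≤ Lam := fun ⟨q, _⟩ =>
    hs.psiBound.nonneg hs.c1Bound (z.symm q)
  have hinner : ∀ q ∈ z.target, ∀ a, Real.sqrt (g.inner (z.symm q) (coordVec z (z.symm q) a)
      (coordVec z (z.symm q) a)) ≤ c * ‖a‖ := fun q hq a => by
    refine hh.sqrt_inner_le hg hq ?_ a
    rw [hmc]; exact (hmet q (hzQ hq)).2.1.trans l1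
  have hdu : ∀ q ∈ z.target, ‖fderivWithin ℝ (fun q => u (z.symm q)) z.target q‖ ≤ 2 * K * c :=
    fun q hq => hh.norm_du_le hs.isSolution.contMDiff hs.c1Bound hq (hinner q hq) (by linarith)
  have hXe : ∀ q, localForm χ z u q = chiCoeff χ z0 (q, u (z.symm q)) := fun q => by
    rw [localForm, hcc]
  have hXb := fun q hq => hB z.target hzQ hS (fun q => u (z.symm q)) hu1 q hq (hK q) (hdu q hq)
  have hmat := fun q (hq : q ∈ z.target) => hh.chiUMatrix_symm χ hu2 hq
  have hdet : ∀ q ∈ z.target, γ ≤ detCoeff J g z q ∧ detCoeff J g z q ≤ C ∧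
      ‖fderivWithin ℝ (detCoeff J g z) z.target q‖ ≤ C := fun q hq => by
    have hb := (hmet q (hzQ hq)).2.2.2
    rw [hdc, fderivWithin_subset' hsub hS ((hz0.contDiffOn_detCoeff g).of_le (by norm_cast)) hq]
    exact hb
  have hrhs := fun q hq => hs.norm_fderivWithin_rhs_le hh hq (hinner q hq) (by linarith) (hdu q hq)
    (by rw [abs_of_pos (hγ.trans_le (hdet q hq).1)]; exact (hdet q hq).2.1) (hdet q hq).2.2 hlam
  have hψl : ∀ q, lam ≤ ψ (z.symm q) (u (z.symm q)) := fun q => hs.psiBound.lower _ _ (hK q)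
  have hψu : ∀ q, ψ (z.symm q) (u (z.symm q)) ≤ Lam := fun q => hs.psiBound.upper _ _ (hK q)
  have hus2 : ContDiffOn ℝ 2 (fun q => usub (z0.symm q)) z0.target := hz0.contDiffOn (n := 2) hus hzW
  have hinv : ∀ t : ℝ, 0 < t → t⁻¹ ≤ κ → κ⁻¹ ≤ t := fun t ht h => by
    rw [inv_le_comm₀ (by linarith) ht]; exact h
  refine
    { smooth := hu4.of_le (by norm_num)
      smooth_X := ?_
      smooth_R := ?_
      herm := fun q hq => hh.isHermitian_chi hχt u (z.map_target hq)
      norm_X := fun q hq => ?_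
      norm_dX := fun q hq => ?_
      pos := fun q hq ξ hξ => ?_
      det_eq := fun q hq => ?_
      le_R := fun q hq => ?_
      R_le := fun q hq => ?_
      norm_dR := fun q hq => ?_
      boundary := fun q hq hρ => ?_
      lower := fun q _ => hs.lower _
      sub_pos := fun q hq ξ => ?_
      norm_du := fun q hq => (hdu q hq).trans (by linarith) }
  · exact (contDiffOn_graph hsub hchi1 hu1).congr fun q _ => hXe q
  · intro q hq; exact (hrhs q hq).1 q hq
  · rw [hXe]; exact (hXb q hq).1.trans (by linarith)
  · rw [fderivWithin_congr (fun q _ => hXe q) (hXe q)]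
    exact (hXb q hq).2.trans (by linarith)
  · have h := hs.isSolution.admissible z hh _ (z.map_target hq) (mem_univ _) ξ hξ
    rwa [hmat q hq] at h
  · have h := hs.isSolution.equation z hh _ (z.map_target hq)
    rw [hmat q hq, det_eq_ofReal_re (hh.isHermitian_gMatrix hg (z.map_target hq))] at h
    rw [h, localRhs, Complex.ofReal_mul]; rfl
  · refine (hinv _ (by positivity) (by linarith)).trans
      (mul_le_mul (hψl q) (hdet q hq).1 hγ.le (hlam.le.trans (hψl q)))
  · exact (mul_le_mul (hψu q) (hdet q hq).2.1 (hγ.le.trans (hdet q hq).1)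
      (hLam ⟨q, hq⟩)).trans (by linarith)
  · exact (hrhs q hq).2.trans (by linarith)
  · refine hs.isSolution.boundary_value _ ((hz.boundary_iff _ (z.map_target hq)).mpr ?_)
    rwa [z.right_inv hq]
  · have h1 := hsubp q (hzQ hq) ξ
    have h2 : κ⁻¹ * ‖ξ‖ ^ 2 ≤ ε * ‖ξ‖ ^ 2 :=
      mul_le_mul_of_nonneg_right (hinv ε hε (by linarith)) (by positivity)
    -- Here both `us ≤ u` and the monotonicity of `χ` in `s` are used.
    have h3 := chiCoeff_mono hz0 hχt hmono (hsub hq) (hs.lower (z0.symm q)) ξ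
    rw [hermQuad_add_mat] at h1 ⊢
    rw [hsymm, hXe, hsymm, D2_subset hsub hS0 hS hus2 hq]
    exact h2.trans (h1.trans (add_le_add_left h3 _))

end LocalSolutionBounds

end HermitianMA

namespace HermitianMA

/-! ### Second derivatives under composition. -/

section Composition

open Set Filter Topology Matrix ComplexConjugate

set_option linter.unusedSectionVars false

section

variable {E F : Type*} [NormedAddCommGroup E] [NormedSpace ℝ E] [NormedAddCommGroup F]
  [NormedSpace ℝ F] {S : Set E} {T : Set F} {Φ : E → F} {w : F → ℝ} {q : E}

theorem dd_comp (hS : UniqueDiffOn ℝ S) (hΦ : ContDiffOn ℝ 1 Φ S) (hm : MapsTo Φ S T)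
    (hw : ContDiffOn ℝ 1 w T) (hq : q ∈ S) (v : E) :
    dd S v (fun x => w (Φ x)) q = fderivWithin ℝ w T (Φ q) (dd S v Φ q) := by
  have h1 := (hw.differentiableOn (by norm_num) _ (hm hq)).hasFDerivWithinAt
  have h2 := (hΦ.differentiableOn (by norm_num) q hq).hasFDerivWithinAt
  exact congrArg (fun A : E →L[ℝ] ℝ => A v) ((h1.comp q h2 hm).fderivWithin (hS q hq))

/-- The second derivative of a composition. -/
theorem D2_comp (hS : UniqueDiffOn ℝ S) (hT : UniqueDiffOn ℝ T) (hΦ : ContDiffOn ℝ 2 Φ S)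
    (hm : MapsTo Φ S T) (hw : ContDiffOn ℝ 2 w T) (hq : q ∈ S) (v t : E) :
    D2 S (fun x => w (Φ x)) q v t = D2 T w (Φ q) (dd S v Φ q) (dd S t Φ q) +
      dd T (D2 S Φ q v t) w (Φ q) := by
  have hΦ1 : ContDiffOn ℝ 1 Φ S := hΦ.of_le (by norm_num)
  have hw1 : ContDiffOn ℝ 1 w T := hw.of_le (by norm_num)
  have hwΦ : ContDiffOn ℝ 2 (fun x => w (Φ x)) S := hw.comp hΦ hm
  rw [D2_apply hS hwΦ hq, D2_apply hS hΦ hq,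
    dd_congr (w' := fun x => fderivWithin ℝ w T (Φ x) (dd S t Φ x))
      (fun x hx => dd_comp hS hΦ1 hm hw1 hx t) hq]
  have h1 := ((contDiffOn_fderivWithin hT hw (k := 1) (by norm_num)).differentiableOn (by norm_num)
    _ (hm hq)).hasFDerivWithinAt
  have h2 := h1.comp q (hΦ1.differentiableOn (by norm_num) q hq).hasFDerivWithinAt hm
  have h3 := ((contDiffOn_dd hS hΦ (k := 1) (by norm_num) t).differentiableOn (by norm_num)
    q hq).hasFDerivWithinAt
  have h4 := (h2.clm_apply h3).fderivWithin (hS q hq)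
  refine (congrArg (fun A : E →L[ℝ] ℝ => A v) h4).trans ?_
  simp [dd, D2, add_comm]

end

variable {ι κ : Type*} [Fintype ι] [Fintype κ] {S : Set (ι → ℂ)} {T : Set (κ → ℂ)}
  {Φ : (ι → ℂ) → (κ → ℂ)} {w : (κ → ℂ) → ℝ} {q : ι → ℂ}

/-- Differentiating the complex linearity of the first derivative gives it in one argument; symmetry
gives it in the other. -/
theorem D2_smul_I (hS : UniqueDiffOn ℝ S) (hcl : S ⊆ closure (interior S))
    (hΦ : ContDiffOn ℝ 2 Φ S)
    (hI : ∀ x ∈ S, ∀ v, dd S (Complex.I • v) Φ x = Complex.I • dd S v Φ x) (hq : q ∈ S)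
    (v t : ι → ℂ) : D2 S Φ q v (Complex.I • t) = Complex.I • D2 S Φ q v t ∧
      D2 S Φ q (Complex.I • v) t = Complex.I • D2 S Φ q v t := by
  have h : ∀ v t, D2 S Φ q v (Complex.I • t) = Complex.I • D2 S Φ q v t := fun v t => by
    rw [D2_apply hS hΦ hq, D2_apply hS hΦ hq,
      dd_congr (w' := fun x => Complex.I • dd S t Φ x) (fun x hx => hI x hx t) hq]
    have h3 := ((contDiffOn_dd hS hΦ (k := 1) (by norm_num) t).differentiableOn (by norm_num)
      q hq).hasFDerivWithinAt
    exact congrArg (fun A : (ι → ℂ) →L[ℝ] (κ → ℂ) => A v)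
      ((h3.const_smul Complex.I).fderivWithin (hS q hq))
  refine ⟨h v t, ?_⟩
  rw [D2_symm hS hcl hΦ hq, h, D2_symm hS hcl hΦ hq]

/-- The Levi form is invariant under holomorphic changes of coordinates. -/
theorem levC_comp (hS : UniqueDiffOn ℝ S) (hcl : S ⊆ closure (interior S)) (hT : UniqueDiffOn ℝ T)
    (hΦ : ContDiffOn ℝ 2 Φ S)
    (hI : ∀ x ∈ S, ∀ v, dd S (Complex.I • v) Φ x = Complex.I • dd S v Φ x)
    (hm : MapsTo Φ S T) (hw : ContDiffOn ℝ 2 w T) (hq : q ∈ S) (v t : ι → ℂ) :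
    levC (D2 S (fun x => w (Φ x)) q) v t = levC (D2 T w (Φ q)) (dd S v Φ q) (dd S t Φ q) := by
  -- The first derivative of `w` is applied to the second derivative of `Φ`, which is complex
  -- bilinear, so its contributions at `(v, t)` and `(√-1 v, √-1 t)` cancel; likewise in the
  -- imaginary part.
  have hII : Complex.I • Complex.I • D2 S Φ q v t = -D2 S Φ q v t := by rw [smul_smul]; simp
  have hneg : ∀ x, dd T (-x) w (Φ q) = -dd T x w (Φ q) := fun x => map_neg _ _
  simp only [levC, D2_comp hS hT hΦ hm hw hq, hI q hq, (D2_smul_I hS hcl hΦ hI hq _ _).1,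
    (D2_smul_I hS hcl hΦ hI hq _ _).2, hII, hneg]
  push_cast
  ring

/-- The product rule for `hermC`. -/
theorem fderivWithin_hermC {E : Type*} [NormedAddCommGroup E] [NormedSpace ℝ E] {S : Set E} {q : E}
    (hS : UniqueDiffWithinAt ℝ S q) {G : E → ι → ι → ℂ} {a b : E → ι → ℂ}
    (hG : DifferentiableWithinAt ℝ G S q) (ha : DifferentiableWithinAt ℝ a S q)
    (hb : DifferentiableWithinAt ℝ b S q) (e : E) :
    fderivWithin ℝ (fun x => hermC (Matrix.of (G x)) (a x) (b x)) S q e =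
      hermC (Matrix.of (fderivWithin ℝ G S q e)) (a q) (b q) +
      hermC (Matrix.of (G q)) (fderivWithin ℝ a S q e) (b q) +
      hermC (Matrix.of (G q)) (a q) (fderivWithin ℝ b S q e) := by
  have hGc := fun j k => hasFDerivWithinAt_pi'.mp (hasFDerivWithinAt_pi'.mp hG.hasFDerivWithinAt j) k
  have hac := fun j => hasFDerivWithinAt_pi'.mp ha.hasFDerivWithinAt j
  have hbc := fun j => hasFDerivWithinAt_pi'.mp hb.hasFDerivWithinAt j
  have hcj := fun k => (Complex.conjCLE.toContinuousLinearMap.hasFDerivAt.comp_hasFDerivWithinAt q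
    (hbc k))
  have h := HasFDerivWithinAt.fun_sum (u := Finset.univ) fun j _ =>
    HasFDerivWithinAt.fun_sum (u := Finset.univ) fun k _ => ((hGc j k).mul (hac j)).mul (hcj k)
  have h' := congrArg (fun A : E →L[ℝ] ℂ => A e) (h.fderivWithin hS)
  refine Eq.trans h' ?_
  simp only [hermC, Matrix.of_apply, ← Finset.sum_add_distrib, _root_.sum_apply]
  refine Finset.sum_congr rfl fun j _ => Finset.sum_congr rfl fun k _ => ?_
  simp
  ring

end Composition

end HermitianMA

namespace HermitianMA

/-! ### Independence of coordinates. -/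

section ChangeOfCoordinates

open Set Filter Topology Matrix ComplexConjugate

set_option linter.unusedSectionVars false

variable {m : ℕ} {M : Type*} [TopologicalSpace M]
  [ChartedSpace (EuclideanHalfSpace (2 * m + 2)) M] [IsManifold (𝓡∂ (2 * m + 2)) ∞ M]
  {J : EndoField m M} {z y : PartialEquiv M (Fin (m + 1) → ℂ)} {x : M}

/-- The change of coordinates from `z` to `y`, on the image under `z` of the common domain. -/
structure CoordChange (z y : PartialEquiv M (Fin (m + 1) → ℂ)) (S : Set (Fin (m + 1) → ℂ))
    (Φ : (Fin (m + 1) → ℂ) → (Fin (m + 1) → ℂ)) : Prop where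
  subset : S ⊆ z.target
  uniqueDiff : UniqueDiffOn ℝ S
  subset_closure : S ⊆ closure (interior S)
  mem : ∀ x ∈ z.source, x ∈ y.source → z x ∈ S
  smooth : ContDiffOn ℝ ∞ Φ S
  mapsTo : MapsTo Φ S y.target
  symm_eq : ∀ q ∈ S, y.symm (Φ q) = z.symm q
  eq : ∀ q ∈ S, Φ q = y (z.symm q)
  dd_eq : ∀ q ∈ S, ∀ v, dd S v Φ q = realDiff (m := m) y (z.symm q) (coordVec z (z.symm q) v)
  dd_I : ∀ q ∈ S, ∀ v, dd S (Complex.I • v) Φ q = Complex.I • dd S v Φ q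

theorem IsHolCoord.exists_coordChange (hz : IsHolCoord J z) (hy : IsHolCoord J y) :
    ∃ S Φ, CoordChange z y S Φ := by
  have h1 := hz.restr hy.open_source
  have hmem : ∀ q ∈ (z.restr y.source).target, q ∈ z.target ∧ z.symm q ∈ y.source := fun q hq => by
    rw [PartialEquiv.restr_target] at hq; exact hq
  have hsm : ContDiffOn ℝ ∞ (fun q => y (z.symm q)) (z.restr y.source).target :=
    h1.contDiffOn hy.smooth (by rw [PartialEquiv.restr_source]; exact inter_subset_right)
  have hdd : ∀ q ∈ (z.restr y.source).target, ∀ v, dd (z.restr y.source).target v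
      (fun q => y (z.symm q)) q = realDiff (m := m) y (z.symm q) (coordVec z (z.symm q) v) := by
    intro q hq v
    have hx : z.symm q ∈ (z.restr y.source).source := (z.restr y.source).map_target hq
    have hq' : z (z.symm q) = q := z.right_inv (hmem q hq).1
    have e := h1.mfderiv_eq (f := (y : M → Fin (m + 1) → ℂ)) hx (by
      have := hsm.differentiableOn (by simp) q hq
      rw [← hq'] at this
      exact this) (coordVec z (z.symm q) v)
    have e2 : realDiff (m := m) (z.restr y.source) (z.symm q) (coordVec z (z.symm q) v) = v :=
      h1.realDiff_coordVec hx v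
    rw [e2] at e
    refine Eq.trans ?_ e.symm
    change _ = fderivWithin ℝ (fun q => y (z.symm q)) (z.restr y.source).target (z (z.symm q)) v
    rw [hq']; rfl
  refine ⟨(z.restr y.source).target, fun q => y (z.symm q), fun q hq => (hmem q hq).1,
    h1.uniqueDiffOn, h1.subset_closure, fun x hx hxy => ?_, hsm, fun q hq => y.map_source (hmem q hq).2,
    fun q hq => y.left_inv (hmem q hq).2, fun q _ => rfl, hdd, fun q hq v => ?_⟩
  · rw [PartialEquiv.restr_target]
    exact ⟨z.map_source hx, by rw [mem_preimage, z.left_inv hx]; exact hxy⟩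
  · rw [hdd q hq, hdd q hq, ← hz.J_coordVec (z.map_target (hmem q hq).1),
      hy.complex_linear _ (hmem q hq).2]

variable {S : Set (Fin (m + 1) → ℂ)} {Φ : (Fin (m + 1) → ℂ) → (Fin (m + 1) → ℂ)}

theorem CoordChange.D2_eq (h : CoordChange z y S Φ) (hz : IsHolCoord J z)
    {u : M → ℝ} (hu : ContMDiff (𝓡∂ (2 * m + 2)) 𝓘(ℝ, ℝ) 4 u) {q : Fin (m + 1) → ℂ} (hq : q ∈ S) :
    D2 z.target (fun q => u (z.symm q)) q = D2 S (fun q => (fun q => u (y.symm q)) (Φ q)) q := by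
  have hu2 : ContDiffOn ℝ 2 (fun q => u (z.symm q)) z.target :=
    (hz.contDiffOn (n := 4) hu.contMDiffOn (subset_univ _)).of_le (by norm_num)
  rw [← D2_subset h.subset hz.uniqueDiffOn h.uniqueDiff hu2 hq]
  exact D2_congr (fun q hq => by simp only [h.symm_eq q hq]) hq

theorem CoordChange.dd_u (h : CoordChange z y S Φ) (hz : IsHolCoord J z) (hy : IsHolCoord J y)
    {u : M → ℝ} (hu : ContMDiff (𝓡∂ (2 * m + 2)) 𝓘(ℝ, ℝ) 4 u) {q : Fin (m + 1) → ℂ} (hq : q ∈ S)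
    (v : Fin (m + 1) → ℂ) : dd z.target v (fun q => u (z.symm q)) q =
      dd y.target (dd S v Φ q) (fun q => u (y.symm q)) (Φ q) := by
  have hu1 : ContDiffOn ℝ 1 (fun q => u (z.symm q)) z.target :=
    (hz.contDiffOn (n := 4) hu.contMDiffOn (subset_univ _)).of_le (by norm_num)
  have hu1' : ContDiffOn ℝ 1 (fun q => u (y.symm q)) y.target :=
    (hy.contDiffOn (n := 4) hu.contMDiffOn (subset_univ _)).of_le (by norm_num)
  have e1 : dd z.target v (fun q => u (z.symm q)) q = dd S v (fun q => u (z.symm q)) q :=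
    congrArg (fun A : (Fin (m + 1) → ℂ) →L[ℝ] ℝ => A v)
      (fderivWithin_subset' h.subset h.uniqueDiff hu1 hq).symm
  rw [e1, dd_congr (w' := fun q => (fun q => u (y.symm q)) (Φ q))
    (fun q hq => by simp only [h.symm_eq q hq]) hq]
  exact dd_comp h.uniqueDiff (h.smooth.of_le (by norm_cast)) h.mapsTo hu1' hq v

/-- The form `χ_u` does not depend on the coordinates. -/
theorem hermC_chiUMatrix_change (hz : IsHolCoord J z) (hy : IsHolCoord J y)
    {χ : ℝ → BilinField m M} (hχ : ∀ s, IsReal11 J (χ s)) {u : M → ℝ}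
    (hu : ContMDiff (𝓡∂ (2 * m + 2)) 𝓘(ℝ, ℝ) 4 u) (hx : x ∈ z.source) (hxy : x ∈ y.source)
    (a b : Fin (m + 1) → ℂ) : hermC (chiUMatrix χ u z x) a b = hermC (chiUMatrix χ u y x)
      (realDiff (m := m) y x (coordVec z x a)) (realDiff (m := m) y x (coordVec z x b)) := by
  have hu2 : ContDiffOn ℝ 2 (fun q => u (z.symm q)) z.target :=
    (hz.contDiffOn (n := 4) hu.contMDiffOn (subset_univ _)).of_le (by norm_num)
  have hu2' : ContDiffOn ℝ 2 (fun q => u (y.symm q)) y.target :=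
    (hy.contDiffOn (n := 4) hu.contMDiffOn (subset_univ _)).of_le (by norm_num)
  obtain ⟨S, Φ, h⟩ := hz.exists_coordChange hy
  have hq := h.mem x hx hxy
  rw [hz.chiUMatrix_eq χ hu2 hx, hy.chiUMatrix_eq χ hu2' hxy, hermC_add_mat, hermC_add_mat,
    hz.hermC_chi hχ u hx, hy.hermC_chi hχ u hxy, hy.coordVec_realDiff hxy, hy.coordVec_realDiff hxy,
    hermC_levMat, hermC_levMat, h.D2_eq hz hu hq,
    levC_comp h.uniqueDiff h.subset_closure hy.uniqueDiffOn (h.smooth.of_le (by norm_cast)) h.dd_I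
      h.mapsTo hu2' hq, h.dd_eq _ hq, h.dd_eq _ hq, h.eq _ hq, z.left_inv hx]

/-- `χ_u` as a quadratic form on the tangent space. -/
noncomputable def solQuad (hJ : IsComplexStructure J) (χ : ℝ → BilinField m M) (u : M → ℝ) (x : M)
    (v : TangentSpace (𝓡∂ (2 * m + 2)) x) : ℝ :=
  hermQuad (chiUMatrix χ u (hJ x).choose x) (realDiff (m := m) (hJ x).choose x v)

/-- The chart chosen at each point in `solQuad` is arbitrary; this makes the choice irrelevant and
lets minima in different charts be compared. -/
theorem IsHolCoord.solQuad_eq (hz : IsHolCoord J z) (hJ : IsComplexStructure J)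
    {χ : ℝ → BilinField m M} (hχ : ∀ s, IsReal11 J (χ s)) {u : M → ℝ}
    (hu : ContMDiff (𝓡∂ (2 * m + 2)) 𝓘(ℝ, ℝ) 4 u) (hx : x ∈ z.source)
    (v : TangentSpace (𝓡∂ (2 * m + 2)) x) :
    solQuad hJ χ u x v = hermQuad (chiUMatrix χ u z x) (realDiff (m := m) z x v) := by
  have h := (hJ x).choose_spec
  rw [solQuad, hermQuad_eq, hermC_chiUMatrix_change h.1 hz hχ hu h.2 hx, h.1.coordVec_realDiff h.2,
    hermQuad_eq]

/-- The maximal complex subspace of the tangent space of the boundary. -/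
def ComplexTangent (J : EndoField m M) (x : M) (v : TangentSpace (𝓡∂ (2 * m + 2)) x) : Prop :=
  bdryDiff x v = 0 ∧ bdryDiff x (J x v) = 0

theorem AdaptedChart.complexTangent_iff {ρ : (Fin (m + 1) → ℂ) → ℝ} (hz : AdaptedChart J z ρ)
    (hx : x ∈ z.source) (hxb : x ∈ (𝓡∂ (2 * m + 2)).boundary M)
    (v : TangentSpace (𝓡∂ (2 * m + 2)) x) : ComplexTangent J x v ↔
      dd z.target (realDiff (m := m) z x v) ρ (z x) = 0 ∧
      dd z.target (Complex.I • realDiff (m := m) z x v) ρ (z x) = 0 := by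
  rw [ComplexTangent, hz.tangent_iff x hx hxb, hz.tangent_iff x hx hxb,
    hz.holCoord.complex_linear x hx]

end ChangeOfCoordinates

end HermitianMA

namespace HermitianMA

/-! ### The least eigenvalue on the complex tangent spaces of the boundary. -/

section TangentialMinimum

open Set Filter Topology Matrix

set_option linter.unusedSectionVars false

variable {m : ℕ} {M : Type*} [TopologicalSpace M]
  [ChartedSpace (EuclideanHalfSpace (2 * m + 2)) M] [IsManifold (𝓡∂ (2 * m + 2)) ∞ M]
  {J : EndoField m M} {z : PartialEquiv M (Fin (m + 1) → ℂ)} {x : M}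
  {g : RMetric m M} {χ : ℝ → BilinField m M} {u : M → ℝ}

/-- The least eigenvalue `m₀`, over the whole boundary, of `χ_u` on the complex tangent spaces of
the boundary. -/
structure IsTangentialMin (hJ : IsComplexStructure J) (g : RMetric m M) (χ : ℝ → BilinField m M)
    (u : M → ℝ) (B : Set M) (m0 : ℝ) : Prop where
  attained : ∃ x ∈ (𝓡∂ (2 * m + 2)).boundary M, ∃ v : TangentSpace (𝓡∂ (2 * m + 2)) x, v ≠ 0 ∧
    ComplexTangent J x v ∧ solQuad hJ χ u x v = m0 * g.inner x v v
  le : ∀ x ∈ (𝓡∂ (2 * m + 2)).boundary M, x ∈ B → ∀ v : TangentSpace (𝓡∂ (2 * m + 2)) x,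
    ComplexTangent J x v → m0 * g.inner x v v ≤ solQuad hJ χ u x v

theorem AdaptedChart.solQuad_coordVec {ρ : (Fin (m + 1) → ℂ) → ℝ} (hz : AdaptedChart J z ρ)
    (hJ : IsComplexStructure J) (hχ : ∀ s, IsReal11 J (χ s))
    (hu : ContMDiff (𝓡∂ (2 * m + 2)) 𝓘(ℝ, ℝ) 4 u) {q : Fin (m + 1) → ℂ} (hq : q ∈ z.target)
    (ξ : Fin (m + 1) → ℂ) : solQuad hJ χ u (z.symm q) (coordVec z (z.symm q) ξ) =
      hermQuad (Matrix.of (localForm χ z u q) + levMat (D2 z.target (fun q => u (z.symm q)) q)) ξ := by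
  have hx := z.map_target hq
  rw [hz.holCoord.solQuad_eq hJ hχ hu hx, hz.holCoord.realDiff_coordVec hx,
    hz.holCoord.chiUMatrix_symm χ ((hz.holCoord.contDiffOn (n := 4) hu.contMDiffOn
      (subset_univ _)).of_le (by norm_num)) hq]

theorem AdaptedChart.complexTangent_coordVec {ρ : (Fin (m + 1) → ℂ) → ℝ} (hz : AdaptedChart J z ρ)
    {q : Fin (m + 1) → ℂ} (hq : q ∈ z.target) (hρ : ρ q = 0) (ξ : Fin (m + 1) → ℂ) :
    ComplexTangent J (z.symm q) (coordVec z (z.symm q) ξ) ↔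
      dd z.target ξ ρ q = 0 ∧ dd z.target (Complex.I • ξ) ρ q = 0 := by
  have hx := z.map_target hq
  rw [hz.complexTangent_iff hx ((hz.boundary_iff _ hx).mpr (by rwa [z.right_inv hq])),
    hz.holCoord.realDiff_coordVec hx, z.right_inv hq]

theorem continuousOn_dd_uncurry {E : Type*} [NormedAddCommGroup E] [NormedSpace ℝ E] {S : Set E}
    (hS : UniqueDiffOn ℝ S) {ρ : E → ℝ} (hρ : ContDiffOn ℝ 1 ρ S) :
    ContinuousOn (fun p : E × E => dd S p.2 ρ p.1) (S ×ˢ univ) :=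
  ((contDiffOn_fderivWithin hS hρ (k := 0) (by norm_num)).continuousOn.comp continuousOn_fst
    fun p hp => hp.1).clm_apply continuousOn_snd

/-- The tangential minimum exists locally. -/
theorem AdaptedChart.exists_isTangentialMin {ρ : (Fin (m + 1) → ℂ) → ℝ} (hz : AdaptedChart J z ρ)
    (hJ : IsComplexStructure J) (hg : IsHermitianMetric J g) (hχs : SmoothFamily χ)
    (hχ : ∀ s, IsReal11 J (χ s))
    (hu : ContMDiff (𝓡∂ (2 * m + 2)) 𝓘(ℝ, ℝ) 4 u) (hx : x ∈ z.source) {x0 : M}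
    (hx0 : x0 ∈ (𝓡∂ (2 * m + 2)).boundary M) {v0 : TangentSpace (𝓡∂ (2 * m + 2)) x0} (hv0 : v0 ≠ 0)
    (hv0t : ComplexTangent J x0 v0) : ∃ t ∈ 𝓝 x, ∃ m0, IsTangentialMin hJ g χ u t m0 := by
  have hh := hz.holCoord
  have hD := hz.boundaryDomain
  have hS := hD.uniqueDiff
  have hu2 : ContDiffOn ℝ 2 (fun q => u (z.symm q)) z.target :=
    (hh.contDiffOn (n := 4) hu.contMDiffOn (subset_univ _)).of_le (by norm_num)
  obtain ⟨r, hr, hB⟩ := hD.exists_compact _ (z.map_source hx)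
  set B := z.target ∩ Metric.closedBall (z x) r
  have hBS : B ⊆ z.target := inter_subset_left
  have hρ1 : ContDiffOn ℝ 1 ρ z.target := hD.smooth.of_le (by norm_cast)
  set P := B ×ˢ Metric.sphere (0 : Fin (m + 1) → ℂ) 1
  have hP : IsCompact P := hB.prod (isCompact_sphere _ _)
  have hPS : P ⊆ z.target ×ˢ univ := prod_mono hBS (subset_univ _)
  set f : (Fin (m + 1) → ℂ) × (Fin (m + 1) → ℂ) → ℝ × ℝ × ℝ := fun p =>
    (ρ p.1, dd z.target p.2 ρ p.1, dd z.target (Complex.I • p.2) ρ p.1)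
  have hf : ContinuousOn f P := by
    have h1 := (continuousOn_dd_uncurry hS hρ1)
    have h2 : ContinuousOn (fun p : (Fin (m + 1) → ℂ) × (Fin (m + 1) → ℂ) =>
        dd z.target (Complex.I • p.2) ρ p.1) (z.target ×ˢ univ) :=
      ContinuousOn.comp (f := fun p : (Fin (m + 1) → ℂ) × (Fin (m + 1) → ℂ) =>
        (p.1, Complex.I • p.2)) h1 (by fun_prop) fun p hp => ⟨hp.1, mem_univ _⟩
    exact (hρ1.continuousOn.comp continuousOn_fst fun p hp => hBS hp.1).prodMk
      ((h1.mono hPS).prodMk (h2.mono hPS))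
  set T := P ∩ f ⁻¹' {0}
  -- `T` consists of the boundary points in a compact piece together with the unit vectors that are
  -- complex tangent there. The quotient of the two quadratic forms attains its minimum on it.
  have hT : IsCompact T :=
    hP.of_isClosed_subset (hf.preimage_isClosed_of_isClosed hP.isClosed isClosed_singleton)
      inter_subset_left
  have hTm : ∀ p ∈ T, p.1 ∈ z.target ∧ ‖p.2‖ = 1 ∧ ρ p.1 = 0 ∧ dd z.target p.2 ρ p.1 = 0 ∧
      dd z.target (Complex.I • p.2) ρ p.1 = 0 := fun p hp => by
    have h1 := hp.2
    simp only [mem_preimage, mem_singleton_iff, f, Prod.mk_eq_zero] at h1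
    exact ⟨hBS hp.1.1, by simpa using hp.1.2, h1⟩
  set G : (Fin (m + 1) → ℂ) → Fin (m + 1) → Fin (m + 1) → ℂ := fun q j k => localForm χ z u q j k +
      levMat (D2 z.target (fun q => u (z.symm q)) q) j k
  have hG : ContinuousOn G z.target := hh.continuousOn_chiUCoeff hχs hu2
  have hGm := (hh.contDiffOn_metricCoeff g).continuousOn
  have hquad : ∀ A : (Fin (m + 1) → ℂ) → Fin (m + 1) → Fin (m + 1) → ℂ, ContinuousOn A z.target →
      ContinuousOn (fun p : (Fin (m + 1) → ℂ) × (Fin (m + 1) → ℂ) =>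
        hermQuad (Matrix.of (A p.1)) p.2) T := fun A hA =>
    (continuous_hermQuad (ι := Fin (m + 1))).comp_continuousOn
      (f := fun p : (Fin (m + 1) → ℂ) × (Fin (m + 1) → ℂ) => (A p.1, p.2))
      ((ContinuousOn.comp (f := fun p : (Fin (m + 1) → ℂ) × (Fin (m + 1) → ℂ) => p.1) hA
        continuousOn_fst fun p hp => (hTm p hp).1).prodMk continuousOn_snd)
  have hgp : ∀ q ∈ z.target, ∀ ξ, ξ ≠ 0 → 0 < hermQuad (Matrix.of (metricCoeff J g z q)) ξ :=
    fun q hq ξ hξ => hh.hermQuad_gMatrix_pos hg (z.map_target hq) ξ hξ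
  have hne : ∀ p ∈ T, p.2 ≠ 0 := fun p hp h0 => by
    have := (hTm p hp).2.1; simp [h0] at this
  have hF : ContinuousOn (fun p : (Fin (m + 1) → ℂ) × (Fin (m + 1) → ℂ) =>
      hermQuad (Matrix.of (G p.1)) p.2 / hermQuad (Matrix.of (metricCoeff J g z p.1)) p.2) T :=
    (hquad G hG).div (hquad _ hGm) fun p hp => (hgp _ (hTm p hp).1 _ (hne p hp)).ne'
  have hsol : ∀ q ∈ z.target, ∀ ξ, solQuad hJ χ u (z.symm q) (coordVec z (z.symm q) ξ) =
      hermQuad (Matrix.of (G q)) ξ := fun q hq ξ => hz.solQuad_coordVec hJ hχ hu hq ξ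
  have hgq : ∀ q ∈ z.target, ∀ ξ, g.inner (z.symm q) (coordVec z (z.symm q) ξ)
      (coordVec z (z.symm q) ξ) = hermQuad (Matrix.of (metricCoeff J g z q)) ξ := fun q hq ξ =>
    (hh.hermQuad_gMatrix hg (z.map_target hq) ξ).symm
  refine ⟨z.source ∩ z ⁻¹' Metric.ball (z x) r, ?_, ?_⟩
  · exact inter_mem (hh.open_source.mem_nhds hx) ((hh.smooth.continuousOn.continuousAt
      (hh.open_source.mem_nhds hx)).preimage_mem_nhds (Metric.ball_mem_nhds _ hr))
  have key : ∀ m0 : ℝ, (∀ p ∈ T, m0 ≤ hermQuad (Matrix.of (G p.1)) p.2 /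
      hermQuad (Matrix.of (metricCoeff J g z p.1)) p.2) →
      ∀ x' ∈ (𝓡∂ (2 * m + 2)).boundary M, x' ∈ z.source ∩ z ⁻¹' Metric.ball (z x) r →
      ∀ v : TangentSpace (𝓡∂ (2 * m + 2)) x', ComplexTangent J x' v →
        m0 * g.inner x' v v ≤ solQuad hJ χ u x' v := by
    intro m0 hm0 x' hb hx' v hv
    obtain ⟨q, hq, rfl⟩ : ∃ q ∈ z.target, z.symm q = x' := ⟨z x', z.map_source hx'.1, z.left_inv hx'.1⟩
    obtain ⟨ξ, rfl⟩ : ∃ ξ, coordVec z (z.symm q) ξ = v := ⟨_, hh.coordVec_realDiff hx'.1 v⟩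
    have hρq : ρ q = 0 := by
      have := (hz.boundary_iff _ hx'.1).mp hb
      rwa [z.right_inv hq] at this
    rw [hsol q hq, hgq q hq]
    rcases eq_or_ne ξ 0 with rfl | hξ
    · simp [hermQuad]
    have hball : q ∈ Metric.ball (z x) r := by
      have := hx'.2; rwa [mem_preimage, z.right_inv hq] at this
    obtain ⟨ht1, ht2⟩ := (hz.complexTangent_coordVec hq hρq ξ).mp hv
    have hpT : (q, ‖ξ‖⁻¹ • ξ) ∈ T := by
      refine ⟨⟨⟨hq, Metric.ball_subset_closedBall hball⟩, by simp [norm_smul, hξ]⟩, ?_⟩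
      simp only [mem_preimage, mem_singleton_iff, f, Prod.mk_eq_zero]
      rw [smul_comm Complex.I, dd_vec_smul, dd_vec_smul, ht1, ht2]
      simp [hρq]
    have h1 := hm0 _ hpT
    simp only [hermQuad_real_smul] at h1
    have hn : (‖ξ‖⁻¹ ^ 2 : ℝ) ≠ 0 := by positivity
    rw [mul_div_mul_left _ _ hn, le_div_iff₀ (hgp q hq ξ hξ)] at h1
    exact h1
  rcases T.eq_empty_or_nonempty with he | hneT
  -- If there are no such pairs, the inequality concerns only zero vectors, and the given pair `x0`,
  -- `v0` serves as a value that is attained.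
  · refine ⟨solQuad hJ χ u x0 v0 / g.inner x0 v0 v0, ⟨⟨x0, hx0, v0, hv0, hv0t, ?_⟩, ?_⟩⟩
    · rw [div_mul_cancel₀ _ (g.pos x0 v0 hv0).ne']
    · exact fun x' hb hx' v hv => key _ (fun p hp => by simp [he] at hp) x' hb hx' v hv
  · obtain ⟨p, hp, hmin⟩ := hT.exists_isMinOn hneT hF
    obtain ⟨h1, h2, h3, h4⟩ := hTm p hp
    refine ⟨_, ⟨⟨z.symm p.1, ?_, coordVec z (z.symm p.1) p.2, ?_, ?_, ?_⟩,
      fun x' hb hx' v hv => key _ (fun p' hp' => hmin hp') x' hb hx' v hv⟩⟩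
    · exact (hz.boundary_iff _ (z.map_target h1)).mpr (by rwa [z.right_inv h1])
    · exact hh.coordVec_ne_zero (z.map_target h1) (hne p hp)
    · exact (hz.complexTangent_coordVec h1 h3 p.2).mpr h4
    · rw [hsol _ h1, hgq _ h1, div_mul_cancel₀ _ (hgp _ h1 _ (hne p hp)).ne']

/-- The tangential minimum exists. -/
theorem exists_isTangentialMin [CompactSpace M] (hJ : IsComplexStructure J)
    (hg : IsHermitianMetric J g) (hχs : SmoothFamily χ) (hχ : ∀ s, IsReal11 J (χ s))
    (hu : ContMDiff (𝓡∂ (2 * m + 2)) 𝓘(ℝ, ℝ) 4 u) {x0 : M}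
    (hx0 : x0 ∈ (𝓡∂ (2 * m + 2)).boundary M) {v0 : TangentSpace (𝓡∂ (2 * m + 2)) x0} (hv0 : v0 ≠ 0)
    (hv0t : ComplexTangent J x0 v0) :
    ∃ m0, IsTangentialMin hJ g χ u ((𝓡∂ (2 * m + 2)).boundary M) m0 := by
  have hc : IsCompact ((𝓡∂ (2 * m + 2)).boundary M) :=
    ((𝓡∂ (2 * m + 2)).isClosed_boundary (M := M) (n := ∞) (by simp)).isCompact
  -- The value may be attained anywhere on the boundary while the inequality is required only on
  -- `s`. The predicate is therefore stable under passing to subsets, and under unions by taking the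
  -- smaller value.
  refine hc.induction_on (p := fun s => ∃ m0, IsTangentialMin hJ g χ u s m0) ?_ ?_ ?_ ?_
  · refine ⟨solQuad hJ χ u x0 v0 / g.inner x0 v0 v0, ⟨⟨x0, hx0, v0, hv0, hv0t, ?_⟩, ?_⟩⟩
    · rw [div_mul_cancel₀ _ (g.pos x0 v0 hv0).ne']
    · simp
  · rintro s t hst ⟨m0, h⟩
    exact ⟨m0, h.attained, fun x hx hxs => h.le x hx (hst hxs)⟩
  · rintro s t ⟨m1, h1⟩ ⟨m2, h2⟩
    rcases le_total m1 m2 with h | h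
    · refine ⟨m1, h1.attained, fun x hx hxs v hv => hxs.elim (fun hxs => h1.le x hx hxs v hv)
        fun hxs => le_trans ?_ (h2.le x hx hxs v hv)⟩
      refine mul_le_mul_of_nonneg_right h ?_
      rcases eq_or_ne v 0 with rfl | hv'
      · simp
      · exact (g.pos x v hv').le
    · refine ⟨m2, h2.attained, fun x hx hxs v hv => hxs.elim (fun hxs => le_trans ?_
        (h1.le x hx hxs v hv)) fun hxs => h2.le x hx hxs v hv⟩
      refine mul_le_mul_of_nonneg_right h ?_
      rcases eq_or_ne v 0 with rfl | hv'
      · simp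
      · exact (g.pos x v hv').le
  · intro x hx
    obtain ⟨z0, U, ρ, v1, Q, -, -, -, -, -, hxs, hz, -⟩ :=
      hJ.exists_adaptedChart isOpen_univ (mem_univ x) hx
    obtain ⟨t, ht, h⟩ := hz.exists_isTangentialMin hJ hg hχs hχ hu hxs hx0 hv0 hv0t
    exact ⟨t, mem_nhdsWithin_of_mem_nhds ht, h⟩

end TangentialMinimum

end HermitianMA

namespace HermitianMA

/-! ### Uniform charts and the tangential lower bound. -/

section TangentialEstimate

open Set Filter Topology Matrix

set_option linter.unusedSectionVars false

variable {m : ℕ} {M : Type*} [TopologicalSpace M]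
  [ChartedSpace (EuclideanHalfSpace (2 * m + 2)) M] [IsManifold (𝓡∂ (2 * m + 2)) ∞ M]

/-- The data of the Dirichlet problem with a subsolution near the boundary. -/
structure DirichletData (J : EndoField m M) (g : RMetric m M) (χ : ℝ → BilinField m M)
    (φ usub : M → ℝ) (W : Set M) : Prop where
  isComplex : IsComplexStructure J
  isHermitian : IsHermitianMetric J g
  smooth : SmoothFamily χ
  isReal11 : ∀ s, IsReal11 J (χ s)
  monotone : MonotoneFamily J χ
  smooth_boundary : ContMDiff (𝓡∂ (2 * m + 2)) 𝓘(ℝ, ℝ) ∞ φ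
  isOpen : IsOpen W
  boundary_subset : (𝓡∂ (2 * m + 2)).boundary M ⊆ W
  smooth_sub : ContMDiffOn (𝓡∂ (2 * m + 2)) 𝓘(ℝ, ℝ) 2 usub W
  admissible_sub : AdmissibleOn J χ usub W
  boundary_sub : ∀ x ∈ (𝓡∂ (2 * m + 2)).boundary M, usub x = φ x

variable {J : EndoField m M} {z : PartialEquiv M (Fin (m + 1) → ℂ)}
  {g : RMetric m M} {χ : ℝ → BilinField m M} {φ usub u : M → ℝ} {W : Set M} {K lam Lam : ℝ}
  {ψ : M → ℝ → ℝ}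

/-- Coordinates near a boundary point in which all bounded solutions are local solutions with
uniform constants. -/
structure UniformChart (J : EndoField m M) (g : RMetric m M) (χ : ℝ → BilinField m M)
    (φ usub : M → ℝ) (K lam Lam : ℝ) (z : PartialEquiv M (Fin (m + 1) → ℂ))
    (ρ : (Fin (m + 1) → ℂ) → ℝ) (v0 : Fin (m + 1) → ℂ) (κ γ : ℝ) : Prop where
  adapted : AdaptedChart J z ρ
  transversal : ∀ q ∈ z.target, 0 < dd z.target v0 ρ q
  one_le : 1 ≤ κ
  pos : 0 < γ
  metric_lower : ∀ q ∈ z.target, ∀ ξ, γ * ‖ξ‖ ^ 2 ≤ hermQuad (Matrix.of (metricCoeff J g z q)) ξ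
  metric_deriv : ∀ q ∈ z.target, ‖fderivWithin ℝ (metricCoeff J g z) z.target q‖ ≤ κ
  smooth_boundary : ContDiffOn ℝ ∞ (fun q => φ (z.symm q)) z.target
  smooth_sub : ContDiffOn ℝ 2 (fun q => usub (z.symm q)) z.target
  boundary_sub : ∀ q ∈ z.target, ρ q = 0 → usub (z.symm q) = φ (z.symm q)
  localSol : ∀ ψ u, BoundedSolution J g χ φ usub K lam Lam ψ u →
    LocalSol z.target ρ (fun q => φ (z.symm q)) (fun q => usub (z.symm q)) κ
      (fun q => u (z.symm q)) (localForm χ z u) (localRhs J g ψ z u)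

theorem DirichletData.exists_uniformChart (h : DirichletData J g χ φ usub W) (K Lam : ℝ)
    (hlam : 0 < lam) {p : M} (hp : p ∈ (𝓡∂ (2 * m + 2)).boundary M) :
    ∃ z ρ v0 κ γ, UniformChart J g χ φ usub K lam Lam z ρ v0 κ γ ∧ p ∈ z.source := by
  obtain ⟨z0, U, ρ, v0, Q, hz0, hzW, hQ, hQz, hzQ, hpz, hz, hv0⟩ :=
    h.isComplex.exists_adaptedChart h.isOpen (h.boundary_subset hp) hp
  obtain ⟨κ, hκ, γ, hγ, hmet, hsol⟩ := exists_localSol (φ := φ) hz0 hzW hQ hQz hz rfl rfl hzQ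
    h.isHermitian h.smooth h.isReal11 h.monotone h.smooth_sub h.admissible_sub K Lam hlam
  refine ⟨z0.restr U, ρ, v0, κ, γ, ⟨hz, hv0, hκ, hγ, fun q hq => (hmet q hq).1,
    fun q hq => (hmet q hq).2, ?_, ?_, ?_, hsol⟩, hpz⟩
  · exact hz.holCoord.contDiffOn h.smooth_boundary.contMDiffOn (subset_univ _)
  · refine hz.holCoord.contDiffOn (n := 2) h.smooth_sub (Subset.trans ?_ hzW)
    rw [PartialEquiv.restr_source]; exact inter_subset_left
  · intro q hq hρ
    refine h.boundary_sub _ ((hz.boundary_iff _ ((z0.restr U).map_target hq)).mpr ?_)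
    rwa [(z0.restr U).right_inv hq]

/-- The tangential minimum is bounded below by a uniform positive constant. -/
theorem DirichletData.exists_isTangentialMin_lower [CompactSpace M]
    (h : DirichletData J g χ φ usub W) (K Lam : ℝ) (hlam : 0 < lam) :
    ∃ c0 > 0, ∀ ψ u, BoundedSolution J g χ φ usub K lam Lam ψ u → ∀ m0,
      IsTangentialMin h.isComplex g χ u ((𝓡∂ (2 * m + 2)).boundary M) m0 → c0 ≤ m0 := by
  have hc : IsCompact ((𝓡∂ (2 * m + 2)).boundary M) :=
    ((𝓡∂ (2 * m + 2)).isClosed_boundary (M := M) (n := ∞) (by simp)).isCompact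
  -- The minimum is global, but the position of the minimum point can be localized: the constant may
  -- depend on a set containing that point, and finitely many such sets cover the boundary.
  suffices hind : ∃ c0 > 0, ∀ ψ u, BoundedSolution J g χ φ usub K lam Lam ψ u → ∀ m0,
      IsTangentialMin h.isComplex g χ u ((𝓡∂ (2 * m + 2)).boundary M) m0 →
      ∀ x ∈ (𝓡∂ (2 * m + 2)).boundary M, x ∈ (𝓡∂ (2 * m + 2)).boundary M →
        ∀ v : TangentSpace (𝓡∂ (2 * m + 2)) x, v ≠ 0 → ComplexTangent J x v →
        solQuad h.isComplex χ u x v = m0 * g.inner x v v → c0 ≤ m0 by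
    obtain ⟨c0, hc0, H⟩ := hind
    refine ⟨c0, hc0, fun ψ u hs m0 hm0 => ?_⟩
    obtain ⟨x, hx, v, hv, hvt, he⟩ := hm0.attained
    exact H ψ u hs m0 hm0 x hx hx v hv hvt he
  refine hc.induction_on (p := fun s => ∃ c0 > 0, ∀ ψ u,
    BoundedSolution J g χ φ usub K lam Lam ψ u → ∀ m0,
      IsTangentialMin h.isComplex g χ u ((𝓡∂ (2 * m + 2)).boundary M) m0 →
      ∀ x ∈ (𝓡∂ (2 * m + 2)).boundary M, x ∈ s →
        ∀ v : TangentSpace (𝓡∂ (2 * m + 2)) x, v ≠ 0 → ComplexTangent J x v →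
        solQuad h.isComplex χ u x v = m0 * g.inner x v v → c0 ≤ m0) ?_ ?_ ?_ ?_
  · exact ⟨1, one_pos, by simp⟩
  · rintro s t hst ⟨c0, hc0, H⟩
    exact ⟨c0, hc0, fun ψ u hs m0 hm0 x hx hxs => H ψ u hs m0 hm0 x hx (hst hxs)⟩
  · rintro s t ⟨c1, hc1, H1⟩ ⟨c2, hc2, H2⟩
    refine ⟨min c1 c2, lt_min hc1 hc2, fun ψ u hs m0 hm0 x hx hxs v hv hvt he => ?_⟩
    rcases hxs with hxs | hxs
    · exact (min_le_left _ _).trans (H1 ψ u hs m0 hm0 x hx hxs v hv hvt he)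
    · exact (min_le_right _ _).trans (H2 ψ u hs m0 hm0 x hx hxs v hv hvt he)
  · intro p hp
    obtain ⟨z, ρ, v0, κ, γ, hU, hpz⟩ := h.exists_uniformChart K Lam hlam hp
    have hz := hU.adapted
    have hh := hz.holCoord
    obtain ⟨r, hr, c0, hc0, H⟩ := exists_tangential_lower_bound hz.boundaryDomain hU.transversal
      hU.smooth_boundary hU.smooth_sub hU.boundary_sub hU.one_le
      -- On the boundary `χ(·, u)` equals `χ(·, φ)`, whose smoothness does not involve `u`.
      (XB := localForm χ z φ) (gM := metricCoeff J g z)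
      (contDiffOn_graph Subset.rfl ((hh.contDiffOn_chiCoeff h.smooth).of_le (by norm_cast))
        (hU.smooth_boundary.of_le (by norm_cast)))
      ((hh.contDiffOn_metricCoeff g).of_le (by norm_cast)) hU.pos hU.metric_lower
      (z.map_source hpz) ((hz.boundary_iff p hpz).mp hp)
    refine ⟨z.source ∩ z ⁻¹' Metric.ball (z p) r, mem_nhdsWithin_of_mem_nhds (inter_mem
      (hh.open_source.mem_nhds hpz) ((hh.smooth.continuousOn.continuousAt
        (hh.open_source.mem_nhds hpz)).preimage_mem_nhds (Metric.ball_mem_nhds _ hr))), c0, hc0,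
      fun ψ u hs m0 hm0 x hx hxs v hv hvt he => ?_⟩
    have hu := hs.isSolution.contMDiff
    obtain ⟨q, hq, rfl⟩ : ∃ q ∈ z.target, z.symm q = x := ⟨z x, z.map_source hxs.1, z.left_inv hxs.1⟩
    obtain ⟨ξ, rfl⟩ : ∃ ξ, coordVec z (z.symm q) ξ = v := ⟨_, hh.coordVec_realDiff hxs.1 v⟩
    have hρq : ρ q = 0 := by
      have := (hz.boundary_iff _ hxs.1).mp hx
      rwa [z.right_inv hq] at this
    have hξ : ξ ≠ 0 := by
      rintro rfl
      exact hv (map_zero (realDiff (m := m) z (z.symm q)).inverse)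
    have hgq : ∀ q ∈ z.target, ∀ ξ, g.inner (z.symm q) (coordVec z (z.symm q) ξ)
        (coordVec z (z.symm q) ξ) = hermQuad (Matrix.of (metricCoeff J g z q)) ξ := fun q hq ξ =>
      (hh.hermQuad_gMatrix h.isHermitian (z.map_target hq) ξ).symm
    obtain ⟨ht1, ht2⟩ := (hz.complexTangent_coordVec hq hρq ξ).mp hvt
    rw [hgq q hq, hz.solQuad_coordVec h.isComplex h.isReal11 hu hq] at he
    have hball : q ∈ Metric.ball (z p) r := by
      have := hxs.2; rwa [mem_preimage, z.right_inv hq] at this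
    refine H _ _ _ (hU.localSol ψ u hs) ?_ q hq hball hρq m0 (‖ξ‖⁻¹ • ξ)
      (by simp [norm_smul, hξ]) ?_ ?_ ?_ ?_
    · intro q hq hρ
      rw [localForm, localForm, hs.isSolution.boundary_value _
        ((hz.boundary_iff _ (z.map_target hq)).mpr (by rwa [z.right_inv hq]))]
    · rw [dd_vec_smul, ht1, smul_zero]
    · rw [smul_comm Complex.I, dd_vec_smul, ht2, smul_zero]
    · rw [hermQuad_real_smul, hermQuad_real_smul, he]; ring
    · intro q' hq' hρ' ζ h1 h2
      have h3 := hm0.le (z.symm q') ((hz.boundary_iff _ (z.map_target hq')).mpr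
        (by rwa [z.right_inv hq'])) ((hz.boundary_iff _ (z.map_target hq')).mpr
        (by rwa [z.right_inv hq'])) (coordVec z (z.symm q') ζ)
        ((hz.complexTangent_coordVec hq' hρ' ζ).mpr ⟨h1, h2⟩)
      rwa [hgq q' hq', hz.solQuad_coordVec h.isComplex h.isReal11 hu hq'] at h3

theorem bdryDiff_add (x : M) (v w : TangentSpace (𝓡∂ (2 * m + 2)) x) :
    bdryDiff x (v + w) = bdryDiff x v + bdryDiff x w := map_add _ v w

theorem bdryDiff_smul (x : M) (r : ℝ) (v : TangentSpace (𝓡∂ (2 * m + 2)) x) :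
    bdryDiff x (r • v) = r * bdryDiff x v := map_smul _ r v

theorem hermC_one (a b : Fin (m + 1) → ℂ) : hermC 1 a b = ∑ j, a j * (starRingEnd ℂ) (b j) := by
  simp [hermC, Matrix.one_apply]

theorem hermQuad_one (a : Fin (m + 1) → ℂ) : hermQuad 1 a = ∑ j, ‖a j‖ ^ 2 := by
  rw [hermQuad_eq, hermC_one, Complex.re_sum]
  exact Finset.sum_congr rfl fun j _ => by rw [Complex.mul_conj']; norm_cast

/-- In regular coordinates the vectors with vanishing last component are tangent to the boundary. -/
theorem IsRegularChart.bdryDiff_coordVec {p : M} (hz : IsRegularChart J g p z)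
    (hg : IsHermitianMetric J g) {c : Fin (m + 1) → ℂ} (hc : (c (Fin.last m)).re = 0) :
    bdryDiff p (coordVec z p c) = 0 := by
  have hh := hz.holCoord
  set N := coordX z p (Fin.last m)
  have hN : N ≠ 0 := hh.coordVec_ne_zero hz.mem_source (by simp)
  have h0 : g.inner p N (coordVec z p c) = 0 := by
    have := congrArg Complex.re (hh.hermC_gMatrix hg hz.mem_source (Pi.single (Fin.last m) 1) c)
    rw [hz.metric, hermC_one, Finset.sum_eq_single (Fin.last m)
      (fun j _ hj => by simp [Pi.single_eq_of_ne hj]) (by simp)] at this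
    simp only [Pi.single_eq_same, one_mul, Complex.conj_re, hc, Complex.add_re, Complex.ofReal_re,
      Complex.mul_re, Complex.I_re, Complex.I_im, Complex.ofReal_im] at this
    rw [zero_mul, sub_zero, add_zero] at this
    exact this.symm
  set t := bdryDiff p (coordVec z p c) / bdryDiff p N
  -- The metric matrix is the identity, so the vector is orthogonal to `N`. Subtracting a multiple
  -- of `N` makes it tangent, hence orthogonal to `N` again; the multiple must vanish.
  have h1 := hz.normal (coordVec z p c + (-t) • N) (by
    rw [bdryDiff_add, bdryDiff_smul, neg_mul, div_mul_cancel₀ _ hz.inward.ne', add_neg_cancel])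
  rw [map_add, map_smul, h0, zero_add, smul_eq_mul, mul_eq_zero, neg_eq_zero] at h1
  rcases h1 with h1 | h1
  · exact (div_eq_zero_iff.mp h1).resolve_right hz.inward.ne'
  · exact absurd h1 (g.pos p N hN).ne'

theorem IsRegularChart.complexTangent {p : M} (hz : IsRegularChart J g p z)
    (hg : IsHermitianMetric J g) {c : Fin (m + 1) → ℂ} (hc : c (Fin.last m) = 0) :
    ComplexTangent J p (coordVec z p c) := by
  refine ⟨hz.bdryDiff_coordVec hg (by simp [hc]), ?_⟩
  rw [hz.holCoord.J_coordVec hz.mem_source]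
  exact hz.bdryDiff_coordVec hg (by simp [hc])

theorem hermQuad_submatrix_castSucc (A : Matrix (Fin (m + 1)) (Fin (m + 1)) ℂ) (ξ : Fin m → ℂ) :
    hermQuad (A.submatrix Fin.castSucc Fin.castSucc) ξ =
      hermQuad A (Fin.snoc (α := fun _ => ℂ) ξ 0) := by
  simp [hermQuad, Fin.sum_univ_castSucc]

/-- The strict positivity of the tangential part of `χ_u` on the boundary. -/
theorem DirichletData.exists_tangential_lower [CompactSpace M]
    (h : DirichletData J g χ φ usub W) (K Lam : ℝ) (hlam : 0 < lam) :
    ∃ c0 > 0, ∀ ψ u, BoundedSolution J g χ φ usub K lam Lam ψ u →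
      ∀ p ∈ (𝓡∂ (2 * m + 2)).boundary M, ∀ z, IsRegularChart J g p z → ∀ ξ : Fin m → ℂ,
        c0 * ∑ α, ‖ξ α‖ ^ 2 ≤
          hermQuad ((chiUMatrix χ u z p).submatrix Fin.castSucc Fin.castSucc) ξ := by
  obtain ⟨c0, hc0, H⟩ := h.exists_isTangentialMin_lower K Lam hlam
  refine ⟨c0, hc0, fun ψ u hs p hp z hz ξ => ?_⟩
  have hu := hs.isSolution.contMDiff
  have hh := hz.holCoord
  set a : Fin (m + 1) → ℂ := Fin.snoc (α := fun _ => ℂ) ξ 0 with ha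
  have hsum : ∑ α, ‖ξ α‖ ^ 2 = hermQuad (gMatrix J g z p) a := by
    rw [hz.metric, hermQuad_one, Fin.sum_univ_castSucc]
    simp [ha]
  rw [hermQuad_submatrix_castSucc, hsum, ← ha]
  rcases eq_or_ne a 0 with h0 | hne
  · rw [h0]; simp [hermQuad]
  have hV := hh.coordVec_ne_zero hz.mem_source hne
  -- A nonzero `ξ` itself provides the complex tangent vector needed for the minimum to exist.
  have hT := hz.complexTangent h.isHermitian (c := a) (by simp [ha])
  obtain ⟨m0, hm0⟩ := exists_isTangentialMin h.isComplex h.isHermitian h.smooth h.isReal11 hu hp hV hT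
  have h1 := hm0.le p hp hp _ hT
  rw [hh.solQuad_eq h.isComplex h.isReal11 hu hz.mem_source, hh.realDiff_coordVec hz.mem_source] at h1
  rw [hh.hermQuad_gMatrix h.isHermitian hz.mem_source]
  exact (mul_le_mul_of_nonneg_right (H ψ u hs m0 hm0) (g.pos p _ hV).le).trans h1

end TangentialEstimate

end HermitianMA

namespace HermitianMA

/-! ### The Chern Hessian under change of coordinates. -/

section ChernHessian

open Set Filter Topology Matrix ComplexConjugate

set_option linter.unusedSectionVars false

variable {m : ℕ} {M : Type*} [TopologicalSpace M]
  [ChartedSpace (EuclideanHalfSpace (2 * m + 2)) M] [IsManifold (𝓡∂ (2 * m + 2)) ∞ M]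
  {J : EndoField m M} {z y : PartialEquiv M (Fin (m + 1) → ℂ)} {p x : M}
  {g : RMetric m M} {u : M → ℝ}

/-- The differential at `x` of the change of coordinates from `z` to `y`. -/
noncomputable def coordJac (z y : PartialEquiv M (Fin (m + 1) → ℂ)) (x : M)
    (v : Fin (m + 1) → ℂ) : Fin (m + 1) → ℂ := realDiff (m := m) y x (coordVec z x v)

theorem CoordChange.dd_eq_coordJac {S : Set (Fin (m + 1) → ℂ)}
    {Φ : (Fin (m + 1) → ℂ) → (Fin (m + 1) → ℂ)} (h : CoordChange z y S Φ) (hx : x ∈ z.source)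
    (hxy : x ∈ y.source) (v : Fin (m + 1) → ℂ) : dd S v Φ (z x) = coordJac z y x v := by
  rw [h.dd_eq _ (h.mem x hx hxy), z.left_inv hx]; rfl

theorem hermC_gMatrix_change (hz : IsHolCoord J z) (hy : IsHolCoord J y)
    (hg : IsHermitianMetric J g) (hx : x ∈ z.source) (hxy : x ∈ y.source)
    (a b : Fin (m + 1) → ℂ) : hermC (gMatrix J g z x) a b =
      hermC (gMatrix J g y x) (coordJac z y x a) (coordJac z y x b) := by
  rw [hz.hermC_gMatrix hg hx, hy.hermC_gMatrix hg hxy, coordJac, coordJac, hy.coordVec_realDiff hxy,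
    hy.coordVec_realDiff hxy]

/-- The derivative of the metric coefficients in terms of another coordinate system. -/
theorem CoordChange.fderivWithin_metricCoeff {S : Set (Fin (m + 1) → ℂ)}
    {Φ : (Fin (m + 1) → ℂ) → (Fin (m + 1) → ℂ)} (h : CoordChange z y S Φ) (hz : IsHolCoord J z)
    (hy : IsHolCoord J y) (hg : IsHermitianMetric J g) (hx : x ∈ z.source) (hxy : x ∈ y.source)
    (e : Fin (m + 1) → ℂ) (j k : Fin (m + 1)) :
    dd z.target e (fun q => metricCoeff J g z q j k) (z x) =
      hermC (Matrix.of (fderivWithin ℝ (metricCoeff J g y) y.target (y x) (coordJac z y x e)))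
        (coordJac z y x (Pi.single j 1)) (coordJac z y x (Pi.single k 1)) +
      hermC (gMatrix J g y x) (D2 S Φ (z x) e (Pi.single j 1)) (coordJac z y x (Pi.single k 1)) +
      hermC (gMatrix J g y x) (coordJac z y x (Pi.single j 1)) (D2 S Φ (z x) e (Pi.single k 1)) := by
  have hq := h.mem x hx hxy
  have hS := h.uniqueDiff
  have hΦ2 : ContDiffOn ℝ 2 Φ S := h.smooth.of_le (by norm_cast)
  have hm1 : ContDiffOn ℝ 1 (fun q => metricCoeff J g z q j k) z.target :=
    (contDiffOn_pi.mp (contDiffOn_pi.mp (hz.contDiffOn_metricCoeff g) j) k).of_le (by norm_cast)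
  have e1 : dd z.target e (fun q => metricCoeff J g z q j k) (z x) =
      dd S e (fun q => metricCoeff J g z q j k) (z x) :=
    congrArg (fun A : (Fin (m + 1) → ℂ) →L[ℝ] ℂ => A e) (fderivWithin_subset' h.subset hS hm1 hq).symm
  have e2 : EqOn (fun q => metricCoeff J g z q j k) (fun q => hermC
      (Matrix.of (metricCoeff J g y (Φ q))) (dd S (Pi.single j 1) Φ q) (dd S (Pi.single k 1) Φ q)) S := by
    intro q hq
    have hx1 := z.map_target (h.subset hq)
    have hx2 : z.symm q ∈ y.source := by
      rw [← h.symm_eq q hq]; exact y.map_target (h.mapsTo hq)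
    have h1 := hermC_gMatrix_change hz hy hg hx1 hx2 (Pi.single j 1) (Pi.single k 1)
    rw [hermC_single] at h1
    change gMatrix J g z (z.symm q) j k = hermC (gMatrix J g y (y.symm (Φ q))) _ _
    rw [h1, h.symm_eq q hq, h.dd_eq q hq, h.dd_eq q hq]; rfl
  have hG : ContDiffOn ℝ 1 (metricCoeff J g y) y.target :=
    (hy.contDiffOn_metricCoeff g).of_le (by norm_cast)
  have hGd := ((hG.differentiableOn (by norm_num) _ (h.mapsTo hq)).hasFDerivWithinAt).comp (z x)
    (hΦ2.differentiableOn (by norm_num) _ hq).hasFDerivWithinAt h.mapsTo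
  have hdd := fun t => (contDiffOn_dd hS hΦ2 (k := 1) (by norm_num) t).differentiableOn
    (by norm_num) (z x) hq
  have hyx : Φ (z x) = y x := by rw [h.eq _ hq, z.left_inv hx]
  have hgy : Matrix.of (metricCoeff J g y (Φ (z x))) = gMatrix J g y x := by
    change gMatrix J g y (y.symm (Φ (z x))) = _
    rw [hyx, y.left_inv hxy]
  rw [e1, dd_congr e2 hq]
  refine (fderivWithin_hermC (hS _ hq) hGd.differentiableWithinAt (hdd _) (hdd _) e).trans ?_
  have hGe : fderivWithin ℝ (metricCoeff J g y ∘ Φ) S (z x) e =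
      fderivWithin ℝ (metricCoeff J g y) y.target (y x) (coordJac z y x e) := by
    rw [hGd.fderivWithin (hS _ hq), ← hyx, ← h.dd_eq_coordJac hx hxy]; rfl
  rw [D2_apply hS hΦ2 hq, D2_apply hS hΦ2 hq, ← h.dd_eq_coordJac hx hxy (Pi.single j 1),
    ← h.dd_eq_coordJac hx hxy (Pi.single k 1), ← hGe, ← hgy]
  rfl

/-- A real differential evaluated on the real vector with complex components `c` is twice the real
part of the pairing of `c` with its `∂/∂z_l` components. This turns the Christoffel term into a
directional derivative. -/
theorem two_mul_re_sum_dZ (L : (Fin (m + 1) → ℂ) →L[ℝ] ℝ) (c : Fin (m + 1) → ℂ) :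
    2 * (∑ l, c l * ((((L (Pi.single l 1) : ℝ) : ℂ) -
      Complex.I * ((L (Complex.I • Pi.single l 1) : ℝ) : ℂ)) / 2)).re = L c := by
  have hc : c = ∑ l, ((c l).re • (Pi.single l 1 : Fin (m + 1) → ℂ) +
      (c l).im • (Complex.I • (Pi.single l 1 : Fin (m + 1) → ℂ))) := by
    ext j
    rw [Finset.sum_apply, Finset.sum_eq_single j (fun l _ hl => by simp [Pi.single_eq_of_ne hl.symm])
      (by simp)]
    simp
  conv_rhs => rw [hc, map_sum]
  rw [Complex.re_sum, Finset.mul_sum]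
  refine Finset.sum_congr rfl fun l _ => ?_
  rw [map_add, L.map_smul (c l).re, L.map_smul (c l).im, smul_eq_mul, smul_eq_mul]
  have : c l * ((((L (Pi.single l 1) : ℝ) : ℂ) -
      Complex.I * ((L (Complex.I • Pi.single l 1) : ℝ) : ℂ)) / 2) =
      (c l * (((L (Pi.single l 1) : ℝ) : ℂ) -
      Complex.I * ((L (Complex.I • Pi.single l 1) : ℝ) : ℂ))) / ((2 : ℝ) : ℂ) := by push_cast; ring
  rw [this, Complex.div_ofReal_re]
  simp
  ring

theorem IsHolCoord.coordDeriv_coordDeriv_ofReal (hz : IsHolCoord J z)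
    (hu : ContDiffOn ℝ 2 (fun q => u (z.symm q)) z.target) (hx : x ∈ z.source)
    (a b : Fin (m + 1) → ℂ) :
    coordDeriv z (fun y => coordDeriv z (fun q => (u q : ℂ)) b y) a x =
      ((D2 z.target (fun q => u (z.symm q)) (z x) a b : ℝ) : ℂ) := by
  have hS := hz.uniqueDiffOn
  have hq := z.map_source hx
  have hu1 : ContDiffOn ℝ 1 (fun q => u (z.symm q)) z.target := hu.of_le (by norm_num)
  have h1 : EqOn (fun w => coordDeriv z (fun q => (u q : ℂ)) b (z.symm w))
      (fun w => ((dd z.target b (fun q => u (z.symm q)) w : ℝ) : ℂ)) z.target := fun w hw => by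
    change coordDeriv z (fun q => (u q : ℂ)) b (z.symm w) = _
    rw [hz.coordDeriv_ofReal hu1 (z.map_target hw), z.right_inv hw]
  change dd z.target a (fun w => coordDeriv z (fun q => (u q : ℂ)) b (z.symm w)) (z x) = _
  rw [dd_congr h1 hq, dd_ofReal hS (contDiffOn_dd hS hu (by norm_num) b) hq, D2_apply hS hu hq]

/-- The Chern Hessian in terms of an arbitrary holomorphic coordinate system. -/
theorem IsRegularChart.chernHessNN_eq (hz : IsRegularChart J g p z) (hy : IsHolCoord J y)
    (hpy : p ∈ y.source) (hg : IsHermitianMetric J g)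
    (hu : ContMDiff (𝓡∂ (2 * m + 2)) 𝓘(ℝ, ℝ) 4 u) :
    chernHessNN J g z u p =
      D2 y.target (fun q => u (y.symm q)) (y p) (coordJac z y p (Pi.single (Fin.last m) 1))
        (coordJac z y p (Pi.single (Fin.last m) 1)) -
      2 * (∑ l, (hermC (Matrix.of (fderivWithin ℝ (metricCoeff J g y) y.target (y p)
              (coordJac z y p (Pi.single (Fin.last m) 1))))
            (coordJac z y p (Pi.single (Fin.last m) 1)) (coordJac z y p (Pi.single l 1)) -
          Complex.I * hermC (Matrix.of (fderivWithin ℝ (metricCoeff J g y) y.target (y p)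
              (coordJac z y p (Complex.I • Pi.single (Fin.last m) 1))))
            (coordJac z y p (Pi.single (Fin.last m) 1)) (coordJac z y p (Pi.single l 1))) / 2 *
        ((((dd y.target (coordJac z y p (Pi.single l 1)) (fun q => u (y.symm q)) (y p) : ℝ) : ℂ) -
          Complex.I * ((dd y.target (coordJac z y p (Complex.I • Pi.single l 1))
            (fun q => u (y.symm q)) (y p) : ℝ) : ℂ)) / 2)).re := by
  have hh := hz.holCoord
  have hp := hz.mem_source
  have hu2 : ContDiffOn ℝ 2 (fun q => u (z.symm q)) z.target :=
    (hh.contDiffOn (n := 4) hu.contMDiffOn (subset_univ _)).of_le (by norm_num)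
  have hu2' : ContDiffOn ℝ 2 (fun q => u (y.symm q)) y.target :=
    (hy.contDiffOn (n := 4) hu.contMDiffOn (subset_univ _)).of_le (by norm_num)
  obtain ⟨S, Φ, h⟩ := hh.exists_coordChange hy
  have hq := h.mem p hp hpy
  have hΦ2 : ContDiffOn ℝ 2 Φ S := h.smooth.of_le (by norm_cast)
  have hyp : Φ (z p) = y p := by rw [h.eq _ hq, z.left_inv hp]
  set n := Fin.last m
  set e : Fin (m + 1) → (Fin (m + 1) → ℂ) := fun l => Pi.single l 1 with he
  -- `Q` is the only second derivative of the coordinate change in the Hessian of `u`, and `c` lists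
  -- its components in the regular chart.
  set Q := D2 S Φ (z p) (e n) (e n)
  set c : Fin (m + 1) → ℂ := realDiff (m := m) z p (coordVec y p Q)
  have hAc : coordJac z y p c = Q := by
    rw [coordJac, hh.coordVec_realDiff hp, hy.realDiff_coordVec hpy]
  have hcl : ∀ l, hermC (gMatrix J g y p) Q (coordJac z y p (e l)) = c l := fun l => by
    rw [← hAc, ← hermC_gMatrix_change hh hy hg hp hpy, hz.metric, hermC_one,
      Finset.sum_eq_single l (fun j _ hj => by simp [he, Pi.single_eq_of_ne hj]) (by simp)]
    simp [he]
  have hddu : ∀ v, dd z.target v (fun q => u (z.symm q)) (z p) =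
      dd y.target (coordJac z y p v) (fun q => u (y.symm q)) (y p) := fun v => by
    rw [h.dd_u hh hy hu hq, h.dd_eq_coordJac hp hpy, hyp]
  have hfirst : D2 z.target (fun q => u (z.symm q)) (z p) (e n) (e n) =
      D2 y.target (fun q => u (y.symm q)) (y p) (coordJac z y p (e n)) (coordJac z y p (e n)) +
        dd y.target Q (fun q => u (y.symm q)) (y p) := by
    rw [h.D2_eq hh hu hq, D2_comp h.uniqueDiff hy.uniqueDiffOn hΦ2 h.mapsTo hu2' hq,
      h.dd_eq_coordJac hp hpy, hyp]
  -- Under `∂/∂z_n` the second derivative of `Φ` survives in the linear slot of the metric and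
  -- cancels in the conjugate linear one. The symbol thus acquires exactly `c l`, removing the term
  -- with `Q` from the Hessian.
  have hchr : ∀ l, christoffel J g z p l n n =
      (hermC (Matrix.of (fderivWithin ℝ (metricCoeff J g y) y.target (y p) (coordJac z y p (e n))))
        (coordJac z y p (e n)) (coordJac z y p (e l)) -
      Complex.I * hermC (Matrix.of (fderivWithin ℝ (metricCoeff J g y) y.target (y p)
        (coordJac z y p (Complex.I • e n)))) (coordJac z y p (e n)) (coordJac z y p (e l))) / 2 +
      c l := fun l => by
    have h1 : christoffel J g z p l n n = dZ z (fun x => gMatrix J g z x n l) n p := by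
      rw [christoffel, hz.metric, inv_one, Finset.sum_eq_single l
        (fun j _ hj => by simp [Matrix.one_apply_ne hj]) (by simp)]
      simp
    have h2 : ∀ v, coordDeriv z (fun x => gMatrix J g z x n l) v p =
        dd z.target v (fun q => metricCoeff J g z q n l) (z p) := fun v => rfl
    have hI := fun t => (D2_smul_I h.uniqueDiff h.subset_closure hΦ2 h.dd_I hq (e n) t).2
    rw [h1, dZ, single_I, h2, h2, h.fderivWithin_metricCoeff hh hy hg hp hpy,
      h.fderivWithin_metricCoeff hh hy hg hp hpy, hI, hI, hermC_smul_left, hermC_smul_right,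
      ← hcl l, Complex.conj_I]
    simp only [Q, he]
    linear_combination (-(hermC (gMatrix J g y p) (D2 S Φ (z p) (Pi.single n 1) (Pi.single n 1))
      (coordJac z y p (Pi.single l 1))) / 2 + (hermC (gMatrix J g y p)
      (coordJac z y p (Pi.single n 1)) (D2 S Φ (z p) (Pi.single n 1) (Pi.single l 1))) / 2) *
      Complex.I_mul_I
  have hsum := two_mul_re_sum_dZ (fderivWithin ℝ (fun q => u (z.symm q)) z.target (z p)) c
  change _ = dd z.target c (fun q => u (z.symm q)) (z p) at hsum
  rw [hddu, hAc] at hsum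
  rw [chernHessNN, hh.coordDeriv_coordDeriv_ofReal hu2 hp, Complex.ofReal_re]
  have hdZ : ∀ l, dZ z (fun q => (u q : ℂ)) l p =
      (((dd z.target (e l) (fun q => u (z.symm q)) (z p) : ℝ) : ℂ) - Complex.I *
        ((dd z.target (Complex.I • e l) (fun q => u (z.symm q)) (z p) : ℝ) : ℂ)) / 2 := fun l =>
    hh.dZ_ofReal (hu2.of_le (by norm_num)) hp l
  have hsplit : ∑ l, christoffel J g z p l n n * dZ z (fun q => (u q : ℂ)) l p =
      (∑ l, (christoffel J g z p l n n - c l) * dZ z (fun q => (u q : ℂ)) l p) +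
      ∑ l, c l * dZ z (fun q => (u q : ℂ)) l p := by
    rw [← Finset.sum_add_distrib]
    exact Finset.sum_congr rfl fun l _ => by ring
  rw [hsplit, Complex.add_re, mul_add]
  have hs2 : 2 * (∑ l, c l * dZ z (fun q => (u q : ℂ)) l p).re =
      dd y.target Q (fun q => u (y.symm q)) (y p) := by
    rw [← hsum]
    simp only [hdZ]
    rfl
  rw [hs2]
  change D2 z.target (fun q => u (z.symm q)) (z p) (e n) (e n) - _ = _
  rw [hfirst]
  simp only [hchr, add_sub_cancel_right, hdZ, hddu]
  ring

end ChernHessian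

end HermitianMA

namespace HermitianMA

/-! ### The double normal derivative. -/

section NormalEstimate

open Set Filter Topology Matrix ComplexConjugate

set_option linter.unusedSectionVars false

variable {m : ℕ} {M : Type*} [TopologicalSpace M]
  [ChartedSpace (EuclideanHalfSpace (2 * m + 2)) M] [IsManifold (𝓡∂ (2 * m + 2)) ∞ M]
  {J : EndoField m M} {z y : PartialEquiv M (Fin (m + 1) → ℂ)} {p : M}
  {g : RMetric m M} {χ : ℝ → BilinField m M} {φ usub u : M → ℝ} {W : Set M} {K lam Lam : ℝ}
  {ψ : M → ℝ → ℝ} {ρ : (Fin (m + 1) → ℂ) → ℝ} {v0 : Fin (m + 1) → ℂ} {κ γ : ℝ}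

theorem norm_levC_le {B : (Fin (m + 1) → ℂ) →L[ℝ] (Fin (m + 1) → ℂ) →L[ℝ] ℝ}
    {v w : Fin (m + 1) → ℂ} {C : ℝ} (h1 : |B v w| ≤ C) (h2 : |B (Complex.I • v) (Complex.I • w)| ≤ C)
    (h3 : |B v (Complex.I • w)| ≤ C) (h4 : |B (Complex.I • v) w| ≤ C) : ‖levC B v w‖ ≤ C := by
  unfold levC
  rw [norm_div]
  have e1 : ‖((B v w + B (Complex.I • v) (Complex.I • w) : ℝ) : ℂ)‖ ≤ 2 * C := by
    rw [Complex.norm_real]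
    exact (norm_add_le _ _).trans (by rw [Real.norm_eq_abs, Real.norm_eq_abs]; linarith)
  have e2 : ‖Complex.I * ((B v (Complex.I • w) - B (Complex.I • v) w : ℝ) : ℂ)‖ ≤ 2 * C := by
    rw [norm_mul, Complex.norm_I, one_mul, Complex.norm_real]
    exact (norm_sub_le _ _).trans (by rw [Real.norm_eq_abs, Real.norm_eq_abs]; linarith)
  have e3 := (norm_add_le _ _).trans (add_le_add e1 e2)
  have e4 : ‖(4 : ℂ)‖ = 4 := by norm_num
  rw [e4, div_le_iff₀ (by norm_num)]
  linarith

theorem coordJac_smul_I (hz : IsHolCoord J z) (hy : IsHolCoord J y) (hp : p ∈ z.source)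
    (hpy : p ∈ y.source) (v : Fin (m + 1) → ℂ) :
    coordJac z y p (Complex.I • v) = Complex.I • coordJac z y p v := by
  rw [coordJac, ← hz.J_coordVec hp, hy.complex_linear p hpy]; rfl

/-- Coordinate vectors of a regular chart have unit length for `g` at `p`, and the metric is bounded
below in the uniform chart. This first order control is all that is available uniformly over regular
charts. -/
theorem UniformChart.norm_coordJac_le (hU : UniformChart J g χ φ usub K lam Lam y ρ v0 κ γ)
    (hg : IsHermitianMetric J g) (hz : IsRegularChart J g p z) (hpy : p ∈ y.source)
    (j : Fin (m + 1)) : ‖coordJac z y p (Pi.single j 1)‖ ≤ 1 + γ⁻¹ := by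
  have hγ := hU.pos
  have h1 := hU.metric_lower (y p) (y.map_source hpy) (coordJac z y p (Pi.single j 1))
  have h2 : Matrix.of (metricCoeff J g y (y p)) = gMatrix J g y p := by
    change gMatrix J g y (y.symm (y p)) = _
    rw [y.left_inv hpy]
  rw [h2, hermQuad_eq, ← hermC_gMatrix_change hz.holCoord hU.adapted.holCoord hg hz.mem_source hpy,
    hermC_single, hz.metric, Matrix.one_apply_eq, Complex.one_re] at h1
  have h3 : ‖coordJac z y p (Pi.single j 1)‖ ^ 2 ≤ γ⁻¹ := by
    rw [← one_div, le_div_iff₀ hγ]; linarith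
  have h4 : 0 < γ⁻¹ := by positivity
  nlinarith [norm_nonneg (coordJac z y p (Pi.single j 1))]

/-- Bound for the double normal derivative in terms of the constants of a chart. -/
theorem UniformChart.abs_chernHessNN_le (hU : UniformChart J g χ φ usub K lam Lam y ρ v0 κ γ)
    (hg : IsHermitianMetric J g) (hχ : ∀ s, IsReal11 J (χ s))
    (hs : BoundedSolution J g χ φ usub K lam Lam ψ u) (hlam : 0 < lam)
    (hz : IsRegularChart J g p z) (hpy : p ∈ y.source) (hpb : p ∈ (𝓡∂ (2 * m + 2)).boundary M)
    {CT C1 a N : ℝ} (hCT : 0 ≤ CT) (ha : a = 1 + γ⁻¹) (hN : N = ((m + 1 : ℕ) : ℝ) ^ 2)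
    (htan : ∀ v w, dd y.target v ρ (y p) = 0 →
      |D2 y.target (fun q => u (y.symm q)) (y p) v w| ≤ CT * ‖v‖ * ‖w‖)
    (hcor : (∀ j k, ¬ (j = Fin.last m ∧ k = Fin.last m) →
        ‖chiUMatrix χ u z p j k‖ ≤ N * κ * a * a + CT * a * a + |Lam|) →
      (chiUMatrix χ u z p).IsHermitian →
      ‖(chiUMatrix χ u z p).det‖ ≤ N * κ * a * a + CT * a * a + |Lam| →
      ‖chiUMatrix χ u z p (Fin.last m) (Fin.last m)‖ ≤ C1) :
    |chernHessNN J g z u p| ≤ 4 * (C1 + N * κ * a * a) + CT * a * a +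
      2 * ((m + 1 : ℕ) * (N * (κ * a) * a * a * (κ * a))) := by
  have hy := hU.adapted.holCoord
  have hh := hz.holCoord
  have hp := hz.mem_source
  have hu := hs.isSolution.contMDiff
  have hq := y.map_source hpy
  have hL := hU.localSol ψ u hs
  have hu2' : ContDiffOn ℝ 2 (fun q => u (y.symm q)) y.target := (hs.contDiffOn hy).of_le (by norm_num)
  have hκ := hU.one_le
  have hγ := hU.pos
  have ha0 : 0 < a := by rw [ha]; positivity
  have hN0 : 0 ≤ N := by rw [hN]; positivity
  set A := coordJac z y p with hA
  set e : Fin (m + 1) → (Fin (m + 1) → ℂ) := fun l => Pi.single l 1 with he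
  set B := D2 y.target (fun q => u (y.symm q)) (y p) with hB
  set n := Fin.last m
  have hAn : ∀ j, ‖A (e j)‖ ≤ a := fun j => by
    rw [ha]; exact hU.norm_coordJac_le hg hz hpy j
  have hAI : ∀ v, A (Complex.I • v) = Complex.I • A v := coordJac_smul_I hh hy hp hpy
  have hIn : ∀ v : Fin (m + 1) → ℂ, ‖Complex.I • v‖ = ‖v‖ := fun v => by
    rw [norm_smul, Complex.norm_I, one_mul]
  have htanA : ∀ v : Fin (m + 1) → ℂ, (v n).re = 0 → dd y.target (A v) ρ (y p) = 0 := fun v hv =>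
    (hU.adapted.tangent_iff p hpy hpb _).mp (hz.bdryDiff_coordVec hg hv)
  have hB' : ∀ v w, dd y.target v ρ (y p) = 0 → ‖v‖ ≤ a → ‖w‖ ≤ a → |B v w| ≤ CT * a * a :=
    fun v w hv h1 h2 => (htan v w hv).trans (by gcongr)
  set X : Matrix (Fin (m + 1)) (Fin (m + 1)) ℂ := Matrix.of (localForm χ y u (y p)) with hX
  have hXn : ∀ v w, ‖v‖ ≤ a → ‖w‖ ≤ a → ‖hermC X v w‖ ≤ N * κ * a * a := fun v w h1 h2 => by
    refine (norm_hermC_le X (κ := κ) (fun j k => hL.norm_X_apply hq j k) v w).trans ?_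
    rw [Fintype.card_fin, ← hN]
    gcongr
  have hGy : chiUMatrix χ u y p = X + levMat B := by
    have := hy.chiUMatrix_symm χ hu2' hq
    rwa [y.left_inv hpy] at this
  have hG : ∀ v w, hermC (chiUMatrix χ u z p) v w = hermC (X + levMat B) (A v) (A w) := fun v w => by
    rw [hermC_chiUMatrix_change hh hy hχ hu hp hpy, hGy]; rfl
  have hherm : (chiUMatrix χ u z p).IsHermitian := isHermitian_of_hermC fun v w => by
    rw [hG, hG, hermC_conj_symm (hL.isHermitian hU.adapted.boundaryDomain hq)]
  -- For `j ≠ n` both `e_j` and `√-1 e_j` are tangent to the boundary, so each second derivative in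
  -- the Levi form has a tangential direction. The last row is then covered by Hermitian symmetry.
  have hent : ∀ j k, j ≠ n → ‖chiUMatrix χ u z p j k‖ ≤ N * κ * a * a + CT * a * a + |Lam| := by
    intro j k hj
    have hjn : e j n = 0 := by simp [he, Pi.single_eq_of_ne (Ne.symm hj)]
    have t1 := htanA (e j) (by simp [hjn])
    have t2 := htanA (Complex.I • e j) (by simp [hjn])
    rw [hAI] at t2
    have hAk := hAn k
    have hAj := hAn j
    have l1 : ‖levC B (A (e j)) (A (e k))‖ ≤ CT * a * a :=
      norm_levC_le (hB' _ _ t1 hAj hAk)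
        (hB' _ _ t2 (by rwa [hIn]) (by rwa [hIn])) (hB' _ _ t1 hAj (by rwa [hIn]))
        (hB' _ _ t2 (by rwa [hIn]) hAk)
    rw [← hermC_single (chiUMatrix χ u z p) j k, hG, hermC_add_mat, hermC_levMat]
    exact (norm_add_le _ _).trans (by linarith [hXn _ _ hAj hAk, abs_nonneg Lam])
  have hent' : ∀ j k, ¬ (j = n ∧ k = n) →
      ‖chiUMatrix χ u z p j k‖ ≤ N * κ * a * a + CT * a * a + |Lam| := by
    intro j k hjk
    by_cases hj : j = n
    · rw [← hherm.apply, norm_star]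
      exact hent k j fun hk => hjk ⟨hj, hk⟩
    · exact hent j k hj
  have hdet : ‖(chiUMatrix χ u z p).det‖ ≤ N * κ * a * a + CT * a * a + |Lam| := by
    rw [hs.isSolution.equation z hh p hp, hz.metric, Matrix.det_one, mul_one, Complex.norm_real,
      Real.norm_eq_abs]
    have hK := hs.c1Bound.abs_le p
    have h1 := hs.psiBound.upper p (u p) hK
    rw [abs_of_pos (hlam.trans_le (hs.psiBound.lower p (u p) hK))]
    have h2 : 0 ≤ N * κ * a * a := by positivity
    have h3 : 0 ≤ CT * a * a := by positivity
    linarith [le_abs_self Lam]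
  have hnn := hcor hent' hherm hdet
  have hAnn := hAn n
  -- The corner entry controls the sum of the second derivatives along `e_n` and `√-1 e_n`. The
  -- latter direction is tangent to the boundary, which isolates the former.
  have hBnn : |B (A (e n)) (A (e n))| ≤ 4 * (C1 + N * κ * a * a) + CT * a * a := by
    have h1 := congrArg Complex.re (hG (e n) (e n))
    rw [hermC_single, hermC_add_mat, hermC_levMat, Complex.add_re, re_levC] at h1
    have t2 := htanA (Complex.I • e n) (by simp [he])
    rw [hAI] at t2
    have h2 := abs_le.mp (hB' (Complex.I • A (e n)) (Complex.I • A (e n)) t2 (by rwa [hIn]) (by rwa [hIn]))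
    have h3 := abs_le.mp ((Complex.abs_re_le_norm _).trans hnn)
    have h4 := abs_le.mp ((Complex.abs_re_le_norm _).trans (hXn _ _ hAnn hAnn))
    rw [abs_le]
    constructor <;> linarith [h2.1, h2.2, h3.1, h3.2, h4.1, h4.2]
  have hdm : ∀ v w s, ‖v‖ ≤ a → ‖w‖ ≤ a → ‖s‖ ≤ a →
      ‖hermC (Matrix.of (fderivWithin ℝ (metricCoeff J g y) y.target (y p) v)) w s‖ ≤
        N * (κ * a) * a * a := fun v w s h1 h2 h3 => by
    refine (norm_hermC_le _ (κ := κ * a) (fun j k => ?_) w s).trans ?_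
    · refine ((norm_le_pi_norm (fderivWithin ℝ (metricCoeff J g y) y.target (y p) v j) k).trans
        (norm_le_pi_norm _ j)).trans ((ContinuousLinearMap.le_opNorm _ _).trans ?_)
      exact mul_le_mul (hU.metric_deriv _ hq) h1 (norm_nonneg _) (by linarith)
    · rw [Fintype.card_fin, ← hN]
      gcongr
  have hdu : ∀ v, ‖v‖ ≤ a → ‖((dd y.target v (fun q => u (y.symm q)) (y p) : ℝ) : ℂ)‖ ≤ κ * a :=
    fun v h1 => by
    rw [Complex.norm_real]
    exact (ContinuousLinearMap.le_opNorm _ _).trans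
      (mul_le_mul (hL.norm_du _ hq) h1 (norm_nonneg _) (by linarith))
  have hhalf : ∀ (s t : ℂ) (c : ℝ), ‖s‖ ≤ c → ‖t‖ ≤ c → ‖(s - Complex.I * t) / 2‖ ≤ c := by
    intro s t c h1 h2
    rw [norm_div, Complex.norm_ofNat, div_le_iff₀ (by norm_num)]
    refine (norm_sub_le _ _).trans ?_
    rw [norm_mul, Complex.norm_I, one_mul]; linarith
  rw [hz.chernHessNN_eq hy hpy hg hu]
  refine (abs_sub _ _).trans (add_le_add hBnn ?_)
  rw [abs_mul, abs_two]
  refine mul_le_mul_of_nonneg_left ((Complex.abs_re_le_norm _).trans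
    ((norm_sum_le_of_le _ (n := fun _ => N * (κ * a) * a * a * (κ * a)) fun l _ => ?_).trans
      (by simp))) (by norm_num)
  rw [norm_mul]
  have hIe : ∀ l, ‖A (Complex.I • e l)‖ ≤ a := fun l => by rw [hAI, hIn]; exact hAn l
  refine mul_le_mul (hhalf _ _ _ (hdm _ _ _ hAnn hAnn (hAn l)) (hdm _ _ _ (hIe n) hAnn (hAn l)))
    (hhalf _ _ _ (hdu _ (hAn l)) (hdu _ (hIe l))) (norm_nonneg _) (by positivity)

/-- The double normal derivative is bounded on the boundary. -/
theorem DirichletData.exists_chernHessNN_bound [CompactSpace M]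
    (h : DirichletData J g χ φ usub W) (K Lam : ℝ) (hlam : 0 < lam) :
    ∃ C, ∀ ψ u, BoundedSolution J g χ φ usub K lam Lam ψ u →
      ∀ p ∈ (𝓡∂ (2 * m + 2)).boundary M, ∀ z, IsRegularChart J g p z →
        |chernHessNN J g z u p| ≤ C := by
  have hc : IsCompact ((𝓡∂ (2 * m + 2)).boundary M) :=
    ((𝓡∂ (2 * m + 2)).isClosed_boundary (M := M) (n := ∞) (by simp)).isCompact
  obtain ⟨c0, hc0, H⟩ := h.exists_tangential_lower K Lam hlam
  suffices hind : ∃ C, ∀ ψ u, BoundedSolution J g χ φ usub K lam Lam ψ u →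
      ∀ p ∈ (𝓡∂ (2 * m + 2)).boundary M, p ∈ (𝓡∂ (2 * m + 2)).boundary M →
        ∀ z, IsRegularChart J g p z → |chernHessNN J g z u p| ≤ C by
    obtain ⟨C, hC⟩ := hind
    exact ⟨C, fun ψ u hs p hp => hC ψ u hs p hp hp⟩
  refine hc.induction_on (p := fun s => ∃ C, ∀ ψ u, BoundedSolution J g χ φ usub K lam Lam ψ u →
      ∀ p ∈ (𝓡∂ (2 * m + 2)).boundary M, p ∈ s →
        ∀ z, IsRegularChart J g p z → |chernHessNN J g z u p| ≤ C) ?_ ?_ ?_ ?_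
  · exact ⟨0, by simp⟩
  · rintro s t hst ⟨C, hC⟩
    exact ⟨C, fun ψ u hs p hp hps => hC ψ u hs p hp (hst hps)⟩
  · rintro s t ⟨C1, h1⟩ ⟨C2, h2⟩
    refine ⟨max C1 C2, fun ψ u hs p hp hps z hz => ?_⟩
    rcases hps with hps | hps
    · exact (h1 ψ u hs p hp hps z hz).trans (le_max_left _ _)
    · exact (h2 ψ u hs p hp hps z hz).trans (le_max_right _ _)
  · intro x hx
    obtain ⟨y, ρ, v0, κ, γ, hU, hxy⟩ := h.exists_uniformChart K Lam hlam hx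
    have hyy := hU.adapted.holCoord
    obtain ⟨r, hr, CT, hCT, htan⟩ := exists_tangential_bound hU.adapted.boundaryDomain hU.transversal
      hU.smooth_boundary hU.smooth_sub hU.boundary_sub hU.one_le (y.map_source hxy)
      ((hU.adapted.boundary_iff x hxy).mp hx)
    set a := 1 + γ⁻¹ with ha
    set N : ℝ := ((m + 1 : ℕ) : ℝ) ^ 2 with hN
    -- The tangential lower bound `c0` is global; the bound for the remaining entries and for the
    -- determinant uses only constants of the uniform chart `y` and `Lam`.
    obtain ⟨C1, hC1⟩ := exists_corner_bound m hc0 (N * κ * a * a + CT * a * a + |Lam|)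
    refine ⟨y.source ∩ y ⁻¹' Metric.ball (y x) r, mem_nhdsWithin_of_mem_nhds (inter_mem
      (hyy.open_source.mem_nhds hxy) ((hyy.smooth.continuousOn.continuousAt
        (hyy.open_source.mem_nhds hxy)).preimage_mem_nhds (Metric.ball_mem_nhds _ hr))), _,
      fun ψ u hs p hp hpy z hz => hU.abs_chernHessNN_le h.isHermitian h.isReal11 hs hlam hz hpy.1 hp
        hCT ha hN (htan _ _ _ (hU.localSol ψ u hs) (y p) (y.map_source hpy.1) hpy.2
          ((hU.adapted.boundary_iff p hpy.1).mp hp))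
        fun h1 h2 h3 => hC1 _ h2 (H ψ u hs p hp z hz) h1 h3⟩

end NormalEstimate

end HermitianMA

theorem proposition4p3 (m : ℕ) (hm : 1 ≤ m) {M : Type*} [TopologicalSpace M] [T2Space M]
    [CompactSpace M] [ChartedSpace (EuclideanHalfSpace (2 * m + 2)) M]
    [IsManifold (𝓡∂ (2 * m + 2)) ∞ M]
    (J : EndoField m M) (hJ : IsComplexStructure J)
    (g : RMetric m M) (hg : IsHermitianMetric J g)
    (χ : ℝ → BilinField m M) (hχ_smooth : SmoothFamily χ) (hχ_type : ∀ s, IsReal11 J (χ s))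
    (hχ_mono : MonotoneFamily J χ)
    (φ : M → ℝ) (hφ : ContMDiff (𝓡∂ (2 * m + 2)) 𝓘(ℝ, ℝ) ∞ φ)
    (usub : M → ℝ) (W : Set M) (hW_open : IsOpen W)
    (hW_boundary : (𝓡∂ (2 * m + 2)).boundary M ⊆ W)
    (husub_smooth : ContMDiffOn (𝓡∂ (2 * m + 2)) 𝓘(ℝ, ℝ) 2 usub W)
    (husub_adm : AdmissibleOn J χ usub W)
    (husub_boundary : ∀ x ∈ (𝓡∂ (2 * m + 2)).boundary M, usub x = φ x)
    (K lam Lam : ℝ) (hlam : 0 < lam) :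
    (∃ c₀ : ℝ, 0 < c₀ ∧
      ∀ (ψ : M → ℝ → ℝ) (u : M → ℝ), PsiBound g ψ K lam Lam → IsSolution J g χ ψ φ u →
        (∀ x, usub x ≤ u x) → C1Bound g u K →
        ∀ p ∈ (𝓡∂ (2 * m + 2)).boundary M,
        ∀ z : PartialEquiv M (Fin (m + 1) → ℂ), IsRegularChart J g p z →
        ∀ ξ : Fin m → ℂ,
          c₀ * ∑ α, ‖ξ α‖ ^ 2 ≤
            hermQuad ((chiUMatrix χ u z p).submatrix Fin.castSucc Fin.castSucc) ξ) ∧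
    (∃ C : ℝ,
      ∀ (ψ : M → ℝ → ℝ) (u : M → ℝ), PsiBound g ψ K lam Lam → IsSolution J g χ ψ φ u →
        (∀ x, usub x ≤ u x) → C1Bound g u K →
        ∀ p ∈ (𝓡∂ (2 * m + 2)).boundary M,
        ∀ z : PartialEquiv M (Fin (m + 1) → ℂ), IsRegularChart J g p z →
          |chernHessNN J g z u p| ≤ C) := by
  have h : DirichletData J g χ φ usub W :=
    ⟨hJ, hg, hχ_smooth, hχ_type, hχ_mono, hφ, hW_open, hW_boundary, husub_smooth, husub_adm,
      husub_boundary⟩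
  refine ⟨?_, ?_⟩
  · obtain ⟨c0, hc0, H⟩ := h.exists_tangential_lower K Lam hlam
    exact ⟨c0, hc0, fun ψ u hψ hu hsub hK => H ψ u ⟨hψ, hu, hsub, hK⟩⟩
  · obtain ⟨C, H⟩ := h.exists_chernHessNN_bound K Lam hlam
    exact ⟨C, fun ψ u hψ hu hsub hK => H ψ u ⟨hψ, hu, hsub, hK⟩⟩
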